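/- Let $d,n\ge 1$, $k\in\{1,\dots,d\}$ and $\alpha<-d/2$. Let $\mathcal H_\alpha$ be the Hilbert space of pairs $Y=(Y^0,Y^1)=(u,v)$ of $\mathbb R^n$-valued functions on $\mathbb Z^d$ with $\|Y\|_\alpha^2=\sum_{x}(1+|x|^2)^{\alpha}(|u(x)|^2+|v(x)|^2)<\infty$. Let $V:\mathbb Z^d\to\mathbb R^{n\times n}$, and let $U(t):\mathcal H_\alpha\to\mathcal H_\alpha$, $t\in\mathbb R$, send $Y_0=(u_0,v_0)$ to $(u(\cdot,t),\dot u(\cdot,t))$, where $u$ solves $\ddot u(x,t)=-\sum_{y}V(x-y)u(y,t)$, $u|_{t=0}=u_0$, $\dot u|_{t=0}=v_0$, with $(u,\dot u)\in C(\mathbb R,\mathcal H_\alpha)$. For a matrix sequence $A$ on $\mathbb Z^d$ put $\hat A(\theta)=\sum_x e^{i(x,\theta)}A(x)$, $\theta\in\mathbb T^d=\mathbb R^d/(2\pi\mathbb Z)^d$. Assume on $V$: (E1) $\|V(x)\|\le Ce^{-\gamma|x|}$ for some $C,\gamma>0$; (E2) $V(-x)=V(x)^{T}$; (E3) $\hat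 V(\theta)\ge 0$ for all $\theta$. Let $\Omega(\theta)=\hat V(\theta)^{1/2}$, let $s$ be the generic (maximal) number of distinct eigenvalues of $\Omega(\theta)$, and let $\mathcal C_*\subset\mathbb T^d$ be the smallest closed set off which $\Omega(\theta)$ has exactly $s$ distinct eigenvalues $\omega_1(\theta)<\dots<\omega_s(\theta)$ and these are real-analytic; $\Pi_\sigma(\theta)$ is the spectral projection for $\omega_\sigma(\theta)$. Assume also: (E4) for all $l\in\{1,\dots,d\}$ and $\sigma$, $\partial_{\theta_l}\omega_\sigma$ does not vanish identically on any nonempty open subset of $\mathbb T^d\setminus\mathcal C_*$; (E6) $\hat V(\theta)$ is invertible for a.e. $\theta$ and $\|\hat V^{-1}(\theta)\|\in L^1(\mathbb T^d)$. Let $\mu_0$ be a Borel probability measure on $\mathcal H_\alpha$ that is Gaussian, i.e. $\hat\mu_0(\Psi):=\int e^{i\langle Y,\Psi\rangle}\mu_0(dY)=e^{-\mathcal Q(\Psi,\Psi)/2}$ for all $\Psi\in\mathcal S$, where $\mathcal S$ is the space of rapidly decreasing $\mathbb R^n\oplus\mathbb R^n$-valued sequences on $\mathbb Z^d$, $\langle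 Y,\Psi\rangle=\sum_{i=0,1}\sum_x(Y^i(x),\Psi^i(x))$, and $\mathcal Q$ is a nonnegative quadratic form on $\mathcal S$. Let $Q_0(x,y)=\int Y(x)\otimes Y(y)\,\mu_0(dY)$, a $2n\times 2n$ matrix with $n\times n$ blocks $Q_0^{ij}$, $i,j=0,1$. Assume: (S1) $\int Y(x)\,\mu_0(dY)=0$ for all $x$; (S2) $|Q_0^{ij}(x,y)|\le h(|x-y|)$ with $r^{d-1}h(r)\in L^1(0,\infty)$ and $\sum_{z\in\mathbb Z^d}h(|z|)<\infty$ (the latter follows from the former if $h$ is non-increasing); (S3) writing $x=(\bar x,\tilde x)$ with $\bar x=(x_1,\dots,x_k)$, $Q_0(x,y)=q_0(\bar x,\bar y,\tilde x-\tilde y)$, and for every $\mathbf n\in\mathcal N^k=\{1,2\}^k$, $z\in\mathbb Z^d$ and $\varepsilon>0$ there is $N$ with $|q_0(\bar y+\bar z,\bar y,\tilde z)-q_{\mathbf n}(z)|<\varepsilon$ for all $\bar y\in\mathbb Z^k$ with $(-1)^{n_j}y_j>N$, $j=1,\dots,k$, where $q_{\mathbf n}(x-y)$ is the covariance of some translation-invariant,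 zero-mean Borel probability measure on $\mathcal H_\alpha$ with finite second moments. Finally assume (E5'): with $p^{ij}_{\mathbf n,\sigma\sigma'}=\Pi_\sigma\hat q^{ij}_{\mathbf n}\Pi_{\sigma'}$, if for some $\sigma\ne\sigma'$ and some nonempty open $O\subset\mathbb T^d\setminus\mathcal C_*$ one has $\omega_\sigma\pm\omega_{\sigma'}\equiv c$ on $O$ with a constant $c\ne0$, then on $O$, for all $\mathbf n\in\mathcal N^k$, $p^{11}_{\mathbf n,\sigma\sigma'}\mp\omega_\sigma\omega_{\sigma'}p^{00}_{\mathbf n,\sigma\sigma'}=0$ and $\omega_\sigma p^{01}_{\mathbf n,\sigma\sigma'}\pm\omega_{\sigma'}p^{10}_{\mathbf n,\sigma\sigma'}=0$. For a.e. $\theta$ define $$\hat q_\infty(\theta)=\sum_{\sigma=1}^s\Pi_\sigma\big(\mathbf M^+_{\sigma}+i\,\mathbf M^-_{\sigma}\big)\Pi_\sigma,\quad \mathbf M^+_\sigma=\frac1{2^k}\sum_{\mathbf n\in\mathcal N^k}L_1^+(\hat q_{\mathbf n})\big[1+S^{\rm even}_{\mathbf n,\sigma}\big],\quad \mathbf M^-_\sigma=\frac1{2^k}\sum_{\mathbf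 n\in\mathcal N^k}L_2^-(\hat q_{\mathbf n})\,S^{\rm odd}_{\mathbf n,\sigma},$$ where $\Pi_\sigma$ acts on both components, $L_1^+(A)=\frac12(A+CAC^*)$, $L_2^-(A)=\frac12(CA-AC^*)$, $C=\begin{pmatrix}0&\Omega^{-1}\\-\Omega&0\end{pmatrix}$, $C^*=\begin{pmatrix}0&-\Omega\\\Omega^{-1}&0\end{pmatrix}$, and $S^{\rm even}_{\mathbf n,\sigma}$ (resp. $S^{\rm odd}_{\mathbf n,\sigma}$) is the sum of $\prod_{j\in P}(-1)^{n_j}\operatorname{sgn}(\partial_{\theta_j}\omega_\sigma)$ over the nonempty subsets $P\subset\{1,\dots,k\}$ of even (resp. odd) cardinality. Then $\hat q_\infty\in L^1(\mathbb T^d)$, and with $q_\infty(x)=(2\pi)^{-d}\int_{\mathbb T^d}e^{-i(x,\theta)}\hat q_\infty(\theta)\,d\theta$ and $\mathcal Q_\infty(\Psi,\Psi)=\sum_{x,y}(q_\infty(x-y),\Psi(x)\otimes\Psi(y))$ there is a Borel probability measure $\mu_\infty$ on $\mathcal H_\alpha$ such that: (i) the distributions $\mu_t$ of $U(t)Y_0$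 ($Y_0$ distributed by $\mu_0$) converge weakly on $\mathcal H_\alpha$ to $\mu_\infty$ as $t\to\infty$; $\mu_\infty$ is Gaussian and translation-invariant, with $\hat\mu_\infty(\Psi)=e^{-\frac12\mathcal Q_\infty(\Psi,\Psi)}$ for all $\Psi\in\mathcal S$; (ii) $\mu_\infty$ is stationary: the image of $\mu_\infty$ under $U(t)$ is $\mu_\infty$ for all $t\in\mathbb R$; (iii) $U(t)$ is mixing with respect to $\mu_\infty$: $\lim_{t\to\infty}\int f(U(t)Y)g(Y)\,\mu_\infty(dY)=\int f\,d\mu_\infty\int g\,d\mu_\infty$ for all $f,g\in L^2(\mathcal H_\alpha,\mu_\infty)$; in particular, $U(t)$ is ergodic with respect to $\mu_\infty$. -/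

import Mathlib

open MeasureTheory Filter Topology
open scoped BigOperators

noncomputable section

namespace HarmonicCrystal

/-! ### Lattice, phase space and test sequences -/

/-- The lattice `ℤ^d`. -/
abbrev Latt (d : ℕ) := Fin d → ℤ

/-- Index set of the `2n` components of `Y(x) = (Y⁰(x), Y¹(x)) = (u(x), v(x))`:
`Sum.inl a` is the component `u_a`, `Sum.inr a` is the component `v_a`. -/
abbrev Comp (n : ℕ) := Fin n ⊕ Fin n

/-- The space `ℝ^n ⊕ ℝ^n` of values `Y(x)`, with `|Y(x)|² = |u(x)|² + |v(x)|²`. -/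
abbrev Fib (n : ℕ) := EuclideanSpace ℝ (Comp n)

/-- The Euclidean length `|x|` of a lattice point. -/
def len {d : ℕ} (x : Latt d) : ℝ := Real.sqrt (∑ i, (x i : ℝ) ^ 2)

/-- `⟨x⟩ = √(1 + |x|²)`. -/
def bracket {d : ℕ} (x : Latt d) : ℝ := Real.sqrt (1 + len x ^ 2)

theorem bracket_pos {d : ℕ} (x : Latt d) : 0 < bracket x :=
  Real.sqrt_pos.2 (by positivity)

/-- The sequences `Y` with `∑ₓ ⟨x⟩^{2α} |Y(x)|² < ∞`, as a linear subspace. -/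
def phaseSubmodule (d n : ℕ) (α : ℝ) : Submodule ℝ (Latt d → Fib n) where
  carrier := {Y | Summable fun x => bracket x ^ (2 * α) * ‖Y x‖ ^ 2}
  zero_mem' := by simp [summable_zero]
  add_mem' := by
    intro Y Z hY hZ
    refine Summable.of_nonneg_of_le (fun x => ?_) (fun x => ?_) ((hY.add hZ).mul_left 2)
    · have := (bracket_pos x).le
      positivity
    · have h1 : 0 ≤ bracket x ^ (2 * α) := Real.rpow_nonneg (bracket_pos x).le _
      have h2 : ‖Y x + Z x‖ ^ 2 ≤ 2 * (‖Y x‖ ^ 2 + ‖Z x‖ ^ 2) := by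
        have := norm_add_le (Y x) (Z x)
        nlinarith [sq_nonneg (‖Y x‖ - ‖Z x‖), norm_nonneg (Y x + Z x),
          norm_nonneg (Y x), norm_nonneg (Z x)]
      calc bracket x ^ (2 * α) * ‖(Y + Z) x‖ ^ 2
          ≤ bracket x ^ (2 * α) * (2 * (‖Y x‖ ^ 2 + ‖Z x‖ ^ 2)) :=
            mul_le_mul_of_nonneg_left h2 h1
        _ = 2 * (bracket x ^ (2 * α) * ‖Y x‖ ^ 2 + bracket x ^ (2 * α) * ‖Z x‖ ^ 2) := by ring
  smul_mem' := by
    intro c Y hY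
    have h : Summable fun x => c ^ 2 * (bracket x ^ (2 * α) * ‖Y x‖ ^ 2) := hY.mul_left _
    refine h.congr (fun x => ?_)
    simp only [Pi.smul_apply, norm_smul, mul_pow, Real.norm_eq_abs, sq_abs]
    ring

/-- The phase space `ℋ_α`. -/
def PhaseSpace (d n : ℕ) (α : ℝ) : Type := phaseSubmodule d n α

instance (d n : ℕ) (α : ℝ) : AddCommGroup (PhaseSpace d n α) :=
  inferInstanceAs (AddCommGroup (phaseSubmodule d n α))

instance (d n : ℕ) (α : ℝ) : Module ℝ (PhaseSpace d n α) :=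
  inferInstanceAs (Module ℝ (phaseSubmodule d n α))

instance (d n : ℕ) (α : ℝ) : CoeFun (PhaseSpace d n α) (fun _ => Latt d → Fib n) :=
  ⟨fun Y => Y.1⟩

theorem bracket_rpow_sq {d : ℕ} (α : ℝ) (x : Latt d) :
    (bracket x ^ α) ^ 2 = bracket x ^ (2 * α) := by
  rw [← Real.rpow_natCast, ← Real.rpow_mul (bracket_pos x).le]
  congr 1
  push_cast
  ring

/-- `Y ↦ (⟨x⟩^α Y(x))ₓ`, a linear injection of `ℋ_α` into the unweighted Hilbert space `ℓ²`. -/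
def weight (d n : ℕ) (α : ℝ) : PhaseSpace d n α →ₗ[ℝ] lp (fun _ : Latt d => Fib n) 2 where
  toFun Y := ⟨fun x => bracket x ^ α • Y x, by
    refine (memℓp_gen_iff (by norm_num)).2 ?_
    have h : Summable fun x => bracket x ^ (2 * α) * ‖Y x‖ ^ 2 := Y.2
    refine h.congr (fun x => ?_)
    rw [norm_smul, ENNReal.toReal_ofNat, Real.rpow_ofNat, mul_pow, Real.norm_eq_abs, sq_abs,
      bracket_rpow_sq]⟩
  map_add' Y Z := by
    ext x : 2
    exact smul_add (bracket x ^ α) (Y x) (Z x)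
  map_smul' c Y := by
    ext x : 2
    exact smul_comm (bracket x ^ α) c (Y x)

theorem weight_injective (d n : ℕ) (α : ℝ) : Function.Injective (weight d n α) := by
  intro Y Z h
  refine Subtype.ext (funext fun x => ?_)
  have h1 : bracket x ^ α • Y x = bracket x ^ α • Z x := congrFun (congrArg Subtype.val h) x
  exact smul_right_injective _ (Real.rpow_pos_of_pos (bracket_pos x) α).ne' h1

/-- The norm of `ℋ_α`, `‖Y‖_α² = ∑ₓ ⟨x⟩^{2α} |Y(x)|²`; see `norm_sq_eq`. -/
instance (d n : ℕ) (α : ℝ) : NormedAddCommGroup (PhaseSpace d n α) :=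
  NormedAddCommGroup.induced _ _ (weight d n α) (weight_injective d n α)

instance (d n : ℕ) (α : ℝ) : NormedSpace ℝ (PhaseSpace d n α) :=
  NormedSpace.induced ℝ _ _ (weight d n α)

theorem norm_sq_eq {d n : ℕ} {α : ℝ} (Y : PhaseSpace d n α) :
    ‖Y‖ ^ 2 = ∑' x, bracket x ^ (2 * α) * ‖Y x‖ ^ 2 := by
  have h : ‖Y‖ = ‖weight d n α Y‖ := rfl
  have h2 := lp.norm_rpow_eq_tsum (p := 2) (by norm_num) (weight d n α Y)
  rw [ENNReal.toReal_ofNat, Real.rpow_ofNat] at h2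
  rw [h, h2]
  refine tsum_congr (fun x => ?_)
  have h3 : (weight d n α Y : Latt d → Fib n) x = bracket x ^ α • Y x := rfl
  rw [h3, norm_smul, Real.rpow_ofNat, mul_pow, Real.norm_eq_abs, sq_abs, bracket_rpow_sq]

/-- `ℋ_α` carries its Borel `σ`-algebra. -/
instance (d n : ℕ) (α : ℝ) : MeasurableSpace (PhaseSpace d n α) := borel _

instance (d n : ℕ) (α : ℝ) : BorelSpace (PhaseSpace d n α) := ⟨rfl⟩

/-- The space `𝒮` of rapidly decreasing sequences `Ψ = (Ψ⁰, Ψ¹)` on `ℤ^d`. -/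
def RapidSeq (d n : ℕ) : Submodule ℝ (Latt d → Fib n) where
  carrier := {Ψ | ∀ N : ℕ, ∃ C : ℝ, ∀ x, bracket x ^ N * ‖Ψ x‖ ≤ C}
  zero_mem' := fun N => ⟨0, fun x => by simp⟩
  add_mem' := by
    intro Ψ Φ hΨ hΦ N
    obtain ⟨C, hC⟩ := hΨ N
    obtain ⟨D, hD⟩ := hΦ N
    refine ⟨C + D, fun x => ?_⟩
    have h1 : 0 ≤ bracket x ^ N := pow_nonneg (bracket_pos x).le _
    have h2 := mul_le_mul_of_nonneg_left (norm_add_le (Ψ x) (Φ x)) h1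
    have h3 := hC x
    have h4 := hD x
    simp only [Pi.add_apply]
    linarith [mul_add (bracket x ^ N) ‖Ψ x‖ ‖Φ x‖]
  smul_mem' := by
    intro c Ψ hΨ N
    obtain ⟨C, hC⟩ := hΨ N
    refine ⟨|c| * C, fun x => ?_⟩
    have h := mul_le_mul_of_nonneg_left (hC x) (abs_nonneg c)
    simp only [Pi.smul_apply, norm_smul, Real.norm_eq_abs]
    linarith [mul_left_comm (bracket x ^ N) |c| ‖Ψ x‖]

/-- The pairing `⟨Y, Ψ⟩ = ∑ₓ (Y(x), Ψ(x))`. -/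
def pairing {d n : ℕ} {α : ℝ} (Y : PhaseSpace d n α) (Ψ : RapidSeq d n) : ℝ :=
  ∑' x, ∑ a, Y x a * Ψ.1 x a

/-! ### The force matrix and its spectral data -/

/-- The scalar product `(x, θ)` of a lattice point and a point of `ℝ^d`. -/
def dotZ {d : ℕ} (x : Latt d) (θ : Fin d → ℝ) : ℝ := ∑ i, (x i : ℝ) * θ i

/-- The Fourier series `∑ₓ e^{i(x,θ)} A(x)` of a matrix-valued sequence, as a
`2π`-periodic function of `θ ∈ ℝ^d`. -/
def fourier {d : ℕ} {ι : Type} (A : Latt d → Matrix ι ι ℝ) (θ : Fin d → ℝ) : Matrix ι ι ℂ :=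
  Matrix.of fun a b => ∑' x, Complex.exp (Complex.I * (dotZ x θ : ℂ)) * (A x a b : ℂ)

/-- The fundamental cell `(-π, π]^d` of the torus `ℝ^d / (2πℤ)^d`. -/
def cell (d : ℕ) : Set (Fin d → ℝ) := Set.pi Set.univ fun _ => Set.Ioc (-Real.pi) Real.pi

section Spectral

variable {d n : ℕ} (V : Latt d → Matrix (Fin n) (Fin n) ℝ)

/-- `Ω(θ) = V̂(θ)^{1/2}` (functional calculus of a Hermitian matrix). -/
def Omega (θ : Fin d → ℝ) : Matrix (Fin n) (Fin n) ℂ := cfc Real.sqrt (fourier V θ)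

/-- The finite set of distinct eigenvalues of `Ω(θ)`. -/
def freqs (θ : Fin d → ℝ) : Finset ℝ :=
  (Matrix.finite_real_spectrum (A := Omega V θ)).toFinset

/-- The number `s ≤ n` of bands: the maximal (equivalently, the generic) number of distinct
eigenvalues of `Ω(θ)`. -/
def numBands : ℕ := sSup (Set.range fun θ => (freqs V θ).card)

/-- The band functions: `ω_0(θ) < ω_1(θ) < …` are the distinct eigenvalues of `Ω(θ)` in increasing
order (with the value `0` when `Ω(θ)` has not that many eigenvalues). -/
def omega (σ : Fin (numBands V)) (θ : Fin d → ℝ) : ℝ :=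
  ((freqs V θ).sort (· ≤ ·)).getD σ 0

/-- The spectral projection `Π_σ(θ)` of `Ω(θ)` for the eigenvalue `ω_σ(θ)`. -/
def specProj (σ : Fin (numBands V)) (θ : Fin d → ℝ) : Matrix (Fin n) (Fin n) ℂ :=
  cfc (fun r : ℝ => if r = omega V σ θ then 1 else 0) (Omega V θ)

/-- The complement of the exceptional set `𝒞_*`: the largest open set of `θ` on which `Ω(θ)` has
exactly `s` distinct eigenvalues and all of them are real-analytic functions of `θ`. -/
def regularSet : Set (Fin d → ℝ) :=
  {Θ | ∃ O : Set (Fin d → ℝ), IsOpen O ∧ Θ ∈ O ∧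
    (∀ θ ∈ O, (freqs V θ).card = numBands V) ∧
    ∀ σ : Fin (numBands V), AnalyticOnNhd ℝ (omega V σ) O}

/-- The partial derivative `∂ω_σ/∂θ_l`. -/
def dOmega (σ : Fin (numBands V)) (l : Fin d) (θ : Fin d → ℝ) : ℝ :=
  fderiv ℝ (omega V σ) θ (Pi.single l 1)

open scoped Matrix.Norms.L2Operator in
/-- E1: exponential decay of the force matrix. -/
def CondE1 : Prop :=
  ∃ C γ : ℝ, 0 < C ∧ 0 < γ ∧ ∀ x, ‖V x‖ ≤ C * Real.exp (-γ * len x)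

/-- E2: symmetry. -/
def CondE2 : Prop := ∀ (x : Latt d) (k l : Fin n), V (-x) l k = V x k l

open scoped ComplexOrder in
/-- E3: `V̂(θ)` is non-negative definite. -/
def CondE3 : Prop := ∀ θ : Fin d → ℝ, (fourier V θ).PosSemidef

/-- E4: no `∂ω_σ/∂θ_l` vanishes identically. Bands are local analytic functions on the possibly
disconnected set `𝕋^d ∖ 𝒞_*`, so that this is required on every open piece of it. -/
def CondE4 : Prop :=
  ∀ (l : Fin d) (σ : Fin (numBands V)) (O : Set (Fin d → ℝ)),
    IsOpen O → O.Nonempty → O ⊆ regularSet V → ∃ θ ∈ O, dOmega V σ l θ ≠ 0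

open scoped Matrix.Norms.L2Operator in
/-- E6: `V̂(θ)` is invertible for almost all `θ` and `‖V̂(θ)⁻¹‖ ∈ L¹(𝕋^d)`. -/
def CondE6 : Prop :=
  (∀ᵐ θ : Fin d → ℝ, (fourier V θ).det ≠ 0) ∧
    IntegrableOn (fun θ => ‖(fourier V θ)⁻¹‖) (cell d)

end Spectral

/-! ### The dynamics -/

section Dynamics

variable {d n : ℕ} {α : ℝ} (V : Latt d → Matrix (Fin n) (Fin n) ℝ)

/-- `t ↦ Y(t) = (u(·,t), v(·,t))` lies in `C(ℝ, ℋ_α)` and solves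
`u̇(x,t) = v(x,t)`, `v̇(x,t) = - ∑_y V(x-y) u(y,t)`. -/
def IsSolution (Y : ℝ → PhaseSpace d n α) : Prop :=
  Continuous Y ∧ ∀ (x : Latt d) (a : Fin n) (t : ℝ),
    HasDerivAt (fun τ => Y τ x (Sum.inl a)) (Y t x (Sum.inr a)) t ∧
    HasDerivAt (fun τ => Y τ x (Sum.inr a))
      (-∑' y, ∑ b, V (x - y) a b * Y t y (Sum.inl b)) t

/-- `U(t) Y₀` is the value at time `t` of the solution with initial datum `Y₀` (which exists and is
unique under E1 and E2). -/
def flow (t : ℝ) (Y₀ : PhaseSpace d n α) : PhaseSpace d n α :=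
  Classical.epsilon (fun Y : ℝ → PhaseSpace d n α => IsSolution V Y ∧ Y 0 = Y₀) t

/-- `μ_t`, the distribution of `U(t) Y₀` when `Y₀` has the distribution `μ₀`. -/
def evolved (μ₀ : Measure (PhaseSpace d n α)) (t : ℝ) : Measure (PhaseSpace d n α) :=
  μ₀.map (flow V t)

end Dynamics

/-! ### Measures on the phase space -/

section Measures

variable {d n : ℕ} {α : ℝ}

/-- The characteristic functional `μ̂(Ψ) = ∫ exp(i⟨Y, Ψ⟩) μ(dY)`. -/
def charFunctional (μ : Measure (PhaseSpace d n α)) (Ψ : RapidSeq d n) : ℂ :=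
  ∫ Y, Complex.exp (Complex.I * (pairing Y Ψ : ℂ)) ∂μ

/-- Gaussian measure (of zero mean): `μ̂(Ψ) = exp(-𝒬(Ψ,Ψ)/2)` with a real non-negative quadratic
form `𝒬` on `𝒮`. -/
def IsGaussianMeasure (μ : Measure (PhaseSpace d n α)) : Prop :=
  ∃ Q : QuadraticForm ℝ (RapidSeq d n), (∀ Ψ, 0 ≤ Q Ψ) ∧
    ∀ Ψ, charFunctional μ Ψ = Complex.exp (-((Q Ψ : ℝ) : ℂ) / 2)

/-- The image `T_h B` of a set under the shift `(T_h Y)(x) = Y(x - h)`. -/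
def shiftSet (h : Latt d) (B : Set (PhaseSpace d n α)) : Set (PhaseSpace d n α) :=
  {Y | ∃ Z ∈ B, ∀ x, Y x = Z (x - h)}

/-- `μ(T_h B) = μ(B)` for all Borel sets `B` and all `h ∈ ℤ^d`. -/
def TranslationInvariant (μ : Measure (PhaseSpace d n α)) : Prop :=
  ∀ (h : Latt d) (B : Set (PhaseSpace d n α)), MeasurableSet B → μ (shiftSet h B) = μ B

/-- S1: zero expectation value. -/
def CondS1 (μ : Measure (PhaseSpace d n α)) : Prop :=
  ∀ (x : Latt d) (a : Comp n), Integrable (fun Y : PhaseSpace d n α => Y x a) μ ∧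
    ∫ Y : PhaseSpace d n α, Y x a ∂μ = 0

/-- All components `Y_a(x)` have finite second moments, so that the covariance is defined. -/
def FiniteSecondMoments (μ : Measure (PhaseSpace d n α)) : Prop :=
  ∀ (x : Latt d) (a : Comp n), MemLp (fun Y : PhaseSpace d n α => Y x a) 2 μ

/-- The covariance `Q(x,y) = E (Y(x) ⊗ Y(y))`, a real `2n × 2n` matrix whose four `n × n` blocks are
`Q^{ij}(x,y)`, `i, j = 0, 1`. -/
def cov (μ : Measure (PhaseSpace d n α)) (x y : Latt d) : Matrix (Comp n) (Comp n) ℝ :=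
  Matrix.of fun a b => ∫ Y : PhaseSpace d n α, Y x a * Y y b ∂μ

open scoped Matrix.Norms.L2Operator in
/-- S2: `|Q₀(x,y)| ≤ h(|x-y|)` with `r^{d-1} h(r) ∈ L¹(0,∞)`. The function `h` is meant to be regular
enough (for instance, non-increasing) for this to give `∑_z h(|z|) < ∞`; an `L¹` condition alone says
nothing on the values of `h` at the countably many distances `|z|`. A bound on the whole matrix is
equivalent to bounds on the four blocks, up to a constant factor in `h`. -/
def CondS2 (μ : Measure (PhaseSpace d n α)) : Prop :=
  FiniteSecondMoments μ ∧
    ∃ h : ℝ → ℝ, IntegrableOn (fun r => r ^ (d - 1) * h r) (Set.Ioi 0) ∧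
      (Summable fun z : Latt d => h (len z)) ∧ ∀ x y, ‖cov μ x y‖ ≤ h (len (x - y))

/-- The first `k` coordinates `x̄ = (x_1, …, x_k)`. -/
def headPart (k : ℕ) (x : Latt d) : {j : Fin d // (j : ℕ) < k} → ℤ := fun j => x j

/-- The last `d - k` coordinates `x̃ = (x_{k+1}, …, x_d)`. -/
def tailPart (k : ℕ) (x : Latt d) : {j : Fin d // ¬ (j : ℕ) < k} → ℤ := fun j => x j

/-- The set `𝒩^k` of vectors `𝐧 = (n_1, …, n_k)` with `n_j ∈ {1, 2}`. -/
abbrev Corner (d k : ℕ) := {j : Fin d // (j : ℕ) < k} → ({1, 2} : Finset ℕ)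

open scoped Matrix.Norms.L2Operator in
/-- S3: `Q₀(x,y) = q₀(x̄, ȳ, x̃ - ỹ)`, and in the corner `(-1)^{n_j} y_j → +∞`, `j = 1, …, k`,
`q₀(ȳ + z̄, ȳ, z̃)` tends to `q_𝐧(z)`, the correlation matrix of a translation-invariant
probability measure `μ_𝐧` on `ℋ_α` with zero mean. -/
def CondS3 (μ : Measure (PhaseSpace d n α)) (k : ℕ)
    (q : Corner d k → Latt d → Matrix (Comp n) (Comp n) ℝ) : Prop :=
  (∃ q₀ : ({j : Fin d // (j : ℕ) < k} → ℤ) → ({j : Fin d // (j : ℕ) < k} → ℤ) →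
      ({j : Fin d // ¬ (j : ℕ) < k} → ℤ) → Matrix (Comp n) (Comp n) ℝ,
    (∀ x y, cov μ x y = q₀ (headPart k x) (headPart k y) (tailPart k x - tailPart k y)) ∧
    ∀ (nn : Corner d k) (z : Latt d) (ε : ℝ), 0 < ε → ∃ N : ℕ,
      ∀ y : {j : Fin d // (j : ℕ) < k} → ℤ, (∀ j, (N : ℤ) < (-1) ^ (nn j : ℕ) * y j) →
        ‖q₀ (y + headPart k z) y (tailPart k z) - q nn z‖ < ε) ∧
  ∀ nn : Corner d k, ∃ ν : Measure (PhaseSpace d n α), IsProbabilityMeasure ν ∧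
    TranslationInvariant ν ∧ CondS1 ν ∧ FiniteSecondMoments ν ∧
    ∀ x y, cov ν x y = q nn (x - y)

/-- Weak convergence `μ_t → μ` as `t → ∞`. -/
def WeaklyConverges (m : ℝ → Measure (PhaseSpace d n α)) (μ : Measure (PhaseSpace d n α)) : Prop :=
  ∀ f : BoundedContinuousFunction (PhaseSpace d n α) ℝ,
    Tendsto (fun t => ∫ Y, f Y ∂(m t)) atTop (𝓝 (∫ Y, f Y ∂μ))

/-- A flow is mixing with respect to `μ`. -/
def IsMixingFlow (U : ℝ → PhaseSpace d n α → PhaseSpace d n α)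
    (μ : Measure (PhaseSpace d n α)) : Prop :=
  ∀ f g : PhaseSpace d n α → ℂ, MemLp f 2 μ → MemLp g 2 μ →
    Tendsto (fun t => ∫ Y, f (U t Y) * g Y ∂μ) atTop (𝓝 ((∫ Y, f Y ∂μ) * ∫ Y, g Y ∂μ))

/-- A flow is ergodic with respect to the probability measure `μ`: sets that are invariant (up to
null sets) under all `U(t)` have measure `0` or `1`. -/
def IsErgodicFlow (U : ℝ → PhaseSpace d n α → PhaseSpace d n α)
    (μ : Measure (PhaseSpace d n α)) : Prop :=
  ∀ B : Set (PhaseSpace d n α), MeasurableSet B → (∀ t, U t ⁻¹' B =ᵐ[μ] B) → μ B = 0 ∨ μ B = 1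

end Measures

/-! ### The limit covariance -/

section Limit

variable {d n : ℕ} (V : Latt d → Matrix (Fin n) (Fin n) ℝ) (k : ℕ)
  (q : Corner d k → Latt d → Matrix (Comp n) (Comp n) ℝ)

/-- `Π_σ(θ) A Π_σ'(θ)`; for `A` the block `q̂_𝐧^{ij}(θ)` of `q̂_𝐧(θ)` this is
`p^{ij}_{𝐧,σσ'}(θ)`. -/
def sandwich (σ σ' : Fin (numBands V)) (A : Matrix (Fin n) (Fin n) ℂ) (θ : Fin d → ℝ) :
    Matrix (Fin n) (Fin n) ℂ :=
  specProj V σ θ * A * specProj V σ' θ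

/-- E5': wherever `ω_σ + ω_σ'` or `ω_σ - ω_σ'` with `σ ≠ σ'` is a nonzero constant on an open piece
of `𝕋^d ∖ 𝒞_*`, the stated relations between the blocks `p_𝐧^{ij} = Π_σ q̂_𝐧^{ij} Π_σ'` hold. -/
def CondE5' : Prop :=
  ∀ (σ σ' : Fin (numBands V)), σ ≠ σ' → ∀ (O : Set (Fin d → ℝ)) (c : ℝ),
    IsOpen O → O.Nonempty → O ⊆ regularSet V → c ≠ 0 →
    ((∀ θ ∈ O, omega V σ θ + omega V σ' θ = c) → ∀ (nn : Corner d k), ∀ θ ∈ O,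
      sandwich V σ σ' (fourier (q nn) θ).toBlocks₂₂ θ -
          ((omega V σ θ * omega V σ' θ : ℝ) : ℂ) •
            sandwich V σ σ' (fourier (q nn) θ).toBlocks₁₁ θ = 0 ∧
        ((omega V σ θ : ℝ) : ℂ) • sandwich V σ σ' (fourier (q nn) θ).toBlocks₁₂ θ +
          ((omega V σ' θ : ℝ) : ℂ) • sandwich V σ σ' (fourier (q nn) θ).toBlocks₂₁ θ = 0) ∧
    ((∀ θ ∈ O, omega V σ θ - omega V σ' θ = c) → ∀ (nn : Corner d k), ∀ θ ∈ O,
      sandwich V σ σ' (fourier (q nn) θ).toBlocks₂₂ θ +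
          ((omega V σ θ * omega V σ' θ : ℝ) : ℂ) •
            sandwich V σ σ' (fourier (q nn) θ).toBlocks₁₁ θ = 0 ∧
        ((omega V σ θ : ℝ) : ℂ) • sandwich V σ σ' (fourier (q nn) θ).toBlocks₁₂ θ -
          ((omega V σ' θ : ℝ) : ℂ) • sandwich V σ σ' (fourier (q nn) θ).toBlocks₂₁ θ = 0)

/-- `C(θ) = (0, Ω⁻¹; -Ω, 0)`. -/
def matC (θ : Fin d → ℝ) : Matrix (Comp n) (Comp n) ℂ :=
  Matrix.fromBlocks 0 (Omega V θ)⁻¹ (-Omega V θ) 0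

/-- `C^*(θ) = (0, -Ω; Ω⁻¹, 0)`. -/
def matCstar (θ : Fin d → ℝ) : Matrix (Comp n) (Comp n) ℂ :=
  Matrix.fromBlocks 0 (-Omega V θ) (Omega V θ)⁻¹ 0

/-- `L_1^+(A) = (A + C A C^*) / 2`. -/
def L1plus (A : Matrix (Comp n) (Comp n) ℂ) (θ : Fin d → ℝ) : Matrix (Comp n) (Comp n) ℂ :=
  (1 / 2 : ℂ) • (A + matC V θ * A * matCstar V θ)

/-- `L_2^-(A) = (C A - A C^*) / 2`. -/
def L2minus (A : Matrix (Comp n) (Comp n) ℂ) (θ : Fin d → ℝ) : Matrix (Comp n) (Comp n) ℂ :=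
  (1 / 2 : ℂ) • (matC V θ * A - A * matCstar V θ)

variable {k} in
/-- The sum over the `m`-element subsets `p` of `{1, …, k}` of
`∏_{j ∈ p} sgn(∂ω_σ/∂θ_j) (-1)^{n_j}`. -/
def signSum (nn : Corner d k) (σ : Fin (numBands V)) (m : ℕ) (θ : Fin d → ℝ) : ℝ :=
  ∑ p ∈ Finset.powersetCard m (Finset.univ : Finset {j : Fin d // (j : ℕ) < k}),
    ∏ j ∈ p, Real.sign (dOmega V σ j θ) * (-1) ^ (nn j : ℕ)

variable {k} in
/-- `S^{even}_{k,𝐧}(ω_σ)`: the terms with even `m ∈ {1, …, k}`. -/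
def Seven (nn : Corner d k) (σ : Fin (numBands V)) (θ : Fin d → ℝ) : ℝ :=
  ∑ m ∈ (Finset.Icc 1 k).filter Even, signSum V nn σ m θ

variable {k} in
/-- `S^{odd}_{k,𝐧}(ω_σ)`: the terms with odd `m ∈ {1, …, k}`. -/
def Sodd (nn : Corner d k) (σ : Fin (numBands V)) (θ : Fin d → ℝ) : ℝ :=
  ∑ m ∈ (Finset.Icc 1 k).filter Odd, signSum V nn σ m θ

/-- `𝐌^+_{k,σ}(θ)`. -/
def Mplus (σ : Fin (numBands V)) (θ : Fin d → ℝ) : Matrix (Comp n) (Comp n) ℂ :=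
  (1 / 2 ^ k : ℂ) • ∑ nn : Corner d k,
    ((1 + Seven V nn σ θ : ℝ) : ℂ) • L1plus V (fourier (q nn) θ) θ

/-- `𝐌^-_{k,σ}(θ)`. -/
def Mminus (σ : Fin (numBands V)) (θ : Fin d → ℝ) : Matrix (Comp n) (Comp n) ℂ :=
  (1 / 2 ^ k : ℂ) • ∑ nn : Corner d k,
    ((Sodd V nn σ θ : ℝ) : ℂ) • L2minus V (fourier (q nn) θ) θ

/-- The projection `Π_σ(θ)` acting on both components of `Y = (Y⁰, Y¹)`. -/
def specProj2 (σ : Fin (numBands V)) (θ : Fin d → ℝ) : Matrix (Comp n) (Comp n) ℂ :=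
  Matrix.fromBlocks (specProj V σ θ) 0 0 (specProj V σ θ)

/-- `q̂_∞(θ) = ∑_σ Π_σ (𝐌^+_{k,σ} + i 𝐌^-_{k,σ}) Π_σ`. -/
def qInfHat (θ : Fin d → ℝ) : Matrix (Comp n) (Comp n) ℂ :=
  ∑ σ : Fin (numBands V),
    specProj2 V σ θ * (Mplus V k q σ θ + Complex.I • Mminus V k q σ θ) * specProj2 V σ θ

/-- `q_∞(x) = (2π)^{-d} ∫_{𝕋^d} e^{-i(x,θ)} q̂_∞(θ) dθ`. -/
def qInf (x : Latt d) : Matrix (Comp n) (Comp n) ℂ :=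
  Matrix.of fun a b => (1 / (2 * Real.pi) ^ d : ℂ) *
    ∫ θ in cell d, Complex.exp (-Complex.I * (dotZ x θ : ℂ)) * qInfHat V k q θ a b

/-- `𝒬_∞(Ψ,Ψ) = ∑_{x,y} (q_∞(x-y), Ψ(x) ⊗ Ψ(y))`. -/
def QInfForm (Ψ : RapidSeq d n) : ℂ :=
  ∑' p : Latt d × Latt d, ∑ a, ∑ b,
    qInf V k q (p.1 - p.2) a b * (Ψ.1 p.1 a : ℂ) * (Ψ.1 p.2 b : ℂ)

end Limit

end HarmonicCrystal

end

open HarmonicCrystal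

/-! Everything is reduced to one quadratic form. The Fourier transform diagonalizes the dynamics:
the functional `Y ↦ ⟨U(t)Y, Ψ⟩` has the amplitude `∑ e^{itλ} F_λ`, summed over the branches `λ =
±ω_σ`, where `F_λ` is the branch part of the transform of `Ψ` (`Rep.comp_prop`, `Setup.rep_evol`).
Since `μ₀` is Gaussian, the characteristic functional of `μ_t` at `Ψ` is the exponential of minus
half the initial covariance form at this amplitude (`Setup.integral_exp_of_rep`). The core is the
limit of this form, `WaveData.tendsto_form`.

Each branch amplitude is split according to the corner `𝐧` that contains the first `k` components of
its velocity `∇λ`; by E4 these are nonzero almost everywhere. A wave packet leaves every half-space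
opposed to its velocity (`tendsto_cutOp_coef`); this follows from powers of the position operator
divided by `t`, without pointwise decay estimates. Far inside the corner the covariance acts as the
convolution with `q_𝐧` (`exists_norm_covOp_cutOp_le`), that is, as multiplication by `q̂_𝐧`. The
form thus becomes a sum of integrals of `e^{it(λ'-λ)}` times fixed integrable functions. Terms with
`λ = λ'` do not depend on `t`. In the others either the phase difference has a nonzero gradient and
the Riemann–Lebesgue lemma applies, or it is constant on an open set and E5' makes the integrand
vanish there (`ae_nonresonant`, `tendsto_cross`). That almost every momentum falls under one of
these cases rests on analyticity: almost every zero of a real-analytic function is interior to its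
zero set (`ae_eventually_eq_zero_of_eq_zero`), and Hankel determinants of power traces show that the
bands are analytic almost everywhere (`analyticAt_omega`, `ae_mem_goodSet`).

The limit form is the one given by `q̂_∞`, because the product of `1 ± (-1)^{n_j} sgn ∂_jω_σ` over
`j ≤ k` is `2^k` times the indicator of a velocity corner; expanded over subsets it yields the even
and odd sign sums (`one_add_Seven`, `qInfHat_eq`).

By E6 the branch amplitudes lie in `L²`, so second moments are bounded uniformly in time and space.
Choosing a weight exponent strictly between `α` and `-d/2`, a compact embedding and Markov's
inequality give tightness (`Setup.isTight`), and Prokhorov's theorem together with the convergence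
of characteristic functionals gives the limit measure. It is stationary as a limit of time-shifted
states, and translation-invariant because its form is a Fourier multiplier. For mixing, the limit
functional at `U(t)^*Ψ + Φ` factorizes up to mixed terms, which vanish by the Riemann–Lebesgue lemma
since every `λ` has nonzero gradient (`Setup.tendsto_integral_exp_mixed`); density of exponentials
extends this to `L²`. Ergodicity is mixing applied to indicators. -/

noncomputable section

namespace HarmonicCrystal

/-! ### Zero sets of real-analytic functions -/

section ZeroSets

variable {E F : Type*} [NormedAddCommGroup E] [NormedSpace ℝ E] [FiniteDimensional ℝ E]
  [MeasurableSpace E] [BorelSpace E] [NormedAddCommGroup F] [NormedSpace ℝ F]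

/-- On a line with direction `v`, a zero with nonzero derivative is isolated. The exceptional set
thus meets every such line in a countable set, and is null by Fubini. -/
theorem ae_fderiv_apply_eq_zero_of_eq_zero (μ : Measure E) [μ.IsAddHaarMeasure]
    {g : E → F} {U : Set E} (hU : IsOpen U)
    (hg : ∀ x ∈ U, DifferentiableAt ℝ g x) (hg' : ContinuousOn (fderiv ℝ g) U) (v : E) :
    ∀ᵐ x ∂μ, x ∈ U → g x = 0 → fderiv ℝ g x v = 0 := by
  set bad : Set E := {x | x ∈ U ∧ g x = 0 ∧ fderiv ℝ g x v ≠ 0} with hbad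
  have hc : ContinuousOn g U := fun x hx => (hg x hx).continuousAt.continuousWithinAt
  have hc' : ContinuousOn (fun x => fderiv ℝ g x v) U := hg'.clm_apply continuousOn_const
  have h1 : IsOpen (U ∩ g ⁻¹' {0}ᶜ) := hc.isOpen_inter_preimage hU isOpen_compl_singleton
  have h2 : IsOpen (U ∩ (fun x => fderiv ℝ g x v) ⁻¹' {0}ᶜ) :=
    hc'.isOpen_inter_preimage hU isOpen_compl_singleton
  have hmeas : MeasurableSet bad := by
    have : bad = (U ∩ (fun x => fderiv ℝ g x v) ⁻¹' {0}ᶜ) \ (U ∩ g ⁻¹' {0}ᶜ) := by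
      ext x
      simp only [hbad, Set.mem_ofPred_eq, Set.mem_sdiff, Set.mem_inter_iff, Set.mem_preimage,
        Set.mem_compl_iff, Set.mem_singleton_iff]
      tauto
    rw [this]
    exact h2.measurableSet.diff h1.measurableSet
  have key : ∀ᵐ x ∂μ, x ∈ badᶜ := by
    refine ae_mem_of_ae_add_linearMap_mem (LinearMap.toSpanSingleton ℝ E v) volume μ
      hmeas.compl fun y => ?_
    set T : Set ℝ := {t | y + t • v ∈ bad}
    have hT : T.Countable := by
      have : DiscreteTopology T := by
        rw [discreteTopology_subtype_iff]
        rintro t ⟨ht1, ht2, ht3⟩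
        have hd : HasDerivAt (fun t : ℝ => g (y + t • v)) (fderiv ℝ g (y + t • v) v) t := by
          have h3 := (hg _ ht1).hasFDerivAt
          have h4 : HasDerivAt (fun t : ℝ => y + t • v) v t := by
            simpa using ((hasDerivAt_id t).smul_const v).const_add y
          exact h3.comp_hasDerivAt t h4
        have h5 := hd.eventually_ne (c := 0) ht3
        rw [inf_principal_eq_bot]
        filter_upwards [h5] with s hs hsT
        exact hs hsT.2.1
      have : Countable T := TopologicalSpace.separableSpace_iff_countable.1 inferInstance
      exact Set.countable_coe_iff.1 this
    have := hT.ae_notMem (volume : Measure ℝ)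
    filter_upwards [this] with t ht
    rw [LinearMap.toSpanSingleton_apply]
    exact ht
  filter_upwards [key] with x hx hxU h0
  by_contra hne
  exact hx ⟨hxU, h0, hne⟩

/-- Almost every zero of a real-analytic function is an interior point of its zero set. -/
theorem ae_eventually_eq_zero_of_eq_zero [CompleteSpace F] (μ : Measure E) [μ.IsAddHaarMeasure]
    {f : E → F} {U : Set E} (hU : IsOpen U) (hf : AnalyticOnNhd ℝ f U) :
    ∀ᵐ x ∂μ, x ∈ U → f x = 0 → ∀ᶠ y in 𝓝 x, f y = 0 := by
  -- The previous lemma for each iterated derivative and each basis direction: off a null set, a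
  -- zero of one derivative is a zero of the next.
  have hstep : ∀ n : ℕ, ∀ᵐ x ∂μ, x ∈ U → iteratedFDeriv ℝ n f x = 0 →
      iteratedFDeriv ℝ (n + 1) f x = 0 := by
    intro n
    have ha : AnalyticOnNhd ℝ (iteratedFDeriv ℝ n f) U := hf.iteratedFDeriv n
    have hb : ∀ i, ∀ᵐ x ∂μ, x ∈ U → iteratedFDeriv ℝ n f x = 0 →
        fderiv ℝ (iteratedFDeriv ℝ n f) x (Module.finBasis ℝ E i) = 0 := fun i =>
      ae_fderiv_apply_eq_zero_of_eq_zero μ hU (fun x hx => (ha x hx).differentiableAt)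
        ha.fderiv.continuousOn _
    filter_upwards [ae_all_iff.2 hb] with x hx hxU h0
    have h1 : fderiv ℝ (iteratedFDeriv ℝ n f) x = 0 := by
      apply ContinuousLinearMap.coe_injective
      exact (Module.finBasis ℝ E).ext fun i => by simpa using hx i hxU h0
    ext m
    rw [iteratedFDeriv_succ_apply_left, h1]
    simp
  filter_upwards [ae_all_iff.2 hstep] with x hx hxU h0
  -- Outside countably many null sets the whole Taylor series vanishes at a zero; connectedness of
  -- `U` plays no role.
  have hall : ∀ n, iteratedFDeriv ℝ n f x = 0 := by
    intro n
    induction n with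
    | zero => ext m; simpa using h0
    | succ n ih => exact hx n hxU ih
  obtain ⟨p, r, hp⟩ := hf x hxU
  have hball : Metric.eball x r ∈ 𝓝 x := Metric.eball_mem_nhds x hp.r_pos
  filter_upwards [hball] with y hy
  have hy' : y - x ∈ Metric.eball (0 : E) r := by
    rw [Metric.mem_eball, edist_zero_right]
    rwa [Metric.mem_eball, edist_eq_enorm_sub] at hy
  have h := hp.hasSum_iteratedFDeriv hy'
  simp only [hall, _root_.zero_apply, smul_zero, add_sub_cancel] at h
  exact h.unique hasSum_zero

end ZeroSets

/-! ### Analyticity of exponential series -/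

section ExpSeries

variable {E : Type*} [NormedAddCommGroup E] [NormedSpace ℝ E] {ι : Type*}

/-- Expanding every exponential and regrouping by degree gives the power series `p`. The hypothesis
`hs` is absolute summability of the double series at radius `r`, which yields both the radius of
convergence and the interchange of sums. -/
theorem analyticAt_zero_tsum_exp (c : ι → ℂ) (l : ι → E →L[ℝ] ℂ) {r : ℝ} (hr : 0 < r)
    (hs : Summable fun x => ‖c x‖ * Real.exp (r * ‖l x‖)) :
    AnalyticAt ℝ (fun h => ∑' x, c x * Complex.exp (l x h)) 0 := by
  classical
  let q : ι → (m : ℕ) → E [×m]→L[ℝ] ℂ := fun x m =>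
    (c x * ((m.factorial : ℂ))⁻¹) •
      (ContinuousMultilinearMap.mkPiAlgebraFin ℝ m ℂ).compContinuousLinearMap (fun _ => l x)
  have hq : ∀ x m, ‖q x m‖ ≤ ‖c x‖ * (‖l x‖ ^ m / m.factorial) := by
    intro x m
    refine ContinuousMultilinearMap.opNorm_le_bound (by positivity) fun v => ?_
    have h1 : q x m v = (c x * ((m.factorial : ℂ))⁻¹) * (List.ofFn fun i => l x (v i)).prod := by
      simp [q]
    rw [h1, List.prod_ofFn, norm_mul, norm_mul, norm_inv, Complex.norm_natCast, norm_prod]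
    have h2 : ∏ i, ‖l x (v i)‖ ≤ ‖l x‖ ^ m * ∏ i, ‖v i‖ := by
      calc ∏ i, ‖l x (v i)‖ ≤ ∏ i, (‖l x‖ * ‖v i‖) :=
            Finset.prod_le_prod (fun _ _ => norm_nonneg _) fun i _ => (l x).le_opNorm _
        _ = ‖l x‖ ^ m * ∏ i, ‖v i‖ := by simp [Finset.prod_mul_distrib]
    calc ‖c x‖ * (m.factorial : ℝ)⁻¹ * ∏ i, ‖l x (v i)‖
        ≤ ‖c x‖ * (m.factorial : ℝ)⁻¹ * (‖l x‖ ^ m * ∏ i, ‖v i‖) := by gcongr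
      _ = _ := by ring
  have hpow : ∀ x (m : ℕ), ‖l x‖ ^ m / m.factorial * r ^ m ≤ Real.exp (r * ‖l x‖) := by
    intro x m
    have := Real.pow_div_factorial_le_exp (r * ‖l x‖) (by positivity) m
    calc _ = (r * ‖l x‖) ^ m / m.factorial := by rw [mul_pow]; ring
      _ ≤ _ := this
  have hqr : ∀ x m, ‖q x m‖ * r ^ m ≤ ‖c x‖ * Real.exp (r * ‖l x‖) := fun x m =>
    calc ‖q x m‖ * r ^ m ≤ ‖c x‖ * (‖l x‖ ^ m / m.factorial) * r ^ m := by
          gcongr; exact hq x m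
      _ = ‖c x‖ * (‖l x‖ ^ m / m.factorial * r ^ m) := by ring
      _ ≤ _ := by gcongr; exact hpow x m
  have hqs : ∀ m, Summable fun x => ‖q x m‖ := by
    intro m
    have h1 : Summable fun x => ‖q x m‖ * r ^ m :=
      Summable.of_nonneg_of_le (fun x => by positivity) (fun x => hqr x m) hs
    have := h1.mul_right (r ^ m)⁻¹
    refine this.congr fun x => ?_
    field_simp
  let p : FormalMultilinearSeries ℝ E ℂ := fun m => ∑' x, q x m
  have hpn : ∀ m, ‖p m‖ * r ^ m ≤ ∑' x, ‖c x‖ * Real.exp (r * ‖l x‖) := by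
    intro m
    calc ‖p m‖ * r ^ m ≤ (∑' x, ‖q x m‖) * r ^ m := by
          gcongr; exact norm_tsum_le_tsum_norm (hqs m)
      _ = ∑' x, ‖q x m‖ * r ^ m := tsum_mul_right.symm
      _ ≤ _ := Summable.tsum_le_tsum (fun x => hqr x m) ((hqs m).mul_right _) hs
  refine ⟨p, ENNReal.ofReal r, ?_, by simpa using hr, ?_⟩
  · have := p.le_radius_of_bound (r := ⟨r, hr.le⟩) _ hpn
    convert this using 1
    rw [ENNReal.ofReal, Real.toNNReal_of_nonneg hr.le]
    rfl
  · intro h hh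
    have hh' : ‖h‖ < r := by
      rw [Metric.mem_eball, edist_zero_right, ← ofReal_norm] at hh
      exact (ENNReal.ofReal_lt_ofReal_iff hr).1 hh
    have hqh : ∀ x m, q x m (fun _ => h) = c x * ((l x h) ^ m / (m.factorial : ℂ)) := by
      intro x m
      simp [q]
      ring
    have hprod : Summable fun z : ℕ × ι => q z.2 z.1 fun _ => h := by
      have hnn : Summable fun z : ι × ℕ => ‖c z.1‖ * ((r * ‖l z.1‖) ^ z.2 / z.2.factorial) := by
        refine (summable_prod_of_nonneg (fun z => by positivity)).2 ⟨fun x => ?_, ?_⟩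
        · exact (Real.summable_pow_div_factorial (r * ‖l x‖)).mul_left ‖c x‖
        · refine hs.congr fun x => ?_
          simp only [tsum_mul_left]
          rw [Real.exp_eq_exp_ℝ, NormedSpace.exp_eq_tsum_div]
      refine Summable.of_norm_bounded ((Equiv.prodComm ℕ ι).summable_iff.2 hnn) fun z => ?_
      simp only [hqh, norm_mul, norm_div, norm_pow, Complex.norm_natCast, Function.comp,
        Equiv.prodComm_apply, Prod.swap]
      have : ‖l z.2 h‖ ≤ r * ‖l z.2‖ := by
        calc ‖l z.2 h‖ ≤ ‖l z.2‖ * ‖h‖ := (l z.2).le_opNorm h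
          _ ≤ ‖l z.2‖ * r := by gcongr
          _ = _ := mul_comm _ _
      gcongr
    have e1 : ∀ m, p m (fun _ => h) = ∑' x, q x m fun _ => h := by
      intro m
      have hsum : Summable fun x => q x m := (hqs m).of_norm
      have := (ContinuousMultilinearMap.apply ℝ (fun _ : Fin m => E) ℂ
        (fun _ => h)).hasSum hsum.hasSum
      simpa using this.tsum_eq.symm
    have e2 : ∀ x, ∑' m, q x m (fun _ => h) = c x * Complex.exp (l x h) := by
      intro x
      simp only [hqh, tsum_mul_left]
      rw [Complex.exp_eq_exp_ℂ, NormedSpace.exp_eq_tsum_div]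
    have hc : ∑' x, c x * Complex.exp (l x h) = ∑' m, ∑' x, q x m fun _ => h := by
      rw [← tsum_congr e2]
      exact Summable.tsum_comm (f := fun m x => q x m fun _ => h) hprod
    simp only [zero_add]
    rw [hc]
    have hS : HasSum (fun m => ∑' x, q x m fun _ => h) (∑' m, ∑' x, q x m fun _ => h) :=
      (Summable.prod (f := fun z : ℕ × ι => q z.2 z.1 fun _ => h) hprod).hasSum
    exact hS.congr_fun e1

/-- As the exponents are imaginary, moving the base point to `h₀` multiplies the coefficients by
unimodular factors and leaves `hs` intact, so the case of the origin suffices. -/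
theorem analyticOnNhd_tsum_exp (c : ι → ℂ) (l : ι → E →L[ℝ] ℂ) {r : ℝ} (hr : 0 < r)
    (hl : ∀ x h, (l x h).re = 0)
    (hs : Summable fun x => ‖c x‖ * Real.exp (r * ‖l x‖)) :
    AnalyticOnNhd ℝ (fun h => ∑' x, c x * Complex.exp (l x h)) Set.univ := by
  intro h₀ _
  have h1 := analyticAt_zero_tsum_exp (fun x => c x * Complex.exp (l x h₀)) l hr (by
    refine hs.congr fun x => ?_
    rw [norm_mul, Complex.norm_exp, hl, Real.exp_zero, mul_one])
  have h2 : AnalyticAt ℝ (fun h => h - h₀) h₀ := analyticAt_id.sub analyticAt_const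
  have h3 := AnalyticAt.fun_comp (f := fun h => h - h₀) (x := h₀) (by simpa using h1) h2
  refine h3.congr (Eventually.of_forall fun h => ?_)
  refine tsum_congr fun x => ?_
  rw [mul_assoc, ← Complex.exp_add, map_sub]
  congr 2
  ring

end ExpSeries

/-! ### Elementary facts on the lattice -/

section Lattice

variable {d : ℕ}

theorem len_eq_norm (x : Latt d) :
    len x = ‖(WithLp.toLp 2 (fun i => (x i : ℝ)) : EuclideanSpace ℝ (Fin d))‖ := by
  rw [EuclideanSpace.norm_eq]
  simp [len]

theorem len_nonneg (x : Latt d) : 0 ≤ len x := Real.sqrt_nonneg _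

theorem len_neg (x : Latt d) : len (-x) = len x := by simp [len]

theorem len_add_le (x y : Latt d) : len (x + y) ≤ len x + len y := by
  simp only [len_eq_norm]
  refine le_trans (le_of_eq ?_) (norm_add_le _ _)
  congr 1
  ext i
  simp

theorem abs_le_len (x : Latt d) (i : Fin d) : |(x i : ℝ)| ≤ len x := by
  rw [len, ← Real.sqrt_sq_eq_abs]
  exact Real.sqrt_le_sqrt
    (Finset.single_le_sum (f := fun i => (x i : ℝ) ^ 2) (fun i _ => sq_nonneg _) (Finset.mem_univ i))

theorem bracket_sq (x : Latt d) : bracket x ^ 2 = 1 + len x ^ 2 :=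
  Real.sq_sqrt (by positivity)

theorem one_le_bracket (x : Latt d) : 1 ≤ bracket x := by
  rw [bracket, Real.one_le_sqrt]
  nlinarith [sq_nonneg (len x)]

theorem len_le_bracket (x : Latt d) : len x ≤ bracket x := by
  refine Real.le_sqrt_of_sq_le ?_
  linarith

theorem bracket_le_one_add_len (x : Latt d) : bracket x ≤ 1 + len x := by
  rw [bracket, Real.sqrt_le_left (by linarith [len_nonneg x])]
  nlinarith [len_nonneg x]

theorem bracket_neg (x : Latt d) : bracket (-x) = bracket x := by rw [bracket, len_neg, bracket]

theorem bracket_add_le (x y : Latt d) : bracket (x + y) ≤ 2 * bracket x * bracket y := by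
  have h1 := one_le_bracket x
  have h2 := one_le_bracket y
  have h3 := len_add_le x y
  have h4 := len_nonneg (x + y)
  have h5 := bracket_sq x
  have h6 := bracket_sq y
  have h7 := bracket_sq (x + y)
  refine le_of_sq_le_sq₀ ?_ (by positivity)
  have h8 : len (x + y) ^ 2 ≤ 2 * (len x ^ 2 + len y ^ 2) := by
    have : len (x + y) ^ 2 ≤ (len x + len y) ^ 2 := by gcongr
    nlinarith [sq_nonneg (len x - len y)]
  rw [h7, mul_pow, mul_pow, h5, h6]
  nlinarith [mul_nonneg (sq_nonneg (len x)) (sq_nonneg (len y)), sq_nonneg (len x),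
    sq_nonneg (len y)]
where
  le_of_sq_le_sq₀ {a b : ℝ} (h : a ^ 2 ≤ b ^ 2) (hb : 0 ≤ b) : a ≤ b := abs_le_of_sq_le_sq' h hb |>.2

/-- Peetre's inequality. -/
theorem bracket_rpow_le (α : ℝ) (x y : Latt d) :
    bracket x ^ α ≤ 2 ^ |α| * bracket (x - y) ^ |α| * bracket y ^ α := by
  have hx := bracket_pos x
  have hy := bracket_pos y
  have hz := bracket_pos (x - y)
  rcases le_or_gt 0 α with h | h
  · rw [abs_of_nonneg h, ← Real.mul_rpow (by norm_num) hz.le, ← Real.mul_rpow (by positivity) hy.le]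
    refine Real.rpow_le_rpow hx.le ?_ h
    simpa using bracket_add_le (x - y) y
  -- For a negative exponent this is the inequality for `-α` with `x` and `y` exchanged.
  · rw [abs_of_neg h]
    have h1 : bracket y ^ (-α) ≤ 2 ^ (-α) * bracket (x - y) ^ (-α) * bracket x ^ (-α) := by
      rw [← Real.mul_rpow (by norm_num) hz.le, ← Real.mul_rpow (by positivity) hx.le]
      refine Real.rpow_le_rpow hy.le ?_ (by linarith)
      have h2 := bracket_add_le (y - x) x
      rwa [sub_add_cancel, ← neg_sub x y, bracket_neg] at h2
    rw [Real.rpow_neg hy.le, Real.rpow_neg hx.le] at h1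
    have p1 := Real.rpow_pos_of_pos hx α
    have p2 := Real.rpow_pos_of_pos hy α
    rw [inv_le_iff_one_le_mul₀ p2] at h1
    calc bracket x ^ α = bracket x ^ α * 1 := (mul_one _).symm
      _ ≤ bracket x ^ α * (2 ^ (-α) * bracket (x - y) ^ (-α) * (bracket x ^ α)⁻¹ * bracket y ^ α) := by
        gcongr
      _ = _ := by field_simp

theorem summable_bracket_rpow {β : ℝ} (hβ : β < -(d : ℝ)) :
    Summable fun x : Latt d => bracket x ^ β := by
  classical
  let L : Submodule ℤ (EuclideanSpace ℝ (Fin d)) :=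
    Submodule.span ℤ (Set.range (EuclideanSpace.basisFun (Fin d) ℝ).toBasis)
  have hrank : Module.finrank ℤ L = d := by
    have := Module.finrank_eq_card_basis
      ((EuclideanSpace.basisFun (Fin d) ℝ).toBasis.restrictScalars ℤ)
    rw [Fintype.card_fin] at this
    exact this
  have hsum := ZLattice.summable_norm_rpow L β (by rw [hrank]; exact hβ)
  have hmem : ∀ x : Latt d, (WithLp.toLp 2 (fun i => (x i : ℝ)) : EuclideanSpace ℝ (Fin d)) ∈ L := by
    intro x
    rw [(EuclideanSpace.basisFun (Fin d) ℝ).toBasis.mem_span_iff_repr_mem ℤ]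
    intro i
    exact ⟨x i, by simp⟩
  let e : Latt d → L := fun x => ⟨WithLp.toLp 2 (fun i => (x i : ℝ)), hmem x⟩
  have he : Function.Injective e := by
    intro x y h
    have h1 := congrArg (fun z : L => (z : EuclideanSpace ℝ (Fin d))) h
    ext i
    have h2 := congrArg (fun z : EuclideanSpace ℝ (Fin d) => z i) h1
    simpa [e] using h2
  have h2 : Summable fun x : Latt d => len x ^ β := by
    refine (hsum.comp_injective he).congr fun x => ?_
    rw [len_eq_norm]
    rfl
  -- At the origin `len x ^ β` is `0` for a negative exponent and cannot dominate `bracket x ^ β =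
  -- 1`; a unit mass is added there.
  have h3 : Summable fun x : Latt d => len x ^ β + if x = 0 then (1 : ℝ) else 0 :=
    h2.add (summable_of_hasFiniteSupport
      ((Set.finite_singleton (0 : Latt d)).subset fun x hx => by
        by_contra hne
        simp only [Function.mem_support, ne_eq, ite_eq_right_iff, one_ne_zero, imp_false,
          not_not] at hx
        exact hne hx))
  refine Summable.of_nonneg_of_le (fun x => Real.rpow_nonneg (bracket_pos x).le _) (fun x => ?_) h3
  have hβ0 : β ≤ 0 := by
    have : (0 : ℝ) ≤ d := Nat.cast_nonneg d
    linarith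
  by_cases hx : x = 0
  · subst hx
    simp only [if_true]
    have : bracket (0 : Latt d) ^ β ≤ 1 := Real.rpow_le_one_of_one_le_of_nonpos (one_le_bracket _) hβ0
    linarith [Real.rpow_nonneg (len_nonneg (0 : Latt d)) β]
  · simp only [hx, if_false, add_zero]
    have hpos : 0 < len x := by
      have : ∃ i, x i ≠ 0 := by
        by_contra! hcon
        exact hx (funext hcon)
      obtain ⟨i, hi⟩ := this
      have h4 : (0 : ℝ) < |(x i : ℝ)| := abs_pos.2 (by exact_mod_cast hi)
      linarith [abs_le_len x i]
    exact Real.rpow_le_rpow_of_nonpos hpos (len_le_bracket x) hβ0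

theorem exists_exp_le_bracket {δ : ℝ} (hδ : 0 < δ) (N : ℕ) :
    ∃ C : ℝ, 0 < C ∧ ∀ x : Latt d, bracket x ^ N * Real.exp (-δ * len x) ≤ C := by
  refine ⟨(N.factorial : ℝ) / δ ^ N * Real.exp δ, by positivity, fun x => ?_⟩
  have h1 := Real.pow_div_factorial_le_exp (δ * (1 + len x))
    (mul_nonneg hδ.le (by linarith [len_nonneg x])) N
  have h2 : bracket x ^ N ≤ (1 + len x) ^ N :=
    pow_le_pow_left₀ (bracket_pos x).le (bracket_le_one_add_len x) N
  have h3 : (1 + len x) ^ N ≤ (N.factorial : ℝ) / δ ^ N * Real.exp (δ * (1 + len x)) := by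
    rw [mul_pow, div_le_iff₀ (by positivity)] at h1
    rw [div_mul_eq_mul_div, le_div_iff₀ (by positivity)]
    linarith
  calc bracket x ^ N * Real.exp (-δ * len x)
      ≤ (N.factorial : ℝ) / δ ^ N * Real.exp (δ * (1 + len x)) * Real.exp (-δ * len x) := by
        gcongr; exact h2.trans h3
    _ = _ := by
      rw [mul_assoc, ← Real.exp_add]
      congr 2
      ring

theorem summable_bracket_rpow_mul_exp (β : ℝ) {δ : ℝ} (hδ : 0 < δ) :
    Summable fun x : Latt d => bracket x ^ β * Real.exp (-δ * len x) := by
  obtain ⟨N, hN⟩ := exists_nat_gt (β + d)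
  obtain ⟨C, hC, hCb⟩ := exists_exp_le_bracket (d := d) hδ N
  refine Summable.of_nonneg_of_le (fun x => ?_) (fun x => ?_)
    ((summable_bracket_rpow (d := d) (β := β - N) (by linarith)).mul_left C)
  · have := bracket_pos x
    positivity
  · have hb := bracket_pos x
    rw [Real.rpow_sub hb, Real.rpow_natCast, ← mul_div_assoc, le_div_iff₀ (by positivity)]
    have := mul_le_mul_of_nonneg_left (hCb x) (Real.rpow_nonneg hb.le β)
    linarith

end Lattice

/-! ### Operators on `ℓ²` given by kernels -/

section Kernel

variable {d : ℕ} {𝕜 : Type*} [RCLike 𝕜] {G : Type*} [NormedAddCommGroup G] [NormedSpace 𝕜 G]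

/-- The space of square-summable `G`-valued sequences on the lattice. -/
abbrev L2seq (d : ℕ) (G : Type*) [NormedAddCommGroup G] := lp (fun _ : Latt d => G) 2

theorem memlp_two_iff {u : Latt d → G} : Memℓp u 2 ↔ Summable fun x => ‖u x‖ ^ 2 := by
  rw [memℓp_gen_iff (by norm_num)]
  simp

theorem summable_norm_sq (u : L2seq d G) : Summable fun x => ‖u x‖ ^ 2 := memlp_two_iff.1 u.2

theorem L2seq_norm_sq (u : L2seq d G) : ‖u‖ ^ 2 = ∑' x, ‖u x‖ ^ 2 := by
  have h2 := lp.norm_rpow_eq_tsum (p := 2) (by norm_num) u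
  simpa using h2

theorem L2seq_norm_apply_le (u : L2seq d G) (x : Latt d) : ‖u x‖ ≤ ‖u‖ :=
  lp.norm_apply_le_norm (by norm_num) u x

theorem L2seq_norm_le {u : L2seq d G} {C : ℝ} (hC : 0 ≤ C) (h : ∑' x, ‖u x‖ ^ 2 ≤ C ^ 2) :
    ‖u‖ ≤ C := by
  rw [← L2seq_norm_sq] at h
  exact abs_le_of_sq_le_sq' h hC |>.2

theorem tsum_norm_sq_shift (u : L2seq d G) (z : Latt d) : ∑' x, ‖u (x - z)‖ ^ 2 = ‖u‖ ^ 2 := by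
  rw [L2seq_norm_sq]
  exact (Equiv.subRight z).tsum_eq (fun x => ‖u x‖ ^ 2)

theorem summable_norm_sq_shift (u : L2seq d G) (z : Latt d) :
    Summable fun x => ‖u (x - z)‖ ^ 2 :=
  (Equiv.subRight z).summable_iff.2 (summable_norm_sq u)

theorem norm_sq_shift_le {M : Latt d → G →L[𝕜] G} {C : ℝ} (hM : ∀ x, ‖M x‖ ≤ C) (z : Latt d)
    (u : L2seq d G) (x : Latt d) : ‖M x (u (x - z))‖ ^ 2 ≤ C ^ 2 * ‖u (x - z)‖ ^ 2 := by
  rw [← mul_pow]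
  gcongr
  exact ((M x).le_opNorm _).trans (by gcongr; exact hM x)

theorem summable_shift {M : Latt d → G →L[𝕜] G} {C : ℝ} (hM : ∀ x, ‖M x‖ ≤ C) (z : Latt d)
    (u : L2seq d G) : Summable fun x => ‖M x (u (x - z))‖ ^ 2 :=
  Summable.of_nonneg_of_le (fun _ => by positivity) (norm_sq_shift_le hM z u)
    ((summable_norm_sq_shift u z).mul_left _)

/-- The linear map `u ↦ (M(x) u(x - z))ₓ`. -/
def lpShiftLin (z : Latt d) (M : Latt d → G →L[𝕜] G) (C : ℝ) (hM : ∀ x, ‖M x‖ ≤ C) :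
    L2seq d G →ₗ[𝕜] L2seq d G where
  toFun u := ⟨fun x => M x (u (x - z)), memlp_two_iff.2 (summable_shift hM z u)⟩
  map_add' u v := by ext x; exact (M x).map_add _ _
  map_smul' c u := by ext x; exact (M x).map_smul c _

theorem norm_lpShiftLin_le (z : Latt d) (M : Latt d → G →L[𝕜] G) (C : ℝ) (hM : ∀ x, ‖M x‖ ≤ C)
    (u : L2seq d G) : ‖lpShiftLin z M C hM u‖ ≤ C * ‖u‖ := by
  refine L2seq_norm_le (mul_nonneg ((norm_nonneg _).trans (hM 0)) (norm_nonneg _)) ?_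
  refine (Summable.tsum_le_tsum (norm_sq_shift_le hM z u) (summable_shift hM z u)
    ((summable_norm_sq_shift u z).mul_left _)).trans ?_
  rw [tsum_mul_left, tsum_norm_sq_shift, mul_pow]

/-- The operator `u ↦ (M(x) u(x - z))ₓ`. -/
def lpShift (z : Latt d) (M : Latt d → G →L[𝕜] G) (C : ℝ) (hM : ∀ x, ‖M x‖ ≤ C) :
    L2seq d G →L[𝕜] L2seq d G :=
  (lpShiftLin z M C hM).mkContinuous C (norm_lpShiftLin_le z M C hM)

theorem lpShift_apply (z : Latt d) (M : Latt d → G →L[𝕜] G) (C : ℝ) (hM : ∀ x, ‖M x‖ ≤ C)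
    (u : L2seq d G) (x : Latt d) : lpShift z M C hM u x = M x (u (x - z)) := rfl

theorem norm_lpShift_le (z : Latt d) (M : Latt d → G →L[𝕜] G) (C : ℝ) (hM : ∀ x, ‖M x‖ ≤ C) :
    ‖lpShift z M C hM‖ ≤ C :=
  LinearMap.mkContinuous_norm_le _ ((norm_nonneg _).trans (hM 0)) _

/-- The operator `u ↦ ∑_y K(x,y) u(y)` for a kernel dominated by a summable convolution kernel. -/
def kerOp (K : Latt d → Latt d → G →L[𝕜] G) (k : Latt d → ℝ)
    (hK : ∀ x y, ‖K x y‖ ≤ k (x - y)) : L2seq d G →L[𝕜] L2seq d G :=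
  -- The kernel is cut into its diagonals `x - y = z`, each a weighted shift of norm at most `k z`.
  -- The sum is meaningful once `k` is summable.
  ∑' z, lpShift z (fun x => K x (x - z)) (k z) (fun x => by simpa using hK x (x - z))

theorem summable_norm_lpShift (K : Latt d → Latt d → G →L[𝕜] G) {k : Latt d → ℝ} (hk : Summable k)
    (hK : ∀ x y, ‖K x y‖ ≤ k (x - y)) :
    Summable fun z => ‖lpShift z (fun x => K x (x - z)) (k z)
      (fun x => by simpa using hK x (x - z))‖ :=
  Summable.of_nonneg_of_le (fun _ => norm_nonneg _) (fun z => norm_lpShift_le z _ _ _) hk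

theorem norm_kerOp_le (K : Latt d → Latt d → G →L[𝕜] G) {k : Latt d → ℝ} (hk : Summable k)
    (hK : ∀ x y, ‖K x y‖ ≤ k (x - y)) : ‖kerOp K k hK‖ ≤ ∑' z, k z :=
  (norm_tsum_le_tsum_norm (summable_norm_lpShift K hk hK)).trans
    (Summable.tsum_le_tsum (fun z => norm_lpShift_le z _ _ _) (summable_norm_lpShift K hk hK) hk)

variable [CompleteSpace G]

theorem hasSum_kerOp (K : Latt d → Latt d → G →L[𝕜] G) {k : Latt d → ℝ} (hk : Summable k)
    (hK : ∀ x y, ‖K x y‖ ≤ k (x - y)) (u : L2seq d G) :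
    HasSum (fun z => lpShift z (fun x => K x (x - z)) (k z)
      (fun x => by simpa using hK x (x - z)) u) (kerOp K k hK u) := by
  have h : HasSum (fun z => lpShift z (fun x => K x (x - z)) (k z)
      (fun x => by simpa using hK x (x - z))) (kerOp K k hK) :=
    (summable_norm_lpShift K hk hK).of_norm.hasSum
  exact h.mapL (ContinuousLinearMap.apply 𝕜 (L2seq d G) u)

variable (𝕜) in
/-- Evaluation of a square-summable sequence at a lattice point. -/
def evalSeq (x : Latt d) : L2seq d G →L[𝕜] G :=
  LinearMap.mkContinuous
    { toFun := fun u => u x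
      map_add' := fun u v => by simp
      map_smul' := fun c u => by simp } 1
    (fun u => by rw [one_mul]; exact L2seq_norm_apply_le u x)

theorem hasSum_kerOp_apply (K : Latt d → Latt d → G →L[𝕜] G) {k : Latt d → ℝ} (hk : Summable k)
    (hK : ∀ x y, ‖K x y‖ ≤ k (x - y)) (u : L2seq d G) (x : Latt d) :
    HasSum (fun y => K x y (u y)) (kerOp K k hK u x) := by
  have h := (evalSeq 𝕜 x).hasSum (hasSum_kerOp K hk hK u)
  rw [← (Equiv.subLeft x).hasSum_iff]
  refine h.congr_fun fun z => ?_
  simp only [Function.comp, Equiv.subLeft_apply]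
  rfl

end Kernel

/-! ### The structure of the phase space -/

section PhaseSpaceStructure

variable {d n : ℕ} {α : ℝ}

theorem bracket_rpow_mul_neg (α : ℝ) (x : Latt d) : bracket x ^ α * bracket x ^ (-α) = 1 := by
  rw [← Real.rpow_add (bracket_pos x), add_neg_cancel, Real.rpow_zero]

theorem bracket_rpow_neg_mul (α : ℝ) (x : Latt d) : bracket x ^ (-α) * bracket x ^ α = 1 := by
  rw [mul_comm, bracket_rpow_mul_neg]

theorem mem_phaseSubmodule_iff {Y : Latt d → Fib n} :
    Y ∈ phaseSubmodule d n α ↔ Summable fun x => ‖bracket x ^ α • Y x‖ ^ 2 := by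
  have : ∀ x, ‖bracket x ^ α • Y x‖ ^ 2 = bracket x ^ (2 * α) * ‖Y x‖ ^ 2 := fun x => by
    rw [norm_smul, mul_pow, Real.norm_eq_abs, sq_abs, bracket_rpow_sq]
  simp only [this]
  exact Iff.rfl

theorem weight_apply (Y : PhaseSpace d n α) (x : Latt d) :
    weight d n α Y x = bracket x ^ α • Y x := rfl

theorem PhaseSpace.ext {Y Z : PhaseSpace d n α} (h : ∀ x, Y x = Z x) : Y = Z :=
  Subtype.ext (funext h)

theorem PhaseSpace.add_apply (Y Z : PhaseSpace d n α) (x : Latt d) : (Y + Z) x = Y x + Z x := rfl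

theorem PhaseSpace.smul_apply (c : ℝ) (Y : PhaseSpace d n α) (x : Latt d) :
    (c • Y) x = c • Y x := rfl

variable (d n α) in
/-- The weighting map is an isometric isomorphism of `ℋ_α` with the unweighted space. -/
def weightEquiv : PhaseSpace d n α ≃ₗᵢ[ℝ] L2seq d (Fib n) where
  toLinearEquiv := LinearEquiv.ofBijective (weight d n α) ⟨weight_injective d n α, fun w => by
    have hx : ∀ x, bracket x ^ α • bracket x ^ (-α) • w x = w x := fun x => by
      rw [smul_smul, bracket_rpow_mul_neg, one_smul]
    refine ⟨⟨fun x => bracket x ^ (-α) • w x, mem_phaseSubmodule_iff.2 ?_⟩, ?_⟩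
    · simp only [hx]
      exact summable_norm_sq w
    · ext x : 2
      exact hx x⟩
  norm_map' _ := rfl

theorem weightEquiv_apply (Y : PhaseSpace d n α) (x : Latt d) :
    weightEquiv d n α Y x = bracket x ^ α • Y x := rfl

theorem weightEquiv_symm_apply (w : L2seq d (Fib n)) (x : Latt d) :
    (weightEquiv d n α).symm w x = bracket x ^ (-α) • w x := by
  have h := weightEquiv_apply ((weightEquiv d n α).symm w) x
  rw [LinearIsometryEquiv.apply_symm_apply] at h
  rw [h, smul_smul, bracket_rpow_neg_mul, one_smul]

instance : CompleteSpace (PhaseSpace d n α) :=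
  (completeSpace_congr (weightEquiv d n α).isometry.isUniformEmbedding
    (e := (weightEquiv d n α).toEquiv)).2 inferInstance

theorem fib_eq_sum (v : Fib n) : v = ∑ a, v a • EuclideanSpace.single a (1 : ℝ) := by
  ext b
  cases b <;> simp [Finset.sum_apply, Pi.single_apply]

instance instSeparableL2seq : TopologicalSpace.SeparableSpace (L2seq d (Fib n)) := by
  let S : Set (L2seq d (Fib n)) := Set.range fun p : Latt d × Comp n =>
    lp.single 2 p.1 (EuclideanSpace.single p.2 (1 : ℝ))
  have hS : TopologicalSpace.IsSeparable S := (Set.countable_range _).isSeparable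
  have h1 : TopologicalSpace.IsSeparable (closure (Submodule.span ℝ S : Set (L2seq d (Fib n)))) :=
    hS.span.closure
  have h2 : closure (Submodule.span ℝ S : Set (L2seq d (Fib n))) = Set.univ := by
    refine Set.eq_univ_of_forall fun u => ?_
    refine mem_closure_of_tendsto (lp.hasSum_single (by norm_num) u) (Eventually.of_forall fun s => ?_)
    refine Submodule.sum_mem _ fun x _ => ?_
    have h3 := fib_eq_sum (u x)
    have h4 : lp.single 2 x (u x) =
        ∑ a, u x a • (lp.single 2 x (EuclideanSpace.single a (1 : ℝ)) : L2seq d (Fib n)) := by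
      conv_lhs => rw [h3]
      rw [← lp.singleContinuousLinearMap_apply (𝕜 := ℝ), map_sum]
      simp only [map_smul, lp.singleContinuousLinearMap_apply]
    rw [h4]
    exact Submodule.sum_mem _ fun a _ => Submodule.smul_mem _ _
      (Submodule.subset_span ⟨(x, a), rfl⟩)
  rw [h2] at h1
  exact TopologicalSpace.isSeparable_univ_iff.1 h1

instance : SecondCountableTopology (PhaseSpace d n α) := by
  have : SecondCountableTopology (L2seq d (Fib n)) :=
    UniformSpace.secondCountable_of_separable _
  exact (weightEquiv d n α).toHomeomorph.isInducing.secondCountableTopology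

variable (d n α) in
/-- Evaluation at a lattice point, as a continuous linear map. -/
def evalP (x : Latt d) : PhaseSpace d n α →L[ℝ] Fib n :=
  bracket x ^ (-α) • (evalSeq ℝ x).comp
    ((weightEquiv d n α).toContinuousLinearEquiv : PhaseSpace d n α →L[ℝ] L2seq d (Fib n))

theorem evalP_apply (x : Latt d) (Y : PhaseSpace d n α) : evalP d n α x Y = Y x := by
  change bracket x ^ (-α) • bracket x ^ α • Y x = Y x
  rw [smul_smul, bracket_rpow_neg_mul, one_smul]

variable (d n α) in
/-- The coordinate functional `Y ↦ Y_a(x)`. -/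
def coordP (x : Latt d) (a : Comp n) : PhaseSpace d n α →L[ℝ] ℝ :=
  (EuclideanSpace.proj a : Fib n →L[ℝ] ℝ).comp (evalP d n α x)

theorem coordP_apply (x : Latt d) (a : Comp n) (Y : PhaseSpace d n α) :
    coordP d n α x a Y = Y x a := by
  simp only [coordP, ContinuousLinearMap.comp_apply, evalP_apply]
  rfl

variable (d n α) in
/-- The element of `ℋ_α` with the value `v` at `x` and `0` elsewhere. -/
def pointP (x : Latt d) : Fib n →L[ℝ] PhaseSpace d n α :=
  bracket x ^ α • (((weightEquiv d n α).symm.toContinuousLinearEquiv :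
    L2seq d (Fib n) →L[ℝ] PhaseSpace d n α).comp
      (lp.singleContinuousLinearMap ℝ (fun _ : Latt d => Fib n) 2 x))

theorem pointP_apply (x : Latt d) (v : Fib n) (y : Latt d) :
    pointP d n α x v y = if y = x then v else 0 := by
  have h : pointP d n α x v y = bracket x ^ α • ((weightEquiv d n α).symm (lp.single 2 x v)) y := rfl
  rw [h, weightEquiv_symm_apply]
  by_cases hy : y = x
  · subst hy
    rw [lp.single_apply_self, smul_smul, bracket_rpow_mul_neg, one_smul, if_pos rfl]
  · have h0 : (lp.single 2 x v : L2seq d (Fib n)) y = 0 :=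
      lp.single_apply_ne (E := fun _ => Fib n) 2 x v hy
    rw [h0, smul_zero, smul_zero, if_neg hy]

theorem hasSum_pointP (Y : PhaseSpace d n α) : HasSum (fun x => pointP d n α x (Y x)) Y := by
  have h := lp.hasSum_single (p := 2) (by norm_num) (weightEquiv d n α Y)
  have h2 := h.mapL ((weightEquiv d n α).symm.toContinuousLinearEquiv :
    L2seq d (Fib n) →L[ℝ] PhaseSpace d n α)
  have e : ((weightEquiv d n α).symm.toContinuousLinearEquiv :
      L2seq d (Fib n) →L[ℝ] PhaseSpace d n α) (weightEquiv d n α Y) = Y :=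
    (weightEquiv d n α).symm_apply_apply Y
  rw [e] at h2
  refine h2.congr_fun fun x => ?_
  refine PhaseSpace.ext fun y => ?_
  change _ = ((weightEquiv d n α).symm (lp.single 2 x (weightEquiv d n α Y x))) y
  rw [pointP_apply, weightEquiv_symm_apply]
  by_cases hy : y = x
  · subst hy
    rw [lp.single_apply_self, weightEquiv_apply, smul_smul, bracket_rpow_neg_mul, one_smul,
      if_pos rfl]
  · have h0 : (lp.single 2 x (weightEquiv d n α Y x) : L2seq d (Fib n)) y = 0 :=
      lp.single_apply_ne (E := fun _ => Fib n) 2 x _ hy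
    rw [h0, smul_zero, if_neg hy]

theorem pointP_eq_sum (x : Latt d) (v : Fib n) :
    pointP d n α x v = ∑ a, v a • pointP d n α x (EuclideanSpace.single a 1) := by
  conv_lhs => rw [fib_eq_sum v]
  simp [map_sum]

/-- A continuous functional is determined by its values on point masses. Through this, finitely
supported test sequences will suffice to identify Borel measures. -/
theorem hasSum_dual (L : PhaseSpace d n α →L[ℝ] ℝ) (Y : PhaseSpace d n α) :
    HasSum (fun x => ∑ a, Y x a * L (pointP d n α x (EuclideanSpace.single a 1))) (L Y) := by
  refine ((hasSum_pointP Y).mapL L).congr_fun fun x => ?_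
  rw [pointP_eq_sum, map_sum]
  simp

/-! ### Rapidly decreasing sequences and the pairing -/

theorem rapid_bound (Ψ : RapidSeq d n) (β : ℝ) :
    ∃ C : ℝ, 0 ≤ C ∧ ∀ x, ‖Ψ.1 x‖ ≤ C * bracket x ^ β := by
  obtain ⟨N, hN⟩ := exists_nat_ge (-β)
  obtain ⟨C, hC⟩ := Ψ.2 N
  have hC0 : 0 ≤ C := le_trans (by have := bracket_pos (0 : Latt d); positivity) (hC 0)
  refine ⟨C, hC0, fun x => ?_⟩
  have hb := bracket_pos x
  have h1 : ‖Ψ.1 x‖ ≤ C * bracket x ^ (-(N : ℝ)) := by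
    rw [Real.rpow_neg hb.le, Real.rpow_natCast, ← div_eq_mul_inv, le_div_iff₀ (by positivity)]
    linarith [hC x]
  refine h1.trans ?_
  gcongr
  · exact one_le_bracket x
  · linarith

theorem summable_rapid_weight (Ψ : RapidSeq d n) (β : ℝ) :
    Summable fun x => bracket x ^ β * ‖Ψ.1 x‖ := by
  obtain ⟨C, hC0, hC⟩ := rapid_bound Ψ (-β - d - 1)
  refine Summable.of_nonneg_of_le (fun x => ?_) (fun x => ?_)
    ((summable_bracket_rpow (d := d) (β := -(d : ℝ) - 1) (by linarith)).mul_left C)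
  · have := bracket_pos x
    positivity
  · have hb := bracket_pos x
    calc bracket x ^ β * ‖Ψ.1 x‖ ≤ bracket x ^ β * (C * bracket x ^ (-β - d - 1)) := by
          gcongr; exact hC x
      _ = C * (bracket x ^ β * bracket x ^ (-β - d - 1)) := by ring
      _ = _ := by
        rw [← Real.rpow_add hb]
        congr 2
        ring

theorem summable_rapid (Ψ : RapidSeq d n) : Summable fun x => ‖Ψ.1 x‖ := by
  simpa using summable_rapid_weight Ψ 0

theorem summable_rapid_sq (Ψ : RapidSeq d n) (β : ℝ) :
    Summable fun x => ‖bracket x ^ β • Ψ.1 x‖ ^ 2 := by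
  have h := summable_rapid_weight Ψ β
  have h1 : Summable fun x => ‖bracket x ^ β • Ψ.1 x‖ := by
    refine h.congr fun x => ?_
    rw [norm_smul, Real.norm_of_nonneg (Real.rpow_nonneg (bracket_pos x).le _)]
  refine summable_of_isBigO h1 ?_
  have h2 : Tendsto (fun x => ‖bracket x ^ β • Ψ.1 x‖) cofinite (𝓝 0) := h1.tendsto_cofinite_zero
  have h3 : ∀ᶠ x in cofinite, ‖bracket x ^ β • Ψ.1 x‖ ≤ 1 :=
    (h2.eventually (eventually_le_nhds zero_lt_one))
  refine Asymptotics.IsBigO.of_bound 1 ?_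
  filter_upwards [h3] with x hx
  rw [one_mul, Real.norm_of_nonneg (by positivity), Real.norm_of_nonneg (norm_nonneg _), sq]
  exact mul_le_of_le_one_left (norm_nonneg _) hx

/-- `(⟨x⟩^{-α} Ψ(x))ₓ` as an element of the unweighted space. -/
def dualWeight (α : ℝ) (Ψ : RapidSeq d n) : L2seq d (Fib n) :=
  ⟨fun x => bracket x ^ (-α) • Ψ.1 x, memlp_two_iff.2 (summable_rapid_sq Ψ (-α))⟩

variable (α) in
/-- The functional `Y ↦ ⟨Y, Ψ⟩`. -/
def pairL (Ψ : RapidSeq d n) : PhaseSpace d n α →L[ℝ] ℝ :=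
  (innerSL ℝ (dualWeight α Ψ)).comp
    ((weightEquiv d n α).toContinuousLinearEquiv : PhaseSpace d n α →L[ℝ] L2seq d (Fib n))

theorem hasSum_pairL (Ψ : RapidSeq d n) (Y : PhaseSpace d n α) :
    HasSum (fun x => ∑ a, Y x a * Ψ.1 x a) (pairL α Ψ Y) := by
  have h := lp.hasSum_inner (𝕜 := ℝ) (dualWeight α Ψ) (weightEquiv d n α Y)
  refine h.congr_fun fun x => ?_
  have h1 : dualWeight α Ψ x = bracket x ^ (-α) • Ψ.1 x := rfl
  rw [h1, weightEquiv_apply, inner_smul_left, inner_smul_right, ← mul_assoc]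
  simp only [conj_trivial, bracket_rpow_neg_mul, one_mul]
  simp [PiLp.inner_apply]

theorem pairing_eq (Ψ : RapidSeq d n) (Y : PhaseSpace d n α) : pairing Y Ψ = pairL α Ψ Y :=
  (hasSum_pairL Ψ Y).tsum_eq

theorem pairL_pointP (Ψ : RapidSeq d n) (x : Latt d) (v : Fib n) :
    pairL α Ψ (pointP d n α x v) = ∑ a, v a * Ψ.1 x a := by
  refine (hasSum_pairL Ψ _).unique ?_
  have := hasSum_ite_eq x (∑ a, v a * Ψ.1 x a)
  refine this.congr_fun fun y => ?_
  rw [pointP_apply]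
  by_cases hy : y = x
  · subst hy; simp
  · simp [hy]

/-- The finitely supported test sequence with values `Φ` on the finite set `S`. -/
def finSeq (S : Finset (Latt d)) (Φ : Latt d → Comp n → ℝ) : RapidSeq d n :=
  ⟨fun x => if x ∈ S then WithLp.toLp 2 (Φ x) else 0, fun N => by
    refine ⟨∑ x ∈ S, bracket x ^ N * ‖(WithLp.toLp 2 (Φ x) : Fib n)‖, fun x => ?_⟩
    by_cases hx : x ∈ S
    · simp only [hx, if_true]
      exact Finset.single_le_sum (f := fun x => bracket x ^ N * ‖(WithLp.toLp 2 (Φ x) : Fib n)‖)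
        (fun y _ => by have := bracket_pos y; positivity) hx
    · simp only [hx, if_false, norm_zero, mul_zero]
      exact Finset.sum_nonneg fun y _ => by have := bracket_pos y; positivity⟩

theorem pairL_finSeq (S : Finset (Latt d)) (Φ : Latt d → Comp n → ℝ) (Y : PhaseSpace d n α) :
    pairL α (finSeq S Φ) Y = ∑ x ∈ S, ∑ a, Y x a * Φ x a := by
  refine (hasSum_pairL _ Y).unique ?_
  have h : HasSum (fun x => if x ∈ S then ∑ a, Y x a * Φ x a else 0)
      (∑ x ∈ S, if x ∈ S then ∑ a, Y x a * Φ x a else 0) :=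
    hasSum_sum_of_ne_finset_zero (fun x hx => if_neg hx)
  rw [Finset.sum_congr rfl (g := fun x => ∑ a, Y x a * Φ x a) (fun x hx => if_pos hx)] at h
  refine h.congr_fun fun x => ?_
  by_cases hx : x ∈ S <;> simp [finSeq, hx]

end PhaseSpaceStructure

/-! ### The dynamics as a uniformly continuous group -/

open scoped Matrix.Norms.L2Operator in
theorem norm_entry_le_l2_opNorm {𝕜 ι κ : Type*} [RCLike 𝕜] [Fintype ι] [Fintype κ] [DecidableEq κ]
    (A : Matrix ι κ 𝕜) (a : ι) (b : κ) : ‖A a b‖ ≤ ‖A‖ := by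
  have h := Matrix.l2_opNorm_mulVec A (EuclideanSpace.single b (1 : 𝕜))
  have h2 := PiLp.norm_apply_le (WithLp.toLp 2 (A.mulVec (EuclideanSpace.single b (1 : 𝕜)).ofLp)) a
  have h3 : (A.mulVec (EuclideanSpace.single b (1 : 𝕜)).ofLp) a = A a b := by
    simp
  rw [PiLp.norm_single, norm_one, mul_one] at h
  calc ‖A a b‖ = ‖(A.mulVec (EuclideanSpace.single b (1 : 𝕜)).ofLp) a‖ := by rw [h3]
    _ ≤ _ := h2
    _ ≤ _ := h

/-- The linear map on a Euclidean space given by a real matrix. -/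
def matCLM {κ : Type*} [Fintype κ] [DecidableEq κ] (B : Matrix κ κ ℝ) :
    EuclideanSpace ℝ κ →L[ℝ] EuclideanSpace ℝ κ := Matrix.toEuclideanCLM (𝕜 := ℝ) B

theorem matCLM_apply {κ : Type*} [Fintype κ] [DecidableEq κ] (B : Matrix κ κ ℝ)
    (v : EuclideanSpace ℝ κ) (a : κ) : matCLM B v a = ∑ b, B a b * v b := by
  change (B.mulVec v.ofLp) a = _
  rfl

theorem norm_matCLM_le {κ : Type*} [Fintype κ] [DecidableEq κ] (B : Matrix κ κ ℝ) :
    ‖matCLM B‖ ≤ ∑ a, ∑ b, |B a b| := by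
  refine ContinuousLinearMap.opNorm_le_bound _
    (Finset.sum_nonneg fun a _ => Finset.sum_nonneg fun b _ => abs_nonneg _) fun v => ?_
  have h1 : ‖matCLM B v‖ ≤ ∑ a, |matCLM B v a| := by
    rw [EuclideanSpace.norm_eq, Real.sqrt_le_left (Finset.sum_nonneg fun i _ => abs_nonneg _)]
    simpa using Finset.sum_sq_le_sq_sum_of_nonneg (s := Finset.univ)
      (f := fun a => |matCLM B v a|) (fun i _ => abs_nonneg _)
  refine h1.trans ?_
  rw [Finset.sum_mul]
  refine Finset.sum_le_sum fun a _ => ?_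
  rw [matCLM_apply, Finset.sum_mul]
  refine (Finset.abs_sum_le_sum_abs _ _).trans (Finset.sum_le_sum fun b _ => ?_)
  rw [abs_mul]
  gcongr
  exact PiLp.norm_apply_le v b

section Generator

variable {d n : ℕ} (V : Latt d → Matrix (Fin n) (Fin n) ℝ)

/-- The convolution kernel of the generator `(u, v) ↦ (v, - V * u)`. -/
def genMat (z : Latt d) : Matrix (Comp n) (Comp n) ℝ :=
  Matrix.fromBlocks 0 (if z = 0 then 1 else 0) (-V z) 0

theorem CondE1.entry {V : Latt d → Matrix (Fin n) (Fin n) ℝ} (h : CondE1 V) :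
    ∃ C γ : ℝ, 0 < C ∧ 0 < γ ∧ ∀ x a b, |V x a b| ≤ C * Real.exp (-γ * len x) := by
  obtain ⟨C, γ, hC, hγ, hV⟩ := h
  exact ⟨C, γ, hC, hγ, fun x a b => (norm_entry_le_l2_opNorm (V x) a b).trans (hV x)⟩

theorem CondE1.summable_bracket {V : Latt d → Matrix (Fin n) (Fin n) ℝ} (h : CondE1 V) (β : ℝ)
    (a b : Fin n) : Summable fun x => bracket x ^ β * |V x a b| := by
  obtain ⟨C, γ, hC, hγ, hV⟩ := h.entry
  refine Summable.of_nonneg_of_le (fun x => ?_) (fun x => ?_)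
    ((summable_bracket_rpow_mul_exp (d := d) β hγ).mul_left C)
  · have := bracket_pos x
    positivity
  · have := bracket_pos x
    calc _ ≤ bracket x ^ β * (C * Real.exp (-γ * len x)) := by gcongr; exact hV x a b
      _ = _ := by ring

theorem CondE1.summable {V : Latt d → Matrix (Fin n) (Fin n) ℝ} (h : CondE1 V)
    (a b : Fin n) : Summable fun x => |V x a b| := by
  simpa using h.summable_bracket 0 a b

/-- The dominating convolution kernel for the generator on the weighted space. -/
def genDom (α : ℝ) (z : Latt d) : ℝ :=
  2 ^ |α| * bracket z ^ |α| * ∑ a, ∑ b, |genMat V z a b|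

theorem summable_genDom (hV : CondE1 V) (α : ℝ) : Summable (genDom V α) := by
  have h1 : ∀ a b, Summable fun z => bracket z ^ |α| * |genMat V z a b| := by
    have hite : ∀ c : ℝ, Summable fun z : Latt d => bracket z ^ |α| * |if z = 0 then c else 0| :=
      fun c => summable_of_ne_finset_zero (s := {0}) fun z hz => by
        rw [Finset.mem_singleton] at hz
        simp [hz]
    rintro (a | a) (b | b)
    · simp [genMat, summable_zero]
    · refine (hite ((1 : Matrix (Fin n) (Fin n) ℝ) a b)).congr fun z => ?_
      by_cases hz : z = 0 <;> simp [genMat, hz]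
    · refine (hV.summable_bracket |α| a b).congr fun z => ?_
      simp [genMat]
    · simp [genMat, summable_zero]
  have h2 : Summable fun z => ∑ a, ∑ b, bracket z ^ |α| * |genMat V z a b| :=
    summable_sum fun a _ => summable_sum fun b _ => h1 a b
  refine (h2.mul_left (2 ^ |α|)).congr fun z => ?_
  simp only [genDom, Finset.mul_sum, mul_assoc]

/-- The kernel of the generator, conjugated by the weights. -/
def genKer (α : ℝ) (x y : Latt d) : Fib n →L[ℝ] Fib n :=
  (bracket x ^ α * bracket y ^ (-α)) • matCLM (genMat V (x - y))

/-- Peetre's inequality bounds the ratio of the weights by a power of `bracket (x - y)`, which the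
exponential decay of `V` absorbs. Hence the generator is bounded on `ℋ_α` for every real `α`. -/
theorem norm_genKer_le (α : ℝ) (x y : Latt d) : ‖genKer V α x y‖ ≤ genDom V α (x - y) := by
  have hx := bracket_pos x
  have hy := bracket_pos y
  rw [genKer, norm_smul, Real.norm_of_nonneg (by positivity), genDom]
  have h1 := bracket_rpow_le α x y
  have h2 : bracket x ^ α * bracket y ^ (-α) ≤ 2 ^ |α| * bracket (x - y) ^ |α| := by
    calc bracket x ^ α * bracket y ^ (-α)
        ≤ 2 ^ |α| * bracket (x - y) ^ |α| * bracket y ^ α * bracket y ^ (-α) := by gcongr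
      _ = _ := by rw [mul_assoc, bracket_rpow_mul_neg, mul_one]
  gcongr
  · exact h2.trans' (by positivity)
  · exact norm_matCLM_le _

/-- The generator `(u, v) ↦ (v, - V * u)` on `ℋ_α`. -/
def gen (α : ℝ) : PhaseSpace d n α →L[ℝ] PhaseSpace d n α :=
  ((weightEquiv d n α).symm.toContinuousLinearEquiv :
    L2seq d (Fib n) →L[ℝ] PhaseSpace d n α).comp
    ((kerOp (genKer V α) (genDom V α) (norm_genKer_le V α)).comp
      ((weightEquiv d n α).toContinuousLinearEquiv : PhaseSpace d n α →L[ℝ] L2seq d (Fib n)))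

variable {V}

theorem hasSum_gen (hV : CondE1 V) {α : ℝ} (Y : PhaseSpace d n α) (x : Latt d) :
    HasSum (fun y => matCLM (genMat V (x - y)) (Y y)) (gen V α Y x) := by
  have h := hasSum_kerOp_apply (genKer V α) (summable_genDom V hV α) (norm_genKer_le V α)
    (weightEquiv d n α Y) x
  have h2 := h.const_smul (bracket x ^ (-α))
  have e : gen V α Y x = bracket x ^ (-α) •
      (kerOp (genKer V α) (genDom V α) (norm_genKer_le V α) (weightEquiv d n α Y)) x :=
    weightEquiv_symm_apply _ _
  rw [e]
  refine h2.congr_fun fun y => ?_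
  rw [weightEquiv_apply, genKer, _root_.smul_apply, map_smul, smul_smul, smul_smul]
  have : bracket x ^ (-α) * (bracket x ^ α * bracket y ^ (-α) * bracket y ^ α) = 1 := by
    rw [mul_assoc, bracket_rpow_neg_mul, mul_one, bracket_rpow_neg_mul]
  rw [mul_assoc, this, one_smul]

theorem hasSum_gen_apply (hV : CondE1 V) {α : ℝ} (Y : PhaseSpace d n α) (x : Latt d)
    (a : Comp n) : HasSum (fun y => ∑ b, genMat V (x - y) a b * Y y b) (gen V α Y x a) := by
  have h := (hasSum_gen hV Y x).mapL (EuclideanSpace.proj a : Fib n →L[ℝ] ℝ)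
  refine h.congr_fun fun y => ?_
  exact (matCLM_apply _ _ _).symm

theorem gen_apply_inl (hV : CondE1 V) {α : ℝ} (Y : PhaseSpace d n α) (x : Latt d) (a : Fin n) :
    gen V α Y x (Sum.inl a) = Y x (Sum.inr a) := by
  refine (hasSum_gen_apply hV Y x (Sum.inl a)).unique ?_
  refine (hasSum_ite_eq x (Y x (Sum.inr a))).congr_fun fun y => ?_
  by_cases hy : y = x
  · subst hy
    simp [genMat, Matrix.one_apply]
  · have : x - y ≠ 0 := sub_ne_zero.2 (Ne.symm hy)
    simp [genMat, this, hy]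

theorem gen_apply_inr (hV : CondE1 V) {α : ℝ} (Y : PhaseSpace d n α) (x : Latt d) (a : Fin n) :
    gen V α Y x (Sum.inr a) = -∑' y, ∑ b, V (x - y) a b * Y y (Sum.inl b) := by
  rw [← tsum_neg]
  refine (hasSum_gen_apply hV Y x (Sum.inr a)).tsum_eq.symm.trans (tsum_congr fun y => ?_)
  simp [genMat]

variable (V) in
/-- The group generated by `gen V α`. -/
def prop (α : ℝ) (t : ℝ) : PhaseSpace d n α →L[ℝ] PhaseSpace d n α :=
  NormedSpace.exp (t • gen V α)

theorem prop_zero (α : ℝ) : prop V α 0 = 1 := by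
  simp [prop]

theorem prop_add (α s t : ℝ) : prop V α (s + t) = prop V α s * prop V α t := by
  let _ : NormedAlgebra ℚ (PhaseSpace d n α →L[ℝ] PhaseSpace d n α) :=
    NormedAlgebra.restrictScalars ℚ ℝ _
  rw [prop, add_smul, NormedSpace.exp_add_of_commute]
  · rfl
  · exact ((Commute.refl (gen V α)).smul_left s).smul_right t

theorem hasDerivAt_prop (α t : ℝ) :
    HasDerivAt (prop V α) (gen V α * prop V α t) t :=
  hasDerivAt_exp_smul_const' (gen V α) t

theorem hasDerivAt_prop_apply (α t : ℝ) (Y : PhaseSpace d n α) :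
    HasDerivAt (fun t => prop V α t Y) (gen V α (prop V α t Y)) t :=
  (ContinuousLinearMap.apply ℝ (PhaseSpace d n α) Y).hasFDerivAt.comp_hasDerivAt t
    (hasDerivAt_prop α t)

theorem isSolution_prop (hV : CondE1 V) {α : ℝ} (Y : PhaseSpace d n α) :
    IsSolution V (fun t => prop V α t Y) := by
  refine ⟨continuous_iff_continuousAt.2 fun t => (hasDerivAt_prop_apply α t Y).continuousAt,
    fun x a t => ⟨?_, ?_⟩⟩
  · have h := (coordP d n α x (Sum.inl a)).hasFDerivAt.comp_hasDerivAt t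
      (hasDerivAt_prop_apply (V := V) α t Y)
    simpa only [Function.comp_def, coordP_apply, gen_apply_inl hV] using h
  · have h := (coordP d n α x (Sum.inr a)).hasFDerivAt.comp_hasDerivAt t
      (hasDerivAt_prop_apply (V := V) α t Y)
    simpa only [Function.comp_def, coordP_apply, gen_apply_inr hV] using h

/-- A solution is only assumed to be differentiable coordinatewise. The integral curve `Z` is
differentiable in norm because `gen V α` is bounded and `Y` is continuous, and its coordinates have
the same derivatives as those of `Y`. -/
theorem IsSolution.hasDerivAt (hV : CondE1 V) {α : ℝ} {Y : ℝ → PhaseSpace d n α}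
    (hY : IsSolution V Y) (t : ℝ) : HasDerivAt Y (gen V α (Y t)) t := by
  have hc : Continuous fun t => gen V α (Y t) := (gen V α).continuous.comp hY.1
  let Z : ℝ → PhaseSpace d n α := fun t => Y 0 + ∫ s in (0 : ℝ)..t, gen V α (Y s)
  have hZ : ∀ t, HasDerivAt Z (gen V α (Y t)) t := fun t =>
    (intervalIntegral.integral_hasDerivAt_right (hc.intervalIntegrable _ _)
      hc.aestronglyMeasurable.stronglyMeasurableAtFilter hc.continuousAt).const_add _
  have hcoord : ∀ x a t, HasDerivAt (fun t => Y t x a) (gen V α (Y t) x a) t := by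
    rintro x (a | a) t
    · rw [gen_apply_inl hV]; exact (hY.2 x a t).1
    · rw [gen_apply_inr hV]; exact (hY.2 x a t).2
  have hYZ : Y = Z := by
    funext t
    refine PhaseSpace.ext fun x => ?_
    ext a
    have hd : ∀ t, HasDerivAt (fun t => Y t x a - coordP d n α x a (Z t)) 0 t := by
      intro t
      have h1 := (coordP d n α x a).hasFDerivAt.comp_hasDerivAt t (hZ t)
      have h2 := (hcoord x a t).sub h1
      simpa only [Function.comp_def, coordP_apply, sub_self] using! h2
    have h3 := is_const_of_deriv_eq_zero (fun t => (hd t).differentiableAt)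
      (fun t => (hd t).deriv) t 0
    have h4 : Z 0 = Y 0 := by simp [Z]
    rw [h4] at h3
    simp only [coordP_apply, sub_self] at h3
    linarith
  rw [hYZ]
  have := hZ t
  rwa [← hYZ] at this ⊢

/-- Uniqueness: `prop V α (-s) (Y s)` has zero derivative in `s`, since the generator commutes with
its exponential. -/
theorem IsSolution.eq_prop (hV : CondE1 V) {α : ℝ} {Y : ℝ → PhaseSpace d n α}
    (hY : IsSolution V Y) (t : ℝ) : Y t = prop V α t (Y 0) := by
  have h1 : ∀ s, HasDerivAt (fun s => prop V α (-s) (Y s)) 0 s := by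
    intro s
    have h2 : HasDerivAt (fun s => prop V α (-s)) (-(gen V α * prop V α (-s))) s := by
      have h := (hasDerivAt_prop (V := V) α (-s)).scomp s (hasDerivAt_neg s)
      rw [neg_one_smul] at h
      exact h
    have h3 := h2.clm_apply (hY.hasDerivAt hV s)
    refine h3.congr_deriv ?_
    have hcomm : gen V α * prop V α (-s) = prop V α (-s) * gen V α :=
      (((Commute.refl (gen V α)).smul_right (-s)).exp_right).eq
    rw [hcomm]
    simp
  have h4 := is_const_of_deriv_eq_zero (fun s => (h1 s).differentiableAt)
    (fun s => (h1 s).deriv) t 0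
  have h5 : prop V α t (prop V α (-t) (Y t)) = Y t := by
    have : prop V α t * prop V α (-t) = 1 := by rw [← prop_add, add_neg_cancel, prop_zero]
    rw [← mul_apply_eq_comp, this, one_apply_eq_self]
  rw [← h5, h4, neg_zero, prop_zero, one_apply_eq_self]

/-- The flow of the statement is the group generated by `gen`. -/
theorem flow_eq_prop (hV : CondE1 V) {α : ℝ} (t : ℝ) (Y : PhaseSpace d n α) :
    flow V t Y = prop V α t Y := by
  have hex : ∃ Z : ℝ → PhaseSpace d n α, IsSolution V Z ∧ Z 0 = Y :=
    ⟨fun t => prop V α t Y, isSolution_prop hV Y, by simp [prop_zero]⟩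
  have h := Classical.epsilon_spec hex
  have h2 := h.1.eq_prop hV t
  rw [h.2] at h2
  exact h2

end Generator

/-! ### Fourier series on the cell -/

section Characters

variable {d : ℕ}

/-- The character `θ ↦ e^{i(x,θ)}`. -/
def ch (x : Latt d) (θ : Fin d → ℝ) : ℂ := Complex.exp (Complex.I * (dotZ x θ : ℂ))

theorem dotZ_add (x y : Latt d) (θ : Fin d → ℝ) : dotZ (x + y) θ = dotZ x θ + dotZ y θ := by
  simp [dotZ, add_mul, Finset.sum_add_distrib]

theorem dotZ_neg (x : Latt d) (θ : Fin d → ℝ) : dotZ (-x) θ = -dotZ x θ := by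
  simp [dotZ]

theorem ch_add (x y : Latt d) (θ : Fin d → ℝ) : ch (x + y) θ = ch x θ * ch y θ := by
  rw [ch, dotZ_add, ch, ch, ← Complex.exp_add]
  push_cast
  ring_nf

theorem norm_ch (x : Latt d) (θ : Fin d → ℝ) : ‖ch x θ‖ = 1 := by
  rw [ch, mul_comm]
  exact Complex.norm_exp_ofReal_mul_I _

theorem conj_ch (x : Latt d) (θ : Fin d → ℝ) : (starRingEnd ℂ) (ch x θ) = ch (-x) θ := by
  rw [ch, ch, ← Complex.exp_conj, dotZ_neg]
  simp

theorem ch_zero (θ : Fin d → ℝ) : ch (0 : Latt d) θ = 1 := by simp [ch, dotZ]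

theorem ch_neg_mul_self (x : Latt d) (θ : Fin d → ℝ) : ch (-x) θ * ch x θ = 1 := by
  rw [← ch_add, neg_add_cancel, ch_zero]

theorem continuous_ch (x : Latt d) : Continuous (ch x) := by
  unfold ch dotZ
  fun_prop

end Characters

section Torus

variable (d : ℕ)

/-- Normalized Lebesgue measure on the cell. -/
def nu : Measure (Fin d → ℝ) := ENNReal.ofReal (1 / (2 * Real.pi) ^ d) • volume.restrict (cell d)

theorem measurableSet_cell : MeasurableSet (cell d) :=
  MeasurableSet.univ_pi fun _ => measurableSet_Ioc

theorem nu_absolutelyContinuous : nu d ≪ (volume : Measure (Fin d → ℝ)) :=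
  Measure.smul_absolutelyContinuous.trans Measure.restrict_le_self.absolutelyContinuous

variable {d} in
theorem ae_nu_of_ae {P : (Fin d → ℝ) → Prop} (h : ∀ᵐ θ : Fin d → ℝ, P θ) : ∀ᵐ θ ∂nu d, P θ :=
  (nu_absolutelyContinuous d).ae_le h

theorem nu_factor_pos : 0 < 1 / (2 * Real.pi) ^ d := by positivity

theorem volume_cell : volume (cell d) = ENNReal.ofReal ((2 * Real.pi) ^ d) := by
  rw [cell, volume_pi_pi]
  simp only [Real.volume_Ioc, Finset.prod_const, Finset.card_univ, Fintype.card_fin]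
  rw [ENNReal.ofReal_pow (by positivity)]
  congr 2
  ring

instance : IsProbabilityMeasure (nu d) := ⟨by
  rw [nu, Measure.smul_apply, Measure.restrict_apply_univ, volume_cell, smul_eq_mul,
    ← ENNReal.ofReal_mul (nu_factor_pos d).le]
  have : (2 * Real.pi) ^ d ≠ 0 := by positivity
  rw [one_div_mul_cancel this, ENNReal.ofReal_one]⟩

variable {d} in
theorem integrable_nu_iff {E : Type*} [NormedAddCommGroup E] {f : (Fin d → ℝ) → E} :
    Integrable f (nu d) ↔ IntegrableOn f (cell d) :=
  integrable_smul_measure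
    (by rw [ne_eq, ENNReal.ofReal_eq_zero, not_le]; exact nu_factor_pos d) ENNReal.ofReal_ne_top

variable {d} in
theorem integral_nu (f : (Fin d → ℝ) → ℂ) :
    ∫ θ, f θ ∂nu d = (1 / (2 * Real.pi) ^ d : ℂ) * ∫ θ in cell d, f θ := by
  rw [nu, integral_smul_measure, ENNReal.toReal_ofReal (nu_factor_pos d).le, Complex.real_smul]
  push_cast
  rfl

section Transport

local instance : MeasureSpace UnitAddCircle := ⟨AddCircle.haarAddCircle⟩

local instance : IsProbabilityMeasure (volume : Measure UnitAddCircle) :=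
  inferInstanceAs (IsProbabilityMeasure AddCircle.haarAddCircle)

/-- The projection of `ℝ^d` to the torus. -/
def toTorus (θ : Fin d → ℝ) : UnitAddTorus (Fin d) := fun i => ((θ i / (2 * Real.pi) : ℝ) : UnitAddCircle)

/-- The section of `toTorus` with values in the cell. -/
def fromTorus (t : UnitAddTorus (Fin d)) : Fin d → ℝ :=
  fun i => 2 * Real.pi * (AddCircle.equivIoc (1 : ℝ) (-1 / 2) (t i) : ℝ)

theorem measurable_toTorus : Measurable (toTorus d) :=
  measurable_pi_lambda _ fun i => AddCircle.measurable_mk'.comp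
    ((measurable_pi_apply i).div_const _)

theorem measurable_fromTorus : Measurable (fromTorus d) :=
  measurable_pi_lambda _ fun i =>
    ((measurable_subtype_coe.comp
      ((AddCircle.measurableEquivIoc (1 : ℝ) (-1 / 2)).measurable.comp
        (measurable_pi_apply i))).const_mul _)

theorem fromTorus_toTorus {θ : Fin d → ℝ} (hθ : θ ∈ cell d) : fromTorus d (toTorus d θ) = θ := by
  funext i
  have h := hθ i (Set.mem_univ i)
  have hpi := Real.pi_pos
  have h2 : θ i / (2 * Real.pi) ∈ Set.Ioc (-1 / 2 : ℝ) (-1 / 2 + 1) := by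
    constructor
    · rw [lt_div_iff₀ (by positivity)]; linarith [h.1]
    · rw [div_le_iff₀ (by positivity)]; linarith [h.2]
  rw [fromTorus, toTorus, AddCircle.equivIoc_coe_of_mem h2]
  field_simp

theorem nu_eq_map : nu d = (volume.restrict
    {x : Fin d → ℝ | ∀ i, x i ∈ Set.Ioc (-1 / 2 : ℝ) (-1 / 2 + 1)}).map
      (fun x => (2 * Real.pi) • x) := by
  have hpi := Real.pi_pos
  have h0 : (2 * Real.pi) ≠ 0 := by positivity
  have h1 := Measure.map_addHaar_smul (volume : Measure (Fin d → ℝ)) h0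
  have hme : MeasurableEmbedding (fun x : Fin d → ℝ => (2 * Real.pi) • x) :=
    (MeasurableEquiv.smul₀ (2 * Real.pi) h0).measurableEmbedding
  have h2 : {x : Fin d → ℝ | ∀ i, x i ∈ Set.Ioc (-1 / 2 : ℝ) (-1 / 2 + 1)} =
      (fun x : Fin d → ℝ => (2 * Real.pi) • x) ⁻¹' cell d := by
    ext x
    simp only [Set.mem_ofPred_eq, cell, Set.mem_preimage, Set.mem_pi, Set.mem_univ, forall_true_left,
      Pi.smul_apply, smul_eq_mul, Set.mem_Ioc]
    refine forall_congr' fun i => and_congr ?_ ?_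
    · constructor <;> intro h <;> nlinarith
    · constructor <;> intro h <;> nlinarith
  rw [h2, ← hme.restrict_map, h1, Measure.restrict_smul, nu]
  congr 2
  rw [abs_of_pos (by positivity)]
  simp

/-- Divided by `2π`, the cell becomes the fundamental domain `(-1/2, 1/2]^d` of the unit torus, on
which Haar measure is Lebesgue measure. -/
theorem measurePreserving_toTorus : MeasurePreserving (toTorus d) (nu d) volume := by
  refine ⟨measurable_toTorus d, ?_⟩
  have hsm : Measurable (fun x : Fin d → ℝ => (2 * Real.pi) • x) := measurable_const_smul _
  rw [nu_eq_map, Measure.map_map (measurable_toTorus d) hsm]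
  have hm : Measurable (toTorus d ∘ fun x => (2 * Real.pi) • x) :=
    (measurable_toTorus d).comp hsm
  have he : (toTorus d ∘ fun x => (2 * Real.pi) • x) =
      fun (x : Fin d → ℝ) => (fun i => (x i : UnitAddCircle) : UnitAddTorus (Fin d)) := by
    funext x i
    have : (2 * Real.pi) ≠ 0 := by positivity
    simp only [toTorus, Function.comp, Pi.smul_apply, smul_eq_mul]
    rw [mul_div_cancel_left₀ _ this]
  ext s hs
  have h := UnitAddTorus.lintegral_preimage (s.indicator 1) (fun _ : Fin d => (-1 / 2 : ℝ))
  rw [lintegral_indicator_one hs] at h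
  rw [h, Measure.map_apply hm hs, ← lintegral_indicator_one (hm hs)]
  refine lintegral_congr fun x => ?_
  rw [he]
  rfl

theorem fromTorus_toTorus_ae : fromTorus d ∘ toTorus d =ᵐ[nu d] id := by
  have h : ∀ᵐ θ ∂(volume.restrict (cell d)), θ ∈ cell d := ae_restrict_mem (measurableSet_cell d)
  have h2 : ∀ᵐ θ ∂nu d, θ ∈ cell d := Measure.ae_smul_measure h _
  filter_upwards [h2] with θ hθ
  exact fromTorus_toTorus d hθ

theorem measurePreserving_fromTorus : MeasurePreserving (fromTorus d) volume (nu d) := by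
  refine ⟨measurable_fromTorus d, ?_⟩
  rw [← (measurePreserving_toTorus d).map_eq,
    Measure.map_map (measurable_fromTorus d) (measurable_toTorus d),
    Measure.map_congr (fromTorus_toTorus_ae d), Measure.map_id]

/-- `L²` of the torus is `L²` of the cell. -/
def torusEquiv : Lp ℂ 2 (volume : Measure (UnitAddTorus (Fin d))) ≃ₗᵢ[ℂ] Lp ℂ 2 (nu d) :=
  LinearIsometryEquiv.ofSurjective
    (Lp.compMeasurePreservingₗᵢ ℂ (toTorus d) (measurePreserving_toTorus d)) fun g => by
      refine ⟨Lp.compMeasurePreserving (fromTorus d) (measurePreserving_fromTorus d) g, ?_⟩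
      refine Lp.ext ?_
      have h1 := Lp.coeFn_compMeasurePreserving
        (Lp.compMeasurePreserving (fromTorus d) (measurePreserving_fromTorus d) g)
        (measurePreserving_toTorus d)
      have h2 := (measurePreserving_toTorus d).quasiMeasurePreserving.ae_eq_comp
        (Lp.coeFn_compMeasurePreserving g (measurePreserving_fromTorus d))
      refine h1.trans (h2.trans ?_)
      filter_upwards [fromTorus_toTorus_ae d] with θ hθ
      simp only [Function.comp, id] at hθ ⊢
      rw [hθ]

theorem mFourier_toTorus (x : Latt d) (θ : Fin d → ℝ) :
    UnitAddTorus.mFourier x (toTorus d θ) = ch x θ := by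
  simp only [UnitAddTorus.mFourier, ContinuousMap.coe_mk, toTorus, fourier_coe_apply, ch, dotZ]
  rw [← Complex.exp_sum]
  congr 1
  push_cast
  rw [Finset.mul_sum]
  refine Finset.sum_congr rfl fun i _ => ?_
  have : (Real.pi : ℂ) ≠ 0 := by exact_mod_cast Real.pi_ne_zero
  field_simp

/-- The Hilbert basis of characters. -/
def chBasis : HilbertBasis (Latt d) ℂ (Lp ℂ 2 (nu d)) :=
  HilbertBasis.ofRepr ((torusEquiv d).symm.trans UnitAddTorus.mFourierBasis.repr)

theorem coeFn_chBasis (x : Latt d) : chBasis d x =ᵐ[nu d] ch x := by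
  have h1 : chBasis d x = torusEquiv d (UnitAddTorus.mFourierBasis x) := by
    rw [← (chBasis d).repr_symm_single, ← UnitAddTorus.mFourierBasis.repr_symm_single]
    rfl
  rw [h1, UnitAddTorus.coe_mFourierBasis]
  have h2 := Lp.coeFn_compMeasurePreserving (UnitAddTorus.mFourierLp 2 x)
    (measurePreserving_toTorus d)
  have h3 := (measurePreserving_toTorus d).quasiMeasurePreserving.ae_eq_comp
    (UnitAddTorus.coeFn_mFourierLp 2 x)
  refine h2.trans (h3.trans (Eventually.of_forall fun θ => ?_))
  exact mFourier_toTorus d x θ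

end Transport

variable {d}

/-- The Fourier coefficients of an `L²` function. -/
def coef : Lp ℂ 2 (nu d) ≃ₗᵢ[ℂ] L2seq d ℂ := (chBasis d).repr

theorem coef_apply (g : Lp ℂ 2 (nu d)) (x : Latt d) :
    coef g x = ∫ θ, ch (-x) θ * g θ ∂nu d := by
  rw [coef, HilbertBasis.repr_apply_apply, L2.inner_def]
  refine integral_congr_ae ?_
  filter_upwards [coeFn_chBasis d x] with θ hθ
  rw [hθ, RCLike.inner_apply, conj_ch, mul_comm]

end Torus

/-! ### Multiplication operators and test functions -/

section MulOp

variable {d : ℕ}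

theorem memLp_bdd_mul {m f : (Fin d → ℝ) → ℂ} {C : ℝ} (hm : AEStronglyMeasurable m (nu d))
    (hC : ∀ θ, ‖m θ‖ ≤ C) (hf : MemLp f 2 (nu d)) : MemLp (fun θ => m θ * f θ) 2 (nu d) :=
  hf.of_le_mul (c := C) (hm.mul hf.1) (Eventually.of_forall fun θ => by
    rw [norm_mul]; gcongr; exact hC θ)

/-- Multiplication by a bounded function, as a linear map on `L²`. -/
def mulLin (m : (Fin d → ℝ) → ℂ) (hm : AEStronglyMeasurable m (nu d)) (C : ℝ)
    (hC : ∀ θ, ‖m θ‖ ≤ C) : Lp ℂ 2 (nu d) →ₗ[ℂ] Lp ℂ 2 (nu d) where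
  toFun f := (memLp_bdd_mul hm hC (Lp.memLp f)).toLp
  map_add' f g := by
    refine Lp.ext ?_
    filter_upwards [MemLp.coeFn_toLp (memLp_bdd_mul hm hC (Lp.memLp (f + g))),
      MemLp.coeFn_toLp (memLp_bdd_mul hm hC (Lp.memLp f)),
      MemLp.coeFn_toLp (memLp_bdd_mul hm hC (Lp.memLp g)), Lp.coeFn_add f g,
      Lp.coeFn_add (memLp_bdd_mul hm hC (Lp.memLp f)).toLp
        (memLp_bdd_mul hm hC (Lp.memLp g)).toLp] with θ h1 h2 h3 h4 h5
    rw [h1, h5, Pi.add_apply, h2, h3, h4, Pi.add_apply, mul_add]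
  map_smul' c f := by
    refine Lp.ext ?_
    filter_upwards [MemLp.coeFn_toLp (memLp_bdd_mul hm hC (Lp.memLp (c • f))),
      MemLp.coeFn_toLp (memLp_bdd_mul hm hC (Lp.memLp f)), Lp.coeFn_smul c f,
      Lp.coeFn_smul c (memLp_bdd_mul hm hC (Lp.memLp f)).toLp] with θ h1 h2 h4 h5
    rw [h1, RingHom.id_apply, h5, Pi.smul_apply, h2, h4, Pi.smul_apply, smul_eq_mul, smul_eq_mul,
      mul_left_comm]

theorem coeFn_mulLin (m : (Fin d → ℝ) → ℂ) (hm : AEStronglyMeasurable m (nu d)) (C : ℝ)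
    (hC : ∀ θ, ‖m θ‖ ≤ C) (f : Lp ℂ 2 (nu d)) :
    mulLin m hm C hC f =ᵐ[nu d] fun θ => m θ * f θ :=
  MemLp.coeFn_toLp (memLp_bdd_mul hm hC (Lp.memLp f))

/-- Multiplication by a bounded function, as an operator on `L²`. -/
def mulOp (m : (Fin d → ℝ) → ℂ) (hm : AEStronglyMeasurable m (nu d)) (C : ℝ)
    (hC : ∀ θ, ‖m θ‖ ≤ C) : Lp ℂ 2 (nu d) →L[ℂ] Lp ℂ 2 (nu d) :=
  (mulLin m hm C hC).mkContinuous C fun f => by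
    refine Lp.norm_le_mul_norm_of_ae_le_mul ?_
    filter_upwards [coeFn_mulLin m hm C hC f] with θ hθ
    rw [hθ, norm_mul]
    gcongr
    exact hC θ

theorem coeFn_mulOp (m : (Fin d → ℝ) → ℂ) (hm : AEStronglyMeasurable m (nu d)) (C : ℝ)
    (hC : ∀ θ, ‖m θ‖ ≤ C) (f : Lp ℂ 2 (nu d)) :
    mulOp m hm C hC f =ᵐ[nu d] fun θ => m θ * f θ := coeFn_mulLin m hm C hC f

/-- The oscillating factor `e^{itψ}`. -/
def osc (ψ : (Fin d → ℝ) → ℝ) (t : ℝ) (θ : Fin d → ℝ) : ℂ :=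
  Complex.exp (((t * ψ θ : ℝ) : ℂ) * Complex.I)

theorem norm_osc (ψ : (Fin d → ℝ) → ℝ) (t : ℝ) (θ : Fin d → ℝ) : ‖osc ψ t θ‖ = 1 :=
  Complex.norm_exp_ofReal_mul_I _

theorem conj_osc (ψ : (Fin d → ℝ) → ℝ) (t : ℝ) (θ : Fin d → ℝ) :
    (starRingEnd ℂ) (osc ψ t θ) = osc ψ (-t) θ := by
  rw [osc, osc, ← Complex.exp_conj]
  simp

theorem osc_sub (ψ φ : (Fin d → ℝ) → ℝ) (t : ℝ) (θ : Fin d → ℝ) :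
    osc (fun θ => ψ θ - φ θ) t θ = osc φ (-t) θ * osc ψ t θ := by
  rw [osc, osc, osc, ← Complex.exp_add]
  push_cast
  ring_nf

theorem aesm_osc {ψ : (Fin d → ℝ) → ℝ} (hψ : AEMeasurable ψ (nu d)) (t : ℝ) :
    AEStronglyMeasurable (osc ψ t) (nu d) := by
  refine AEMeasurable.aestronglyMeasurable ?_
  unfold osc
  fun_prop

/-- Multiplication by `e^{itψ}`. -/
def oscOp (ψ : (Fin d → ℝ) → ℝ) (hψ : AEMeasurable ψ (nu d)) (t : ℝ) :
    Lp ℂ 2 (nu d) →L[ℂ] Lp ℂ 2 (nu d) :=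
  mulOp (osc ψ t) (aesm_osc hψ t) 1 fun θ => (norm_osc ψ t θ).le

theorem coeFn_oscOp {ψ : (Fin d → ℝ) → ℝ} (hψ : AEMeasurable ψ (nu d)) (t : ℝ)
    (f : Lp ℂ 2 (nu d)) : oscOp ψ hψ t f =ᵐ[nu d] fun θ => osc ψ t θ * f θ :=
  coeFn_mulOp _ _ _ _ f

theorem norm_oscOp {ψ : (Fin d → ℝ) → ℝ} (hψ : AEMeasurable ψ (nu d)) (t : ℝ)
    (f : Lp ℂ 2 (nu d)) : ‖oscOp ψ hψ t f‖ = ‖f‖ := by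
  rw [Lp.norm_def, Lp.norm_def]
  congr 1
  refine eLpNorm_congr_norm_ae ?_
  filter_upwards [coeFn_oscOp hψ t f] with θ hθ
  rw [hθ, norm_mul, norm_osc, one_mul]

/-- Smooth functions with compact support in the open set `W`. -/
structure IsTest (W : Set (Fin d → ℝ)) (f : (Fin d → ℝ) → ℂ) : Prop where
  smooth : ContDiff ℝ (⊤ : ℕ∞) f
  compact : HasCompactSupport f
  sub : tsupport f ⊆ W

namespace IsTest

variable {W : Set (Fin d → ℝ)} {f : (Fin d → ℝ) → ℂ}

theorem memLp (hf : IsTest W f) : MemLp f 2 (nu d) :=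
  hf.smooth.continuous.memLp_of_hasCompactSupport hf.compact

/-- Smoothness of the factor on `W` is enough, because the product vanishes near each point off the
support. This allows phases that are smooth only at good momenta. -/
theorem mul (hf : IsTest W f) {a : (Fin d → ℝ) → ℂ} (hW : IsOpen W)
    (ha : ContDiffOn ℝ (⊤ : ℕ∞) a W) : IsTest W fun θ => a θ * f θ := by
  have hs : tsupport (fun θ => a θ * f θ) ⊆ tsupport f :=
    closure_mono (Function.support_mul_subset_right a f)
  refine ⟨contDiff_iff_contDiffAt.2 fun θ => ?_, hf.compact.mul_left, hs.trans hf.sub⟩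
  by_cases hθ : θ ∈ tsupport f
  · exact (ha.contDiffAt (hW.mem_nhds (hf.sub hθ))).mul hf.smooth.contDiffAt
  · have h1 : f =ᶠ[𝓝 θ] 0 := notMem_tsupport_iff_eventuallyEq.1 hθ
    have h2 : (fun θ => a θ * f θ) =ᶠ[𝓝 θ] fun _ => 0 := by
      filter_upwards [h1] with x hx
      simp [hx]
    exact contDiffAt_const.congr_of_eventuallyEq h2

theorem deriv (hf : IsTest W f) (v : Fin d → ℝ) : IsTest W fun θ => fderiv ℝ f θ v := by
  refine ⟨?_, hf.compact.fderiv_apply (𝕜 := ℝ) v, ?_⟩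
  · have h1 : ContDiff ℝ (⊤ : ℕ∞) (fderiv ℝ f) := hf.smooth.fderiv_right (by simp)
    exact h1.clm_apply contDiff_const
  · exact (tsupport_fderiv_apply_subset ℝ v).trans hf.sub

end IsTest

/-- The open cell. -/
def ocell (d : ℕ) : Set (Fin d → ℝ) := Set.pi Set.univ fun _ => Set.Ioo (-Real.pi) Real.pi

theorem isOpen_ocell : IsOpen (ocell d) := isOpen_set_pi Set.finite_univ fun _ _ => isOpen_Ioo

theorem ocell_subset_cell : ocell d ⊆ cell d :=
  Set.pi_mono fun _ _ => Set.Ioo_subset_Ioc_self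

theorem ae_mem_ocell : ∀ᵐ θ ∂nu d, θ ∈ ocell d := by
  have h : ∀ᵐ θ ∂nu d, θ ∈ cell d :=
    Measure.ae_smul_measure (ae_restrict_mem (measurableSet_cell d)) _
  have h2 : ∀ i : Fin d, ∀ᵐ θ ∂nu d, θ i ≠ Real.pi := fun i =>
    ae_nu_of_ae (Measure.ae_eval_ne (μ := fun _ : Fin d => (volume : Measure ℝ)) i Real.pi)
  filter_upwards [h, ae_all_iff.2 h2] with θ h3 h4 i _
  exact ⟨(h3 i (Set.mem_univ i)).1, lt_of_le_of_ne (h3 i (Set.mem_univ i)).2 (h4 i)⟩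

theorem integral_nu_eq_of_support {f : (Fin d → ℝ) → ℂ} (hf : ∀ θ, θ ∉ cell d → f θ = 0) :
    ∫ θ, f θ ∂nu d = (1 / (2 * Real.pi) ^ d : ℂ) * ∫ θ, f θ := by
  rw [integral_nu, setIntegral_eq_integral_of_forall_compl_eq_zero hf]

theorem IsTest.eq_zero {W : Set (Fin d → ℝ)} {f : (Fin d → ℝ) → ℂ} (hf : IsTest W f)
    {θ : Fin d → ℝ} (hθ : θ ∉ W) : f θ = 0 := by
  by_contra h
  exact hθ (hf.sub (subset_tsupport f h))

theorem hasFDerivAt_dotZ (x : Latt d) (θ : Fin d → ℝ) :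
    HasFDerivAt (fun θ => dotZ x θ)
      (∑ i, (x i : ℝ) • (ContinuousLinearMap.proj i : (Fin d → ℝ) →L[ℝ] ℝ)) θ := by
  have : (fun θ : Fin d → ℝ => dotZ x θ) =
      ⇑(∑ i, (x i : ℝ) • (ContinuousLinearMap.proj i : (Fin d → ℝ) →L[ℝ] ℝ)) := by
    funext θ
    simp [dotZ]
  rw [this]
  exact ContinuousLinearMap.hasFDerivAt _

theorem hasFDerivAt_ofReal_comp {f : (Fin d → ℝ) → ℝ} {f' : (Fin d → ℝ) →L[ℝ] ℝ} {θ : Fin d → ℝ}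
    (h : HasFDerivAt f f' θ) :
    HasFDerivAt (fun θ => (f θ : ℂ)) (Complex.ofRealCLM.comp f') θ :=
  Complex.ofRealCLM.hasFDerivAt.comp θ h

theorem fderiv_ch (x : Latt d) (θ : Fin d → ℝ) (j : Fin d) :
    fderiv ℝ (ch x) θ (Pi.single j 1) = Complex.I * (x j : ℂ) * ch x θ := by
  have h1 := hasFDerivAt_ofReal_comp (hasFDerivAt_dotZ x θ)
  have h2 := (h1.const_mul Complex.I).cexp
  have h3 : fderiv ℝ (ch x) θ = _ := h2.fderiv
  rw [h3]
  simp [ch, Pi.single_apply]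
  ring

theorem contDiff_ch (x : Latt d) : ContDiff ℝ (⊤ : ℕ∞) (ch x) := by
  have h : ContDiff ℝ (⊤ : ℕ∞) (fun θ => dotZ x θ) := by
    unfold dotZ
    fun_prop
  exact (contDiff_const.mul (Complex.ofRealCLM.contDiff.comp h)).cexp

theorem integrable_mul_test {W : Set (Fin d → ℝ)} {a f : (Fin d → ℝ) → ℂ} (ha : Continuous a)
    (hf : IsTest W f) : Integrable fun θ => a θ * f θ :=
  (ha.mul hf.smooth.continuous).integrable_of_hasCompactSupport hf.compact.mul_left

/-- Integration by parts for Fourier coefficients. -/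
theorem integral_ch_mul_deriv {W : Set (Fin d → ℝ)} (hWc : W ⊆ ocell d) {f : (Fin d → ℝ) → ℂ}
    (hf : IsTest W f) (x : Latt d) (j : Fin d) :
    ∫ θ, ch (-x) θ * fderiv ℝ f θ (Pi.single j 1) ∂nu d =
      Complex.I * (x j : ℂ) * ∫ θ, ch (-x) θ * f θ ∂nu d := by
  -- The supports lie in the open cell, so integrals over the cell are integrals over `ℝ^d` and
  -- there are no boundary terms.
  have hz : ∀ {g : (Fin d → ℝ) → ℂ}, IsTest W g → ∀ θ, θ ∉ cell d → ch (-x) θ * g θ = 0 :=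
    fun hg θ hθ => by
      rw [hg.eq_zero fun h => hθ (ocell_subset_cell (hWc h)), mul_zero]
  rw [integral_nu_eq_of_support (hz (hf.deriv _)), integral_nu_eq_of_support (hz hf)]
  have hparts := integral_mul_fderiv_eq_neg_fderiv_mul_of_integrable (μ := volume)
    (f := ch (-x)) (g := f) (v := Pi.single j 1)
    (by
      simp only [fderiv_ch]
      exact integrable_mul_test (continuous_const.mul (continuous_ch _)) hf)
    (integrable_mul_test (continuous_ch _) (hf.deriv _))
    (integrable_mul_test (continuous_ch _) hf)
    (fun θ _ => (contDiff_ch (-x)).differentiable (by simp) θ)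
    (fun θ _ => hf.smooth.differentiable (by simp) θ)
  rw [hparts]
  simp only [fderiv_ch, mul_assoc, integral_const_mul]
  simp
  ring

theorem integral_deriv_eq_zero {W : Set (Fin d → ℝ)} (hWc : W ⊆ ocell d) {f : (Fin d → ℝ) → ℂ}
    (hf : IsTest W f) (j : Fin d) : ∫ θ, fderiv ℝ f θ (Pi.single j 1) ∂nu d = 0 := by
  have h := integral_ch_mul_deriv hWc hf 0 j
  simpa [ch_zero] using h

theorem contDiffOn_osc {W : Set (Fin d → ℝ)} {ψ : (Fin d → ℝ) → ℝ}
    (hψ : ContDiffOn ℝ (⊤ : ℕ∞) ψ W) (t : ℝ) : ContDiffOn ℝ (⊤ : ℕ∞) (osc ψ t) W :=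
  (((Complex.ofRealCLM.contDiff.comp_contDiffOn (contDiffOn_const.mul hψ))).mul
    contDiffOn_const).cexp

theorem fderiv_osc_mul {W : Set (Fin d → ℝ)} (hW : IsOpen W) {ψ : (Fin d → ℝ) → ℝ}
    (hψ : ContDiffOn ℝ (⊤ : ℕ∞) ψ W) {f : (Fin d → ℝ) → ℂ} (hf : IsTest W f) (t : ℝ)
    (v θ : Fin d → ℝ) :
    fderiv ℝ (fun θ => osc ψ t θ * f θ) θ v =
      osc ψ t θ * (Complex.I * (t : ℂ) * ((fderiv ℝ ψ θ v : ℝ) : ℂ) * f θ + fderiv ℝ f θ v) := by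
  by_cases hθ : θ ∈ W
  · have h1 : HasFDerivAt ψ (fderiv ℝ ψ θ) θ :=
      ((hψ.contDiffAt (hW.mem_nhds hθ)).differentiableAt (by simp)).hasFDerivAt
    have h2 := ((hasFDerivAt_ofReal_comp (h1.const_mul t)).mul_const Complex.I).cexp
    have h3 : HasFDerivAt f (fderiv ℝ f θ) θ := (hf.smooth.differentiable (by simp) θ).hasFDerivAt
    have h4 := (h2.mul h3).fderiv
    have h5 : (fun θ => osc ψ t θ * f θ) =
        (fun θ => Complex.exp (((t * ψ θ : ℝ) : ℂ) * Complex.I)) * f := rfl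
    rw [h5, h4]
    simp [osc]
    ring
  · have h0 : θ ∉ tsupport f := fun h => hθ (hf.sub h)
    have h1 : f =ᶠ[𝓝 θ] 0 := notMem_tsupport_iff_eventuallyEq.1 h0
    have h2 : (fun θ => osc ψ t θ * f θ) =ᶠ[𝓝 θ] fun _ => 0 := by
      filter_upwards [h1] with x hx
      simp [hx]
    have h3 : fderiv ℝ f θ v = 0 := hf.deriv v |>.eq_zero hθ
    rw [h2.fderiv_eq, hf.eq_zero hθ, h3]
    simp

end MulOp

/-! ### Density of test functions in `L²` -/

section Density

variable {d : ℕ}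

/-- Test functions supported in the members of a family of open sets span a dense subspace of the
`L²` functions that vanish off the union. -/
theorem mem_of_test_mem {ι : Type*} [Countable ι] (W : ι → Set (Fin d → ℝ))
    (hW : ∀ i, IsOpen (W i)) (hWc : ∀ i, W i ⊆ ocell d) (K : Submodule ℂ (Lp ℂ 2 (nu d)))
    (hK : IsClosed (K : Set (Lp ℂ 2 (nu d))))
    (h : ∀ i f, ∀ hf : IsTest (W i) f, hf.memLp.toLp f ∈ K)
    (g : Lp ℂ 2 (nu d)) (hg : ∀ᵐ θ ∂nu d, g θ ≠ 0 → ∃ i, θ ∈ W i) : g ∈ K := by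
  have hKK : Kᗮᗮ = K := by
    rw [Submodule.orthogonal_orthogonal_eq_closure]
    exact hK.submodule_topologicalClosure_eq
  rw [← hKK, Submodule.mem_orthogonal]
  intro u hu
  have hint : Integrable u (nu d) := (Lp.memLp u).integrable (by norm_num)
  -- A function orthogonal to all test functions in `W i` vanishes almost everywhere there, by the
  -- fundamental lemma of the calculus of variations. It is then orthogonal to `g`, and double
  -- orthogonality returns to `K`.
  have hz : ∀ i, ∀ᵐ θ : Fin d → ℝ, θ ∈ W i → u θ = 0 := by
    intro i
    refine (hW i).ae_eq_zero_of_integral_contDiff_smul_eq_zero ?_ fun φ hφ hφc hφs => ?_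
    · have h1 : IntegrableOn u (cell d) := integrable_nu_iff.1 hint
      exact (h1.mono_set ((hWc i).trans ocell_subset_cell)).locallyIntegrableOn
    · have ht : IsTest (W i) (fun θ => (φ θ : ℂ)) := by
        refine ⟨Complex.ofRealCLM.contDiff.comp hφ, hφc.comp_left (g := fun r : ℝ => (r : ℂ)) rfl, ?_⟩
        refine (closure_mono fun θ hθ => ?_).trans hφs
        simpa using hθ
      have h2 := (Submodule.mem_orthogonal _ _).1 hu _ (h i _ ht)
      rw [L2.inner_def] at h2
      have h3 : ∫ θ, φ θ • u θ ∂nu d = 0 := by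
        rw [← h2]
        refine integral_congr_ae ?_
        filter_upwards [ht.memLp.coeFn_toLp] with θ hθ
        rw [hθ, RCLike.inner_apply, Complex.conj_ofReal, Complex.real_smul, mul_comm]
      rw [integral_nu_eq_of_support] at h3
      · refine (mul_eq_zero.1 h3).resolve_left ?_
        have : (Real.pi : ℂ) ≠ 0 := by exact_mod_cast Real.pi_ne_zero
        simp [this]
      · intro θ hθ
        have : φ θ = 0 := by
          by_contra hne
          exact hθ (ocell_subset_cell (hWc i (hφs (subset_tsupport φ hne))))
        rw [this, zero_smul]
  rw [L2.inner_def]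
  refine integral_eq_zero_of_ae ?_
  filter_upwards [ae_nu_of_ae (ae_all_iff.2 hz), hg] with θ h1 h2
  by_cases hθ : g θ = 0
  · simp [hθ]
  · obtain ⟨i, hi⟩ := h2 hθ
    simp [h1 i hi]

end Density

/-! ### Vectors annihilated in the limit by a bounded family of operators -/

section NullSub

variable {E F τ : Type*} [NormedAddCommGroup E] [NormedSpace ℂ E] [NormedAddCommGroup F]
  [NormedSpace ℂ F]

/-- The vectors on which a family of operators tends to zero. -/
def nullSub (l : Filter τ) (T : τ → E →L[ℂ] F) : Submodule ℂ E where
  carrier := {g | Tendsto (fun t => T t g) l (𝓝 0)}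
  zero_mem' := by simpa using tendsto_const_nhds
  add_mem' := fun {a b} ha hb => by
    have h : Tendsto (fun t => T t a + T t b) l (𝓝 (0 + 0)) := Tendsto.add ha hb
    simpa using h
  smul_mem' := fun c a ha => by
    have h : Tendsto (fun t => c • T t a) l (𝓝 (c • (0 : F))) := Tendsto.const_smul ha c
    simpa using h

/-- An approximation argument based on the uniform bound `M`. Combined with `mem_of_test_mem` it
reduces limits on all of `L²` to test functions. -/
theorem isClosed_nullSub {l : Filter τ} {T : τ → E →L[ℂ] F} {M : ℝ} (hM : ∀ t, ‖T t‖ ≤ M) :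
    IsClosed (nullSub l T : Set E) := by
  refine isClosed_of_closure_subset fun g hg => ?_
  rw [Metric.mem_closure_iff] at hg
  change Tendsto (fun t => T t g) l (𝓝 0)
  rcases isEmpty_or_nonempty τ with hτ | ⟨⟨t₀⟩⟩
  · have : l = ⊥ := filter_eq_bot_of_isEmpty l
    rw [this]
    exact tendsto_bot
  have hM0 : 0 ≤ M := (norm_nonneg _).trans (hM t₀)
  rw [Metric.tendsto_nhds]
  intro ε hε
  obtain ⟨b, hb, hgb⟩ := hg (ε / (2 * (M + 1))) (by positivity)
  have hb' : Tendsto (fun t => T t b) l (𝓝 0) := hb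
  filter_upwards [Metric.tendsto_nhds.1 hb' (ε / 2) (by positivity)] with t ht
  rw [dist_zero_right] at ht ⊢
  rw [dist_eq_norm] at hgb
  have h1 : ‖T t (g - b)‖ ≤ M * (ε / (2 * (M + 1))) :=
    ((T t).le_opNorm _).trans (by gcongr; exact hM t)
  have h2 : M * (ε / (2 * (M + 1))) ≤ ε / 2 := by
    rw [mul_div_assoc', div_le_div_iff₀ (by positivity) (by positivity)]
    nlinarith
  calc ‖T t g‖ = ‖T t (g - b) + T t b‖ := by rw [map_sub, sub_add_cancel]
    _ ≤ ‖T t (g - b)‖ + ‖T t b‖ := norm_add_le _ _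
    _ < ε := by linarith

end NullSub

/-! ### Propagation of wave packets -/

section Propagation

variable {d : ℕ}

/-- Truncation of a sequence to a set of lattice points. -/
def cutOp (S : Set (Latt d)) : L2seq d ℂ →L[ℂ] L2seq d ℂ :=
  open Classical in
  lpShift 0 (fun x => if x ∈ S then ContinuousLinearMap.id ℂ ℂ else 0) 1 fun x => by
    split_ifs
    · exact ContinuousLinearMap.norm_id_le
    · simp

open Classical in
theorem cutOp_apply (S : Set (Latt d)) (u : L2seq d ℂ) (x : Latt d) :
    cutOp S u x = if x ∈ S then u x else 0 := by
  rw [cutOp, lpShift_apply, sub_zero]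
  split_ifs <;> rfl

variable {W : Set (Fin d → ℝ)} {ψ : (Fin d → ℝ) → ℝ}

theorem aemeasurable_of_contDiffOn (hW : IsOpen W) (hWm : ∀ᵐ θ ∂nu d, θ ∈ W)
    (hψ : ContinuousOn ψ W) : AEMeasurable ψ (nu d) := by
  have h : AEMeasurable ψ ((nu d).restrict W) := hψ.aemeasurable hW.measurableSet
  rwa [Measure.restrict_eq_self_of_ae_mem hWm] at h

theorem coef_oscOp_toLp (hψm : AEMeasurable ψ (nu d)) {f : (Fin d → ℝ) → ℂ}
    (hf : MemLp f 2 (nu d)) (t : ℝ) (x : Latt d) :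
    coef (oscOp ψ hψm t (hf.toLp f)) x = ∫ θ, ch (-x) θ * (osc ψ t θ * f θ) ∂nu d := by
  rw [coef_apply]
  refine integral_congr_ae ?_
  filter_upwards [coeFn_oscOp hψm t (hf.toLp f), hf.coeFn_toLp] with θ h1 h2
  rw [h1, h2]

theorem integrable_nu_test {a f : (Fin d → ℝ) → ℂ} (ha : Continuous a) (hf : IsTest W f) :
    Integrable (fun θ => a θ * f θ) (nu d) :=
  integrable_nu_iff.2 (integrable_mul_test ha hf).integrableOn

theorem contDiffOn_fderiv_apply (hW : IsOpen W) (hψ : ContDiffOn ℝ (⊤ : ℕ∞) ψ W)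
    (v : Fin d → ℝ) : ContDiffOn ℝ (⊤ : ℕ∞) (fun θ => fderiv ℝ ψ θ v) W :=
  (hψ.fderiv_of_isOpen hW (by simp)).clm_apply contDiffOn_const

theorem contDiffOn_velocity (hW : IsOpen W) (hψ : ContDiffOn ℝ (⊤ : ℕ∞) ψ W)
    (v : Fin d → ℝ) (s R : ℝ) :
    ContDiffOn ℝ (⊤ : ℕ∞) (fun θ => ((s * fderiv ℝ ψ θ v - R : ℝ) : ℂ)) W :=
  Complex.ofRealCLM.contDiff.comp_contDiffOn
    ((contDiffOn_const.mul (contDiffOn_fderiv_apply hW hψ v)).sub contDiffOn_const)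

/-- The position operator divided by time acts on a wave packet as its velocity, up to `O(1/t)`. -/
theorem position_mul_coef (hW : IsOpen W) (hWc : W ⊆ ocell d) (hψm : AEMeasurable ψ (nu d))
    (hψ : ContDiffOn ℝ (⊤ : ℕ∞) ψ W) {f : (Fin d → ℝ) → ℂ} (hf : IsTest W f) (j : Fin d)
    (s R : ℝ) {t : ℝ} (ht : t ≠ 0) (x : Latt d)
    (hf1 : IsTest W fun θ => ((s * fderiv ℝ ψ θ (Pi.single j 1) - R : ℝ) : ℂ) * f θ)
    (hf2 : IsTest W fun θ => (-Complex.I * s) * fderiv ℝ f θ (Pi.single j 1)) :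
    ((s * x j / t - R : ℝ) : ℂ) * coef (oscOp ψ hψm t (hf.memLp.toLp f)) x =
      coef (oscOp ψ hψm t (hf1.memLp.toLp _)) x +
        (1 / t : ℂ) * coef (oscOp ψ hψm t (hf2.memLp.toLp _)) x := by
  have hF : IsTest W fun θ => osc ψ t θ * f θ := hf.mul hW (contDiffOn_osc hψ t)
  have hF1 := hf1.mul hW (contDiffOn_osc hψ t)
  have hF2 := hf2.mul hW (contDiffOn_osc hψ t)
  have key := integral_ch_mul_deriv hWc hF x j
  have hI1 := integrable_nu_test (continuous_ch (-x)) hF1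
  have hI2 := integrable_nu_test (continuous_ch (-x)) hF2
  have hI := integrable_nu_test (continuous_ch (-x)) hF
  have hID := integrable_nu_test (continuous_ch (-x)) (hF.deriv (Pi.single j 1))
  rw [coef_oscOp_toLp, coef_oscOp_toLp, coef_oscOp_toLp]
  have ht' : (t : ℂ) ≠ 0 := by exact_mod_cast ht
  have e1 : ∀ θ, ch (-x) θ * (osc ψ t θ *
      (((s * fderiv ℝ ψ θ (Pi.single j 1) - R : ℝ) : ℂ) * f θ)) +
        (1 / t : ℂ) * (ch (-x) θ * (osc ψ t θ *
          ((-Complex.I * s) * fderiv ℝ f θ (Pi.single j 1)))) =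
      (-Complex.I * s / t) * (ch (-x) θ * fderiv ℝ (fun θ => osc ψ t θ * f θ) θ (Pi.single j 1)) -
        R * (ch (-x) θ * (osc ψ t θ * f θ)) := by
    intro θ
    rw [fderiv_osc_mul hW hψ hf]
    push_cast
    field_simp
    linear_combination (ch (-x) θ * osc ψ t θ * f θ * s * t * fderiv ℝ ψ θ (Pi.single j 1)) *
      Complex.I_sq
  rw [← integral_const_mul (1 / t : ℂ), ← integral_add hI1 (hI2.const_mul _)]
  simp only [e1]
  rw [integral_sub (hID.const_mul _) (hI.const_mul _), integral_const_mul, integral_const_mul, key]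
  generalize ∫ θ, ch (-x) θ * (osc ψ t θ * f θ) ∂nu d = J
  push_cast
  field_simp
  linear_combination ((x j : ℂ) * s * J) * Complex.I_sq

/-- Iteration of `position_mul_coef`: every factor of position becomes a factor of velocity, and
each term in which the amplitude is differentiated carries `1 / t` and has bounded norm. The
induction ranges over all amplitudes because a step replaces `f` by its velocity multiple and by its
derivative. -/
theorem position_pow_mul_coef (hW : IsOpen W) (hWc : W ⊆ ocell d) (hψm : AEMeasurable ψ (nu d))
    (hψ : ContDiffOn ℝ (⊤ : ℕ∞) ψ W) (j : Fin d) (s R : ℝ) (p : ℕ) :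
    ∀ (f : (Fin d → ℝ) → ℂ) (_ : IsTest W f)
      (hfp : IsTest W fun θ => ((s * fderiv ℝ ψ θ (Pi.single j 1) - R : ℝ) : ℂ) ^ p * f θ)
      (f₀ : Lp ℂ 2 (nu d)), f₀ =ᵐ[nu d] f →
    ∃ C : ℝ, ∀ t : ℝ, 1 ≤ t → ∃ r : Lp ℂ 2 (nu d), ‖r‖ ≤ C / t ∧ ∀ x : Latt d,
      ((s * x j / t - R : ℝ) : ℂ) ^ p * coef (oscOp ψ hψm t f₀) x =
        coef (oscOp ψ hψm t (hfp.memLp.toLp _)) x + coef r x := by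
  induction p with
  | zero =>
    intro f hf hfp f₀ hf₀
    refine ⟨0, fun t _ => ⟨0, by simp, fun x => ?_⟩⟩
    have : f₀ = hfp.memLp.toLp _ := by
      refine Lp.ext (hf₀.trans ?_)
      filter_upwards [hfp.memLp.coeFn_toLp] with θ hθ
      rw [hθ, pow_zero, one_mul]
    rw [this]
    simp
  | succ p ih =>
    intro f hf hfp f₀ hf₀
    have hv := contDiffOn_velocity hW hψ (Pi.single j 1) s R
    have hf1 : IsTest W fun θ => ((s * fderiv ℝ ψ θ (Pi.single j 1) - R : ℝ) : ℂ) * f θ :=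
      hf.mul hW hv
    have hf2 : IsTest W fun θ => (-Complex.I * s) * fderiv ℝ f θ (Pi.single j 1) :=
      (hf.deriv _).mul hW contDiffOn_const
    have hf1p := hf1.mul hW (hv.pow p)
    have hf2p := hf2.mul hW (hv.pow p)
    obtain ⟨C1, h1⟩ := ih _ hf1 hf1p _ hf1.memLp.coeFn_toLp
    obtain ⟨C2, h2⟩ := ih _ hf2 hf2p _ hf2.memLp.coeFn_toLp
    refine ⟨C1 + (‖hf2p.memLp.toLp _‖ + |C2|), fun t ht => ?_⟩
    obtain ⟨r1, hr1, e1⟩ := h1 t ht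
    obtain ⟨r2, hr2, e2⟩ := h2 t ht
    have htp : 0 < t := by linarith
    refine ⟨r1 + (1 / t : ℂ) • (oscOp ψ hψm t (hf2p.memLp.toLp _) + r2), ?_, fun x => ?_⟩
    · have h3 : ‖r2‖ ≤ |C2| := hr2.trans (by
        rw [div_le_iff₀ htp]
        nlinarith [abs_nonneg C2, le_abs_self C2])
      have h4 : ‖(1 / t : ℂ)‖ = 1 / t := by
        rw [norm_div, norm_one, Complex.norm_real, Real.norm_of_nonneg htp.le]
      calc _ ≤ ‖r1‖ + ‖(1 / t : ℂ)‖ * ‖oscOp ψ hψm t (hf2p.memLp.toLp _) + r2‖ := by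
            rw [← norm_smul]; exact norm_add_le _ _
        _ ≤ C1 / t + 1 / t * (‖hf2p.memLp.toLp _‖ + |C2|) := by
            rw [h4]
            gcongr
            refine (norm_add_le _ _).trans ?_
            rw [norm_oscOp]
            gcongr
        _ = _ := by ring
    · have hf0' : f₀ = hf.memLp.toLp f := Lp.ext (hf₀.trans hf.memLp.coeFn_toLp.symm)
      have e3 : hfp.memLp.toLp _ = hf1p.memLp.toLp _ := by
        refine Lp.ext ?_
        filter_upwards [hfp.memLp.coeFn_toLp, hf1p.memLp.coeFn_toLp] with θ h5 h6
        rw [h5, h6]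
        ring
      rw [pow_succ, mul_assoc, hf0',
        position_mul_coef hW hWc hψm hψ hf j s R htp.ne' x hf1 hf2, mul_add, e1 x,
        mul_left_comm, e2 x, e3]
      simp only [map_add, map_smul, lp.coeFn_add, lp.coeFn_smul, Pi.add_apply, Pi.smul_apply,
        smul_eq_mul]
      ring

theorem norm_mul_le_of_forall {u w : L2seq d ℂ} {S : Set (Latt d)} {c : ℝ} (hc : 0 ≤ c)
    (h : ∀ x ∈ S, c * ‖u x‖ ≤ ‖w x‖) : c * ‖cutOp S u‖ ≤ ‖w‖ := by
  classical
  have h1 : ‖(c : ℂ) • cutOp S u‖ ≤ ‖w‖ := by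
    refine L2seq_norm_le (norm_nonneg _) ?_
    rw [L2seq_norm_sq]
    refine Summable.tsum_le_tsum (fun x => ?_) (summable_norm_sq _) (summable_norm_sq _)
    have e : ((c : ℂ) • cutOp S u) x = (c : ℂ) * cutOp S u x := rfl
    rw [e, cutOp_apply]
    split_ifs with hx
    · have := h x hx
      rw [norm_mul, Complex.norm_real, Real.norm_of_nonneg hc]
      gcongr
    · simp
  rwa [norm_smul, Complex.norm_real, Real.norm_of_nonneg hc] at h1

/-- A wave packet whose `j`-th velocity has the sign `s` leaves every half-space
`s x_j ≤ N`. -/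
theorem tendsto_cutOp_coef (hW : IsOpen W) (hWc : W ⊆ ocell d) (hψm : AEMeasurable ψ (nu d))
    (hψ : ContDiffOn ℝ (⊤ : ℕ∞) ψ W) (j : Fin d) (s N : ℝ)
    (hpos : ∀ θ ∈ W, 0 < s * fderiv ℝ ψ θ (Pi.single j 1)) {f : (Fin d → ℝ) → ℂ}
    (hf : IsTest W f) :
    Tendsto (fun t => cutOp {x | s * x j ≤ N} (coef (oscOp ψ hψm t (hf.memLp.toLp f)))) atTop
      (𝓝 0) := by
  classical
  have hvc : ContinuousOn (fun θ => s * fderiv ℝ ψ θ (Pi.single j 1)) (tsupport f) :=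
    (continuousOn_const.mul (contDiffOn_fderiv_apply hW hψ _).continuousOn).mono hf.sub
  -- On the compact support of the amplitude the velocity is bounded and bounded away from zero.
  obtain ⟨c, R, hc, hcR, hbd⟩ : ∃ c R : ℝ, 0 < c ∧ c ≤ R ∧ ∀ θ ∈ tsupport f,
      c ≤ s * fderiv ℝ ψ θ (Pi.single j 1) ∧ s * fderiv ℝ ψ θ (Pi.single j 1) ≤ R := by
    rcases (tsupport f).eq_empty_or_nonempty with he | hne
    · exact ⟨1, 1, one_pos, le_rfl, by simp [he]⟩
    · obtain ⟨a, ha, hamin⟩ := hf.compact.isCompact.exists_isMinOn hne hvc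
      obtain ⟨b, hb, hbmax⟩ := hf.compact.isCompact.exists_isMaxOn hne hvc
      exact ⟨_, _, hpos a (hf.sub ha), hamin hb, fun θ hθ => ⟨hamin hθ, hbmax hθ⟩⟩
  have hR : 0 < R := by linarith
  have hRc : 0 < R - c / 2 := by linarith
  -- On the packet the velocity differs from `R` by at most `R - c`, whereas at a site with `s x_j ≤
  -- N` the quotient `s x_j / t` differs from `R` by at least `R - c / 2` once `t` is large.
  -- Comparing `p`-th powers bounds the norm in the half-space by `ρ ^ p` times that of the packet,
  -- plus `O(1/t)`.
  set ρ := (R - c) / (R - c / 2) with hρ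
  have hρ0 : 0 ≤ ρ := div_nonneg (by linarith) hRc.le
  have hρ1 : ρ < 1 := by rw [hρ, div_lt_one hRc]; linarith
  rw [tendsto_zero_iff_norm_tendsto_zero]
  rw [Metric.tendsto_nhds]
  intro ε hε
  -- The exponent is fixed before the time, since the constant of the `O(1/t)` term depends on it.
  obtain ⟨p, hp⟩ : ∃ p : ℕ, ρ ^ p * ‖hf.memLp.toLp f‖ < ε / 2 := by
    have h1 := (tendsto_pow_atTop_nhds_zero_of_lt_one hρ0 hρ1).mul_const ‖hf.memLp.toLp f‖
    rw [zero_mul] at h1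
    exact (h1.eventually_lt_const (by positivity)).exists
  have hfp : IsTest W fun θ => ((s * fderiv ℝ ψ θ (Pi.single j 1) - R : ℝ) : ℂ) ^ p * f θ :=
    hf.mul hW ((contDiffOn_velocity hW hψ _ s R).pow p)
  obtain ⟨C, hC⟩ := position_pow_mul_coef hW hWc hψm hψ j s R p f hf hfp _ hf.memLp.coeFn_toLp
  have hfpn : ‖hfp.memLp.toLp _‖ ≤ (R - c) ^ p * ‖hf.memLp.toLp f‖ := by
    refine Lp.norm_le_mul_norm_of_ae_le_mul ?_
    filter_upwards [hfp.memLp.coeFn_toLp, hf.memLp.coeFn_toLp] with θ h1 h2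
    rw [h1, h2, norm_mul, norm_pow, Complex.norm_real]
    by_cases hθ : θ ∈ tsupport f
    · have h3 := hbd θ hθ
      gcongr
      rw [Real.norm_eq_abs, abs_le]
      constructor <;> linarith
    · rw [image_eq_zero_of_notMem_tsupport hθ]
      simp
  have hev : ∀ᶠ t : ℝ in atTop, N / t ≤ c / 2 ∧ C / t / (R - c / 2) ^ p < ε / 2 := by
    have h1 : Tendsto (fun t : ℝ => N / t) atTop (𝓝 0) := tendsto_const_nhds.div_atTop tendsto_id
    have h2 : Tendsto (fun t : ℝ => C / t / (R - c / 2) ^ p) atTop (𝓝 (0 / (R - c / 2) ^ p)) :=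
      (tendsto_const_nhds.div_atTop tendsto_id).div_const _
    rw [zero_div] at h2
    exact (h1.eventually_le_const (by positivity)).and (h2.eventually_lt_const (by positivity))
  filter_upwards [hev, eventually_ge_atTop 1] with t ht ht1
  rw [Real.dist_eq, sub_zero, abs_of_nonneg (norm_nonneg _)]
  have htp : 0 < t := by linarith
  obtain ⟨r, hr, e⟩ := hC t ht1
  have hmain : (R - c / 2) ^ p *
      ‖cutOp {x | s * x j ≤ N} (coef (oscOp ψ hψm t (hf.memLp.toLp f)))‖ ≤
      ‖coef (oscOp ψ hψm t (hfp.memLp.toLp _) + r)‖ := by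
    refine norm_mul_le_of_forall (by positivity) fun x hx => ?_
    have e' : coef (oscOp ψ hψm t (hfp.memLp.toLp _) + r) x =
        ((s * x j / t - R : ℝ) : ℂ) ^ p * coef (oscOp ψ hψm t (hf.memLp.toLp f)) x := by
      rw [e x, map_add]
      rfl
    rw [e', norm_mul, norm_pow, Complex.norm_real]
    gcongr
    have h3 : s * x j / t ≤ c / 2 := by
      refine le_trans ?_ ht.1
      gcongr
      exact hx
    rw [Real.norm_eq_abs, le_abs]
    right
    linarith
  rw [LinearIsometryEquiv.norm_map] at hmain
  have h5 : ‖oscOp ψ hψm t (hfp.memLp.toLp _) + r‖ ≤ (R - c) ^ p * ‖hf.memLp.toLp f‖ + C / t := by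
    refine (norm_add_le _ _).trans ?_
    rw [norm_oscOp]
    gcongr
  have h6 := hmain.trans h5
  have hpp : 0 < (R - c / 2) ^ p := by positivity
  rw [← le_div_iff₀' hpp] at h6
  have h7 : ((R - c) ^ p * ‖hf.memLp.toLp f‖ + C / t) / (R - c / 2) ^ p =
      ρ ^ p * ‖hf.memLp.toLp f‖ + C / t / (R - c / 2) ^ p := by
    rw [hρ, div_pow]
    ring
  rw [h7] at h6
  linarith [ht.2]

end Propagation

/-! ### Non-stationary phase and the Riemann–Lebesgue lemma -/

section RiemannLebesgue

variable {d : ℕ} {W : Set (Fin d → ℝ)} {φ : (Fin d → ℝ) → ℝ}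

/-- Non-stationary phase for a test amplitude. -/
theorem tendsto_integral_osc_test (hW : IsOpen W) (hWc : W ⊆ ocell d)
    (hφ : ContDiffOn ℝ (⊤ : ℕ∞) φ W) (j : Fin d)
    (hne : ∀ θ ∈ W, fderiv ℝ φ θ (Pi.single j 1) ≠ 0) {f : (Fin d → ℝ) → ℂ} (hf : IsTest W f) :
    Tendsto (fun t => ∫ θ, osc φ t θ * f θ ∂nu d) atTop (𝓝 0) := by
  have hv : ContDiffOn ℝ (⊤ : ℕ∞)
      (fun θ => ((fderiv ℝ φ θ (Pi.single j 1))⁻¹ : ℂ)) W := by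
    refine ContDiffOn.inv (Complex.ofRealCLM.contDiff.comp_contDiffOn
      (contDiffOn_fderiv_apply hW hφ _)) fun θ hθ => ?_
    exact Complex.ofReal_ne_zero.2 (hne θ hθ)
  have hb := hf.mul hW hv
  -- With this amplitude, `I * t * osc φ t θ * f θ` is the `j`-th derivative of `osc φ t θ * b θ`
  -- minus `osc φ t θ * ∂_j b θ`. The derivative integrates to zero, which gains a factor `1 / t`.
  set b : (Fin d → ℝ) → ℂ := fun θ => ((fderiv ℝ φ θ (Pi.single j 1))⁻¹ : ℂ) * f θ with hbdef
  have hbf : ∀ θ, ((fderiv ℝ φ θ (Pi.single j 1) : ℝ) : ℂ) * b θ = f θ := by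
    intro θ
    by_cases hθ : θ ∈ W
    · have : ((fderiv ℝ φ θ (Pi.single j 1) : ℝ) : ℂ) ≠ 0 := Complex.ofReal_ne_zero.2 (hne θ hθ)
      rw [hbdef]
      field_simp
    · rw [hb.eq_zero hθ, hf.eq_zero hθ, mul_zero]
  have hdb := hb.deriv (Pi.single j 1)
  have key : ∀ t : ℝ, Complex.I * t * ∫ θ, osc φ t θ * f θ ∂nu d =
      -∫ θ, osc φ t θ * fderiv ℝ b θ (Pi.single j 1) ∂nu d := by
    intro t
    have h0 := integral_deriv_eq_zero hWc (hb.mul hW (contDiffOn_osc hφ t)) j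
    simp only [fderiv_osc_mul hW hφ hb] at h0
    have h1 := hf.mul hW (contDiffOn_osc hφ t)
    have h2 := hdb.mul hW (contDiffOn_osc hφ t)
    have i1 : Integrable (fun θ => osc φ t θ * f θ) (nu d) := h1.memLp.integrable (by norm_num)
    have i2 : Integrable (fun θ => osc φ t θ * fderiv ℝ b θ (Pi.single j 1)) (nu d) :=
      h2.memLp.integrable (by norm_num)
    rw [← integral_const_mul, eq_neg_iff_add_eq_zero, ← integral_add (i1.const_mul _) i2, ← h0]
    refine integral_congr_ae (Eventually.of_forall fun θ => ?_)
    simp only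
    rw [← hbf θ]
    ring
  have hI : Integrable (fun θ => fderiv ℝ b θ (Pi.single j 1)) (nu d) :=
    hdb.memLp.integrable (by norm_num)
  refine squeeze_zero_norm' (a := fun t => (∫ θ, ‖fderiv ℝ b θ (Pi.single j 1)‖ ∂nu d) / t) ?_
    (tendsto_const_nhds.div_atTop tendsto_id)
  filter_upwards [eventually_gt_atTop 0] with t ht
  rw [le_div_iff₀ ht]
  have h3 := congrArg norm (key t)
  rw [norm_mul, norm_mul, Complex.norm_I, one_mul, norm_neg, Complex.norm_real,
    Real.norm_of_nonneg ht.le] at h3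
  rw [mul_comm, h3]
  refine (norm_integral_le_integral_norm _).trans_eq ?_
  simp only [norm_mul, norm_osc, one_mul]

/-- The Riemann–Lebesgue lemma for the phase `φ`. -/
theorem tendsto_inner_oscOp (hW : IsOpen W) (hWc : W ⊆ ocell d) (hφm : AEMeasurable φ (nu d))
    (hφ : ContDiffOn ℝ (⊤ : ℕ∞) φ W) (u g : Lp ℂ 2 (nu d))
    (hg : ∀ᵐ θ ∂nu d, g θ ≠ 0 → θ ∈ W ∧ ∃ j, fderiv ℝ φ θ (Pi.single j 1) ≠ 0) :
    Tendsto (fun t => inner ℂ u (oscOp φ hφm t g)) atTop (𝓝 0) := by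
  -- One open set for each direction in which the phase is non-stationary; together they carry `g`.
  set Wj : Fin d → Set (Fin d → ℝ) := fun j => {θ ∈ W | fderiv ℝ φ θ (Pi.single j 1) ≠ 0} with hWj
  have hWjo : ∀ j, IsOpen (Wj j) := fun j =>
    (contDiffOn_fderiv_apply hW hφ (Pi.single j 1)).continuousOn.isOpen_inter_preimage hW
      isOpen_ne
  have hWjc : ∀ j, Wj j ⊆ ocell d := fun j => (Set.sep_subset _ _).trans hWc
  have hmem : g ∈ nullSub atTop fun t : ℝ => (innerSL ℂ u).comp (oscOp φ hφm t) := by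
    refine mem_of_test_mem Wj hWjo hWjc _ (isClosed_nullSub (M := ‖u‖) fun t => ?_) ?_ g ?_
    · refine (ContinuousLinearMap.opNorm_comp_le _ _).trans ?_
      rw [innerSL_apply_norm]
      refine mul_le_of_le_one_right (norm_nonneg _) ?_
      exact ContinuousLinearMap.opNorm_le_bound _ zero_le_one fun f => by rw [norm_oscOp, one_mul]
    · intro j f hf
      -- With a test amplitude on one side, the other side is approximated in turn. Its test
      -- functions may live anywhere in the open cell, as the product is still supported in `Wj j`.
      have hmem2 : u ∈ nullSub atTop
          fun t : ℝ => innerSL ℂ (oscOp φ hφm t (hf.memLp.toLp f)) := by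
        refine mem_of_test_mem (fun _ : Unit => ocell d) (fun _ => isOpen_ocell) (fun _ => le_rfl) _
          (isClosed_nullSub (M := ‖hf.memLp.toLp f‖) fun t => ?_) ?_ u ?_
        · rw [innerSL_apply_norm, norm_oscOp]
        · intro _ v hv
          have hc : ContDiffOn ℝ (⊤ : ℕ∞) (fun θ => (starRingEnd ℂ) (v θ)) (Wj j) :=
            (Complex.conjCLE.contDiff.comp hv.smooth).contDiffOn
          have h1 := tendsto_integral_osc_test (hWjo j) (hWjc j) (hφ.mono (Set.sep_subset _ _)) j
            (fun θ hθ => hθ.2) (hf.mul (hWjo j) hc)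
          have h2 := (Complex.continuous_conj.tendsto 0).comp h1
          rw [map_zero] at h2
          refine h2.congr fun t => ?_
          rw [Function.comp_apply, ← integral_conj]
          change _ = inner ℂ (oscOp φ hφm t (hf.memLp.toLp f)) (hv.memLp.toLp v)
          rw [L2.inner_def]
          refine integral_congr_ae ?_
          filter_upwards [coeFn_oscOp hφm t (hf.memLp.toLp f), hf.memLp.coeFn_toLp,
            hv.memLp.coeFn_toLp] with θ e1 e2 e3
          rw [e1, e2, e3, RCLike.inner_apply]
          simp only [map_mul, Complex.conj_conj]
          ring
        · filter_upwards [ae_mem_ocell] with θ hθ _ using ⟨(), hθ⟩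
      have h3 : Tendsto (fun t => inner ℂ (oscOp φ hφm t (hf.memLp.toLp f)) u) atTop (𝓝 0) := hmem2
      have h4 := (Complex.continuous_conj.tendsto 0).comp h3
      rw [map_zero] at h4
      refine h4.congr fun t => ?_
      exact inner_conj_symm _ _
    · filter_upwards [hg] with θ h h0
      obtain ⟨h1, j, hj⟩ := h h0
      exact ⟨j, h1, hj⟩
  exact hmem

end RiemannLebesgue

/-! ### Scalar covariance kernels as operators -/

section ScalarKernels

variable {d : ℕ}

/-- The operator on `ℓ²` with the real scalar kernel `K`. -/
def covOp (K : Latt d → Latt d → ℝ) (k : Latt d → ℝ) (hK : ∀ x y, |K x y| ≤ k (x - y)) :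
    L2seq d ℂ →L[ℂ] L2seq d ℂ :=
  kerOp (fun x y => (K x y : ℂ) • ContinuousLinearMap.id ℂ ℂ) k fun x y => by
    rw [norm_smul, ContinuousLinearMap.norm_id, mul_one, Complex.norm_real]
    exact hK x y

variable {K : Latt d → Latt d → ℝ} {k : Latt d → ℝ}

theorem hasSum_covOp_apply (hk : Summable k) (hK : ∀ x y, |K x y| ≤ k (x - y)) (u : L2seq d ℂ)
    (x : Latt d) : HasSum (fun y => (K x y : ℂ) * u y) (covOp K k hK u x) :=
  hasSum_kerOp_apply _ hk _ u x

theorem norm_covOp_le (hk : Summable k) (hK : ∀ x y, |K x y| ≤ k (x - y)) :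
    ‖covOp K k hK‖ ≤ ∑' z, k z := norm_kerOp_le _ hk _

/-- The symbol `∑_z e^{i(z,θ)} r(z)` of a convolution operator. -/
def symb (r : Latt d → ℝ) (θ : Fin d → ℝ) : ℂ := ∑' z, ch z θ * (r z : ℂ)

variable {r : Latt d → ℝ}

theorem norm_symb_le (hr : Summable fun z => |r z|) (θ : Fin d → ℝ) :
    ‖symb r θ‖ ≤ ∑' z, |r z| := by
  refine tsum_of_norm_bounded hr.hasSum fun z => ?_
  rw [norm_mul, norm_ch, one_mul, Complex.norm_real, Real.norm_eq_abs]

theorem continuous_symb (hr : Summable fun z => |r z|) : Continuous (symb r) := by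
  refine continuous_tsum (fun z => (continuous_ch z).mul continuous_const) hr fun z θ => ?_
  rw [norm_mul, norm_ch, one_mul, Complex.norm_real, Real.norm_eq_abs]

/-- Multiplication by the symbol. -/
def symbOp (r : Latt d → ℝ) (hr : Summable fun z => |r z|) : Lp ℂ 2 (nu d) →L[ℂ] Lp ℂ 2 (nu d) :=
  mulOp (symb r) (continuous_symb hr).aestronglyMeasurable _ (norm_symb_le hr)

/-- A convolution operator is a Fourier multiplier. -/
theorem covOp_coef (hr : Summable fun z => |r z|) (hk : Summable k)
    (hrk : ∀ x y : Latt d, |r (x - y)| ≤ k (x - y)) (g : Lp ℂ 2 (nu d)) :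
    covOp (fun x y => r (x - y)) k hrk (coef g) = coef (symbOp r hr g) := by
  ext x
  refine (hasSum_covOp_apply hk hrk (coef g) x).unique ?_
  rw [coef_apply]
  have hgi : Integrable g (nu d) := (Lp.memLp g).integrable (by norm_num)
  have h1 : ∀ z : Latt d, Integrable (fun θ => ch (-x) θ * (ch z θ * (r z : ℂ) * g θ)) (nu d) := by
    intro z
    have : (fun θ => ch (-x) θ * (ch z θ * (r z : ℂ) * g θ)) =
        fun θ => (ch (-x) θ * ch z θ * (r z : ℂ)) * g θ := by
      funext θ; ring
    rw [this]
    refine hgi.bdd_mul (c := |r z|) ?_ (Eventually.of_forall fun θ => ?_)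
    · exact (((continuous_ch _).mul (continuous_ch _)).mul continuous_const).aestronglyMeasurable
    · rw [norm_mul, norm_mul, norm_ch, norm_ch, Complex.norm_real, Real.norm_eq_abs]
      simp
  have h2 : Summable fun z : Latt d => ∫ θ, ‖ch (-x) θ * (ch z θ * (r z : ℂ) * g θ)‖ ∂nu d := by
    refine (hr.mul_right (∫ θ, ‖g θ‖ ∂nu d)).congr fun z => ?_
    rw [← integral_const_mul]
    refine integral_congr_ae (Eventually.of_forall fun θ => ?_)
    simp only [norm_mul, norm_ch, one_mul, Complex.norm_real, Real.norm_eq_abs]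
  have h3 := hasSum_integral_of_summable_integral_norm h1 h2
  rw [← (Equiv.subLeft x).hasSum_iff]
  have h4 : ∫ θ, ∑' z, ch (-x) θ * (ch z θ * (r z : ℂ) * g θ) ∂nu d =
      ∫ θ, ch (-x) θ * symbOp r hr g θ ∂nu d := by
    refine integral_congr_ae ?_
    filter_upwards [coeFn_mulOp (symb r) (continuous_symb hr).aestronglyMeasurable _
      (norm_symb_le hr) g] with θ hθ
    rw [tsum_mul_left, tsum_mul_right, symbOp, hθ, symb]
  rw [← h4]
  refine h3.congr_fun fun z => ?_
  simp only [Function.comp_apply, Equiv.subLeft_apply, sub_sub_cancel]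
  rw [coef_apply, ← integral_const_mul]
  refine integral_congr_ae (Eventually.of_forall fun θ => ?_)
  simp only
  rw [show -(x - z) = -x + z by abel, ch_add]
  ring

theorem cutOp_add_compl (S : Set (Latt d)) (u : L2seq d ℂ) : u = cutOp S u + cutOp Sᶜ u := by
  ext x
  change u x = cutOp S u x + cutOp Sᶜ u x
  rw [cutOp_apply, cutOp_apply]
  by_cases h : x ∈ S <;> simp [h]

theorem norm_cutOp_iUnion_le {J : Type*} [Fintype J] (S : Set (Latt d)) (T : J → Set (Latt d))
    (hST : S ⊆ ⋃ j, T j) (u : L2seq d ℂ) : ‖cutOp S u‖ ^ 2 ≤ ∑ j, ‖cutOp (T j) u‖ ^ 2 := by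
  simp only [L2seq_norm_sq]
  rw [← Summable.tsum_finsetSum fun j _ => summable_norm_sq _]
  refine Summable.tsum_le_tsum (fun x => ?_) (summable_norm_sq _)
    (summable_sum fun j _ => summable_norm_sq _)
  rw [cutOp_apply]
  split_ifs with h
  · obtain ⟨j, hj⟩ := Set.mem_iUnion.1 (hST h)
    refine le_trans ?_ (Finset.single_le_sum (f := fun j => ‖cutOp (T j) u x‖ ^ 2)
      (fun _ _ => by positivity) (Finset.mem_univ j))
    simp only [cutOp_apply, hj, if_true, le_refl]
  · rw [norm_zero, zero_pow two_ne_zero]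
    exact Finset.sum_nonneg fun _ _ => by positivity

variable {J : Type*} [Fintype J]

/-- Far inside a corner the operator with kernel `K` acts as the convolution with the limit
kernel. -/
theorem exists_norm_covOp_cutOp_le (hk : Summable k) (hK : ∀ x y, |K x y| ≤ k (x - y))
    (e : J → Fin d) (s : J → ℝ)
    (hlim : ∀ (z : Latt d) (ε : ℝ), 0 < ε → ∃ N : ℕ, ∀ y : Latt d,
      (∀ j, (N : ℝ) < s j * y (e j)) → |K (y + z) y| < ε) {ε : ℝ} (hε : 0 < ε) :
    ∃ N : ℕ, ∀ u : L2seq d ℂ,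
      ‖covOp K k hK (cutOp {y | ∀ j, (N : ℝ) < s j * y (e j)} u)‖ ≤ ε * ‖u‖ := by
  classical
  have hk0 : ∀ z, 0 ≤ k z := fun z => by simpa using (abs_nonneg _).trans (hK z 0)
  -- Finitely many displacements carry all but `ε / 2` of the dominating kernel. For these the limit
  -- hypothesis gives thresholds, whose maximum is `M`; the remaining displacements are bounded by
  -- `k`.
  obtain ⟨S, hS⟩ : ∃ S : Finset (Latt d), ∑' z : {z // z ∉ S}, k z < ε / 2 := by
    have h := tendsto_tsum_compl_atTop_zero k
    exact ((tendsto_order.1 h).2 _ (by positivity)).exists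
  choose N hN using fun z => hlim z (ε / (2 * (S.card + 1))) (by positivity)
  set M := S.sup N with hM
  set E : Set (Latt d) := {y | ∀ j, (M : ℝ) < s j * y (e j)} with hE
  -- The restricted kernel is dominated by `kk`, of total mass at most `ε`. The `+ 1` keeps the
  -- denominator positive when `S` is empty.
  set kk : Latt d → ℝ := fun z => if z ∈ S then ε / (2 * (S.card + 1)) else k z with hkk
  have hkks : Summable kk := by
    refine (hk.add (summable_of_ne_finset_zero (s := S)
      (f := fun z => if z ∈ S then ε / (2 * (S.card + 1)) - k z else 0)
      (fun z hz => by simp [hz]))).congr fun z => ?_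
    simp only [hkk]
    split_ifs <;> ring
  have hkksum : ∑' z, kk z ≤ ε := by
    rw [← hkks.sum_add_tsum_subtype_compl S]
    have h1 : ∑ z ∈ S, kk z = S.card * (ε / (2 * (S.card + 1))) := by
      rw [Finset.sum_congr rfl fun z hz => show kk z = ε / (2 * (S.card + 1)) by simp [hkk, hz],
        Finset.sum_const, nsmul_eq_mul]
    have h2 : ∑' z : {z // z ∉ S}, kk z = ∑' z : {z // z ∉ S}, k z :=
      tsum_congr fun z => by simp [hkk, z.2]
    have h3 : (S.card : ℝ) * (ε / (2 * (S.card + 1))) ≤ ε / 2 := by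
      rw [mul_div_assoc', div_le_div_iff₀ (by positivity) (by positivity)]
      nlinarith
    rw [h1]
    calc _ ≤ ε / 2 + ε / 2 := add_le_add h3 (h2.trans_le hS.le)
      _ = ε := by ring
  have hKE : ∀ x y, |if y ∈ E then K x y else 0| ≤ kk (x - y) := by
    intro x y
    by_cases hz : x - y ∈ S
    · simp only [hkk, hz, if_true]
      split_ifs with hy
      · have := hN (x - y) y fun j => lt_of_le_of_lt
          (by exact_mod_cast Finset.le_sup (f := N) hz) (hy j)
        rw [add_sub_cancel] at this
        exact this.le
      · rw [abs_zero]; positivity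
    · simp only [hkk, hz, if_false]
      split_ifs with hy
      · exact hK x y
      · rw [abs_zero]; exact hk0 _
  refine ⟨M, fun u => ?_⟩
  have heq : covOp K k hK (cutOp E u) = covOp (fun x y => if y ∈ E then K x y else 0) kk hKE u := by
    ext x
    refine (hasSum_covOp_apply hk hK _ x).unique ?_
    refine (hasSum_covOp_apply hkks hKE u x).congr_fun fun y => ?_
    rw [cutOp_apply]
    split_ifs <;> simp
  rw [heq]
  exact (ContinuousLinearMap.le_opNorm _ _).trans
    (by gcongr; exact (norm_covOp_le hkks hKE).trans hkksum)

variable {W : Set (Fin d → ℝ)} {ψ : (Fin d → ℝ) → ℝ}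

/-- Wave packets moving into a corner do not see a kernel that vanishes there. -/
theorem tendsto_covOp_coef (hk : Summable k) (hK : ∀ x y, |K x y| ≤ k (x - y))
    (e : J → Fin d) (s : J → ℝ)
    (hlim : ∀ (z : Latt d) (ε : ℝ), 0 < ε → ∃ N : ℕ, ∀ y : Latt d,
      (∀ j, (N : ℝ) < s j * y (e j)) → |K (y + z) y| < ε)
    (hW : IsOpen W) (hWc : W ⊆ ocell d) (hψm : AEMeasurable ψ (nu d))
    (hψ : ContDiffOn ℝ (⊤ : ℕ∞) ψ W) (g : Lp ℂ 2 (nu d))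
    (hg : ∀ᵐ θ ∂nu d, g θ ≠ 0 →
      θ ∈ W ∧ ∀ j, 0 < s j * fderiv ℝ ψ θ (Pi.single (e j) 1)) :
    Tendsto (fun t => covOp K k hK (coef (oscOp ψ hψm t g))) atTop (𝓝 0) := by
  set W' : Set (Fin d → ℝ) := {θ | θ ∈ W ∧ ∀ j, 0 < s j * fderiv ℝ ψ θ (Pi.single (e j) 1)} with hW'
  have hW'o : IsOpen W' := by
    have : W' = W ∩ ⋂ j, {θ | θ ∈ W ∧ 0 < s j * fderiv ℝ ψ θ (Pi.single (e j) 1)} := by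
      ext θ
      simp only [hW', Set.mem_ofPred_eq, Set.mem_inter_iff, Set.mem_iInter]
      exact ⟨fun h => ⟨h.1, fun j => ⟨h.1, h.2 j⟩⟩, fun h => ⟨h.1, fun j => (h.2 j).2⟩⟩
    rw [this]
    refine hW.inter (isOpen_iInter_of_finite fun j => ?_)
    exact (continuousOn_const.mul
      (contDiffOn_fderiv_apply hW hψ (Pi.single (e j) 1)).continuousOn).isOpen_inter_preimage hW
      isOpen_Ioi
  have hW'W : W' ⊆ W := fun θ h => h.1
  let T : ℝ → Lp ℂ 2 (nu d) →L[ℂ] L2seq d ℂ := fun t =>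
    (covOp K k hK).comp
      ((coef (d := d)).toContinuousLinearEquiv.toContinuousLinearMap.comp (oscOp ψ hψm t))
  have hTn : ∀ t, ‖T t‖ ≤ ‖covOp K k hK‖ := fun t =>
    ContinuousLinearMap.opNorm_le_bound _ (norm_nonneg _) fun f => by
      refine ((covOp K k hK).le_opNorm _).trans_eq ?_
      change _ * ‖coef (oscOp ψ hψm t f)‖ = _
      rw [LinearIsometryEquiv.norm_map, norm_oscOp]
  have hmem : g ∈ nullSub atTop T := by
    refine mem_of_test_mem (fun _ : Unit => W') (fun _ => hW'o) (fun _ => hW'W.trans hWc) _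
      (isClosed_nullSub hTn) (fun _ f hf => ?_) g ?_
    · change Tendsto (fun t => covOp K k hK (coef (oscOp ψ hψm t (hf.memLp.toLp f)))) atTop (𝓝 0)
      rw [Metric.tendsto_nhds]
      intro ε hε
      set F := hf.memLp.toLp f
      -- Inside the corner the kernel is small. The complement of the corner is a union of
      -- half-spaces, and the packet leaves each of them.
      obtain ⟨N, hN⟩ := exists_norm_covOp_cutOp_le hk hK e s hlim
        (ε := ε / (2 * (‖F‖ + 1))) (by positivity)
      set E : Set (Latt d) := {y | ∀ j, (N : ℝ) < s j * y (e j)} with hE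
      have h1 : Tendsto (fun t => covOp K k hK (cutOp Eᶜ (coef (oscOp ψ hψm t F)))) atTop
          (𝓝 0) := by
        have h2 : Tendsto (fun t => cutOp Eᶜ (coef (oscOp ψ hψm t F))) atTop (𝓝 0) := by
          rw [tendsto_zero_iff_norm_tendsto_zero]
          have h3 : ∀ j, Tendsto (fun t => ‖cutOp {x | s j * x (e j) ≤ N}
              (coef (oscOp ψ hψm t F))‖ ^ 2) atTop (𝓝 0) := fun j => by
            have h4 := (tendsto_cutOp_coef hW'o (hW'W.trans hWc) hψm (hψ.mono hW'W) (e j) (s j) N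
              (fun θ hθ => hθ.2 j) hf).norm.pow 2
            simpa using h4
          have h5 := tendsto_finsetSum (Finset.univ : Finset J) fun j _ => h3 j
          rw [Finset.sum_const_zero] at h5
          have h6 : Tendsto (fun t => ‖cutOp Eᶜ (coef (oscOp ψ hψm t F))‖ ^ 2) atTop (𝓝 0) := by
            refine squeeze_zero (fun _ => by positivity) (fun t => ?_) h5
            refine norm_cutOp_iUnion_le _ _ (fun x hx => ?_) _
            simp only [hE, Set.mem_compl_iff, Set.mem_ofPred_eq, not_forall, not_lt] at hx
            exact Set.mem_iUnion.2 hx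
          have h7 := h6.sqrt
          simpa using h7
        have h9 := ((covOp K k hK).continuous.tendsto 0).comp h2
        rw [map_zero] at h9
        exact h9
      filter_upwards [Metric.tendsto_nhds.1 h1 (ε / 2) (by positivity)] with t ht
      rw [dist_zero_right] at ht ⊢
      have h8 : ‖covOp K k hK (cutOp E (coef (oscOp ψ hψm t F)))‖ ≤ ε / 2 := by
        refine (hN _).trans ?_
        rw [LinearIsometryEquiv.norm_map, norm_oscOp, div_mul_eq_mul_div,
          div_le_div_iff₀ (by positivity) (by positivity)]
        nlinarith [norm_nonneg F]
      calc _ = ‖covOp K k hK (cutOp E (coef (oscOp ψ hψm t F))) +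
            covOp K k hK (cutOp Eᶜ (coef (oscOp ψ hψm t F)))‖ := by
            rw [← map_add, ← cutOp_add_compl E]
        _ ≤ _ := norm_add_le _ _
        _ < ε := by linarith
    · filter_upwards [hg] with θ h h0 using ⟨(), h h0⟩
  exact hmem

end ScalarKernels

/-! ### Counting distinct eigenvalues by Hankel determinants -/

section Hankel

variable {n : ℕ} {A : Matrix (Fin n) (Fin n) ℂ}

/-- The finite real spectrum of a complex matrix. -/
def specFin (A : Matrix (Fin n) (Fin n) ℂ) : Finset ℝ :=
  (Matrix.finite_real_spectrum (A := A)).toFinset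

theorem mem_specFin {z : ℝ} : z ∈ specFin A ↔ z ∈ spectrum ℝ A := by simp [specFin]

theorem aeval_eq_zero_iff (hA : A.IsHermitian) (p : Polynomial ℝ) :
    Polynomial.aeval A p = 0 ↔ ∀ z ∈ specFin A, p.eval z = 0 := by
  have hA' : IsSelfAdjoint A := hA
  rw [← cfc_polynomial p A hA']
  constructor
  · intro h z hz
    have h2 : cfc (fun x => p.eval x) A = cfc (fun _ : ℝ => (0 : ℝ)) A := by
      rw [h, cfc_const_zero]
    exact eqOn_of_cfc_eq_cfc h2 (p.continuous.continuousOn) continuousOn_const hA'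
      (mem_specFin.1 hz)
  · intro h
    rw [cfc_congr (g := fun _ : ℝ => (0 : ℝ)) fun z hz => h z (mem_specFin.2 hz), cfc_const_zero]

theorem card_specFin_le (hA : A.IsHermitian) : (specFin A).card ≤ n := by
  classical
  have h : specFin A ⊆ Finset.univ.image hA.eigenvalues := by
    intro z hz
    rw [mem_specFin, hA.spectrum_real_eq_range_eigenvalues] at hz
    simpa using hz
  refine (Finset.card_le_card h).trans (Finset.card_image_le.trans ?_)
  simp

/-- The Hankel matrix of the power sums of the eigenvalues. -/
def hankel (m : ℕ) (A : Matrix (Fin n) (Fin n) ℂ) : Matrix (Fin m) (Fin m) ℝ :=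
  Matrix.of fun i j => (A ^ (i + j : ℕ)).trace.re

/-- The polynomial `∑_{i<m} c_i X^i`. -/
def coeffPoly {m : ℕ} (c : Fin m → ℝ) : Polynomial ℝ :=
  ∑ i, Polynomial.C (c i) * Polynomial.X ^ (i : ℕ)

theorem aeval_coeffPoly {m : ℕ} (c : Fin m → ℝ) :
    Polynomial.aeval A (coeffPoly c) = ∑ i, c i • A ^ (i : ℕ) := by
  simp [coeffPoly, map_sum, Algebra.smul_def]

theorem coeff_coeffPoly {m : ℕ} (c : Fin m → ℝ) (j : Fin m) : (coeffPoly c).coeff j = c j := by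
  rw [coeffPoly, Polynomial.finsetSum_coeff]
  rw [Finset.sum_eq_single j]
  · simp
  · intro i _ hij
    rw [Polynomial.coeff_C_mul, Polynomial.coeff_X_pow, if_neg, mul_zero]
    exact fun h => hij (Fin.ext h.symm)
  · simp

theorem degree_coeffPoly_lt {m : ℕ} (c : Fin m → ℝ) : (coeffPoly c).degree < m := by
  refine (Polynomial.degree_lt_iff_coeff_zero _ _).2 fun k hk => ?_
  rw [coeffPoly, Polynomial.finsetSum_coeff]
  refine Finset.sum_eq_zero fun i _ => ?_
  rw [Polynomial.coeff_C_mul, Polynomial.coeff_X_pow, if_neg, mul_zero]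
  have := i.2
  omega

theorem coeffPoly_coeff {m : ℕ} {p : Polynomial ℝ} (hp : p.degree < m) :
    coeffPoly (fun i : Fin m => p.coeff i) = p := by
  ext k
  by_cases hk : k < m
  · exact coeff_coeffPoly (fun i : Fin m => p.coeff i) ⟨k, hk⟩
  · rw [(Polynomial.degree_lt_iff_coeff_zero _ _).1 (degree_coeffPoly_lt _) k (not_lt.1 hk),
      (Polynomial.degree_lt_iff_coeff_zero _ _).1 hp k (not_lt.1 hk)]

theorem hankel_mulVec {m : ℕ} (c : Fin m → ℝ) (j : Fin m) :
    (hankel m A).mulVec c j = (A ^ (j : ℕ) * Polynomial.aeval A (coeffPoly c)).trace.re := by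
  rw [aeval_coeffPoly, Finset.mul_sum, Matrix.trace_sum, Complex.re_sum, Matrix.mulVec, dotProduct]
  refine Finset.sum_congr rfl fun i _ => ?_
  rw [hankel, Matrix.of_apply, mul_smul_comm, ← pow_add, Matrix.trace_smul, Complex.smul_re,
    smul_eq_mul, mul_comm]

theorem isHermitian_aeval (hA : A.IsHermitian) (p : Polynomial ℝ) :
    (Polynomial.aeval A p).IsHermitian := by
  have hA' : IsSelfAdjoint A := hA
  rw [← cfc_polynomial p A hA']
  exact cfc_predicate _ A

open scoped ComplexOrder in
-- `hankel m A` is the Gram matrix of the powers of `A` for the trace product: its quadratic form at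
-- `c` is the trace of `B * B`, which for the Hermitian matrix `B` is the sum of the squared moduli
-- of its entries.
theorem aeval_coeffPoly_eq_zero (hA : A.IsHermitian) {m : ℕ} {c : Fin m → ℝ}
    (h : (hankel m A).mulVec c = 0) : Polynomial.aeval A (coeffPoly c) = 0 := by
  set B := Polynomial.aeval A (coeffPoly c) with hB
  have h1 : (B * B).trace.re = 0 := by
    have h2 : B * B = ∑ j, c j • (A ^ (j : ℕ) * B) := by
      conv_lhs => rw [hB, aeval_coeffPoly, Finset.sum_mul]
      rw [← aeval_coeffPoly, ← hB]
      simp only [smul_mul_assoc]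
    rw [h2, Matrix.trace_sum, Complex.re_sum]
    refine Finset.sum_eq_zero fun j _ => ?_
    rw [Matrix.trace_smul, Complex.smul_re, ← hankel_mulVec, h]
    simp
  have hBh : B.conjTranspose = B := isHermitian_aeval hA _
  have h3 : (B.conjTranspose * B).trace = ((∑ j, ∑ i, ‖B i j‖ ^ 2 : ℝ) : ℂ) := by
    simp only [Matrix.trace, Matrix.diag_apply, Matrix.mul_apply, Matrix.conjTranspose_apply]
    push_cast
    refine Finset.sum_congr rfl fun j _ => Finset.sum_congr rfl fun i _ => ?_
    exact Complex.conj_mul' _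
  rw [← Matrix.trace_conjTranspose_mul_self_eq_zero_iff, h3]
  rw [hBh] at h3
  rw [h3, Complex.ofReal_re] at h1
  rw [h1, Complex.ofReal_zero]

theorem prod_specFin_natDegree : (∏ z ∈ specFin A, (Polynomial.X - Polynomial.C z)).natDegree =
    (specFin A).card := by
  rw [Polynomial.natDegree_prod_of_monic _ _ fun z _ => Polynomial.monic_X_sub_C z]
  simp

theorem aeval_prod_specFin (hA : A.IsHermitian) :
    Polynomial.aeval A (∏ z ∈ specFin A, (Polynomial.X - Polynomial.C z)) = 0 := by
  rw [aeval_eq_zero_iff hA]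
  intro z hz
  rw [Polynomial.eval_prod]
  exact Finset.prod_eq_zero hz (by simp)

theorem monic_prod_specFin : (∏ z ∈ specFin A, (Polynomial.X - Polynomial.C z)).Monic :=
  Polynomial.monic_prod_of_monic _ _ fun z _ => Polynomial.monic_X_sub_C z

/-- The Hankel determinant detects the number of distinct eigenvalues. -/
theorem hankel_det_ne_zero_iff (hA : A.IsHermitian) (m : ℕ) :
    (hankel m A).det ≠ 0 ↔ m ≤ (specFin A).card := by
  rw [← not_lt, not_iff_not, ← Matrix.exists_mulVec_eq_zero_iff]
  constructor
  · rintro ⟨c, hc, h⟩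
    by_contra! hm
    refine hc (funext fun j => ?_)
    have h1 := (aeval_eq_zero_iff hA _).1 (aeval_coeffPoly_eq_zero hA h)
    have h2 : coeffPoly c = 0 := by
      refine Polynomial.eq_zero_of_degree_lt_of_eval_finset_eq_zero (specFin A) ?_ h1
      exact (degree_coeffPoly_lt c).trans_le (by exact_mod_cast hm)
    rw [← coeff_coeffPoly c j, h2]
    simp
  · intro hm
    -- The minimal polynomial has degree below `m`, so its coefficient vector fits into the Hankel
    -- kernel; it is nonzero because the polynomial is monic.
    set p := ∏ z ∈ specFin A, (Polynomial.X - Polynomial.C z)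
    have hp : p.degree < m := by
      rw [Polynomial.degree_eq_natDegree monic_prod_specFin.ne_zero, prod_specFin_natDegree]
      exact_mod_cast hm
    refine ⟨fun i => p.coeff i, fun h => ?_, funext fun j => ?_⟩
    · have h1 := congrFun h ⟨(specFin A).card, hm⟩
      have h2 := monic_prod_specFin (A := A)
      rw [Polynomial.Monic, Polynomial.leadingCoeff, prod_specFin_natDegree] at h2
      simp only [Pi.zero_apply] at h1
      exact one_ne_zero (h2.symm.trans h1)
    · rw [hankel_mulVec, coeffPoly_coeff hp, aeval_prod_specFin hA, mul_zero]
      simp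

/-- The coefficients of the minimal polynomial, by Cramer's rule for the Hankel system. -/
def minCoeff (m : ℕ) (A : Matrix (Fin n) (Fin n) ℂ) : Fin m → ℝ :=
  (hankel m A).det⁻¹ • (hankel m A).cramer fun j : Fin m => (A ^ ((j : ℕ) + m)).trace.re

/-- Since `A ^ j` times the minimal polynomial at `A` has zero trace for every `j`, the lower
coefficients solve the Hankel system, and Cramer's rule recovers them. The point is a polynomial
with analytic coefficients whose roots are all simple; the characteristic polynomial may have
multiple roots. -/
theorem eval_minPoly (hA : A.IsHermitian) {m : ℕ} (hm : (specFin A).card = m) (z : ℝ) :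
    z ^ m - ∑ i, minCoeff m A i * z ^ (i : ℕ) = ∏ w ∈ specFin A, (z - w) := by
  set p := ∏ z ∈ specFin A, (Polynomial.X - Polynomial.C z) with hp
  set c : Fin m → ℝ := fun i => (Polynomial.X ^ m - p).coeff i with hc
  have hdeg : (Polynomial.X ^ m - p).degree < (m : WithBot ℕ) := by
    have h1 : (Polynomial.X ^ m : Polynomial ℝ).degree = p.degree := by
      rw [Polynomial.degree_X_pow, Polynomial.degree_eq_natDegree monic_prod_specFin.ne_zero,
        prod_specFin_natDegree, hm]
    have h2 := Polynomial.degree_sub_lt_left h1 (Polynomial.monic_X_pow m).ne_zero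
      (by rw [Polynomial.monic_X_pow m, monic_prod_specFin])
    rwa [Polynomial.degree_X_pow] at h2
  have hcp : coeffPoly c = Polynomial.X ^ m - p := coeffPoly_coeff hdeg
  have hH : (hankel m A).mulVec c = fun j : Fin m => (A ^ ((j : ℕ) + m)).trace.re := by
    funext j
    rw [hankel_mulVec, hcp, map_sub, aeval_prod_specFin hA, sub_zero, map_pow, Polynomial.aeval_X,
      ← pow_add]
  have hdet : (hankel m A).det ≠ 0 := (hankel_det_ne_zero_iff hA m).2 hm.ge
  have hmc : minCoeff m A = c := by
    rw [minCoeff, ← hH, Matrix.cramer_eq_adjugate_mulVec, Matrix.mulVec_mulVec,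
      Matrix.adjugate_mul, Matrix.smul_mulVec, Matrix.one_mulVec, smul_smul,
      inv_mul_cancel₀ hdet, one_smul]
  have h3 : ∑ i, c i * z ^ (i : ℕ) = (coeffPoly c).eval z := by
    simp [coeffPoly, Polynomial.eval_finsetSum]
  rw [hmc, h3, hcp, Polynomial.eval_sub, hp, Polynomial.eval_prod]
  simp

end Hankel

/-! ### Analytic dependence of determinants, traces and roots on parameters -/

section Analytic

variable {E : Type*} [NormedAddCommGroup E] [NormedSpace ℝ E] {m : ℕ}

theorem analyticAt_det {M : E → Matrix (Fin m) (Fin m) ℝ} {x : E}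
    (h : ∀ i j, AnalyticAt ℝ (fun y => M y i j) x) : AnalyticAt ℝ (fun y => (M y).det) x := by
  simp only [Matrix.det_apply]
  refine Finset.analyticAt_fun_sum _ fun σ _ => ?_
  simp only [Units.smul_def, zsmul_eq_mul]
  exact analyticAt_const.mul (Finset.analyticAt_fun_prod _ fun i _ => h _ _)

theorem analyticAt_cramer {M : E → Matrix (Fin m) (Fin m) ℝ} {b : E → Fin m → ℝ} {x : E}
    (h : ∀ i j, AnalyticAt ℝ (fun y => M y i j) x) (hb : ∀ i, AnalyticAt ℝ (fun y => b y i) x)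
    (i : Fin m) : AnalyticAt ℝ (fun y => (M y).cramer (b y) i) x := by
  simp only [Matrix.cramer_apply]
  refine analyticAt_det fun k l => ?_
  simp only [Matrix.updateCol_apply]
  split_ifs
  · exact hb k
  · exact h k l

theorem analyticAt_matrix_pow {n : ℕ} {A : E → Matrix (Fin n) (Fin n) ℂ} {x : E}
    (h : ∀ i j, AnalyticAt ℝ (fun y => A y i j) x) (p : ℕ) :
    ∀ i j, AnalyticAt ℝ (fun y => (A y ^ p) i j) x := by
  induction p with
  | zero => intro i j; simpa using analyticAt_const
  | succ p ih =>
    intro i j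
    simp only [pow_succ, Matrix.mul_apply]
    exact Finset.analyticAt_fun_sum _ fun k _ => (ih i k).mul (h k j)

theorem analyticAt_trace_re {n : ℕ} {A : E → Matrix (Fin n) (Fin n) ℂ} {x : E}
    (h : ∀ i j, AnalyticAt ℝ (fun y => A y i j) x) (p : ℕ) :
    AnalyticAt ℝ (fun y => (A y ^ p).trace.re) x := by
  have h1 : AnalyticAt ℝ (fun y => (A y ^ p).trace) x := by
    simp only [Matrix.trace, Matrix.diag_apply]
    exact Finset.analyticAt_fun_sum _ fun k _ => analyticAt_matrix_pow h p k k
  exact (Complex.reCLM.analyticAt _).comp h1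

theorem analyticAt_hankel_det {n : ℕ} {A : E → Matrix (Fin n) (Fin n) ℂ} {x : E}
    (h : ∀ i j, AnalyticAt ℝ (fun y => A y i j) x) :
    AnalyticAt ℝ (fun y => (hankel m (A y)).det) x :=
  analyticAt_det fun _ _ => analyticAt_trace_re h _

theorem analyticAt_minCoeff {n : ℕ} {A : E → Matrix (Fin n) (Fin n) ℂ} {x : E}
    (h : ∀ i j, AnalyticAt ℝ (fun y => A y i j) x) (hx : (hankel m (A x)).det ≠ 0) (i : Fin m) :
    AnalyticAt ℝ (fun y => minCoeff m (A y) i) x := by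
  have h1 : AnalyticAt ℝ (fun y => (hankel m (A y)).det⁻¹) x := (analyticAt_hankel_det h).inv hx
  have h2 := analyticAt_cramer (M := fun y => hankel m (A y))
    (b := fun y (j : Fin m) => (A y ^ ((j : ℕ) + m)).trace.re)
    (fun i j => analyticAt_trace_re h _) (fun j => analyticAt_trace_re h _) i
  exact h1.mul h2

end Analytic

section ImplicitRoot

/-- A simple root of an analytic family of functions depends analytically on the parameter. -/
theorem exists_analyticAt_root {E : Type*} [NormedAddCommGroup E] [NormedSpace ℝ E]
    [CompleteSpace E] {F : E × ℝ → ℝ} {x : E} {z c : ℝ} (hF : AnalyticAt ℝ F (x, z))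
    (h0 : F (x, z) = 0) (hd : HasDerivAt (fun w => F (x, w)) c z) (hc : c ≠ 0) :
    ∃ ζ : E → ℝ, AnalyticAt ℝ ζ x ∧ ζ x = z ∧ ∀ᶠ y in 𝓝 x, F (y, ζ y) = 0 := by
  have cdf : ContDiffAt ℝ ⊤ F (x, z) := hF.contDiffAt
  have hinr : fderiv ℝ F (x, z) ∘L .inr ℝ E ℝ = c • ContinuousLinearMap.id ℝ ℝ := by
    ext
    have h1 : HasDerivAt (fun w => F (x, w)) (fderiv ℝ F (x, z) (0, 1)) z := by
      have h2 : HasDerivAt (fun w : ℝ => (x, w)) ((0 : E), (1 : ℝ)) z :=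
        (hasDerivAt_const z x).prodMk (hasDerivAt_id z)
      exact (hF.differentiableAt.hasFDerivAt).comp_hasDerivAt z h2
    simpa using h1.unique hd
  have hinv : (fderiv ℝ F (x, z) ∘L .inr ℝ E ℝ).IsInvertible := by
    rw [hinr]
    refine ⟨ContinuousLinearEquiv.unitsEquivAut ℝ (Units.mk0 c hc), ?_⟩
    ext
    simp
  refine ⟨cdf.implicitFunction (by simp) hinv, ?_, cdf.implicitFunction_apply_self _ hinv, ?_⟩
  · exact (cdf.contDiffAt_implicitFunction (by simp) hinv).analyticAt
  · have := cdf.eventually_apply_implicitFunction (by simp) hinv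
    rwa [h0] at this

end ImplicitRoot

/-! ### Analyticity of the force symbol -/

section Fourier

variable {d n : ℕ} {V : Latt d → Matrix (Fin n) (Fin n) ℝ}

theorem fourier_apply {ι : Type} (A : Latt d → Matrix ι ι ℝ) (θ : Fin d → ℝ) (a b : ι) :
    fourier A θ a b = symb (fun z => A z a b) θ := rfl

theorem continuous_fourier_apply (hV : CondE1 V) (a b : Fin n) :
    Continuous fun θ => fourier V θ a b :=
  continuous_symb (hV.summable a b)

theorem continuous_fourier (hV : CondE1 V) : Continuous (fourier V) :=
  continuous_matrix fun a b => continuous_fourier_apply hV a b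

theorem analyticAt_fourier_apply (hV : CondE1 V) (a b : Fin n) (θ : Fin d → ℝ) :
    AnalyticAt ℝ (fun θ => fourier V θ a b) θ := by
  obtain ⟨C, γ, hC, hγ, hb⟩ := hV.entry
  set l : Latt d → (Fin d → ℝ) →L[ℝ] ℂ := fun x =>
    Complex.I • Complex.ofRealCLM.comp
      (∑ i, (x i : ℝ) • (ContinuousLinearMap.proj i : (Fin d → ℝ) →L[ℝ] ℝ)) with hl
  have hlx : ∀ x h, l x h = Complex.I * (dotZ x h : ℂ) := by
    intro x h
    simp [hl, dotZ]
  have hln : ∀ x, ‖l x‖ ≤ d * len x := by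
    intro x
    refine ContinuousLinearMap.opNorm_le_bound _
      (mul_nonneg (Nat.cast_nonneg _) (len_nonneg x)) fun h => ?_
    rw [hlx, norm_mul, Complex.norm_I, one_mul, Complex.norm_real, dotZ]
    refine (norm_sum_le _ _).trans ?_
    have : ∀ i ∈ Finset.univ, ‖(x i : ℝ) * h i‖ ≤ len x * ‖h‖ := fun i _ => by
      rw [norm_mul]
      exact mul_le_mul (abs_le_len x i) (norm_le_pi_norm h i) (norm_nonneg _) (len_nonneg x)
    refine (Finset.sum_le_sum this).trans_eq ?_
    simp
    ring
  -- As `‖l x‖ ≤ d * len x`, the radius `γ / (2 * (d + 1))` uses up at most half of the exponential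
  -- decay of `V`.
  have hs : Summable fun x => ‖(V x a b : ℂ)‖ * Real.exp (γ / (2 * (d + 1)) * ‖l x‖) := by
    refine Summable.of_nonneg_of_le (fun x => by positivity) (fun x => ?_)
      ((summable_bracket_rpow_mul_exp (d := d) 0 (δ := γ / 2) (by positivity)).mul_left C)
    rw [Complex.norm_real, Real.norm_eq_abs, Real.rpow_zero, one_mul]
    have h1 : γ / (2 * (d + 1)) * ‖l x‖ ≤ γ / 2 * len x := by
      have h2 : γ / (2 * (d + 1)) * ‖l x‖ ≤ γ / (2 * (d + 1)) * (d * len x) := by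
        gcongr; exact hln x
      refine h2.trans ?_
      rw [← mul_assoc]
      refine mul_le_mul_of_nonneg_right ?_ (len_nonneg x)
      rw [div_mul_eq_mul_div, div_le_div_iff₀ (by positivity) (by positivity)]
      nlinarith
    calc _ ≤ (C * Real.exp (-γ * len x)) * Real.exp (γ / 2 * len x) := by
          gcongr; exact hb x a b
      _ = C * Real.exp (-(γ / 2) * len x) := by
          rw [mul_assoc, ← Real.exp_add]; ring_nf
  have h := analyticOnNhd_tsum_exp (fun x => (V x a b : ℂ)) l (r := γ / (2 * (d + 1)))
    (by positivity) (fun x h => by simp [hlx]) hs θ (Set.mem_univ _)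
  refine h.congr (Eventually.of_forall fun θ => ?_)
  simp only [hlx]
  exact tsum_congr fun x => mul_comm _ _

end Fourier

/-! ### Generic multiplicity and analyticity of the bands -/

section Bands

variable {d n : ℕ} {V : Latt d → Matrix (Fin n) (Fin n) ℝ}

open scoped ComplexOrder in
theorem CondE3.isHermitian (h3 : CondE3 V) (θ : Fin d → ℝ) : (fourier V θ).IsHermitian :=
  (h3 θ).isHermitian

open scoped ComplexOrder in
theorem CondE3.nonneg (h3 : CondE3 V) {θ : Fin d → ℝ} {z : ℝ} (hz : z ∈ specFin (fourier V θ)) :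
    0 ≤ z := by
  rw [mem_specFin, (h3.isHermitian θ).spectrum_real_eq_range_eigenvalues] at hz
  obtain ⟨i, rfl⟩ := hz
  exact (h3 θ).eigenvalues_nonneg i

theorem mem_freqs_iff (h3 : CondE3 V) {θ : Fin d → ℝ} {w : ℝ} :
    w ∈ freqs V θ ↔ 0 ≤ w ∧ w ^ 2 ∈ specFin (fourier V θ) := by
  have h1 : w ∈ freqs V θ ↔ w ∈ spectrum ℝ (Omega V θ) := by simp [freqs]
  have hA : IsSelfAdjoint (fourier V θ) := h3.isHermitian θ
  rw [h1, Omega, cfc_map_spectrum Real.sqrt (fourier V θ) hA Real.continuous_sqrt.continuousOn]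
  constructor
  · rintro ⟨z, hz, rfl⟩
    have hz' := mem_specFin.2 hz
    exact ⟨Real.sqrt_nonneg _, by rwa [Real.sq_sqrt (h3.nonneg hz')]⟩
  · rintro ⟨h0, h2⟩
    exact ⟨w ^ 2, mem_specFin.1 h2, Real.sqrt_sq h0⟩

theorem card_freqs (h3 : CondE3 V) (θ : Fin d → ℝ) :
    (freqs V θ).card = (specFin (fourier V θ)).card := by
  refine Finset.card_bij (fun w _ => w ^ 2) (fun w hw => ((mem_freqs_iff h3).1 hw).2) ?_ ?_
  · intro w hw w' hw' h
    exact (sq_eq_sq₀ ((mem_freqs_iff h3).1 hw).1 ((mem_freqs_iff h3).1 hw').1).1 h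
  · intro z hz
    have h0 := h3.nonneg hz
    refine ⟨Real.sqrt z, (mem_freqs_iff h3).2 ⟨Real.sqrt_nonneg _, ?_⟩, Real.sq_sqrt h0⟩
    rwa [Real.sq_sqrt h0]

theorem bddAbove_card_freqs (h3 : CondE3 V) :
    BddAbove (Set.range fun θ => (freqs V θ).card) := by
  refine ⟨n, ?_⟩
  rintro _ ⟨θ, rfl⟩
  simp only [card_freqs h3]
  exact card_specFin_le (h3.isHermitian θ)

theorem card_freqs_le (h3 : CondE3 V) (θ : Fin d → ℝ) : (freqs V θ).card ≤ numBands V :=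
  le_csSup (bddAbove_card_freqs h3) ⟨θ, rfl⟩

theorem exists_card_freqs_eq (h3 : CondE3 V) : ∃ θ, (freqs V θ).card = numBands V :=
  Nat.sSup_mem (Set.range_nonempty _) (bddAbove_card_freqs h3)

/-- The number of frequencies never exceeds `numBands V`, so genericity amounts to the nonvanishing
of a single analytic function of `θ`. -/
theorem card_freqs_eq_iff (h3 : CondE3 V) (θ : Fin d → ℝ) :
    (freqs V θ).card = numBands V ↔ (hankel (numBands V) (fourier V θ)).det ≠ 0 := by
  rw [hankel_det_ne_zero_iff (h3.isHermitian θ), ← card_freqs h3]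
  exact ⟨fun h => h.ge, fun h => le_antisymm (card_freqs_le h3 θ) h⟩

theorem omega_eq_orderEmb {θ : Fin d → ℝ} (h : (freqs V θ).card = numBands V)
    (σ : Fin (numBands V)) : omega V σ θ = (freqs V θ).orderEmbOfFin h σ := by
  have hl : (σ : ℕ) < ((freqs V θ).sort (· ≤ ·)).length := by
    rw [Finset.length_sort, h]; exact σ.2
  rw [Finset.orderEmbOfFin_apply, omega, List.getD_eq_getElem _ _ hl]
  rfl

theorem omega_mem {θ : Fin d → ℝ} (h : (freqs V θ).card = numBands V) (σ : Fin (numBands V)) :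
    omega V σ θ ∈ freqs V θ := by
  rw [omega_eq_orderEmb h]
  exact Finset.orderEmbOfFin_mem _ _ _

theorem omega_strictMono {θ : Fin d → ℝ} (h : (freqs V θ).card = numBands V) :
    StrictMono fun σ => omega V σ θ := by
  simp only [omega_eq_orderEmb h]
  exact ((freqs V θ).orderEmbOfFin h).strictMono

theorem omega_unique {θ : Fin d → ℝ} (h : (freqs V θ).card = numBands V)
    {f : Fin (numBands V) → ℝ} (hf : ∀ σ, f σ ∈ freqs V θ) (hmono : StrictMono f)
    (σ : Fin (numBands V)) : omega V σ θ = f σ := by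
  rw [omega_eq_orderEmb h, Finset.orderEmbOfFin_unique h hf hmono]

/-- The points where the number of bands is generic and the force matrix is invertible. -/
def goodSet (V : Latt d → Matrix (Fin n) (Fin n) ℝ) : Set (Fin d → ℝ) :=
  {θ | (freqs V θ).card = numBands V ∧ (fourier V θ).det ≠ 0}

theorem isOpen_goodSet (h1 : CondE1 V) (h3 : CondE3 V) : IsOpen (goodSet V) := by
  have hc : Continuous fun θ => (hankel (numBands V) (fourier V θ)).det :=
    continuous_iff_continuousAt.2 fun θ =>
      (analyticAt_hankel_det fun i j => analyticAt_fourier_apply h1 i j θ).continuousAt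
  have : goodSet V = {θ | (hankel (numBands V) (fourier V θ)).det ≠ 0} ∩
      {θ | (fourier V θ).det ≠ 0} := by
    ext θ
    exact and_congr_left' (card_freqs_eq_iff h3 θ)
  rw [this]
  exact (isOpen_ne_fun hc continuous_const).inter
    (isOpen_ne_fun (continuous_fourier h1).matrix_det continuous_const)

/-- The Hankel determinant is analytic on the whole of `ℝ^d`. If it vanished on a set of positive
measure it would vanish near some point, hence everywhere by connectedness, contrary to the fact
that the maximal number of bands is attained. -/
theorem ae_mem_goodSet (h1 : CondE1 V) (h3 : CondE3 V) (h6 : CondE6 V) :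
    ∀ᵐ θ : Fin d → ℝ, θ ∈ goodSet V := by
  set f : (Fin d → ℝ) → ℝ := fun θ => (hankel (numBands V) (fourier V θ)).det with hf
  have han : AnalyticOnNhd ℝ f Set.univ := fun θ _ =>
    analyticAt_hankel_det fun i j => analyticAt_fourier_apply h1 i j θ
  filter_upwards [ae_eventually_eq_zero_of_eq_zero volume isOpen_univ han, h6.1] with θ hθ hdet
  refine ⟨(card_freqs_eq_iff h3 θ).2 fun h0 => ?_, hdet⟩
  obtain ⟨θ₀, hθ₀⟩ := exists_card_freqs_eq h3
  have := han.eqOn_zero_of_preconnected_of_eventuallyEq_zero isPreconnected_univ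
    (Set.mem_univ θ) (hθ (Set.mem_univ θ) h0) (Set.mem_univ θ₀)
  exact (card_freqs_eq_iff h3 θ₀).1 hθ₀ this

theorem omega_pos (h3 : CondE3 V) {θ : Fin d → ℝ} (hθ : θ ∈ goodSet V) (σ : Fin (numBands V)) :
    0 < omega V σ θ := by
  obtain ⟨h0, h2⟩ := (mem_freqs_iff h3).1 (omega_mem hθ.1 σ)
  refine lt_of_le_of_ne h0 fun h => ?_
  rw [← h, zero_pow two_ne_zero, mem_specFin, spectrum.zero_mem_iff,
    Matrix.isUnit_iff_isUnit_det, isUnit_iff_ne_zero] at h2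
  exact h2 hθ.2

/-- The squared frequencies are simple roots of a polynomial with analytic coefficients, so the
implicit function theorem yields analytic roots `ζ`. Their strict order persists near `θ₀`, which
identifies their square roots with the increasing enumeration `omega`. Invertibility of the force
symbol keeps the roots away from zero, where the square root is not analytic. -/
theorem analyticAt_omega (h1 : CondE1 V) (h3 : CondE3 V) {θ₀ : Fin d → ℝ} (hθ₀ : θ₀ ∈ goodSet V)
    (σ : Fin (numBands V)) : AnalyticAt ℝ (omega V σ) θ₀ := by
  set F : (Fin d → ℝ) × ℝ → ℝ :=
    fun p => p.2 ^ numBands V - ∑ i, minCoeff (numBands V) (fourier V p.1) i * p.2 ^ (i : ℕ) with hF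
  have hFprod : ∀ θ, (freqs V θ).card = numBands V → ∀ z, F (θ, z) =
      ∏ w ∈ specFin (fourier V θ), (z - w) := fun θ hθ z =>
    eval_minPoly (h3.isHermitian θ) ((card_freqs h3 θ).symm.trans hθ) z
  have hFan : ∀ z, AnalyticAt ℝ F (θ₀, z) := by
    intro z
    refine AnalyticAt.sub (analyticAt_snd.pow _) (Finset.analyticAt_fun_sum _ fun i _ => ?_)
    refine AnalyticAt.mul ?_ (analyticAt_snd.pow _)
    have := analyticAt_minCoeff (m := numBands V) (A := fourier V) (x := θ₀)
      (fun a b => analyticAt_fourier_apply h1 a b θ₀) ((card_freqs_eq_iff h3 θ₀).1 hθ₀.1) i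
    exact this.comp_of_eq analyticAt_fst rfl
  have hroot : ∀ τ : Fin (numBands V), ∃ ζ : (Fin d → ℝ) → ℝ, AnalyticAt ℝ ζ θ₀ ∧ ζ θ₀ = omega V τ θ₀ ^ 2 ∧
      ∀ᶠ θ in 𝓝 θ₀, F (θ, ζ θ) = 0 := by
    intro τ
    have hmem := ((mem_freqs_iff h3).1 (omega_mem hθ₀.1 τ)).2
    set p := Lagrange.nodal (specFin (fourier V θ₀)) (id : ℝ → ℝ) with hp
    have heq : (fun w => F (θ₀, w)) = fun w => p.eval w := by
      funext w
      rw [hFprod θ₀ hθ₀.1, hp, Lagrange.eval_nodal]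
      rfl
    have hd : HasDerivAt (fun w => F (θ₀, w)) (p.derivative.eval (omega V τ θ₀ ^ 2))
        (omega V τ θ₀ ^ 2) := by
      rw [heq]
      exact p.hasDerivAt _
    refine exists_analyticAt_root (hFan _) ?_ hd ?_
    · rw [hFprod θ₀ hθ₀.1]
      exact Finset.prod_eq_zero hmem (sub_self _)
    · have h := Lagrange.eval_nodal_derivative_eval_node_eq (v := (id : ℝ → ℝ)) hmem
      rw [hp]
      rw [id] at h
      rw [h, Lagrange.eval_nodal]
      refine Finset.prod_ne_zero_iff.2 fun w hw => ?_
      exact sub_ne_zero.2 (Finset.ne_of_mem_erase hw).symm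
  choose ζ hζan hζ0 hζF using hroot
  have hmono : ∀ᶠ θ in 𝓝 θ₀, StrictMono fun τ => ζ τ θ := by
    have h2 : ∀ τ τ' : Fin (numBands V), τ < τ' → ∀ᶠ θ in 𝓝 θ₀, ζ τ θ < ζ τ' θ := by
      intro τ τ' hlt
      refine (hζan τ).continuousAt.eventually_lt (hζan τ').continuousAt ?_
      rw [hζ0, hζ0]
      exact pow_lt_pow_left₀ (omega_strictMono hθ₀.1 hlt) (omega_pos h3 hθ₀ τ).le two_ne_zero
    have h4 : ∀ᶠ θ in 𝓝 θ₀, ∀ τ τ' : Fin (numBands V), τ < τ' → ζ τ θ < ζ τ' θ := by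
      simp only [eventually_all]
      exact h2
    exact h4.mono fun θ h τ τ' hlt => h τ τ' hlt
  have hev : (fun θ => Real.sqrt (ζ σ θ)) =ᶠ[𝓝 θ₀] omega V σ := by
    filter_upwards [(isOpen_goodSet h1 h3).mem_nhds hθ₀, hmono, eventually_all.2 hζF]
      with θ hθ hm hFz
    have hz : ∀ τ, ζ τ θ ∈ specFin (fourier V θ) := by
      intro τ
      have := hFz τ
      rw [hFprod θ hθ.1, Finset.prod_eq_zero_iff] at this
      obtain ⟨w, hw, h0⟩ := this
      rwa [sub_eq_zero.1 h0]
    refine (omega_unique hθ.1 (f := fun τ => Real.sqrt (ζ τ θ)) (fun τ => ?_) ?_ σ).symm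
    · refine (mem_freqs_iff h3).2 ⟨Real.sqrt_nonneg _, ?_⟩
      rw [Real.sq_sqrt (h3.nonneg (hz τ))]
      exact hz τ
    · exact fun τ τ' hlt => Real.sqrt_lt_sqrt (h3.nonneg (hz τ)) (hm hlt)
  have hpos : 0 < ζ σ θ₀ := by
    rw [hζ0]
    exact pow_pos (omega_pos h3 hθ₀ σ) 2
  have hsq : AnalyticAt ℝ Real.sqrt (ζ σ θ₀) :=
    (Real.contDiffAt_sqrt hpos.ne' (n := ⊤)).analyticAt
  exact (hsq.comp (hζan σ)).congr hev

/-- This inclusion suffices for the sequel, because E4 and E5' are assumed on all open pieces of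
`regularSet V`. -/
theorem goodSet_subset_regularSet (h1 : CondE1 V) (h3 : CondE3 V) : goodSet V ⊆ regularSet V :=
  fun _ hθ => ⟨goodSet V, isOpen_goodSet h1 h3, hθ, fun _ h => h.1,
    fun σ _ h => analyticAt_omega h1 h3 h σ⟩

end Bands

/-! ### Zeros of the gradients of the phases -/

section Gradients

variable {d : ℕ}

theorem analyticAt_fderiv_apply {φ : (Fin d → ℝ) → ℝ} {θ : Fin d → ℝ} (h : AnalyticAt ℝ φ θ)
    (v : Fin d → ℝ) : AnalyticAt ℝ (fun θ => fderiv ℝ φ θ v) θ :=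
  ((ContinuousLinearMap.apply ℝ ℝ v).analyticAt _).comp h.fderiv

/-- Almost everywhere, an analytic function has a nonzero gradient or is locally constant. -/
theorem ae_fderiv_ne_zero_or_eventually_const {φ : (Fin d → ℝ) → ℝ} {U : Set (Fin d → ℝ)}
    (hU : IsOpen U) (hφ : AnalyticOnNhd ℝ φ U) :
    ∀ᵐ θ : Fin d → ℝ, θ ∈ U → (∃ j, fderiv ℝ φ θ (Pi.single j 1) ≠ 0) ∨
      ∃ O : Set (Fin d → ℝ), IsOpen O ∧ θ ∈ O ∧ O ⊆ U ∧ ∀ θ' ∈ O, φ θ' = φ θ := by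
  have h : ∀ j : Fin d, ∀ᵐ θ : Fin d → ℝ, θ ∈ U → fderiv ℝ φ θ (Pi.single j 1) = 0 →
      ∀ᶠ θ' in 𝓝 θ, fderiv ℝ φ θ' (Pi.single j 1) = 0 := fun j =>
    ae_eventually_eq_zero_of_eq_zero volume hU fun θ hθ => analyticAt_fderiv_apply (hφ θ hθ) _
  filter_upwards [ae_all_iff.2 h] with θ hθ hU'
  by_cases hne : ∃ j, fderiv ℝ φ θ (Pi.single j 1) ≠ 0
  · exact Or.inl hne
  · push Not at hne
    refine Or.inr ?_
    have h1 : ∀ᶠ θ' in 𝓝 θ, (∀ j, fderiv ℝ φ θ' (Pi.single j 1) = 0) ∧ θ' ∈ U :=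
      (eventually_all.2 fun j => hθ j hU' (hne j)).and (hU.mem_nhds hU')
    obtain ⟨r, hr, hball⟩ := Metric.eventually_nhds_iff_ball.1 h1
    refine ⟨Metric.ball θ r, Metric.isOpen_ball, Metric.mem_ball_self hr,
      fun θ' h' => (hball θ' h').2, fun θ' h' => ?_⟩
    refine (convex_ball θ r).is_const_of_fderivWithin_eq_zero (𝕜 := ℝ)
      (fun x hx => ((hφ x (hball x hx).2).differentiableAt).differentiableWithinAt)
      (fun x hx => ?_) h' (Metric.mem_ball_self hr)
    rw [fderivWithin_of_isOpen Metric.isOpen_ball hx]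
    ext v
    rw [pi_eq_sum_univ' v, map_sum]
    simp [(hball x hx).1]

variable {n : ℕ} {V : Latt d → Matrix (Fin n) (Fin n) ℝ}

/-- Almost every zero of the analytic function `dOmega V σ l` would be interior to its zero set, and
E4 excludes interior zeros. -/
theorem ae_dOmega_ne_zero (h1 : CondE1 V) (h3 : CondE3 V) (h4 : CondE4 V) (l : Fin d)
    (σ : Fin (numBands V)) : ∀ᵐ θ : Fin d → ℝ, θ ∈ goodSet V → dOmega V σ l θ ≠ 0 := by
  have han : AnalyticOnNhd ℝ (dOmega V σ l) (goodSet V) := fun θ hθ =>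
    analyticAt_fderiv_apply (analyticAt_omega h1 h3 hθ σ) _
  filter_upwards [ae_eventually_eq_zero_of_eq_zero volume (isOpen_goodSet h1 h3) han] with
    θ hθ hg h0
  have hev := (hθ hg h0).and ((isOpen_goodSet h1 h3).mem_nhds hg)
  obtain ⟨O, hO, hOo, hθO⟩ := eventually_nhds_iff.1 hev
  obtain ⟨θ', hθ', hne⟩ := h4 l σ O hOo ⟨θ, hθO⟩
    fun x hx => goodSet_subset_regularSet h1 h3 (hO x hx).2
  exact hne (hO θ' hθ').1

end Gradients

/-! ### Spectral projections of the force symbol -/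

section Projections

variable {d n : ℕ} {V : Latt d → Matrix (Fin n) (Fin n) ℝ} {θ : Fin d → ℝ}

theorem isSelfAdjoint_Omega : IsSelfAdjoint (Omega V θ) := cfc_predicate _ _

theorem continuousOn_spectrum {A : Matrix (Fin n) (Fin n) ℂ} (f : ℝ → ℝ) :
    ContinuousOn f (spectrum ℝ A) := Matrix.finite_real_spectrum.continuousOn f

theorem Omega_mul_self (h3 : CondE3 V) : Omega V θ * Omega V θ = fourier V θ := by
  have hA : IsSelfAdjoint (fourier V θ) := h3.isHermitian θ
  rw [Omega, ← cfc_mul _ _ _ (continuousOn_spectrum _) (continuousOn_spectrum _)]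
  conv_rhs => rw [← cfc_id' ℝ (fourier V θ) hA]
  exact cfc_congr fun z hz => Real.mul_self_sqrt (h3.nonneg (mem_specFin.2 hz))

theorem exists_omega_of_mem_spectrum (hθ : (freqs V θ).card = numBands V) {z : ℝ}
    (hz : z ∈ spectrum ℝ (Omega V θ)) : ∃ τ, z = omega V τ θ := by
  have h1 : z ∈ freqs V θ := by simpa [freqs] using hz
  have h2 : z ∈ Set.range ((freqs V θ).orderEmbOfFin hθ) := by
    rw [Finset.range_orderEmbOfFin]
    exact h1
  obtain ⟨τ, hτ⟩ := h2
  exact ⟨τ, by rw [omega_eq_orderEmb hθ, hτ]⟩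

theorem omega_injective (hθ : (freqs V θ).card = numBands V) {σ τ : Fin (numBands V)}
    (h : omega V σ θ = omega V τ θ) : σ = τ := (omega_strictMono hθ).injective h

theorem isHermitian_specProj (σ : Fin (numBands V)) : (specProj V σ θ).IsHermitian :=
  cfc_predicate (p := IsSelfAdjoint) _ _

theorem specProj_mul_self (σ : Fin (numBands V)) :
    specProj V σ θ * specProj V σ θ = specProj V σ θ := by
  rw [specProj, ← cfc_mul _ _ _ (continuousOn_spectrum _) (continuousOn_spectrum _)]
  exact cfc_congr fun z _ => by split_ifs <;> simp

theorem sum_specProj (hθ : (freqs V θ).card = numBands V) : ∑ σ, specProj V σ θ = 1 := by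
  simp only [specProj]
  rw [← cfc_sum_univ _ _ fun _ => continuousOn_spectrum _]
  rw [← cfc_const_one ℝ (Omega V θ) isSelfAdjoint_Omega]
  refine cfc_congr fun z hz => ?_
  obtain ⟨τ, rfl⟩ := exists_omega_of_mem_spectrum hθ hz
  simp only [Finset.sum_apply]
  rw [Finset.sum_eq_single τ]
  · simp
  · intro σ _ hστ
    rw [if_neg]
    exact fun h => hστ (omega_injective hθ h).symm
  · simp

theorem Omega_mul_specProj (σ : Fin (numBands V)) :
    Omega V θ * specProj V σ θ = (omega V σ θ : ℂ) • specProj V σ θ := by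
  have h1 : Omega V θ * specProj V σ θ = omega V σ θ • specProj V σ θ := by
    conv_lhs => rw [← cfc_id' ℝ (Omega V θ) isSelfAdjoint_Omega]
    rw [specProj, cfc_id' ℝ (Omega V θ) isSelfAdjoint_Omega]
    conv_lhs => enter [1]; rw [← cfc_id' ℝ (Omega V θ) isSelfAdjoint_Omega]
    rw [← cfc_mul _ _ _ (continuousOn_spectrum _) (continuousOn_spectrum _),
      ← cfc_smul _ _ _ (continuousOn_spectrum _)]
    refine cfc_congr fun z _ => ?_
    simp only [smul_eq_mul]
    split_ifs with h
    · rw [h]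
    · simp
  rw [h1]
  ext a b
  simp

theorem fourier_mul_specProj (h3 : CondE3 V) (σ : Fin (numBands V)) :
    fourier V θ * specProj V σ θ = ((omega V σ θ : ℂ) ^ 2) • specProj V σ θ := by
  rw [← Omega_mul_self h3, mul_assoc, Omega_mul_specProj, mul_smul_comm, Omega_mul_specProj,
    smul_smul, sq]

theorem specProj_mul_fourier (h3 : CondE3 V) (σ : Fin (numBands V)) :
    specProj V σ θ * fourier V θ = ((omega V σ θ : ℂ) ^ 2) • specProj V σ θ := by
  have h := congrArg Matrix.conjTranspose (fourier_mul_specProj (θ := θ) h3 σ)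
  rw [Matrix.conjTranspose_mul, Matrix.conjTranspose_smul, isHermitian_specProj,
    h3.isHermitian] at h
  simpa using h

theorem isUnit_Omega_det (h3 : CondE3 V) (hθ : θ ∈ goodSet V) : IsUnit (Omega V θ).det := by
  rw [isUnit_iff_ne_zero]
  intro h
  refine hθ.2 ?_
  rw [← Omega_mul_self h3, Matrix.det_mul, h, mul_zero]

theorem Omega_inv_mul_specProj (h3 : CondE3 V) (hθ : θ ∈ goodSet V) (σ : Fin (numBands V)) :
    (Omega V θ)⁻¹ * specProj V σ θ = ((omega V σ θ : ℂ)⁻¹) • specProj V σ θ := by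
  have h0 : (omega V σ θ : ℂ) ≠ 0 := Complex.ofReal_ne_zero.2 (omega_pos h3 hθ σ).ne'
  have h1 : specProj V σ θ = (omega V σ θ : ℂ)⁻¹ • (Omega V θ * specProj V σ θ) := by
    rw [Omega_mul_specProj, smul_smul, inv_mul_cancel₀ h0, one_smul]
  conv_lhs => rw [h1]
  rw [mul_smul_comm, Matrix.nonsing_inv_mul_cancel_left _ _ (isUnit_Omega_det h3 hθ)]

theorem fourier_inv_mul_specProj (h3 : CondE3 V) (hθ : θ ∈ goodSet V) (σ : Fin (numBands V)) :
    (fourier V θ)⁻¹ * specProj V σ θ = ((omega V σ θ : ℂ)⁻¹ ^ 2) • specProj V σ θ := by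
  rw [← Omega_mul_self h3, Matrix.mul_inv_rev, mul_assoc, Omega_inv_mul_specProj h3 hθ,
    mul_smul_comm, Omega_inv_mul_specProj h3 hθ, smul_smul, sq]

/-- `Π_τ p` is an eigenvector for both `ω_τ²` and `ω_σ²`; these differ when `τ ≠ σ`, the frequencies
being nonnegative and distinct. Only the term `τ = σ` survives in the resolution of the identity. -/
theorem specProj_mulVec_eq (h3 : CondE3 V) (hθ : (freqs V θ).card = numBands V)
    (σ : Fin (numBands V)) {p : Fin n → ℂ}
    (hp : (fourier V θ).mulVec p = ((omega V σ θ : ℂ) ^ 2) • p) :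
    (specProj V σ θ).mulVec p = p := by
  have h0 : ∀ τ, 0 ≤ omega V τ θ := fun τ => ((mem_freqs_iff h3).1 (omega_mem hθ τ)).1
  have h1 : ∀ τ, τ ≠ σ → (specProj V τ θ).mulVec p = 0 := by
    intro τ hτ
    have h2 : ((omega V τ θ : ℂ) ^ 2) • (specProj V τ θ).mulVec p =
        ((omega V σ θ : ℂ) ^ 2) • (specProj V τ θ).mulVec p := by
      rw [← Matrix.smul_mulVec, ← specProj_mul_fourier h3, ← Matrix.mulVec_mulVec, hp,
        Matrix.mulVec_smul]
    rw [← sub_eq_zero, ← sub_smul, smul_eq_zero] at h2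
    refine h2.resolve_left fun h => hτ (omega_injective hθ ?_)
    have h4 : omega V τ θ ^ 2 = omega V σ θ ^ 2 := by exact_mod_cast sub_eq_zero.1 h
    exact (sq_eq_sq₀ (h0 τ) (h0 σ)).1 h4
  calc (specProj V σ θ).mulVec p = (∑ τ, specProj V τ θ).mulVec p := by
        rw [Matrix.sum_mulVec, Finset.sum_eq_single σ (fun τ _ h => h1 τ h) (by simp)]
    _ = p := by rw [sum_specProj hθ, Matrix.one_mulVec]

/-- Column `b` of an orthogonal projection has squared length `Π_bb`. In particular `|Π_bb|² ≤
|Π_bb|`, so this length is at most one. -/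
theorem norm_specProj_apply_le (σ : Fin (numBands V)) (a b : Fin n) :
    ‖specProj V σ θ a b‖ ≤ 1 := by
  have hdiag : ∀ b, specProj V σ θ b b = ((∑ a, ‖specProj V σ θ a b‖ ^ 2 : ℝ) : ℂ) := by
    intro b
    have h := congrFun (congrFun (specProj_mul_self (θ := θ) σ) b) b
    rw [Matrix.mul_apply] at h
    rw [← h]
    push_cast
    refine Finset.sum_congr rfl fun a _ => ?_
    rw [← Complex.conj_mul', ← (isHermitian_specProj (θ := θ) σ).apply b a]
    rfl
  have h1 : ∀ a b, ‖specProj V σ θ a b‖ ^ 2 ≤ (specProj V σ θ b b).re := by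
    intro a b
    rw [hdiag b, Complex.ofReal_re]
    exact Finset.single_le_sum (f := fun a => ‖specProj V σ θ a b‖ ^ 2)
      (fun _ _ => by positivity) (Finset.mem_univ a)
  have h2 : (specProj V σ θ b b).re ≤ 1 := by
    have h3 := h1 b b
    have h4 := Complex.re_le_norm (specProj V σ θ b b)
    have h5 : ‖specProj V σ θ b b‖ ^ 2 ≤ ‖specProj V σ θ b b‖ := h3.trans h4
    have h6 : ‖specProj V σ θ b b‖ ≤ 1 := by
      by_contra! h7
      nlinarith
    exact h4.trans h6
  have h3 := (h1 a b).trans h2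
  exact (sq_le_one_iff₀ (norm_nonneg _)).1 h3

theorem fourier_pow_eq_sum (h3 : CondE3 V) (hθ : (freqs V θ).card = numBands V) (j : ℕ) :
    fourier V θ ^ j = ∑ τ, (((omega V τ θ ^ 2) ^ j : ℝ) : ℂ) • specProj V τ θ := by
  induction j with
  | zero => simp [sum_specProj hθ]
  | succ j ih =>
    rw [pow_succ', ih, Finset.mul_sum]
    refine Finset.sum_congr rfl fun τ _ => ?_
    rw [mul_smul_comm, fourier_mul_specProj h3, smul_smul]
    push_cast
    ring_nf

/-- Inversion of the Vandermonde system that expresses the powers of `V̂` through the projections.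
It makes the projections continuous in `θ` on the good set, whence their measurability. -/
theorem specProj_eq_sum (h3 : CondE3 V) (hθ : (freqs V θ).card = numBands V)
    (σ : Fin (numBands V)) :
    specProj V σ θ = ∑ j : Fin (numBands V),
      ((((Matrix.vandermonde fun τ => omega V τ θ ^ 2)⁻¹ j σ : ℝ)) : ℂ) •
        fourier V θ ^ (j : ℕ) := by
  set M := Matrix.vandermonde fun τ => omega V τ θ ^ 2 with hM
  have hdet : M.det ≠ 0 := by
    rw [hM, Matrix.det_vandermonde_ne_zero_iff]
    intro τ τ' h
    have h0 : ∀ τ, 0 ≤ omega V τ θ := fun τ => ((mem_freqs_iff h3).1 (omega_mem hθ τ)).1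
    exact omega_injective hθ ((sq_eq_sq₀ (h0 τ) (h0 τ')).1 h)
  have hMM : M * M⁻¹ = 1 := Matrix.mul_nonsing_inv _ (isUnit_iff_ne_zero.2 hdet)
  simp only [fourier_pow_eq_sum h3 hθ, Finset.smul_sum, smul_smul]
  rw [Finset.sum_comm]
  have h1 : ∀ τ, ∑ j : Fin (numBands V), ((M⁻¹ j σ : ℝ) : ℂ) *
      (((omega V τ θ ^ 2) ^ (j : ℕ) : ℝ) : ℂ) = if τ = σ then 1 else 0 := by
    intro τ
    have h2 := congrFun (congrFun hMM τ) σ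
    rw [Matrix.mul_apply, Matrix.one_apply] at h2
    have h4 : ((∑ j, M τ j * M⁻¹ j σ : ℝ) : ℂ) = if τ = σ then 1 else 0 := by
      rw [h2]
      split_ifs <;> simp
    rw [← h4]
    push_cast
    refine Finset.sum_congr rfl fun j _ => ?_
    rw [hM, Matrix.vandermonde_apply]
    push_cast
    ring
  simp only [← Finset.sum_smul, h1]
  simp

theorem continuousOn_omega (h1 : CondE1 V) (h3 : CondE3 V) (σ : Fin (numBands V)) :
    ContinuousOn (omega V σ) (goodSet V) := fun _ hθ =>
  (analyticAt_omega h1 h3 hθ σ).continuousAt.continuousWithinAt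

theorem continuousOn_specProj (h1 : CondE1 V) (h3 : CondE3 V) (σ : Fin (numBands V)) :
    ContinuousOn (specProj V σ) (goodSet V) := by
  have h2 : ContinuousOn (fun θ => ∑ j : Fin (numBands V),
      ((((Matrix.vandermonde fun τ => omega V τ θ ^ 2)⁻¹ j σ : ℝ)) : ℂ) •
        fourier V θ ^ (j : ℕ)) (goodSet V) := by
    rw [continuousOn_iff_continuous_domRestrict]
    refine continuous_finsetSum _ fun j _ => ?_
    have hvc : Continuous fun x : goodSet V =>
        (Matrix.vandermonde fun τ => omega V τ x.1 ^ 2) := by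
      refine continuous_matrix fun τ i => ?_
      simp only [Matrix.vandermonde_apply]
      exact (((continuousOn_iff_continuous_domRestrict.1 (continuousOn_omega h1 h3 τ)).pow 2).pow _)
    have hinv : Continuous fun x : goodSet V =>
        (Matrix.vandermonde fun τ => omega V τ x.1 ^ 2)⁻¹ := by
      simp only [Matrix.inv_def, Ring.inverse_eq_inv']
      refine Continuous.smul (hvc.matrix_det.inv₀ fun x => ?_) hvc.matrix_adjugate
      rw [Matrix.det_vandermonde_ne_zero_iff]
      intro τ τ' h
      exact omega_injective x.2.1 ((sq_eq_sq₀ (omega_pos h3 x.2 τ).le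
        (omega_pos h3 x.2 τ').le).1 h)
    exact (Complex.continuous_ofReal.comp (hinv.matrix_elem j σ)).smul
      (((continuous_fourier h1).comp continuous_subtype_val).pow _)
  exact h2.congr fun θ hθ => specProj_eq_sum h3 hθ.1 σ

end Projections

/-! ### Modes and non-resonance of the branches -/

section Modes

variable {d n k : ℕ} {V : Latt d → Matrix (Fin n) (Fin n) ℝ}

/-- The two frequencies `± ω_σ` of each band. -/
abbrev Branch (V : Latt d → Matrix (Fin n) (Fin n) ℝ) := Fin (numBands V) × Bool

/-- The sign of a branch. -/
def sg (b : Bool) : ℝ := if b then 1 else -1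

theorem sg_true : sg true = 1 := rfl

theorem sg_false : sg false = -1 := rfl

theorem sg_sq (b : Bool) : sg b ^ 2 = 1 := by cases b <;> simp [sg]

theorem sg_mul_self (b : Bool) : sg b * sg b = 1 := by cases b <;> simp [sg]

/-- The signed frequency `± ω_σ(θ)`. -/
def bfreq (β : Branch V) (θ : Fin d → ℝ) : ℝ := sg β.2 * omega V β.1 θ

/-- Eigenvectors with eigenvalue `iλ` of the adjoint of the symbol of the generator. -/
def IsMode (V : Latt d → Matrix (Fin n) (Fin n) ℝ) (θ : Fin d → ℝ) (l : ℝ)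
    (F : Comp n → ℂ) : Prop :=
  (∀ a, F (Sum.inl a) = Complex.I * l * F (Sum.inr a)) ∧
    (fourier V θ).mulVec (fun a => F (Sum.inr a)) = ((l : ℂ) ^ 2) • fun a => F (Sum.inr a)

/-- The first component of a mode is `iλ` times the second, so the four blocks of `Q` collapse to
one matrix between the second components. -/
theorem IsMode.form {θ : Fin d → ℝ} {l l' : ℝ} {F G : Comp n → ℂ} (hF : IsMode V θ l F)
    (hG : IsMode V θ l' G) (Q : Matrix (Comp n) (Comp n) ℂ) :
    ∑ a, ∑ b, (starRingEnd ℂ) (F a) * Q a b * G b =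
      star (fun a => F (Sum.inr a)) ⬝ᵥ
        (((l * l' : ℂ) • Q.toBlocks₁₁ - (Complex.I * l) • Q.toBlocks₁₂ +
          (Complex.I * l') • Q.toBlocks₂₁ + Q.toBlocks₂₂).mulVec fun a => G (Sum.inr a)) := by
  simp only [Fintype.sum_sum_type, hF.1, hG.1, dotProduct, Matrix.mulVec, Finset.mul_sum,
    ← Finset.sum_add_distrib]
  refine Finset.sum_congr rfl fun a _ => Finset.sum_congr rfl fun b _ => ?_
  simp only [Matrix.add_apply, Matrix.sub_apply, Matrix.smul_apply, smul_eq_mul, Pi.star_apply,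
    RCLike.star_def, map_mul, Complex.conj_I, Complex.conj_ofReal, Matrix.toBlocks₁₁,
    Matrix.toBlocks₁₂, Matrix.toBlocks₂₁, Matrix.toBlocks₂₂, Matrix.of_apply]
  linear_combination (-(starRingEnd ℂ) (F (Sum.inr a)) * Q (Sum.inl a) (Sum.inl b) * l * l' *
    G (Sum.inr b)) * Complex.I_sq

/-- The second components are fixed by `Π_σ` and `Π_σ'`, so the collapsed matrix may be replaced by
its sandwich between them. The hypothesis `hQ` is the combination of sandwiches that E5' controls.
-/
theorem IsMode.form_eq_zero (h3 : CondE3 V) {θ : Fin d → ℝ}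
    (hθ : (freqs V θ).card = numBands V) {σ σ' : Fin (numBands V)} {l l' : ℝ} {F G : Comp n → ℂ}
    (hl : l ^ 2 = omega V σ θ ^ 2) (hl' : l' ^ 2 = omega V σ' θ ^ 2)
    (hF : IsMode V θ l F) (hG : IsMode V θ l' G) (Q : Matrix (Comp n) (Comp n) ℂ)
    (hQ : (l * l' : ℂ) • sandwich V σ σ' Q.toBlocks₁₁ θ -
      (Complex.I * l) • sandwich V σ σ' Q.toBlocks₁₂ θ +
      (Complex.I * l') • sandwich V σ σ' Q.toBlocks₂₁ θ + sandwich V σ σ' Q.toBlocks₂₂ θ = 0) :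
    ∑ a, ∑ b, (starRingEnd ℂ) (F a) * Q a b * G b = 0 := by
  rw [hF.form hG]
  set M := ((l * l' : ℂ) • Q.toBlocks₁₁ - (Complex.I * l) • Q.toBlocks₁₂ +
          (Complex.I * l') • Q.toBlocks₂₁ + Q.toBlocks₂₂) with hM
  have hp : (specProj V σ θ).mulVec (fun a => F (Sum.inr a)) = fun a => F (Sum.inr a) :=
    specProj_mulVec_eq h3 hθ σ (by rw [hF.2]; congr 1; exact_mod_cast hl)
  have hp' : (specProj V σ' θ).mulVec (fun a => G (Sum.inr a)) = fun a => G (Sum.inr a) :=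
    specProj_mulVec_eq h3 hθ σ' (by rw [hG.2]; congr 1; exact_mod_cast hl')
  have hS : specProj V σ θ * M * specProj V σ' θ = 0 := by
    rw [← hQ, hM]
    simp only [sandwich, mul_add, mul_sub, add_mul, sub_mul, mul_smul_comm, smul_mul_assoc]
  rw [← hp, ← hp', Matrix.star_mulVec, isHermitian_specProj, Matrix.dotProduct_mulVec,
    Matrix.vecMul_vecMul, ← Matrix.dotProduct_mulVec, Matrix.mulVec_mulVec, hS]
  simp

theorem analyticAt_bfreq (h1 : CondE1 V) (h3 : CondE3 V) {θ : Fin d → ℝ} (hθ : θ ∈ goodSet V)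
    (β : Branch V) : AnalyticAt ℝ (bfreq β) θ :=
  analyticAt_const.mul (analyticAt_omega h1 h3 hθ β.1)

theorem bfreq_sq (β : Branch V) (θ : Fin d → ℝ) : bfreq β θ ^ 2 = omega V β.1 θ ^ 2 := by
  rw [bfreq, mul_pow, sg_sq, one_mul]

theorem fderiv_bfreq (h1 : CondE1 V) (h3 : CondE3 V) {θ : Fin d → ℝ} (hθ : θ ∈ goodSet V)
    (β : Branch V) (j : Fin d) :
    fderiv ℝ (bfreq β) θ (Pi.single j 1) = sg β.2 * dOmega V β.1 j θ := by
  have h : fderiv ℝ (bfreq β) θ = sg β.2 • fderiv ℝ (omega V β.1) θ :=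
    fderiv_const_mul (analyticAt_omega h1 h3 hθ β.1).differentiableAt _
  rw [h]
  rfl

theorem ae_fderiv_bfreq_ne_zero (h1 : CondE1 V) (h3 : CondE3 V) (h4 : CondE4 V) (β : Branch V)
    (j : Fin d) : ∀ᵐ θ : Fin d → ℝ, θ ∈ goodSet V →
      fderiv ℝ (bfreq β) θ (Pi.single j 1) ≠ 0 := by
  filter_upwards [ae_dOmega_ne_zero h1 h3 h4 j β.1] with θ hθ hg
  rw [fderiv_bfreq h1 h3 hg]
  refine mul_ne_zero ?_ (hθ hg)
  cases β.2 <;> simp [sg]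

/-- Different branches are non-resonant, or their interaction vanishes by E5'. -/
theorem ae_nonresonant (hd : 1 ≤ d) (h1 : CondE1 V) (h3 : CondE3 V) (h4 : CondE4 V)
    {q : Corner d k → Latt d → Matrix (Comp n) (Comp n) ℝ} (h5 : CondE5' V k q) {β β' : Branch V}
    (hβ : β ≠ β') : ∀ᵐ θ : Fin d → ℝ, θ ∈ goodSet V →
      (∃ j, fderiv ℝ (fun θ => bfreq β θ - bfreq β' θ) θ (Pi.single j 1) ≠ 0) ∨
      ∀ (nn : Corner d k) (F G : Comp n → ℂ), IsMode V θ (bfreq β θ) F →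
        IsMode V θ (bfreq β' θ) G →
        ∑ a, ∑ b, (starRingEnd ℂ) (F a) * fourier (q nn) θ a b * G b = 0 := by
  have han : AnalyticOnNhd ℝ (fun θ => bfreq β θ - bfreq β' θ) (goodSet V) := fun θ hθ =>
    (analyticAt_bfreq h1 h3 hθ β).sub (analyticAt_bfreq h1 h3 hθ β')
  filter_upwards [ae_fderiv_ne_zero_or_eventually_const (isOpen_goodSet h1 h3) han,
    ae_dOmega_ne_zero h1 h3 h4 ⟨0, hd⟩ β.1] with θ hθ hdω hg
  rcases hθ hg with h | ⟨O, hO, hθO, hOg, hconst⟩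
  · exact Or.inl h
  -- Two different branches of the same band have opposite signs, so their phase difference is `±2
  -- ω_σ`, whose gradient is nonzero by E4.
  by_cases hσ : β.1 = β'.1
  · refine Or.inl ⟨⟨0, hd⟩, ?_⟩
    have hb : sg β.2 ≠ sg β'.2 := by
      intro h
      refine hβ (Prod.ext hσ ?_)
      cases h1 : β.2 <;> cases h2 : β'.2 <;> simp [h1, h2, sg] at h ⊢ <;> norm_num at h
    have heq : fderiv ℝ (fun θ => bfreq β θ - bfreq β' θ) θ =
        fderiv ℝ (bfreq β) θ - fderiv ℝ (bfreq β') θ :=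
      fderiv_fun_sub (analyticAt_bfreq h1 h3 hg β).differentiableAt
        (analyticAt_bfreq h1 h3 hg β').differentiableAt
    rw [heq]
    change fderiv ℝ (bfreq β) θ _ - fderiv ℝ (bfreq β') θ _ ≠ 0
    rw [fderiv_bfreq h1 h3 hg, fderiv_bfreq h1 h3 hg, ← hσ, ← sub_mul]
    exact mul_ne_zero (sub_ne_zero.2 hb) (hdω hg)
  · refine Or.inr fun nn F G hF hG => ?_
    have hOr : O ⊆ regularSet V := hOg.trans (goodSet_subset_regularSet h1 h3)
    refine hF.form_eq_zero h3 hg.1 (bfreq_sq β θ) (bfreq_sq β' θ) hG _ ?_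
    obtain ⟨σ, b⟩ := β
    obtain ⟨σ', b'⟩ := β'
    simp only at hσ
    have hp := omega_pos h3 hg σ
    have hp' := omega_pos h3 hg σ'
    by_cases hbb : b = b'
    · subst hbb
      -- E5' concerns nonzero constants only; here the constant is nonzero because distinct bands
      -- have distinct frequencies at a good momentum.
      have hc0 : omega V σ θ - omega V σ' θ ≠ 0 :=
        sub_ne_zero.2 fun h => hσ (omega_injective hg.1 h)
      have hcc : ∀ θ' ∈ O, omega V σ θ' - omega V σ' θ' = omega V σ θ - omega V σ' θ := by
        intro θ' hθ'
        have := hconst θ' hθ'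
        simp only [bfreq, ← mul_sub] at this
        refine mul_left_cancel₀ ?_ this
        cases b <;> simp [sg]
      obtain ⟨e1, e2⟩ := (h5 σ σ' hσ O _ hO ⟨θ, hθO⟩ hOr hc0).2 hcc nn θ hθO
      have hs : ((sg b : ℝ) : ℂ) * (sg b : ℝ) = 1 := by exact_mod_cast sg_mul_self b
      push_cast at e1
      simp only [bfreq]
      push_cast
      rw [show ((sg b : ℂ) * (omega V σ θ : ℂ) * ((sg b : ℂ) * (omega V σ' θ : ℂ))) =
        ((sg b : ℂ) * (sg b : ℂ)) * ((omega V σ θ : ℂ) * (omega V σ' θ : ℂ)) by ring, hs, one_mul]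
      -- With `λ = sg b * ω_σ` inserted, the required identity is the first relation of E5' minus `i
      -- sg b` times the second.
      linear_combination (norm := module) e1 - (Complex.I * (sg b : ℂ)) • e2
    · have hb' : sg b' = -sg b := by
        cases b <;> cases b' <;> simp [sg] at hbb ⊢
      -- For opposite signs the phase difference is, up to sign, the sum of two frequencies, which
      -- are positive at a good momentum.
      have hc0 : omega V σ θ + omega V σ' θ ≠ 0 := by positivity
      have hcc : ∀ θ' ∈ O, omega V σ θ' + omega V σ' θ' = omega V σ θ + omega V σ' θ := by
        intro θ' hθ'
        have := hconst θ' hθ'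
        simp only [bfreq, hb', neg_mul, sub_neg_eq_add, ← mul_add] at this
        refine mul_left_cancel₀ ?_ this
        cases b <;> simp [sg]
      obtain ⟨e1, e2⟩ := (h5 σ σ' hσ O _ hO ⟨θ, hθO⟩ hOr hc0).1 hcc nn θ hθO
      have hs : ((sg b : ℝ) : ℂ) * (sg b : ℝ) = 1 := by exact_mod_cast sg_mul_self b
      push_cast at e1
      simp only [bfreq, hb']
      push_cast
      rw [show ((sg b : ℂ) * (omega V σ θ : ℂ) * (-(sg b : ℂ) * (omega V σ' θ : ℂ))) =
        -(((sg b : ℂ) * (sg b : ℂ)) * ((omega V σ θ : ℂ) * (omega V σ' θ : ℂ))) by ring, hs,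
        one_mul]
      linear_combination (norm := module) e1 - (Complex.I * (sg b : ℂ)) • e2

end Modes

/-! ### Cut-offs and multipliers in momentum space -/

section Indicator

variable {d : ℕ}

/-- Restriction of an `L²` function to a measurable set. -/
def indOp (S : Set (Fin d → ℝ)) (hS : MeasurableSet S) : Lp ℂ 2 (nu d) →L[ℂ] Lp ℂ 2 (nu d) :=
  mulOp (S.indicator 1) ((measurable_one.indicator hS).aestronglyMeasurable) 1 fun θ => by
    by_cases h : θ ∈ S <;> simp [h]

open Classical in
theorem coeFn_indOp {S : Set (Fin d → ℝ)} (hS : MeasurableSet S) (g : Lp ℂ 2 (nu d)) :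
    indOp S hS g =ᵐ[nu d] fun θ => if θ ∈ S then g θ else 0 := by
  filter_upwards [coeFn_mulOp _ _ _ _ g] with θ hθ
  rw [indOp, hθ]
  by_cases h : θ ∈ S <;> simp [h]

theorem coeFn_symbOp {r : Latt d → ℝ} (hr : Summable fun z => |r z|) (g : Lp ℂ 2 (nu d)) :
    symbOp r hr g =ᵐ[nu d] fun θ => symb r θ * g θ := coeFn_mulOp _ _ _ _ g

/-- Multiplication operators commute, so the two oscillating factors merge into one whose phase is
the difference. -/
theorem inner_oscOp_symbOp {ψ ψ' : (Fin d → ℝ) → ℝ} (hψ : AEMeasurable ψ (nu d))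
    (hψ' : AEMeasurable ψ' (nu d)) {r : Latt d → ℝ} (hr : Summable fun z => |r z|)
    (f g : Lp ℂ 2 (nu d)) (t : ℝ) :
    inner ℂ (oscOp ψ hψ t f) (symbOp r hr (oscOp ψ' hψ' t g)) =
      inner ℂ f (oscOp (fun θ => ψ' θ - ψ θ) (hψ'.sub hψ) t (symbOp r hr g)) := by
  rw [L2.inner_def, L2.inner_def]
  refine integral_congr_ae ?_
  filter_upwards [coeFn_oscOp hψ t f, coeFn_symbOp hr (oscOp ψ' hψ' t g), coeFn_oscOp hψ' t g,
    coeFn_oscOp (hψ'.sub hψ) t (symbOp r hr g), coeFn_symbOp hr g] with θ e1 e2 e3 e4 e5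
  rw [e1, e2, e3, RCLike.inner_apply, RCLike.inner_apply]
  have e4' : (oscOp (fun θ => ψ' θ - ψ θ) (hψ'.sub hψ) t (symbOp r hr g) : (Fin d → ℝ) → ℂ) θ =
    osc (fun θ => ψ' θ - ψ θ) t θ * symbOp r hr g θ := e4
  rw [e4', e5, map_mul, conj_osc, osc_sub]
  ring

theorem oscOp_self_inner {ψ : (Fin d → ℝ) → ℝ} (hψ : AEMeasurable ψ (nu d)) {r : Latt d → ℝ}
    (hr : Summable fun z => |r z|) (f g : Lp ℂ 2 (nu d)) (t : ℝ) :
    inner ℂ (oscOp ψ hψ t f) (symbOp r hr (oscOp ψ hψ t g)) = inner ℂ f (symbOp r hr g) := by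
  rw [inner_oscOp_symbOp, L2.inner_def, L2.inner_def]
  refine integral_congr_ae ?_
  filter_upwards [coeFn_oscOp (hψ.sub hψ) t (symbOp r hr g)] with θ e1
  have e1' : (oscOp (fun θ => ψ θ - ψ θ) (hψ.sub hψ) t (symbOp r hr g) : (Fin d → ℝ) → ℂ) θ =
    osc (fun θ => ψ θ - ψ θ) t θ * symbOp r hr g θ := e1
  rw [e1']
  simp [osc]

end Indicator

/-! ### Interaction of different branches -/

section CrossTerms

variable {d : ℕ} {κ : Type*} [Fintype κ] {W : Set (Fin d → ℝ)}

theorem sum_sum_integral {X : Type*} [MeasurableSpace X] {μ : Measure X} {G : κ → κ → X → ℂ}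
    (hG : ∀ a b, Integrable (G a b) μ) :
    ∑ a, ∑ b, ∫ x, G a b x ∂μ = ∫ x, ∑ a, ∑ b, G a b x ∂μ := by
  rw [integral_finsetSum _ fun a _ => integrable_finsetSum _ fun b _ => hG a b]
  exact Finset.sum_congr rfl fun a _ => (integral_finsetSum _ fun b _ => hG a b).symm

/-- Interaction of two branches through a convolution operator. -/
theorem tendsto_cross (hW : IsOpen W) (hWc : W ⊆ ocell d) {ψ ψ' : (Fin d → ℝ) → ℝ}
    (hψm : AEMeasurable ψ (nu d)) (hψm' : AEMeasurable ψ' (nu d))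
    (hψ : ContDiffOn ℝ (⊤ : ℕ∞) ψ W) (hψ' : ContDiffOn ℝ (⊤ : ℕ∞) ψ' W)
    {r : κ → κ → Latt d → ℝ} (hr : ∀ a b, Summable fun z => |r a b z|) (f g : κ → Lp ℂ 2 (nu d))
    (hne : ∀ᵐ θ ∂nu d, θ ∈ W ∧
      ((∃ j, fderiv ℝ (fun θ => ψ' θ - ψ θ) θ (Pi.single j 1) ≠ 0) ∨
        ∑ a, ∑ b, (starRingEnd ℂ) (f a θ) * symb (r a b) θ * g b θ = 0)) :
    Tendsto (fun t => ∑ a, ∑ b,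
      inner ℂ (oscOp ψ hψm t (f a)) (symbOp (r a b) (hr a b) (oscOp ψ' hψm' t (g b))))
      atTop (𝓝 0) := by
  classical
  set φ : (Fin d → ℝ) → ℝ := fun θ => ψ' θ - ψ θ with hφdef
  have hφ : ContDiffOn ℝ (⊤ : ℕ∞) φ W := hψ'.sub hψ
  have hφm : AEMeasurable φ (nu d) := hψm'.sub hψm
  -- On `G` the Riemann–Lebesgue lemma applies to each pair of components. Off `G` only the double
  -- sum over components is zero, not its single terms, so the sum has to be formed under the
  -- integral before it is discarded.
  set G : Set (Fin d → ℝ) := {θ | θ ∈ W ∧ ∃ j, fderiv ℝ φ θ (Pi.single j 1) ≠ 0} with hG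
  have hGo : IsOpen G := by
    have : G = ⋃ j : Fin d, {θ | θ ∈ W ∧ fderiv ℝ φ θ (Pi.single j 1) ≠ 0} := by
      ext θ
      simp [hG]
    rw [this]
    exact isOpen_iUnion fun j =>
      (contDiffOn_fderiv_apply hW hφ (Pi.single j 1)).continuousOn.isOpen_inter_preimage hW
        isOpen_ne
  have hGm := hGo.measurableSet
  have h1 : ∀ a b, Tendsto (fun t => inner ℂ (f a)
      (oscOp φ hφm t (indOp G hGm (symbOp (r a b) (hr a b) (g b))))) atTop (𝓝 0) := by
    intro a b
    refine tendsto_inner_oscOp hW hWc hφm hφ _ _ ?_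
    filter_upwards [coeFn_indOp hGm (symbOp (r a b) (hr a b) (g b))] with θ hθ h0
    rw [hθ] at h0
    by_contra hc
    exact h0 (if_neg hc)
  have h2 := tendsto_finsetSum (Finset.univ : Finset κ) fun a _ =>
    tendsto_finsetSum (Finset.univ : Finset κ) fun b _ => h1 a b
  simp only [Finset.sum_const_zero] at h2
  refine h2.congr fun t => ?_
  simp only [inner_oscOp_symbOp]
  have hint : ∀ u v : Lp ℂ 2 (nu d),
      Integrable (fun θ => inner ℂ (u θ) (v θ)) (nu d) := fun u v => L2.integrable_inner u v
  rw [← sub_eq_zero]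
  simp only [← Finset.sum_sub_distrib, L2.inner_def]
  set H : κ → κ → (Fin d → ℝ) → ℂ := fun a b θ =>
    inner ℂ (f a θ) (oscOp φ hφm t (indOp G hGm (symbOp (r a b) (hr a b) (g b))) θ) -
      inner ℂ (f a θ) (oscOp φ hφm t (symbOp (r a b) (hr a b) (g b)) θ) with hH
  have h3 : ∀ a b, ∫ θ, inner ℂ (f a θ) (oscOp φ hφm t (indOp G hGm
      (symbOp (r a b) (hr a b) (g b))) θ) ∂nu d -
      ∫ θ, inner ℂ (f a θ) (oscOp φ hφm t (symbOp (r a b) (hr a b) (g b)) θ) ∂nu d =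
      ∫ θ, H a b θ ∂nu d := fun a b => (integral_sub (hint _ _) (hint _ _)).symm
  refine (Finset.sum_congr rfl fun a _ => Finset.sum_congr rfl fun b _ => h3 a b).trans ?_
  have hHi : ∀ a b, Integrable (H a b) (nu d) := fun a b => (hint _ _).sub (hint _ _)
  rw [sum_sum_integral hHi]
  refine integral_eq_zero_of_ae ?_
  have e1 := ae_all_iff.2 fun a => ae_all_iff.2 fun b =>
    coeFn_oscOp hφm t (indOp G hGm (symbOp (r a b) (hr a b) (g b)))
  have e2 := ae_all_iff.2 fun a => ae_all_iff.2 fun b =>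
    coeFn_oscOp hφm t (symbOp (r a b) (hr a b) (g b))
  have e3 := ae_all_iff.2 fun a => ae_all_iff.2 fun b =>
    coeFn_indOp hGm (symbOp (r a b) (hr a b) (g b))
  have e4 := ae_all_iff.2 fun a => ae_all_iff.2 fun b => coeFn_symbOp (hr a b) (g b)
  filter_upwards [e1, e2, e3, e4, hne] with θ e1 e2 e3 e4 ⟨hθW, hne⟩
  simp only [hH, e1, e2, e3, e4, Pi.zero_apply, RCLike.inner_apply]
  by_cases hθ : θ ∈ G
  · simp [hθ]
  · simp only [hθ, if_false, mul_zero, zero_mul, zero_sub, Finset.sum_neg_distrib]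
    have h0 := hne.resolve_left fun h => hθ ⟨hθW, h⟩
    rw [neg_eq_zero, ← mul_zero (osc φ t θ), ← h0, Finset.mul_sum]
    refine Finset.sum_congr rfl fun a _ => ?_
    rw [Finset.mul_sum]
    exact Finset.sum_congr rfl fun b _ => by ring

end CrossTerms

/-! ### The limit of the correlation form for abstract wave data -/

section LimitForm

variable {d : ℕ} {κ B N J : Type*} [Fintype κ] [Fintype B] [Fintype N] [Fintype J]

/-- The points where the velocity of the phase `ψ` lies in the corner with signs `s`. -/
def velSet (W : Set (Fin d → ℝ)) (ψ : (Fin d → ℝ) → ℝ) (e : J → Fin d) (s : J → ℝ) :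
    Set (Fin d → ℝ) := {θ | θ ∈ W ∧ ∀ j, 0 < s j * fderiv ℝ ψ θ (Pi.single (e j) 1)}

theorem isOpen_velSet {W : Set (Fin d → ℝ)} (hW : IsOpen W) {ψ : (Fin d → ℝ) → ℝ}
    (hψ : ContDiffOn ℝ (⊤ : ℕ∞) ψ W) (e : J → Fin d) (s : J → ℝ) :
    IsOpen (velSet W ψ e s) := by
  have : velSet W ψ e s = W ∩ ⋂ j, {θ | θ ∈ W ∧ 0 < s j * fderiv ℝ ψ θ (Pi.single (e j) 1)} := by
    ext θ
    simp only [velSet, Set.mem_ofPred_eq, Set.mem_inter_iff, Set.mem_iInter]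
    exact ⟨fun h => ⟨h.1, fun j => ⟨h.1, h.2 j⟩⟩, fun h => ⟨h.1, fun j => (h.2 j).2⟩⟩
  rw [this]
  refine hW.inter (isOpen_iInter_of_finite fun j => ?_)
  exact (continuousOn_const.mul
    (contDiffOn_fderiv_apply hW hψ (Pi.single (e j) 1)).continuousOn).isOpen_inter_preimage hW
    isOpen_Ioi

/-- The data of the scattering problem: finitely many phases, a correlation kernel, and its limits
in the corners. -/
structure WaveData (d : ℕ) (κ B N J : Type*) [Fintype κ] [Fintype B] [Fintype N] [Fintype J] where
  W : Set (Fin d → ℝ)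
  isOpen_W : IsOpen W
  W_subset : W ⊆ ocell d
  ae_W : ∀ᵐ θ ∂nu d, θ ∈ W
  ψ : B → (Fin d → ℝ) → ℝ
  smooth : ∀ β, ContDiffOn ℝ (⊤ : ℕ∞) (ψ β) W
  e : J → Fin d
  s : N → J → ℝ
  existsUnique_corner : ∀ β, ∀ᵐ θ ∂nu d, ∃! ν : N,
    ∀ j, 0 < s ν j * fderiv ℝ (ψ β) θ (Pi.single (e j) 1)
  K : κ → κ → Latt d → Latt d → ℝ
  r : N → κ → κ → Latt d → ℝ
  dom : Latt d → ℝ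
  summable_dom : Summable dom
  K_le : ∀ a b x y, |K a b x y| ≤ dom (x - y)
  r_le : ∀ ν a b z, |r ν a b z| ≤ dom z
  lim : ∀ ν a b (z : Latt d) (ε : ℝ), 0 < ε → ∃ M : ℕ, ∀ y : Latt d,
      (∀ j, (M : ℝ) < s ν j * y (e j)) → |K a b (y + z) y - r ν a b z| < ε

namespace WaveData

variable (D : WaveData d κ B N J)

theorem aem (β : B) : AEMeasurable (D.ψ β) (nu d) :=
  aemeasurable_of_contDiffOn D.isOpen_W D.ae_W (D.smooth β).continuousOn

theorem summable_r (ν : N) (a b : κ) : Summable fun z => |D.r ν a b z| :=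
  Summable.of_nonneg_of_le (fun _ => abs_nonneg _) (D.r_le ν a b) D.summable_dom

/-- The propagator of a branch. -/
def U (β : B) (t : ℝ) : Lp ℂ 2 (nu d) →L[ℂ] Lp ℂ 2 (nu d) := oscOp (D.ψ β) (D.aem β) t

/-- The initial correlation operator. -/
def T (a b : κ) : L2seq d ℂ →L[ℂ] L2seq d ℂ := covOp (D.K a b) D.dom (D.K_le a b)

/-- The limit correlation operator in a corner. -/
def R (ν : N) (a b : κ) : Lp ℂ 2 (nu d) →L[ℂ] Lp ℂ 2 (nu d) := symbOp (D.r ν a b) (D.summable_r ν a b)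

/-- Restriction to the momenta whose velocity lies in the corner `ν`. -/
def P (β : B) (ν : N) : Lp ℂ 2 (nu d) →L[ℂ] Lp ℂ 2 (nu d) :=
  indOp (velSet D.W (D.ψ β) D.e (D.s ν))
    (isOpen_velSet D.isOpen_W (D.smooth β) D.e (D.s ν)).measurableSet

/-- The corners of velocity space partition almost all momenta, by `existsUnique_corner`. -/
theorem sum_P (β : B) (g : Lp ℂ 2 (nu d)) : ∑ ν, D.P β ν g = g := by
  classical
  refine Lp.ext ?_
  have h1 := ae_all_iff.2 fun ν => coeFn_indOp
    (isOpen_velSet D.isOpen_W (D.smooth β) D.e (D.s ν)).measurableSet g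
  filter_upwards [Lp.coeFn_finsetSum Finset.univ fun ν => D.P β ν g, h1, D.existsUnique_corner β,
    D.ae_W] with θ e1 e2 ⟨ν, hν, huniq⟩ hW
  rw [e1]
  simp only [Finset.sum_apply, P, e2]
  rw [Finset.sum_eq_single ν]
  · exact if_pos ⟨hW, hν⟩
  · intro ν' _ hne
    exact if_neg fun h => hne (huniq ν' h.2)
  · simp

theorem U_P (β : B) (ν : N) (t : ℝ) (g : Lp ℂ 2 (nu d)) : D.U β t (D.P β ν g) =
    D.P β ν (D.U β t g) := by
  classical
  refine Lp.ext ?_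
  have hm := (isOpen_velSet D.isOpen_W (D.smooth β) D.e (D.s ν)).measurableSet
  filter_upwards [coeFn_oscOp (D.aem β) t (D.P β ν g), coeFn_indOp hm (D.U β t g),
    coeFn_oscOp (D.aem β) t g, coeFn_indOp hm g] with θ e1 e2 e3 e4
  simp only [U, P] at *
  rw [e1, e2, e3, e4]
  split_ifs <;> simp

/-- The kernel minus its limit tends to zero in the corner `ν`, which is where the packets selected
by `P β ν` travel. Both kernels have the majorant `dom`, hence the factor `2`. -/
theorem tendsto_sub (β : B) (ν : N) (a b : κ) (g : Lp ℂ 2 (nu d)) :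
    Tendsto (fun t => D.T a b (coef (D.U β t (D.P β ν g))) -
      coef (D.R ν a b (D.U β t (D.P β ν g)))) atTop (𝓝 0) := by
  classical
  have hK : ∀ x y, |D.K a b x y - D.r ν a b (x - y)| ≤ 2 * D.dom (x - y) := fun x y => by
    refine (abs_sub _ _).trans ?_
    linarith [D.K_le a b x y, D.r_le ν a b (x - y)]
  have h := tendsto_covOp_coef (D.summable_dom.mul_left 2) hK D.e (D.s ν) (fun z ε hε => by
      obtain ⟨M, hM⟩ := D.lim ν a b z ε hε
      refine ⟨M, fun y hy => ?_⟩
      rw [add_sub_cancel_left]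
      exact hM y hy) D.isOpen_W D.W_subset (D.aem β) (D.smooth β) (D.P β ν g) (by
      filter_upwards [coeFn_indOp
        (isOpen_velSet D.isOpen_W (D.smooth β) D.e (D.s ν)).measurableSet g] with θ e1 h0
      simp only [P] at h0
      rw [e1] at h0
      by_contra hc
      exact h0 (if_neg hc))
  refine h.congr fun t => ?_
  have hr : ∀ x y : Latt d, |D.r ν a b (x - y)| ≤ D.dom (x - y) := fun x y => D.r_le ν a b _
  rw [R, ← covOp_coef (D.summable_r ν a b) D.summable_dom hr]
  ext x
  refine (hasSum_covOp_apply (D.summable_dom.mul_left 2) hK _ x).unique ?_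
  have h1 := hasSum_covOp_apply D.summable_dom (D.K_le a b) (coef (D.U β t (D.P β ν g))) x
  have h2 := hasSum_covOp_apply D.summable_dom hr (coef (D.U β t (D.P β ν g))) x
  refine (h1.sub h2).congr_fun fun y => ?_
  push_cast
  exact sub_mul _ _ _

/-- The form of the initial correlations. -/
def form (F : κ → Lp ℂ 2 (nu d)) : ℂ := ∑ a, ∑ b, inner ℂ (coef (F a)) (D.T a b (coef (F b)))

/-- The state at time `t` of a superposition of branches. -/
def evol (f : B → κ → Lp ℂ 2 (nu d)) (t : ℝ) (a : κ) : Lp ℂ 2 (nu d) := ∑ β, D.U β t (f β a)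

/-- The limit form, polarized. -/
def limForm (f g : B → κ → Lp ℂ 2 (nu d)) : ℂ :=
  ∑ β, ∑ ν, ∑ a, ∑ b, inner ℂ (f β a) (D.R ν a b (D.P β ν (g β b)))

/-- The interaction of different branches vanishes, either by non-stationary phase or
pointwise. -/
def NonResonant (f : B → κ → Lp ℂ 2 (nu d)) : Prop :=
  ∀ β β', β ≠ β' → ∀ ν, ∀ᵐ θ ∂nu d,
    (∃ j, fderiv ℝ (fun θ => D.ψ β' θ - D.ψ β θ) θ (Pi.single j 1) ≠ 0) ∨
      ∑ a, ∑ b, (starRingEnd ℂ) (f β a θ) * symb (D.r ν a b) θ * f β' b θ = 0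

/-- Convergence of the correlations of the evolved state. -/
theorem tendsto_form (f : B → κ → Lp ℂ 2 (nu d)) (hf : D.NonResonant f) :
    Tendsto (fun t => D.form (D.evol f t)) atTop (𝓝 (D.limForm f f)) := by
  classical
  -- Only the second amplitude is split by corners; boundedness of the first is enough. After `T` is
  -- replaced by the multiplier `R`, equal branches give a quantity independent of `t` and different
  -- ones decouple.
  have hpair : ∀ β β' ν, Tendsto (fun t => ∑ a, ∑ b,
      inner ℂ (coef (D.U β t (f β a))) (D.T a b (coef (D.U β' t (D.P β' ν (f β' b))))))
      atTop (𝓝 (if β = β' then ∑ a, ∑ b, inner ℂ (f β a) (D.R ν a b (D.P β ν (f β b))) else 0)) := by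
    intro β β' ν
    have h1 : Tendsto (fun t => ∑ a, ∑ b, inner ℂ (coef (D.U β t (f β a)))
        (D.T a b (coef (D.U β' t (D.P β' ν (f β' b)))) -
          coef (D.R ν a b (D.U β' t (D.P β' ν (f β' b)))))) atTop (𝓝 0) := by
      have h2 : ∀ a b, Tendsto (fun t => inner ℂ (coef (D.U β t (f β a)))
        (D.T a b (coef (D.U β' t (D.P β' ν (f β' b)))) -
          coef (D.R ν a b (D.U β' t (D.P β' ν (f β' b)))))) atTop (𝓝 (0 : ℂ)) := by
        intro a b
        have h3 := ((D.tendsto_sub β' ν a b (f β' b)).norm).const_mul ‖f β a‖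
        rw [norm_zero, mul_zero] at h3
        refine squeeze_zero_norm (fun t => ?_) h3
        refine (norm_inner_le_norm _ _).trans_eq ?_
        rw [LinearIsometryEquiv.norm_map, U, norm_oscOp]
      have h4 := tendsto_finsetSum (Finset.univ : Finset κ) fun a _ =>
        tendsto_finsetSum (Finset.univ : Finset κ) fun b _ => h2 a b
      simpa only [Finset.sum_const_zero] using h4
    have h5 : Tendsto (fun t => ∑ a, ∑ b, inner ℂ (D.U β t (f β a))
        (D.R ν a b (D.U β' t (D.P β' ν (f β' b))))) atTop
        (𝓝 (if β = β' then ∑ a, ∑ b, inner ℂ (f β a) (D.R ν a b (D.P β ν (f β b))) else 0)) := by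
      split_ifs with hβ
      · subst hβ
        refine tendsto_const_nhds.congr fun t => ?_
        refine Finset.sum_congr rfl fun a _ => Finset.sum_congr rfl fun b _ => ?_
        exact (oscOp_self_inner (D.aem β) (D.summable_r ν a b) _ _ t).symm
      · refine tendsto_cross D.isOpen_W D.W_subset (D.aem β) (D.aem β') (D.smooth β)
          (D.smooth β') (D.summable_r ν) (f β) (fun b => D.P β' ν (f β' b)) ?_
        have e1 := ae_all_iff.2 fun b => coeFn_indOp
          (isOpen_velSet D.isOpen_W (D.smooth β') D.e (D.s ν)).measurableSet (f β' b)
        filter_upwards [D.ae_W, hf β β' hβ ν, e1] with θ hW h e1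
        refine ⟨hW, h.imp_right fun h0 => ?_⟩
        simp only [P, e1]
        split_ifs
        · exact h0
        · simp
    have h6 := h1.add h5
    rw [zero_add] at h6
    refine h6.congr fun t => ?_
    rw [← Finset.sum_add_distrib]
    refine Finset.sum_congr rfl fun a _ => ?_
    rw [← Finset.sum_add_distrib]
    refine Finset.sum_congr rfl fun b _ => ?_
    rw [inner_sub_right, LinearIsometryEquiv.inner_map_map, sub_add_cancel]
  have h7 := tendsto_finsetSum (Finset.univ : Finset B) fun β _ =>
    tendsto_finsetSum (Finset.univ : Finset B) fun β' _ =>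
      tendsto_finsetSum (Finset.univ : Finset N) fun ν _ => hpair β β' ν
  have h8 : (∑ β, ∑ β', ∑ ν, (if β = β' then
      ∑ a, ∑ b, inner ℂ (f β a) (D.R ν a b (D.P β ν (f β b))) else 0 : ℂ)) = D.limForm f f := by
    rw [limForm]
    refine Finset.sum_congr rfl fun β _ => ?_
    rw [Finset.sum_eq_single β]
    · simp
    · intro β' _ h
      simp [h.symm]
    · simp
  rw [h8] at h7
  refine h7.congr fun t => ?_
  have h9 : ∀ b, coef (D.evol f t b) = ∑ β', ∑ ν, coef (D.U β' t (D.P β' ν (f β' b))) := by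
    intro b
    rw [evol, map_sum]
    refine Finset.sum_congr rfl fun β' _ => ?_
    rw [← map_sum, ← map_sum, sum_P]
  have h10 : ∀ a, coef (D.evol f t a) = ∑ β, coef (D.U β t (f β a)) := fun a => by
    rw [evol, map_sum]
  have h11 : D.form (D.evol f t) = ∑ a, ∑ b, ∑ β, ∑ β', ∑ ν,
      inner ℂ (coef (D.U β t (f β a))) (D.T a b (coef (D.U β' t (D.P β' ν (f β' b))))) := by
    rw [form]
    refine Finset.sum_congr rfl fun a _ => Finset.sum_congr rfl fun b _ => ?_
    rw [h9 b, h10 a, sum_inner]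
    refine Finset.sum_congr rfl fun β _ => ?_
    rw [map_sum, inner_sum]
    refine Finset.sum_congr rfl fun β' _ => ?_
    rw [map_sum, inner_sum]
  rw [h11]
  have h12 : ∀ X : κ → κ → B → B → N → ℂ, ∑ β, ∑ β', ∑ ν, ∑ a, ∑ b, X a b β β' ν =
      ∑ a, ∑ b, ∑ β, ∑ β', ∑ ν, X a b β β' ν := by
    intro X
    simp only [← Fintype.sum_prod_type']
    exact Fintype.sum_equiv ⟨fun p => (p.2.2.2.1, p.2.2.2.2, p.1, p.2.1, p.2.2.1),
      fun p => (p.2.2.1, p.2.2.2.1, p.2.2.2.2, p.1, p.2.1), fun _ => rfl, fun _ => rfl⟩ _ _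
      fun _ => rfl
  exact h12 fun a b β β' ν => inner ℂ (coef (D.U β t (f β a)))
    (D.T a b (coef (D.U β' t (D.P β' ν (f β' b)))))

/-- Mixed limit forms of a branch-wise evolution vanish in the limit. -/
theorem tendsto_limForm_evol (hne : ∀ β, ∀ᵐ θ ∂nu d, ∃ j, fderiv ℝ (D.ψ β) θ (Pi.single j 1) ≠ 0)
    (f g : B → κ → Lp ℂ 2 (nu d)) :
    Tendsto (fun t => D.limForm f fun β b => D.U β t (g β b)) atTop (𝓝 0) := by
  have h1 : ∀ β ν a b, Tendsto (fun t => inner ℂ (f β a)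
      (D.R ν a b (D.P β ν (D.U β t (g β b))))) atTop (𝓝 (0 : ℂ)) := by
    intro β ν a b
    have h2 := tendsto_inner_oscOp D.isOpen_W D.W_subset (D.aem β) (D.smooth β) (f β a)
      (D.R ν a b (D.P β ν (g β b))) (by
        filter_upwards [D.ae_W, hne β] with θ h1 h2 _ using ⟨h1, h2⟩)
    refine h2.congr fun t => ?_
    rw [← D.U_P]
    congr 1
    refine Lp.ext ?_
    filter_upwards [coeFn_oscOp (D.aem β) t (D.R ν a b (D.P β ν (g β b))),
      coeFn_symbOp (D.summable_r ν a b) (D.P β ν (g β b)),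
      coeFn_symbOp (D.summable_r ν a b) (D.U β t (D.P β ν (g β b))),
      coeFn_oscOp (D.aem β) t (D.P β ν (g β b))] with θ e1 e2 e3 e4
    simp only [R, U] at *
    rw [e1, e2, e3, e4]
    ring
  have h3 := tendsto_finsetSum (Finset.univ : Finset B) fun β _ =>
    tendsto_finsetSum (Finset.univ : Finset N) fun ν _ =>
      tendsto_finsetSum (Finset.univ : Finset κ) fun a _ =>
        tendsto_finsetSum (Finset.univ : Finset κ) fun b _ => h1 β ν a b
  simp only [Finset.sum_const_zero] at h3
  exact h3

end WaveData

end LimitForm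

/-! ### The crystal as an instance of the wave data -/

section Setup

variable {d n k : ℕ} {α : ℝ}

/-- The standing assumptions on the force matrix and on the initial correlations. -/
structure Setup (V : Latt d → Matrix (Fin n) (Fin n) ℝ) (μ₀ : Measure (PhaseSpace d n α)) (k : ℕ)
    (q : Corner d k → Latt d → Matrix (Comp n) (Comp n) ℝ) : Prop where
  one_le : 1 ≤ d
  e1 : CondE1 V
  e3 : CondE3 V
  e4 : CondE4 V
  e5 : CondE5' V k q
  e6 : CondE6 V
  s2 : CondS2 μ₀
  s3 : CondS3 μ₀ k q

/-- The sign of the coordinate `y_j` in the corner `𝐧`. -/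
def cornerSign (nn : Corner d k) (j : {j : Fin d // (j : ℕ) < k}) : ℝ := (-1) ^ (nn j : ℕ)

theorem cornerSign_eq (nn : Corner d k) (j : {j : Fin d // (j : ℕ) < k}) :
    (nn j : ℕ) = 1 ∧ cornerSign nn j = -1 ∨ (nn j : ℕ) = 2 ∧ cornerSign nn j = 1 := by
  have h := (nn j).2
  simp only [Finset.mem_insert, Finset.mem_singleton] at h
  rcases h with h | h
  · exact Or.inl ⟨h, by simp [cornerSign, h]⟩
  · exact Or.inr ⟨h, by simp [cornerSign, h]⟩

theorem existsUnique_cornerSign {v : {j : Fin d // (j : ℕ) < k} → ℝ} (hv : ∀ j, v j ≠ 0) :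
    ∃! nn : Corner d k, ∀ j, 0 < cornerSign nn j * v j := by
  refine ⟨fun j => if 0 < v j then ⟨2, by simp⟩ else ⟨1, by simp⟩, fun j => ?_, ?_⟩
  · rcases lt_or_gt_of_ne (hv j) with h | h
    · simp [cornerSign, not_lt.2 h.le, h]
    · simp [cornerSign, h]
  · intro nn hnn
    funext j
    have hj := hnn j
    rcases cornerSign_eq nn j with ⟨h1, h2⟩ | ⟨h1, h2⟩
    · rw [h2] at hj
      have : ¬ 0 < v j := by linarith
      simp only [this, if_false]
      exact Subtype.ext h1
    · rw [h2] at hj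
      have : 0 < v j := by linarith
      simp only [this, if_true]
      exact Subtype.ext h1

theorem exists_mem_corner (nn : Corner d k) (M : ℕ) :
    ∃ y : Latt d, ∀ j : {j : Fin d // (j : ℕ) < k}, (M : ℝ) < cornerSign nn j * y j := by
  refine ⟨fun i => if h : (i : ℕ) < k then (-1) ^ (nn ⟨i, h⟩ : ℕ) * (M + 1) else 0, fun j => ?_⟩
  simp only [j.2, dif_pos]
  push_cast
  rw [← mul_assoc]
  change (M : ℝ) < cornerSign nn j * cornerSign nn j * _
  rcases cornerSign_eq nn j with ⟨_, h2⟩ | ⟨_, h2⟩ <;> rw [h2] <;> norm_num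

variable {V : Latt d → Matrix (Fin n) (Fin n) ℝ} {μ₀ : Measure (PhaseSpace d n α)}
  {q : Corner d k → Latt d → Matrix (Comp n) (Comp n) ℝ}

open scoped Matrix.Norms.L2Operator in
theorem CondS3.lim (h : CondS3 μ₀ k q) (nn : Corner d k) (a b : Comp n) (z : Latt d) {ε : ℝ}
    (hε : 0 < ε) : ∃ M : ℕ, ∀ y : Latt d,
      (∀ j : {j : Fin d // (j : ℕ) < k}, (M : ℝ) < cornerSign nn j * y j) →
        |cov μ₀ (y + z) y a b - q nn z a b| < ε := by
  obtain ⟨⟨q₀, hq₀, hlim⟩, -⟩ := h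
  obtain ⟨M, hM⟩ := hlim nn z ε hε
  refine ⟨M, fun y hy => ?_⟩
  have h1 := hM (headPart k y) fun j => by
    have := hy j
    rw [cornerSign] at this
    exact_mod_cast this
  rw [hq₀]
  have e1 : headPart k (y + z) = headPart k y + headPart k z := rfl
  have e2 : tailPart k (y + z) - tailPart k y = tailPart k z := by
    funext j
    simp [tailPart]
  rw [e1, e2]
  exact (norm_entry_le_l2_opNorm _ a b).trans_lt h1

/-- The dominating function of the correlations. -/
def corrDom (h : CondS2 μ₀) (z : Latt d) : ℝ := h.2.choose (len z)

open scoped Matrix.Norms.L2Operator in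
theorem abs_cov_le (h : CondS2 μ₀) (a b : Comp n) (x y : Latt d) :
    |cov μ₀ x y a b| ≤ corrDom h (x - y) :=
  (norm_entry_le_l2_opNorm _ a b).trans (h.2.choose_spec.2.2 x y)

theorem summable_corrDom (h : CondS2 μ₀) : Summable (corrDom h) := h.2.choose_spec.2.1

/-- The bound on the covariance passes to its limit along a corner, which contains sites beyond any
threshold. -/
theorem abs_limit_le (h2 : CondS2 μ₀) (h3 : CondS3 μ₀ k q) (nn : Corner d k) (a b : Comp n)
    (z : Latt d) : |q nn z a b| ≤ corrDom h2 z := by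
  refine le_of_forall_pos_le_add fun ε hε => ?_
  obtain ⟨M, hM⟩ := h3.lim nn a b z hε
  obtain ⟨y, hy⟩ := exists_mem_corner nn M
  have h4 := hM y hy
  have h5 := abs_cov_le h2 a b (y + z) y
  rw [add_sub_cancel_left] at h5
  have h6 := abs_sub_abs_le_abs_sub (q nn z a b) (cov μ₀ (y + z) y a b)
  rw [abs_sub_comm] at h6
  linarith

namespace Setup

variable (S : Setup V μ₀ k q)

/-- The scattering data of the crystal. -/
def waves (S : Setup V μ₀ k q) :
    WaveData d (Comp n) (Branch V) (Corner d k) {j : Fin d // (j : ℕ) < k} where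
  W := goodSet V ∩ ocell d
  isOpen_W := (isOpen_goodSet S.e1 S.e3).inter isOpen_ocell
  W_subset := Set.inter_subset_right
  ae_W := by
    filter_upwards [ae_nu_of_ae (ae_mem_goodSet S.e1 S.e3 S.e6), ae_mem_ocell] with θ h1 h2
      using ⟨h1, h2⟩
  ψ := bfreq
  smooth := fun β θ hθ =>
    (analyticAt_bfreq S.e1 S.e3 hθ.1 β).contDiffAt.contDiffWithinAt
  e := Subtype.val
  s := cornerSign
  existsUnique_corner := fun β => by
    filter_upwards [ae_nu_of_ae (ae_mem_goodSet S.e1 S.e3 S.e6), ae_nu_of_ae (ae_all_iff.2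
      fun j => ae_fderiv_bfreq_ne_zero S.e1 S.e3 S.e4 β j)] with θ h1 h2
    exact existsUnique_cornerSign fun j => h2 j h1
  K := fun a b x y => cov μ₀ x y a b
  r := fun nn a b z => q nn z a b
  dom := corrDom S.s2
  summable_dom := summable_corrDom S.s2
  K_le := abs_cov_le S.s2
  r_le := abs_limit_le S.s2 S.s3
  lim := fun nn a b z _ hε => S.s3.lim nn a b z hε

theorem ae_goodSet (S : Setup V μ₀ k q) : ∀ᵐ θ ∂nu d, θ ∈ goodSet V :=
  ae_nu_of_ae (ae_mem_goodSet S.e1 S.e3 S.e6)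

/-- The amplitudes of a superposition of modes. -/
def Modal (f : Branch V → Comp n → Lp ℂ 2 (nu d)) : Prop :=
  ∀ β, ∀ᵐ θ ∂nu d, IsMode V θ (bfreq β θ) fun a => f β a θ

theorem nonResonant (S : Setup V μ₀ k q) {f : Branch V → Comp n → Lp ℂ 2 (nu d)}
    (hf : Modal f) : S.waves.NonResonant f := by
  intro β β' hne nn
  filter_upwards [hf β, hf β', S.ae_goodSet,
    ae_nu_of_ae (ae_nonresonant S.one_le S.e1 S.e3 S.e4 S.e5 hne)] with θ h1 h2 hg h
  rcases h hg with ⟨j, hj⟩ | h0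
  · refine Or.inl ⟨j, fun hc => hj ?_⟩
    have e : (fun θ => bfreq β θ - bfreq β' θ) = -fun θ => bfreq β' θ - bfreq β θ := by
      funext θ
      simp
    rw [e, fderiv_neg]
    change -(fderiv ℝ (fun θ => bfreq β' θ - bfreq β θ) θ (Pi.single j 1)) = 0
    rw [neg_eq_zero]
    exact hc
  · exact Or.inr (h0 nn _ _ h1 h2)

theorem ae_exists_velocity_ne_zero (S : Setup V μ₀ k q) (β : Branch V) :
    ∀ᵐ θ ∂nu d, ∃ j, fderiv ℝ (S.waves.ψ β) θ (Pi.single j 1) ≠ 0 := by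
  filter_upwards [S.ae_goodSet,
    ae_nu_of_ae (ae_fderiv_bfreq_ne_zero S.e1 S.e3 S.e4 β ⟨0, S.one_le⟩)] with θ hg h
  exact ⟨_, h hg⟩

end Setup

end Setup

/-! ### A uniform bound on the frequencies -/

section FrequencyBound

variable {d n : ℕ} {V : Latt d → Matrix (Fin n) (Fin n) ℝ}

/-- Read the eigenvector equation at a coordinate of largest modulus. -/
theorem abs_le_of_mem_specFin {A : Matrix (Fin n) (Fin n) ℂ} {z : ℝ} (hz : z ∈ specFin A) :
    |z| ≤ ∑ i, ∑ j, ‖A i j‖ := by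
  rw [mem_specFin] at hz
  have h0 : ¬IsUnit (algebraMap ℝ (Matrix (Fin n) (Fin n) ℂ) z - A) := spectrum.mem_iff.1 hz
  rw [Matrix.isUnit_iff_isUnit_det, isUnit_iff_ne_zero, not_not,
    ← Matrix.exists_mulVec_eq_zero_iff] at h0
  obtain ⟨v, hv, h⟩ := h0
  obtain ⟨i, -, hi⟩ : ∃ i ∈ Finset.univ, ∀ j ∈ Finset.univ, ‖v j‖ ≤ ‖v i‖ := by
    have : (Finset.univ : Finset (Fin n)).Nonempty := by
      by_contra hne
      rw [Finset.not_nonempty_iff_eq_empty, Finset.univ_eq_empty_iff] at hne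
      exact hv (Subsingleton.elim _ _)
    exact Finset.exists_max_image _ _ this
  have hvi : 0 < ‖v i‖ := by
    rw [norm_pos_iff]
    intro h1
    refine hv (funext fun j => ?_)
    have := hi j (Finset.mem_univ j)
    rw [h1, norm_zero] at this
    simpa using le_antisymm this (norm_nonneg _)
  have h2 : (z : ℂ) * v i = ∑ j, A i j * v j := by
    have h3 := congrFun h i
    rw [Matrix.sub_mulVec, Pi.sub_apply, Algebra.algebraMap_eq_smul_one, Matrix.smul_mulVec,
      Matrix.one_mulVec] at h3
    have h4 : (z : ℂ) * v i - A.mulVec v i = 0 := by simpa using h3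
    exact sub_eq_zero.1 h4
  have h3 : |z| * ‖v i‖ ≤ (∑ i, ∑ j, ‖A i j‖) * ‖v i‖ := by
    calc |z| * ‖v i‖ = ‖(z : ℂ) * v i‖ := by rw [norm_mul, Complex.norm_real, Real.norm_eq_abs]
      _ = ‖∑ j, A i j * v j‖ := by rw [h2]
      _ ≤ ∑ j, ‖A i j‖ * ‖v i‖ := by
        refine (norm_sum_le _ _).trans (Finset.sum_le_sum fun j hj => ?_)
        rw [norm_mul]
        gcongr
        exact hi j hj
      _ = (∑ j, ‖A i j‖) * ‖v i‖ := by rw [Finset.sum_mul]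
      _ ≤ _ := by
        refine mul_le_mul_of_nonneg_right ?_ (norm_nonneg _)
        exact Finset.single_le_sum (f := fun i => ∑ j, ‖A i j‖)
          (fun _ _ => Finset.sum_nonneg fun _ _ => norm_nonneg _) (Finset.mem_univ i)
  exact le_of_mul_le_mul_right h3 hvi

theorem exists_bfreq_bound (h1 : CondE1 V) (h3 : CondE3 V) :
    ∃ C : ℝ, ∀ (β : Branch V) (θ : Fin d → ℝ), |bfreq β θ| ≤ C := by
  set D := ∑ i, ∑ j, ∑' x, |V x i j| with hD
  have hD0 : 0 ≤ D := Finset.sum_nonneg fun i _ => Finset.sum_nonneg fun j _ =>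
    tsum_nonneg fun _ => abs_nonneg _
  -- Squared frequencies are at most `D`, and `ω ≤ 1 + ω²`. Where `omega` takes its default value
  -- `0` the bound is trivial, so it holds at every `θ`.
  refine ⟨1 + D, fun β θ => ?_⟩
  have habs : |bfreq β θ| = |omega V β.1 θ| := by
    rw [bfreq, abs_mul]
    have : |sg β.2| = 1 := by cases β.2 <;> simp [sg]
    rw [this, one_mul]
  rw [habs]
  by_cases hl : (β.1 : ℕ) < ((freqs V θ).sort (· ≤ ·)).length
  · have hmem : omega V β.1 θ ∈ freqs V θ := by
      rw [omega, List.getD_eq_getElem _ _ hl, ← Finset.mem_sort (· ≤ ·)]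
      exact List.getElem_mem hl
    obtain ⟨h0, h2⟩ := (mem_freqs_iff h3).1 hmem
    have h4 := abs_le_of_mem_specFin h2
    have h5 : ∑ i, ∑ j, ‖fourier V θ i j‖ ≤ D :=
      Finset.sum_le_sum fun i _ => Finset.sum_le_sum fun j _ => norm_symb_le (h1.summable i j) θ
    rw [abs_of_nonneg (by positivity)] at h4
    rw [abs_of_nonneg h0]
    nlinarith [sq_nonneg (omega V β.1 θ - 1)]
  · rw [omega, List.getD_eq_default _ _ (not_lt.1 hl), abs_zero]
    positivity

end FrequencyBound

/-! ### Functionals and their Fourier amplitudes -/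

section Representation

variable {d n : ℕ} {α : ℝ} {V : Latt d → Matrix (Fin n) (Fin n) ℝ}

/-- The functional `L` has the amplitude `F`: `L(Y) = ∑ₓ (Y(x), u(x))` with Fourier transform `F`
of `u`. -/
def Rep (L : PhaseSpace d n α →L[ℝ] ℝ) (F : Comp n → Lp ℂ 2 (nu d)) : Prop :=
  ∀ x a, coef (F a) x = (L (pointP d n α x (EuclideanSpace.single a 1)) : ℂ)

theorem Rep.add {L M : PhaseSpace d n α →L[ℝ] ℝ} {F G : Comp n → Lp ℂ 2 (nu d)} (hF : Rep L F)
    (hG : Rep M G) : Rep (L + M) fun a => F a + G a := by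
  intro x a
  rw [map_add]
  change coef (F a) x + coef (G a) x = _
  rw [hF, hG, ← Complex.ofReal_add]
  rfl

/-- The kernel of the adjoint of the generator. -/
def adjKer (V : Latt d → Matrix (Fin n) (Fin n) ℝ) (a b : Comp n) (z : Latt d) : ℝ :=
  genMat V (-z) b a

theorem summable_adjKer (hV : CondE1 V) (a b : Comp n) :
    Summable fun z => |adjKer V a b z| := by
  have hite : ∀ c : ℝ, Summable fun z : Latt d => |if -z = 0 then c else 0| := fun c =>
    summable_of_ne_finset_zero (s := {0}) fun z hz => by
      rw [Finset.mem_singleton] at hz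
      simp [hz]
  rcases a with a | a <;> rcases b with b | b
  · simp [adjKer, genMat]
  · have h := (Equiv.neg (Latt d)).summable_iff.2 (hV.summable b a)
    refine h.congr fun z => ?_
    simp [adjKer, genMat]
  · refine (hite ((1 : Matrix (Fin n) (Fin n) ℝ) b a)).congr fun z => ?_
    by_cases hz : z = 0 <;> simp [adjKer, genMat, hz]
  · simp [adjKer, genMat]

/-- The adjoint of the generator in the Fourier picture. -/
def adjOp (hV : CondE1 V) (F : Comp n → Lp ℂ 2 (nu d)) (a : Comp n) : Lp ℂ 2 (nu d) :=
  ∑ b, symbOp (adjKer V a b) (summable_adjKer hV a b) (F b)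

/-- Composing a functional with the generator transposes and reflects the convolution kernel, which
is how `adjKer` arises; the result is again a multiplier on the amplitude. -/
theorem Rep.comp_gen (hV : CondE1 V) {L : PhaseSpace d n α →L[ℝ] ℝ} {F : Comp n → Lp ℂ 2 (nu d)}
    (hF : Rep L F) : Rep (L.comp (gen V α)) (adjOp hV F) := by
  intro x a
  have hgen : ∀ y b, gen V α (pointP d n α x (EuclideanSpace.single a 1)) y b =
      genMat V (y - x) b a := by
    intro y b
    refine (hasSum_gen_apply hV _ y b).unique ?_
    refine (hasSum_ite_eq x (genMat V (y - x) b a)).congr_fun fun y' => ?_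
    simp only [pointP_apply]
    by_cases h : y' = x
    · simp [h]
    · simp [h]
  have h1 := hasSum_dual L (gen V α (pointP d n α x (EuclideanSpace.single a 1)))
  simp only [hgen] at h1
  have h2 := h1.mapL Complex.ofRealCLM
  have h3 : ∀ b, HasSum (fun y => (adjKer V a b (x - y) : ℂ) * coef (F b) y)
      (coef (symbOp (adjKer V a b) (summable_adjKer hV a b) (F b)) x) := by
    intro b
    rw [← covOp_coef (summable_adjKer hV a b) (summable_adjKer hV a b) (fun _ _ => le_rfl)]
    exact hasSum_covOp_apply (summable_adjKer hV a b) (fun _ _ => le_rfl) _ _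
  have h4 := hasSum_sum fun b (_ : b ∈ (Finset.univ : Finset (Comp n))) => h3 b
  have h5 : coef (adjOp hV F a) x =
      ∑ b, coef (symbOp (adjKer V a b) (summable_adjKer hV a b) (F b)) x := by
    rw [adjOp, map_sum]
    exact map_sum (evalSeq ℂ x) _ _
  rw [h5]
  refine h4.unique ?_
  refine h2.congr_fun fun y => ?_
  simp only [Complex.ofRealCLM_apply]
  push_cast
  refine Finset.sum_congr rfl fun b _ => ?_
  rw [adjKer, neg_sub, hF]

/-- Transposing and reflecting a kernel takes the adjoint of its symbol. As `V̂` is Hermitian, its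
block reappears unchanged. -/
theorem symb_adjKer (h3 : CondE3 V) (θ : Fin d → ℝ) (a b : Fin n) :
    symb (adjKer V (Sum.inl a) (Sum.inl b)) θ = 0 ∧
    symb (adjKer V (Sum.inl a) (Sum.inr b)) θ = -fourier V θ a b ∧
    symb (adjKer V (Sum.inr a) (Sum.inl b)) θ = (1 : Matrix (Fin n) (Fin n) ℂ) a b ∧
    symb (adjKer V (Sum.inr a) (Sum.inr b)) θ = 0 := by
  refine ⟨by simp [symb, adjKer, genMat], ?_, ?_, by simp [symb, adjKer, genMat]⟩
  · rw [← (h3.isHermitian θ).apply a b, fourier_apply, symb, symb, tsum_star, ← tsum_neg,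
      ← (Equiv.neg (Latt d)).tsum_eq]
    refine tsum_congr fun z => ?_
    simp only [adjKer, genMat, Equiv.neg_apply, Matrix.fromBlocks_apply₂₁, neg_neg, Matrix.neg_apply,
      RCLike.star_def, map_mul, conj_ch, Complex.conj_ofReal]
    push_cast
    ring
  · rw [symb, tsum_eq_single 0]
    · simp only [adjKer, genMat, ch_zero, Matrix.one_apply, neg_zero, if_true,
        Matrix.fromBlocks_apply₁₂, eq_comm (a := b)]
      split_ifs <;> simp
    · intro z hz
      simp [adjKer, genMat, hz]

/-- The block matrix `(0, -V̂; 1, 0)` sends `(iλp, p)` with `V̂p = λ²p` to `(-λ²p, iλp)`. This is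
the reason for the definition of `IsMode`. -/
theorem adjOp_mode (h1 : CondE1 V) (h3 : CondE3 V) {F : Comp n → Lp ℂ 2 (nu d)}
    {l : (Fin d → ℝ) → ℝ} (hF : ∀ᵐ θ ∂nu d, IsMode V θ (l θ) fun a => F a θ) (a : Comp n) :
    adjOp h1 F a =ᵐ[nu d] fun θ => Complex.I * l θ * F a θ := by
  have e1 := ae_all_iff.2 fun b => coeFn_symbOp (summable_adjKer h1 a b) (F b)
  filter_upwards [hF, e1, Lp.coeFn_finsetSum Finset.univ fun b =>
    symbOp (adjKer V a b) (summable_adjKer h1 a b) (F b)] with θ hm e1 e2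
  rw [adjOp, e2, Finset.sum_apply]
  simp only [e1, Fintype.sum_sum_type]
  rcases a with a | a
  · simp only [(symb_adjKer h3 θ a _).1, (symb_adjKer h3 θ a _).2.1]
    have h := congrFun hm.2 a
    simp only [Matrix.mulVec, dotProduct, Pi.smul_apply, smul_eq_mul] at h
    simp only [zero_mul, Finset.sum_const_zero, zero_add, neg_mul, Finset.sum_neg_distrib, h]
    have h' : F (Sum.inl a) θ = Complex.I * l θ * F (Sum.inr a) θ := hm.1 a
    rw [h']
    linear_combination (-(l θ : ℂ) ^ 2 * F (Sum.inr a) θ) * Complex.I_sq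
  · simp only [(symb_adjKer h3 θ a _).2.2.1, (symb_adjKer h3 θ a _).2.2.2]
    simp [Matrix.one_apply, hm.1 a]

end Representation

/-! ### Power series of the oscillating factor -/

section ExponentialSeries

variable {d : ℕ}

theorem hasSum_integral_pow_osc {l : (Fin d → ℝ) → ℝ} {C : ℝ} (hC : ∀ θ, |l θ| ≤ C)
    (hl : AEMeasurable l (nu d)) {u : (Fin d → ℝ) → ℂ} (hu : Integrable u (nu d)) (t : ℝ) :
    HasSum (fun m : ℕ => ((t ^ m / m.factorial : ℝ) : ℂ) * ∫ θ, (Complex.I * l θ) ^ m * u θ ∂nu d)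
      (∫ θ, osc l t θ * u θ ∂nu d) := by
  have hC0 : 0 ≤ C := (abs_nonneg _).trans (hC 0)
  have hn : ∀ (m : ℕ) θ, ‖(Complex.I * l θ) ^ m‖ ≤ C ^ m := fun m θ => by
    rw [norm_pow, norm_mul, Complex.norm_I, one_mul, Complex.norm_real, Real.norm_eq_abs]
    gcongr
    exact hC θ
  have hi : ∀ m : ℕ, Integrable (fun θ => (Complex.I * l θ) ^ m * u θ) (nu d) := fun m => by
    refine hu.bdd_mul (c := C ^ m) ?_ (Eventually.of_forall (hn m))
    exact (((Complex.measurable_ofReal.comp_aemeasurable hl).const_mul _).pow_const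
      m).aestronglyMeasurable
  have h1 : ∀ m : ℕ, Integrable (fun θ => ((t ^ m / m.factorial : ℝ) : ℂ) *
      ((Complex.I * l θ) ^ m * u θ)) (nu d) := fun m => (hi m).const_mul _
  have h2 : Summable fun m : ℕ => ∫ θ, ‖((t ^ m / m.factorial : ℝ) : ℂ) *
      ((Complex.I * l θ) ^ m * u θ)‖ ∂nu d := by
    refine Summable.of_nonneg_of_le (fun m => integral_nonneg fun _ => norm_nonneg _)
      (fun m => ?_) ((Real.summable_pow_div_factorial (|t| * C)).mul_right (∫ θ, ‖u θ‖ ∂nu d))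
    rw [← integral_const_mul]
    refine integral_mono (h1 m).norm (hu.norm.const_mul _) fun θ => ?_
    have e : ‖((t ^ m / m.factorial : ℝ) : ℂ)‖ = |t| ^ m / m.factorial := by
      rw [Complex.norm_real, Real.norm_eq_abs, abs_div, abs_pow, Nat.abs_cast]
    rw [norm_mul, norm_mul, e, ← mul_assoc, mul_pow |t| C, mul_div_right_comm (|t| ^ m)]
    refine mul_le_mul_of_nonneg_right ?_ (norm_nonneg _)
    exact mul_le_mul_of_nonneg_left (hn m θ) (by positivity)
  have h3 := hasSum_integral_of_summable_integral_norm h1 h2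
  simp only [integral_const_mul] at h3
  suffices e : (∫ θ, osc l t θ * u θ ∂nu d) = ∫ θ, ∑' m : ℕ, ((t ^ m / m.factorial : ℝ) : ℂ) *
      ((Complex.I * l θ) ^ m * u θ) ∂nu d by
    rw [e]
    exact h3
  refine integral_congr_ae (Eventually.of_forall fun θ => ?_)
  simp only
  have h4 := NormedSpace.expSeries_div_hasSum_exp (𝔸 := ℂ) (((t * l θ : ℝ) : ℂ) * Complex.I)
  rw [← Complex.exp_eq_exp_ℂ] at h4
  have h5 := (h4.mul_right (u θ)).tsum_eq
  rw [osc, ← h5]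
  refine tsum_congr fun m => ?_
  push_cast
  rw [mul_pow, mul_pow]
  ring

end ExponentialSeries

/-! ### Evolution of amplitudes -/

section Flow

variable {d n : ℕ} {α : ℝ} {V : Latt d → Matrix (Fin n) (Fin n) ℝ}

theorem hasSum_prop (L : PhaseSpace d n α →L[ℝ] ℝ) (t : ℝ) (Y : PhaseSpace d n α) :
    HasSum (fun m : ℕ => (t ^ m / m.factorial) * L ((gen V α ^ m) Y)) (L (prop V α t Y)) := by
  have h := NormedSpace.exp_series_hasSum_exp' (𝕂 := ℝ) (t • gen V α)
  have h2 := (h.mapL (ContinuousLinearMap.apply ℝ (PhaseSpace d n α) Y)).mapL L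
  refine h2.congr_fun fun m => ?_
  simp only [ContinuousLinearMap.apply_apply, smul_pow, smul_smul, map_smul, smul_eq_mul]
  ring

/-- Frequency powers applied to an amplitude. -/
theorem exists_pow_amplitude (h1 : CondE1 V) (h3 : CondE3 V)
    (hm : ∀ β : Branch V, AEMeasurable (bfreq β) (nu d)) (f : Branch V → Comp n → Lp ℂ 2 (nu d)) :
    ∃ g : ℕ → Branch V → Comp n → Lp ℂ 2 (nu d), ∀ m β a,
      g m β a =ᵐ[nu d] fun θ => (Complex.I * bfreq β θ) ^ m * f β a θ := by
  obtain ⟨C, hC⟩ := exists_bfreq_bound h1 h3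
  refine ⟨fun m β a => mulOp (fun θ => (Complex.I * bfreq β θ) ^ m)
    (((Complex.measurable_ofReal.comp_aemeasurable (hm β)).const_mul _).pow_const
      m).aestronglyMeasurable (C ^ m) (fun θ => ?_) (f β a), fun m β a => coeFn_mulOp _ _ _ _ _⟩
  rw [norm_pow, norm_mul, Complex.norm_I, one_mul, Complex.norm_real, Real.norm_eq_abs]
  gcongr
  exact hC β θ

theorem adjOp_sum (h1 : CondE1 V) {B : Type*} [Fintype B] (f : B → Comp n → Lp ℂ 2 (nu d))
    (a : Comp n) : adjOp h1 (fun b => ∑ β, f β b) a = ∑ β, adjOp h1 (f β) a := by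
  simp only [adjOp, map_sum]
  exact Finset.sum_comm

/-- The evolution of an amplitude: each branch is multiplied by its phase factor. -/
theorem Rep.comp_prop (h1 : CondE1 V) (h3 : CondE3 V)
    (hm : ∀ β : Branch V, AEMeasurable (bfreq β) (nu d)) {f : Branch V → Comp n → Lp ℂ 2 (nu d)}
    (hf : ∀ β, ∀ᵐ θ ∂nu d, IsMode V θ (bfreq β θ) fun a => f β a θ)
    {L : PhaseSpace d n α →L[ℝ] ℝ} (hL : Rep L fun a => ∑ β, f β a) (t : ℝ) :
    Rep (L.comp (prop V α t)) fun a => ∑ β, oscOp (bfreq β) (hm β) t (f β a) := by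
  obtain ⟨C, hC⟩ := exists_bfreq_bound h1 h3
  obtain ⟨g, hg⟩ := exists_pow_amplitude h1 h3 hm f
  have hmode : ∀ m β, ∀ᵐ θ ∂nu d, IsMode V θ (bfreq β θ) fun a => g m β a θ := by
    intro m β
    filter_upwards [hf β, ae_all_iff.2 (hg m β)] with θ h2 h4
    refine ⟨fun a => ?_, ?_⟩
    · change g m β (Sum.inl a) θ = Complex.I * bfreq β θ * g m β (Sum.inr a) θ
      rw [h4, h4]
      have h5 : f β (Sum.inl a) θ = Complex.I * bfreq β θ * f β (Sum.inr a) θ := h2.1 a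
      rw [h5]
      ring
    · have h5 : (fun a => g m β (Sum.inr a) θ) =
          ((Complex.I * bfreq β θ) ^ m) • fun a => f β (Sum.inr a) θ := by
        funext a
        rw [h4]
        rfl
      rw [h5, Matrix.mulVec_smul, h2.2, smul_comm]
  -- Powers of the generator act on modes through powers of `iλ`. The exponential series of the
  -- group then agrees with that of `e^{itλ}` in each Fourier coefficient.
  have hrep : ∀ m, Rep (L.comp (gen V α ^ m)) fun a => ∑ β, g m β a := by
    intro m
    induction m with
    | zero =>
      have e : ∀ β a, g 0 β a = f β a := fun β a => Lp.ext (by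
        filter_upwards [hg 0 β a] with θ h
        rw [h]
        simp)
      simp only [e, pow_zero]
      exact hL
    | succ m ih =>
      have e : ∀ β a, adjOp h1 (g m β) a = g (m + 1) β a := fun β a => Lp.ext (by
        filter_upwards [adjOp_mode h1 h3 (hmode m β) a, hg m β a, hg (m + 1) β a] with θ h2 h4 h5
        rw [h2, h4, h5]
        ring)
      have h2 := ih.comp_gen h1
      have e2 : (adjOp h1 fun a => ∑ β, g m β a) = fun a => ∑ β, g (m + 1) β a := by
        funext a
        rw [adjOp_sum]
        exact Finset.sum_congr rfl fun β _ => e β a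
      rw [e2] at h2
      rw [pow_succ]
      exact h2
  intro x a
  have hcoef : ∀ F : Branch V → Lp ℂ 2 (nu d), coef (∑ β, F β) x = ∑ β, coef (F β) x := fun F => by
    rw [map_sum]
    exact map_sum (evalSeq ℂ x) _ _
  have hs := (hasSum_prop (V := V) L t (pointP d n α x (EuclideanSpace.single a 1))).mapL
    Complex.ofRealCLM
  refine HasSum.unique ?_ hs
  rw [hcoef]
  have hβ : ∀ β, HasSum (fun m : ℕ => ((t ^ m / m.factorial : ℝ) : ℂ) * coef (g m β a) x)
      (coef (oscOp (bfreq β) (hm β) t (f β a)) x) := by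
    intro β
    have hu : Integrable (fun θ => ch (-x) θ * f β a θ) (nu d) := by
      refine ((Lp.memLp (f β a)).integrable (by norm_num)).bdd_mul (c := 1)
        (continuous_ch _).aestronglyMeasurable (Eventually.of_forall fun θ => (norm_ch _ _).le)
    have h2 := hasSum_integral_pow_osc (hC β) (hm β) hu t
    have e1 : coef (oscOp (bfreq β) (hm β) t (f β a)) x =
        ∫ θ, osc (bfreq β) t θ * (ch (-x) θ * f β a θ) ∂nu d := by
      rw [coef_apply]
      refine integral_congr_ae ?_
      filter_upwards [coeFn_oscOp (hm β) t (f β a)] with θ h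
      rw [h]
      ring
    rw [e1]
    refine h2.congr_fun fun m => ?_
    rw [coef_apply]
    congr 1
    refine integral_congr_ae ?_
    filter_upwards [hg m β a] with θ h
    rw [h]
    ring
  refine (hasSum_sum fun β (_ : β ∈ Finset.univ) => hβ β).congr_fun fun m => ?_
  rw [← Finset.mul_sum, ← hcoef, hrep m x a]
  simp

end Flow

/-! ### Fourier transforms of test sequences -/

section Amplitudes

variable {d n : ℕ} {α : ℝ} {V : Latt d → Matrix (Fin n) (Fin n) ℝ}

theorem summable_rapid_apply (Ψ : RapidSeq d n) (a : Comp n) : Summable fun x => |Ψ.1 x a| :=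
  Summable.of_nonneg_of_le (fun _ => abs_nonneg _)
    (fun x => by
      have := PiLp.norm_apply_le (Ψ.1 x) a
      rwa [Real.norm_eq_abs] at this) (summable_rapid Ψ)

/-- The Fourier transform of a rapidly decreasing sequence. -/
def ftest (Ψ : RapidSeq d n) (θ : Fin d → ℝ) (a : Comp n) : ℂ := symb (fun x => Ψ.1 x a) θ

theorem continuous_ftest (Ψ : RapidSeq d n) (a : Comp n) : Continuous fun θ => ftest Ψ θ a :=
  continuous_symb (summable_rapid_apply Ψ a)

theorem norm_ftest_le (Ψ : RapidSeq d n) (a : Comp n) (θ : Fin d → ℝ) :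
    ‖ftest Ψ θ a‖ ≤ ∑' x, |Ψ.1 x a| := norm_symb_le (summable_rapid_apply Ψ a) θ

theorem rep_pairL {F : Comp n → Lp ℂ 2 (nu d)} (Ψ : RapidSeq d n)
    (hF : ∀ a, F a =ᵐ[nu d] fun θ => ftest Ψ θ a) : Rep (pairL α Ψ) F := by
  intro x a
  -- The transform is viewed as a multiplier applied to the constant character, whose coefficient
  -- sequence is the unit mass at the origin; the convolution formula then returns `Ψ`.
  have e : F a = symbOp (fun x => Ψ.1 x a) (summable_rapid_apply Ψ a) (chBasis d 0) := by
    refine Lp.ext ?_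
    filter_upwards [hF a, coeFn_symbOp (summable_rapid_apply Ψ a) (chBasis d 0),
      coeFn_chBasis d 0] with θ h1 h2 h3
    rw [h1, h2, h3, ch_zero, mul_one]
    rfl
  have hs := summable_rapid_apply Ψ a
  rw [e, ← covOp_coef hs hs (fun _ _ => le_rfl), pairL_pointP]
  refine (hasSum_covOp_apply hs (fun _ _ => le_rfl) _ x).unique ?_
  have e2 : ((∑ a', (EuclideanSpace.single a 1 : Fib n) a' * Ψ.1 x a' : ℝ) : ℂ) = Ψ.1 x a := by
    simp
  rw [e2]
  refine (hasSum_ite_eq 0 (Ψ.1 x a : ℂ)).congr_fun fun y => ?_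
  have h1 : coef (chBasis d 0) y = (lp.single 2 (0 : Latt d) (1 : ℂ) : L2seq d ℂ) y := by
    rw [coef, HilbertBasis.repr_self]
  rw [h1]
  by_cases hy : y = 0
  · subst hy; simp
  · simp [hy]

end Amplitudes

/-! ### Decomposition of test functions into branch amplitudes -/

section BranchAmplitudes

variable {d n k : ℕ} {α : ℝ} {V : Latt d → Matrix (Fin n) (Fin n) ℝ}

/-- The projection of a test function to the branch `β`. -/
def modAdj (V : Latt d → Matrix (Fin n) (Fin n) ℝ) (β : Branch V) (θ : Fin d → ℝ) :
    Matrix (Comp n) (Comp n) ℂ :=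
  (1 / 2 : ℂ) • Matrix.fromBlocks (specProj V β.1 θ)
    ((Complex.I * bfreq β θ) • specProj V β.1 θ)
    ((-Complex.I * (bfreq β θ : ℂ)⁻¹) • specProj V β.1 θ) (specProj V β.1 θ)

theorem bfreq_ne_zero (h3 : CondE3 V) {θ : Fin d → ℝ} (hθ : θ ∈ goodSet V) (β : Branch V) :
    (bfreq β θ : ℂ) ≠ 0 := by
  rw [Complex.ofReal_ne_zero, bfreq]
  refine mul_ne_zero (fun h => ?_) (omega_pos h3 hθ _).ne'
  have := sg_sq β.2
  rw [h] at this
  norm_num at this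

theorem isMode_modAdj (h3 : CondE3 V) {θ : Fin d → ℝ} (hθ : θ ∈ goodSet V) (β : Branch V)
    (w : Comp n → ℂ) : IsMode V θ (bfreq β θ) ((modAdj V β θ).mulVec w) := by
  have h0 := bfreq_ne_zero h3 hθ β
  have hr : (fun a => (modAdj V β θ).mulVec w (Sum.inr a)) = (specProj V β.1 θ).mulVec
      ((1 / 2 : ℂ) • ((-Complex.I * (bfreq β θ : ℂ)⁻¹) • (fun a => w (Sum.inl a)) +
        fun a => w (Sum.inr a))) := by
    rw [modAdj, Matrix.smul_mulVec, Matrix.fromBlocks_mulVec]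
    funext a
    simp only [Pi.smul_apply, Sum.elim_inr, Matrix.mulVec_smul, Matrix.mulVec_add,
      Matrix.smul_mulVec]
    rfl
  have hl : (fun a => (modAdj V β θ).mulVec w (Sum.inl a)) = (specProj V β.1 θ).mulVec
      ((1 / 2 : ℂ) • ((fun a => w (Sum.inl a)) +
        (Complex.I * bfreq β θ) • fun a => w (Sum.inr a))) := by
    rw [modAdj, Matrix.smul_mulVec, Matrix.fromBlocks_mulVec]
    funext a
    simp only [Pi.smul_apply, Sum.elim_inl, Matrix.mulVec_smul, Matrix.mulVec_add,
      Matrix.smul_mulVec]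
    rfl
  refine ⟨fun a => ?_, ?_⟩
  · have e := congrFun hl a
    have e2 := congrFun hr a
    have e3 : (1 / 2 : ℂ) • ((fun a => w (Sum.inl a)) +
        (Complex.I * bfreq β θ) • fun a => w (Sum.inr a)) = (Complex.I * bfreq β θ) •
        ((1 / 2 : ℂ) • ((-Complex.I * (bfreq β θ : ℂ)⁻¹) • (fun a => w (Sum.inl a)) +
        fun a => w (Sum.inr a))) := by
      funext c
      simp only [Pi.smul_apply, Pi.add_apply, smul_eq_mul]
      field_simp
      linear_combination (w (Sum.inl c)) * Complex.I_sq
    rw [e3, Matrix.mulVec_smul] at e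
    exact e.trans (congrArg (fun z => Complex.I * (bfreq β θ : ℂ) * z) e2.symm)
  · rw [hr, Matrix.mulVec_mulVec, fourier_mul_specProj h3, Matrix.smul_mulVec]
    congr 1
    have := bfreq_sq β θ
    exact_mod_cast this.symm

/-- The off-diagonal blocks are odd in the sign of the frequency and cancel between the two branches
of a band; the diagonal ones add up to the resolution of the identity. -/
theorem sum_modAdj (hθ : θ ∈ goodSet V) : ∑ β : Branch V, modAdj V β θ = 1 := by
  have h : ∀ σ : Fin (numBands V), ∑ b : Bool, modAdj V (σ, b) θ =
      Matrix.fromBlocks (specProj V σ θ) 0 0 (specProj V σ θ) := by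
    intro σ
    rw [Fintype.sum_bool, modAdj, modAdj, ← smul_add, Matrix.fromBlocks_add,
      Matrix.fromBlocks_smul]
    congr 1
    · rw [← two_smul ℂ, smul_smul]; norm_num
    · rw [← add_smul]; simp [bfreq, sg]
    · rw [← add_smul]; simp [bfreq, sg, inv_neg]
    · rw [← two_smul ℂ, smul_smul]; norm_num
  rw [Fintype.sum_prod_type]
  simp only [h]
  have h2 := sum_specProj hθ.1
  rw [← Matrix.fromBlocks_one, ← h2]
  ext (a | a) (b | b) <;> simp [Matrix.sum_apply]

theorem aestronglyMeasurable_of_continuousOn_goodSet (h1 : CondE1 V) (h3 : CondE3 V)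
    (h6 : CondE6 V) {f : (Fin d → ℝ) → ℂ} (hf : ContinuousOn f (goodSet V)) :
    AEStronglyMeasurable f (nu d) := by
  have h := hf.aestronglyMeasurable (μ := nu d) (isOpen_goodSet h1 h3).measurableSet
  rwa [Measure.restrict_eq_self_of_ae_mem (ae_nu_of_ae (ae_mem_goodSet h1 h3 h6))] at h

open scoped Matrix.Norms.L2Operator in
-- Squaring produces `ω⁻² Π = V̂⁻¹ Π`, and entries of a projection are at most one. This converts
-- the integrability of `‖V̂⁻¹‖` in E6 into square integrability of `ω⁻¹ Π`, hence of the branch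
-- amplitudes.
theorem norm_omega_inv_smul_specProj_sq_le (h3 : CondE3 V) {θ : Fin d → ℝ} (hθ : θ ∈ goodSet V)
    (σ : Fin (numBands V)) (a b : Fin n) :
    ‖(omega V σ θ : ℂ)⁻¹ * specProj V σ θ a b‖ ^ 2 ≤ n * ‖(fourier V θ)⁻¹‖ := by
  have h1 := norm_specProj_apply_le (θ := θ) σ a b
  calc ‖(omega V σ θ : ℂ)⁻¹ * specProj V σ θ a b‖ ^ 2
      = ‖(omega V σ θ : ℂ)⁻¹ ^ 2 * specProj V σ θ a b‖ * ‖specProj V σ θ a b‖ := by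
        rw [norm_mul, norm_mul, norm_pow]; ring
    _ ≤ ‖(omega V σ θ : ℂ)⁻¹ ^ 2 * specProj V σ θ a b‖ :=
        mul_le_of_le_one_right (norm_nonneg _) h1
    _ = ‖((fourier V θ)⁻¹ * specProj V σ θ) a b‖ := by
        rw [fourier_inv_mul_specProj h3 hθ, Matrix.smul_apply, smul_eq_mul]
    _ ≤ ∑ c, ‖(fourier V θ)⁻¹ a c * specProj V σ θ c b‖ := by
        rw [Matrix.mul_apply]; exact norm_sum_le _ _
    _ ≤ ∑ _c : Fin n, ‖(fourier V θ)⁻¹‖ := by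
        refine Finset.sum_le_sum fun c _ => ?_
        rw [norm_mul]
        exact (mul_le_of_le_one_right (norm_nonneg _) (norm_specProj_apply_le σ c b)).trans
          (norm_entry_le_l2_opNorm _ a c)
    _ = n * ‖(fourier V θ)⁻¹‖ := by simp

theorem memLp_specProj_apply (h1 : CondE1 V) (h3 : CondE3 V) (h6 : CondE6 V)
    (σ : Fin (numBands V)) (a b : Fin n) : MemLp (fun θ => specProj V σ θ a b) 2 (nu d) :=
  MemLp.of_bound (aestronglyMeasurable_of_continuousOn_goodSet h1 h3 h6
    ((continuous_apply_apply a b).comp_continuousOn (continuousOn_specProj h1 h3 σ))) 1 (Eventually.of_forall fun _ => norm_specProj_apply_le σ a b)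

theorem continuousOn_ofReal_omega (h1 : CondE1 V) (h3 : CondE3 V) (σ : Fin (numBands V)) :
    ContinuousOn (fun θ => (omega V σ θ : ℂ)) (goodSet V) :=
  Complex.continuous_ofReal.comp_continuousOn (continuousOn_omega h1 h3 σ)

open scoped Matrix.Norms.L2Operator in
theorem memLp_omega_inv_mul_specProj (h1 : CondE1 V) (h3 : CondE3 V) (h6 : CondE6 V)
    (σ : Fin (numBands V)) (a b : Fin n) :
    MemLp (fun θ => (omega V σ θ : ℂ)⁻¹ * specProj V σ θ a b) 2 (nu d) := by
  have hm := (aestronglyMeasurable_of_continuousOn_goodSet h1 h3 h6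
    ((continuousOn_ofReal_omega h1 h3 σ).inv₀ fun θ hθ =>
      Complex.ofReal_ne_zero.2 (omega_pos h3 hθ σ).ne')).mul
    (memLp_specProj_apply h1 h3 h6 σ a b).1
  refine (memLp_two_iff_integrable_sq_norm hm).2 ?_
  refine ((integrable_nu_iff.2 h6.2).const_mul (n : ℝ)).mono' ((hm.norm).pow 2) ?_
  filter_upwards [ae_nu_of_ae (ae_mem_goodSet h1 h3 h6)] with θ hθ
  have := norm_omega_inv_smul_specProj_sq_le h3 hθ σ a b
  rw [Real.norm_eq_abs, abs_of_nonneg (by positivity)]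
  exact this

theorem memLp_modAdj (h1 : CondE1 V) (h3 : CondE3 V) (h6 : CondE6 V) (β : Branch V)
    (a b : Comp n) : MemLp (fun θ => modAdj V β θ a b) 2 (nu d) := by
  have hP := memLp_specProj_apply h1 h3 h6 β.1
  rcases a with a | a <;> rcases b with b | b
  · exact (hP a b).const_mul _
  · obtain ⟨C, hC⟩ := exists_bfreq_bound h1 h3
    have hm := aestronglyMeasurable_of_continuousOn_goodSet h1 h3 h6
      (continuousOn_const (c := Complex.I * sg β.2) |>.mul (continuousOn_ofReal_omega h1 h3 β.1))
    refine ((memLp_bdd_mul (C := C) hm (fun θ => ?_) (hP a b)).const_mul (1 / 2 : ℂ)).ae_eq ?_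
    · have := hC β θ
      rw [bfreq, abs_mul] at this
      simpa using this
    · refine Eventually.of_forall fun θ => ?_
      simp only [modAdj, Matrix.smul_apply, Matrix.fromBlocks_apply₁₂, smul_eq_mul, bfreq,
        Pi.mul_apply]
      push_cast
      ring
  · refine ((memLp_omega_inv_mul_specProj h1 h3 h6 β.1 a b).const_mul
      (1 / 2 * (-Complex.I * (sg β.2 : ℂ)⁻¹))).ae_eq (Eventually.of_forall fun θ => ?_)
    simp only [modAdj, Matrix.smul_apply, Matrix.fromBlocks_apply₂₁, smul_eq_mul, bfreq]
    push_cast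
    rw [mul_inv]
    ring
  · exact (hP a b).const_mul _

theorem memLp_modAdj_ftest (h1 : CondE1 V) (h3 : CondE3 V) (h6 : CondE6 V) (Ψ : RapidSeq d n)
    (β : Branch V) (a : Comp n) :
    MemLp (fun θ => (modAdj V β θ).mulVec (ftest Ψ θ) a) 2 (nu d) := by
  simp only [Matrix.mulVec, dotProduct]
  refine memLp_finsetSum _ fun b _ => ?_
  have h := memLp_bdd_mul (continuous_ftest Ψ b).aestronglyMeasurable (norm_ftest_le Ψ b)
    (memLp_modAdj h1 h3 h6 β a b)
  simpa only [mul_comm] using h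

namespace Setup

variable {μ₀ : Measure (PhaseSpace d n α)} {q : Corner d k → Latt d → Matrix (Comp n) (Comp n) ℝ}
  (S : Setup V μ₀ k q)

/-- The branch amplitudes of a rapidly decreasing sequence. -/
def amp (S : Setup V μ₀ k q) (Ψ : RapidSeq d n) (β : Branch V) (a : Comp n) : Lp ℂ 2 (nu d) :=
  (memLp_modAdj_ftest S.e1 S.e3 S.e6 Ψ β a).toLp

theorem coeFn_amp (Ψ : RapidSeq d n) (β : Branch V) (a : Comp n) :
    S.amp Ψ β a =ᵐ[nu d] fun θ => (modAdj V β θ).mulVec (ftest Ψ θ) a := MemLp.coeFn_toLp _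

theorem modal_amp (Ψ : RapidSeq d n) : Modal (S.amp Ψ) := by
  intro β
  filter_upwards [ae_all_iff.2 (S.coeFn_amp Ψ β), S.ae_goodSet] with θ h hg
  simp only [h]
  exact isMode_modAdj S.e3 hg β _

theorem rep_amp (Ψ : RapidSeq d n) : Rep (pairL α Ψ) fun a => ∑ β, S.amp Ψ β a := by
  refine rep_pairL Ψ fun a => ?_
  filter_upwards [Lp.coeFn_finsetSum Finset.univ fun β => S.amp Ψ β a,
    ae_all_iff.2 fun β => S.coeFn_amp Ψ β a, S.ae_goodSet] with θ h1 h2 hg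
  rw [h1, Finset.sum_apply]
  simp only [h2]
  have h3 := congrFun (congrArg (fun M => M.mulVec (ftest Ψ θ)) (sum_modAdj hg)) a
  rw [Matrix.one_mulVec, Matrix.sum_mulVec, Finset.sum_apply] at h3
  exact h3

theorem rep_evol (Ψ : RapidSeq d n) (t : ℝ) :
    Rep ((pairL α Ψ).comp (prop V α t)) (S.waves.evol (S.amp Ψ) t) :=
  (S.rep_amp Ψ).comp_prop S.e1 S.e3 S.waves.aem (S.modal_amp Ψ) t

end Setup

end BranchAmplitudes

/-! ### Additivity and mixed terms of the limit form -/

section Polarization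

variable {d : ℕ} {κ B N J : Type*} [Fintype κ] [Fintype B] [Fintype N] [Fintype J]

namespace WaveData

variable (D : WaveData d κ B N J)

theorem tendsto_limForm_evol_left
    (hne : ∀ β, ∀ᵐ θ ∂nu d, ∃ j, fderiv ℝ (D.ψ β) θ (Pi.single j 1) ≠ 0)
    (f g : B → κ → Lp ℂ 2 (nu d)) :
    Tendsto (fun t => D.limForm (fun β b => D.U β t (g β b)) f) atTop (𝓝 0) := by
  have h1 : ∀ β ν a b, Tendsto (fun t => inner ℂ (D.U β t (g β a))
      (D.R ν a b (D.P β ν (f β b)))) atTop (𝓝 (0 : ℂ)) := by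
    intro β ν a b
    have h2 := tendsto_inner_oscOp D.isOpen_W D.W_subset (D.aem β) (D.smooth β)
      (D.R ν a b (D.P β ν (f β b))) (g β a) (by
        filter_upwards [D.ae_W, hne β] with θ h1 h2 _ using ⟨h1, h2⟩)
    have h3 := (Complex.continuous_conj.tendsto 0).comp h2
    rw [map_zero] at h3
    exact h3.congr fun t => inner_conj_symm _ _
  have h3 := tendsto_finsetSum (Finset.univ : Finset B) fun β _ =>
    tendsto_finsetSum (Finset.univ : Finset N) fun ν _ =>
      tendsto_finsetSum (Finset.univ : Finset κ) fun a _ =>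
        tendsto_finsetSum (Finset.univ : Finset κ) fun b _ => h1 β ν a b
  simp only [Finset.sum_const_zero] at h3
  exact h3

theorem limForm_add_left (f f' g : B → κ → Lp ℂ 2 (nu d)) :
    D.limForm (fun β a => f β a + f' β a) g = D.limForm f g + D.limForm f' g := by
  simp only [limForm, inner_add_left, Finset.sum_add_distrib]

theorem limForm_add_right (f g g' : B → κ → Lp ℂ 2 (nu d)) :
    D.limForm f (fun β a => g β a + g' β a) = D.limForm f g + D.limForm f g' := by
  simp only [limForm, map_add, inner_add_right, Finset.sum_add_distrib]

end WaveData

end Polarization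

/-! ### Sign sums as indicators of velocity corners -/

section Signs

variable {d n k : ℕ}

theorem card_head (hkd : k ≤ d) : Fintype.card {j : Fin d // (j : ℕ) < k} = k := by
  have e : {j : Fin d // (j : ℕ) < k} ≃ Fin k :=
    ⟨fun j => ⟨j.1, j.2⟩, fun i => ⟨⟨i, i.2.trans_le hkd⟩, i.2⟩, fun _ => rfl, fun _ => rfl⟩
  rw [Fintype.card_congr e, Fintype.card_fin]

theorem prod_one_add_eq_sum_powersetCard {ι : Type*} [Fintype ι] [DecidableEq ι] (a : ι → ℝ) :
    ∏ j, (1 + a j) = 1 + (∑ m ∈ (Finset.Icc 1 (Fintype.card ι)).filter Even,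
        ∑ p ∈ Finset.powersetCard m Finset.univ, ∏ j ∈ p, a j) +
      ∑ m ∈ (Finset.Icc 1 (Fintype.card ι)).filter Odd,
        ∑ p ∈ Finset.powersetCard m Finset.univ, ∏ j ∈ p, a j := by
  rw [Finset.prod_one_add, Finset.sum_powerset, Finset.card_univ, Finset.sum_range_succ',
    Finset.powersetCard_zero, Finset.sum_singleton, Finset.prod_empty, add_comm _ (1 : ℝ), add_assoc]
  congr 1
  have h : (Finset.Icc 1 (Fintype.card ι)).filter Odd =
      (Finset.Icc 1 (Fintype.card ι)).filter fun m => ¬ Even m :=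
    Finset.filter_congr fun m _ => Nat.not_even_iff_odd.symm
  rw [h, Finset.sum_filter_add_sum_filter_not, Finset.range_eq_Ico, Finset.sum_Ico_add'
    (fun m => ∑ p ∈ Finset.powersetCard m Finset.univ, ∏ j ∈ p, a j)]
  rfl

theorem prod_one_sub_eq_sum_powersetCard {ι : Type*} [Fintype ι] [DecidableEq ι] (a : ι → ℝ) :
    ∏ j, (1 + -a j) = 1 + (∑ m ∈ (Finset.Icc 1 (Fintype.card ι)).filter Even,
        ∑ p ∈ Finset.powersetCard m Finset.univ, ∏ j ∈ p, a j) -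
      ∑ m ∈ (Finset.Icc 1 (Fintype.card ι)).filter Odd,
        ∑ p ∈ Finset.powersetCard m Finset.univ, ∏ j ∈ p, a j := by
  rw [prod_one_add_eq_sum_powersetCard, sub_eq_add_neg, ← Finset.sum_neg_distrib]
  congr 1
  · congr 1
    refine Finset.sum_congr rfl fun m hm => Finset.sum_congr rfl fun p hp => ?_
    rw [Finset.prod_neg, (Finset.mem_powersetCard.1 hp).2,
      (Finset.mem_filter.1 hm).2.neg_one_pow, one_mul]
  · refine Finset.sum_congr rfl fun m hm => ?_
    rw [← Finset.sum_neg_distrib]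
    refine Finset.sum_congr rfl fun p hp => ?_
    rw [Finset.prod_neg, (Finset.mem_powersetCard.1 hp).2,
      (Finset.mem_filter.1 hm).2.neg_one_pow, neg_one_mul]

variable {V : Latt d → Matrix (Fin n) (Fin n) ℝ}

open Classical in
/-- The indicator of the momenta for which the velocity of the branch `β` points to the
corner `𝐧`. -/
def cornerInd (nn : Corner d k) (β : Branch V) (θ : Fin d → ℝ) : ℝ :=
  if ∀ j, 0 < cornerSign nn j * (sg β.2 * dOmega V β.1 j θ) then 1 else 0

/-- Each factor is `2` or `0`, according to whether the `j`-th velocity component of the branch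
points into the corner. -/
theorem prod_one_add_sign (nn : Corner d k) (β : Branch V) {θ : Fin d → ℝ}
    (h0 : ∀ j, dOmega V β.1 j θ ≠ 0) :
    ∏ j : {j : Fin d // (j : ℕ) < k}, (1 + sg β.2 *
      (Real.sign (dOmega V β.1 j θ) * (-1) ^ (nn j : ℕ))) =
      2 ^ Fintype.card {j : Fin d // (j : ℕ) < k} * cornerInd nn β θ := by
  have key : ∀ j : {j : Fin d // (j : ℕ) < k}, 1 + sg β.2 *
      (Real.sign (dOmega V β.1 j θ) * (-1) ^ (nn j : ℕ)) =
      if 0 < cornerSign nn j * (sg β.2 * dOmega V β.1 j θ) then 2 else 0 := by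
    intro j
    have hc : ((-1 : ℝ)) ^ (nn j : ℕ) = cornerSign nn j := rfl
    rw [hc]
    have h1 : cornerSign nn j = 1 ∨ cornerSign nn j = -1 := by
      rcases cornerSign_eq nn j with ⟨_, h⟩ | ⟨_, h⟩
      · exact Or.inr h
      · exact Or.inl h
    have h2 : sg β.2 = 1 ∨ sg β.2 = -1 := by
      rcases β.2 with _ | _
      · exact Or.inr rfl
      · exact Or.inl rfl
    rcases lt_or_gt_of_ne (h0 j) with h | h
    · rw [Real.sign_of_neg h]
      rcases h1 with h1 | h1 <;> rcases h2 with h2 | h2 <;> rw [h1, h2] <;>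
        split_ifs <;> first | (exfalso; linarith) | norm_num
    · rw [Real.sign_of_pos h]
      rcases h1 with h1 | h1 <;> rcases h2 with h2 | h2 <;> rw [h1, h2] <;>
        split_ifs <;> first | (exfalso; linarith) | norm_num
  rw [Finset.prod_congr rfl fun j _ => key j, cornerInd]
  by_cases h : ∀ j, 0 < cornerSign nn j * (sg β.2 * dOmega V β.1 j θ)
  · rw [if_pos h, Finset.prod_congr rfl fun j _ => if_pos (h j)]
    simp
  · rw [if_neg h, mul_zero]
    push Not at h
    obtain ⟨j, hj⟩ := h
    exact Finset.prod_eq_zero (Finset.mem_univ j) (if_neg (not_lt.2 hj))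

/-- In the expansion of the product over subsets, reversing the sign of the branch preserves the
even terms and reverses the odd ones. The two sign sums are thus the half-sum and the
half-difference of the corner indicators of `ω_σ` and `-ω_σ`. -/
theorem one_add_Seven (hkd : k ≤ d) (nn : Corner d k) (σ : Fin (numBands V)) {θ : Fin d → ℝ}
    (h0 : ∀ j, dOmega V σ j θ ≠ 0) :
    1 / 2 ^ k * (1 + Seven V nn σ θ) =
      1 / 2 * (cornerInd nn (σ, true) θ + cornerInd nn (σ, false) θ) ∧
    1 / 2 ^ k * Sodd V nn σ θ =
      1 / 2 * (cornerInd nn (σ, true) θ - cornerInd nn (σ, false) θ) := by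
  have h1 := prod_one_add_sign nn (σ, true) h0
  have h2 := prod_one_add_sign nn (σ, false) h0
  simp only [sg_true, sg_false, one_mul, neg_one_mul] at h1 h2
  rw [prod_one_add_eq_sum_powersetCard, card_head hkd] at h1
  rw [prod_one_sub_eq_sum_powersetCard, card_head hkd] at h2
  change 1 + Seven V nn σ θ + Sodd V nn σ θ = _ at h1
  change 1 + Seven V nn σ θ - Sodd V nn σ θ = _ at h2
  have h3 : (2 : ℝ) ^ k ≠ 0 := by positivity
  constructor
  · field_simp
    linear_combination h1 + h2
  · field_simp
    linear_combination h1 - h2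

end Signs

/-! ### The limit symbol as a sum over branches and corners -/

section LimitSymbol

variable {d n k : ℕ} {V : Latt d → Matrix (Fin n) (Fin n) ℝ} {θ : Fin d → ℝ}
  {q : Corner d k → Latt d → Matrix (Comp n) (Comp n) ℝ}

theorem modAdj_eq (h3 : CondE3 V) (hθ : θ ∈ goodSet V) (β : Branch V) : modAdj V β θ =
    (1 / 2 : ℂ) • ((1 - (Complex.I * sg β.2) • matCstar V θ) * specProj2 V β.1 θ) := by
  have hs : ((sg β.2 : ℂ))⁻¹ = sg β.2 := by
    refine inv_eq_of_mul_eq_one_left ?_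
    exact_mod_cast sg_mul_self β.2
  rw [modAdj]
  congr 1
  rw [specProj2, matCstar, ← Matrix.fromBlocks_one, Matrix.fromBlocks_smul,
    sub_eq_add_neg, Matrix.fromBlocks_neg, Matrix.fromBlocks_add, Matrix.fromBlocks_multiply]
  congr 1
  · simp
  · simp only [Omega_mul_specProj, bfreq, Complex.ofReal_mul, Matrix.smul_mul,
      Matrix.mul_zero, zero_add, smul_neg, neg_neg, smul_zero, neg_zero, ← mul_assoc,
      mul_smul]
  · simp [Omega_inv_mul_specProj h3 hθ, bfreq, smul_smul, hs, mul_assoc,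
      mul_comm (omega V β.1 θ : ℂ)⁻¹]
  · simp

theorem conjTranspose_modAdj (h3 : CondE3 V) (hθ : θ ∈ goodSet V) (β : Branch V) :
    (modAdj V β θ).conjTranspose =
    (1 / 2 : ℂ) • (specProj2 V β.1 θ * (1 + (Complex.I * sg β.2) • matC V θ)) := by
  have hO : (Omega V θ).conjTranspose = Omega V θ := isSelfAdjoint_Omega
  rw [modAdj_eq h3 hθ]
  simp only [Matrix.conjTranspose_smul, Matrix.conjTranspose_mul, Matrix.conjTranspose_sub,
    Matrix.conjTranspose_one, specProj2, matCstar, matC, Matrix.fromBlocks_conjTranspose,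
    Matrix.conjTranspose_neg, Matrix.conjTranspose_nonsing_inv, hO,
    isHermitian_specProj β.1 |>.eq, Matrix.conjTranspose_zero]
  congr 1
  · simp
  · congr 1
    rw [sub_eq_add_neg, ← neg_smul]
    congr 2
    simp

/-- With `c = i sg` and `c² = -1`, the expansion of `(1 + cC) A (1 - cC^*)` separates into `2 L₁⁺(A)
+ 2c L₂⁻(A)`. This is where these two operators come from. -/
theorem modAdj_sandwich (h3 : CondE3 V) (hθ : θ ∈ goodSet V) (β : Branch V)
    (A : Matrix (Comp n) (Comp n) ℂ) :
    (modAdj V β θ).conjTranspose * A * modAdj V β θ =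
    (1 / 2 : ℂ) • (specProj2 V β.1 θ * (L1plus V A θ +
      (Complex.I * sg β.2) • L2minus V A θ) * specProj2 V β.1 θ) := by
  have hs : (Complex.I * sg β.2) * (Complex.I * sg β.2) = -1 := by
    have : ((sg β.2 : ℝ) : ℂ) * sg β.2 = 1 := by exact_mod_cast sg_mul_self β.2
    linear_combination Complex.I ^ 2 * this + Complex.I_sq
  rw [conjTranspose_modAdj h3 hθ, modAdj_eq h3 hθ, L1plus, L2minus]
  set c := Complex.I * (sg β.2 : ℂ)
  set P := specProj2 V β.1 θ
  have h1 : (1 + c • matC V θ) * A * (1 - c • matCstar V θ) =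
      (A + matC V θ * A * matCstar V θ) + c • (matC V θ * A - A * matCstar V θ) := by
    have e : c • (matC V θ * A) * (c • matCstar V θ) = -(matC V θ * A * matCstar V θ) := by
      rw [smul_mul_smul_comm, hs, neg_one_smul]
    rw [add_mul, one_mul, smul_mul_assoc, mul_sub, mul_one, add_mul, e, mul_smul_comm, smul_sub]
    abel
  have h2 : P * (1 + c • matC V θ) * A * ((1 - c • matCstar V θ) * P) =
      P * ((1 + c • matC V θ) * A * (1 - c • matCstar V θ)) * P := by
    simp only [mul_assoc]
  rw [smul_mul_assoc, smul_mul_smul_comm, h2, h1, smul_comm c (1 / 2 : ℂ), ← smul_add,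
    mul_smul_comm, smul_mul_assoc, smul_smul]

/-- The two branches of a band are combined: by `one_add_Seven` the half-sum of the indicators goes
with `L₁⁺` and the half-difference with `i L₂⁻`. This links the closed formula for the symbol to the
limit form produced by the dynamics. -/
theorem qInfHat_eq (hkd : k ≤ d) (h3 : CondE3 V) (hθ : θ ∈ goodSet V)
    (h0 : ∀ σ j, dOmega V σ j θ ≠ 0) :
    qInfHat V k q θ = ∑ β : Branch V, ∑ nn : Corner d k, (cornerInd nn β θ : ℂ) •
      ((modAdj V β θ).conjTranspose * fourier (q nn) θ * modAdj V β θ) := by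
  rw [Fintype.sum_prod_type, qInfHat]
  refine Finset.sum_congr rfl fun σ _ => ?_
  have h1 : Mplus V k q σ θ + Complex.I • Mminus V k q σ θ = ∑ nn : Corner d k,
      ((1 / 2 * (cornerInd nn (σ, true) θ + cornerInd nn (σ, false) θ) : ℂ) •
        L1plus V (fourier (q nn) θ) θ +
      (Complex.I * (1 / 2 * (cornerInd nn (σ, true) θ - cornerInd nn (σ, false) θ))) •
        L2minus V (fourier (q nn) θ) θ) := by
    rw [Mplus, Mminus, Finset.smul_sum, Finset.smul_sum, Finset.smul_sum,
      ← Finset.sum_add_distrib]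
    refine Finset.sum_congr rfl fun nn _ => ?_
    obtain ⟨e1, e2⟩ := one_add_Seven hkd nn σ (h0 σ)
    have e1' := congrArg (Complex.ofReal) e1
    have e2' := congrArg (Complex.ofReal) e2
    push_cast at e1' e2'
    rw [smul_smul, smul_smul, smul_smul, ← e1', ← e2', ← mul_assoc]
    push_cast
    rfl
  rw [h1, Finset.mul_sum, Finset.sum_mul, Finset.sum_comm]
  refine Finset.sum_congr rfl fun nn _ => ?_
  rw [Fintype.sum_bool, modAdj_sandwich h3 hθ, modAdj_sandwich h3 hθ]
  simp only [sg_true, sg_false, mul_add, add_mul, mul_smul_comm, smul_mul_assoc, smul_add,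
    smul_smul]
  push_cast
  module

end LimitSymbol

/-! ### The limit covariance as a Fourier integral -/

section LimitCovariance

variable {d n k : ℕ} {α : ℝ} {V : Latt d → Matrix (Fin n) (Fin n) ℝ}
  {μ₀ : Measure (PhaseSpace d n α)} {q : Corner d k → Latt d → Matrix (Comp n) (Comp n) ℝ}

/-- The unit vector at a site. -/
def unitSeq (x : Latt d) (a : Comp n) : RapidSeq d n := finSeq {x} fun _ => Pi.single a 1

theorem ftest_unitSeq (x : Latt d) (a c : Comp n) (θ : Fin d → ℝ) :
    ftest (unitSeq x a) θ c = if c = a then ch x θ else 0 := by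
  rw [ftest, symb, tsum_eq_single x]
  · simp only [unitSeq, finSeq, Finset.mem_singleton, if_true, Pi.single_apply]
    split_ifs <;> simp
  · intro y hy
    simp [unitSeq, finSeq, hy]

theorem conj_symb (r : Latt d → ℝ) (θ : Fin d → ℝ) :
    (starRingEnd ℂ) (symb r θ) = ∑' z, ch (-z) θ * (r z : ℂ) := by
  rw [symb, Complex.conj_tsum]
  refine tsum_congr fun z => ?_
  rw [map_mul, conj_ch, Complex.conj_ofReal]

namespace Setup

variable (S : Setup V μ₀ k q)

theorem ae_qInfHat_eq (S : Setup V μ₀ k q) (hkd : k ≤ d) :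
    ∀ᵐ θ ∂nu d, θ ∈ goodSet V ∧ qInfHat V k q θ = ∑ β : Branch V, ∑ nn : Corner d k,
      (cornerInd nn β θ : ℂ) •
        ((modAdj V β θ).conjTranspose * fourier (q nn) θ * modAdj V β θ) := by
  filter_upwards [S.ae_goodSet, ae_nu_of_ae (ae_all_iff.2 fun σ => ae_all_iff.2 fun j =>
    ae_dOmega_ne_zero S.e1 S.e3 S.e4 j σ)] with θ hg h0
  exact ⟨hg, qInfHat_eq hkd S.e3 hg fun σ j => h0 σ j hg⟩

theorem coeFn_P (β : Branch V) (nn : Corner d k) (g : Lp ℂ 2 (nu d)) :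
    S.waves.P β nn g =ᵐ[nu d] fun θ => (cornerInd nn β θ : ℂ) * g θ := by
  classical
  filter_upwards [coeFn_indOp (isOpen_velSet S.waves.isOpen_W (S.waves.smooth β) S.waves.e
    (S.waves.s nn)).measurableSet g, S.waves.ae_W] with θ h1 hW
  refine h1.trans ?_
  have e : θ ∈ velSet S.waves.W (S.waves.ψ β) S.waves.e (S.waves.s nn) ↔
      ∀ j, 0 < cornerSign nn j * (sg β.2 * dOmega V β.1 j θ) := by
    rw [velSet, Set.mem_ofPred_eq, and_iff_right hW]
    refine forall_congr' fun j => ?_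
    rw [← fderiv_bfreq S.e1 S.e3 hW.1 β j]
    rfl
  simp only [e, cornerInd]
  split_ifs <;> simp

theorem ae_sum_amp (hkd : k ≤ d) (Ψ Φ : RapidSeq d n) : ∀ᵐ θ ∂nu d,
    ∑ β, ∑ nn, ∑ a, ∑ b, inner ℂ (S.amp Ψ β a θ)
      (S.waves.R nn a b (S.waves.P β nn (S.amp Φ β b)) θ) =
    ∑ a, ∑ b, (starRingEnd ℂ) (ftest Ψ θ a) * qInfHat V k q θ a b * ftest Φ θ b := by
  filter_upwards [S.ae_qInfHat_eq hkd, ae_all_iff.2 fun β => ae_all_iff.2 fun a => S.coeFn_amp Ψ β a,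
    ae_all_iff.2 fun β => ae_all_iff.2 fun a => S.coeFn_amp Φ β a,
    ae_all_iff.2 fun β => ae_all_iff.2 fun nn => ae_all_iff.2 fun b =>
      S.coeFn_P β nn (S.amp Φ β b),
    ae_all_iff.2 fun β => ae_all_iff.2 fun nn => ae_all_iff.2 fun a => ae_all_iff.2 fun b =>
      coeFn_symbOp (S.waves.summable_r nn a b) (S.waves.P β nn (S.amp Φ β b))]
    with θ ⟨hg, hq⟩ h1 h2 h3 h4
  have h5 : ∑ a, ∑ b, (starRingEnd ℂ) (ftest Ψ θ a) * qInfHat V k q θ a b * ftest Φ θ b =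
      dotProduct (star (ftest Ψ θ)) ((qInfHat V k q θ).mulVec (ftest Φ θ)) := by
    simp only [dotProduct, Matrix.mulVec, Finset.mul_sum, mul_assoc]
    rfl
  rw [h5, hq]
  simp only [Matrix.sum_mulVec, dotProduct_sum, Matrix.smul_mulVec, dotProduct_smul]
  refine Finset.sum_congr rfl fun β _ => Finset.sum_congr rfl fun nn _ => ?_
  rw [← Matrix.mulVec_mulVec, ← Matrix.mulVec_mulVec, Matrix.dotProduct_mulVec,
    ← Matrix.star_mulVec]
  have h6 : ∀ (w : Comp n → ℂ) a, (fourier (q nn) θ).mulVec w a =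
    ∑ b, fourier (q nn) θ a b * w b := fun _ _ => rfl
  simp only [dotProduct, h6, Finset.mul_sum, Finset.smul_sum]
  refine Finset.sum_congr rfl fun a _ => Finset.sum_congr rfl fun b _ => ?_
  have e4 : S.waves.R nn a b (S.waves.P β nn (S.amp Φ β b)) θ =
      symb (S.waves.r nn a b) θ * S.waves.P β nn (S.amp Φ β b) θ := h4 β nn a b
  rw [e4, h3, h1, h2, RCLike.inner_apply, Pi.star_apply, fourier_apply, smul_eq_mul]
  change symb (fun z => q nn z a b) θ * _ * _ = _ * (star _ * _)
  simp only [RCLike.star_def]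
  ring

theorem integrable_inner_amp (Ψ Φ : RapidSeq d n) : Integrable (fun θ =>
    ∑ β, ∑ nn, ∑ a, ∑ b, inner ℂ (S.amp Ψ β a θ)
      (S.waves.R nn a b (S.waves.P β nn (S.amp Φ β b)) θ)) (nu d) :=
  integrable_finsetSum _ fun _ _ => integrable_finsetSum _ fun _ _ =>
    integrable_finsetSum _ fun _ _ => integrable_finsetSum _ fun _ _ => L2.integrable_inner _ _

theorem limForm_amp (hkd : k ≤ d) (Ψ Φ : RapidSeq d n) :
    S.waves.limForm (S.amp Ψ) (S.amp Φ) = ∫ θ, ∑ a, ∑ b,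
      (starRingEnd ℂ) (ftest Ψ θ a) * qInfHat V k q θ a b * ftest Φ θ b ∂nu d := by
  rw [← integral_congr_ae (S.ae_sum_amp hkd Ψ Φ)]
  rw [integral_finsetSum _ fun _ _ => integrable_finsetSum _ fun _ _ =>
    integrable_finsetSum _ fun _ _ => integrable_finsetSum _ fun _ _ => L2.integrable_inner _ _]
  refine Finset.sum_congr rfl fun β _ => ?_
  rw [integral_finsetSum _ fun _ _ =>
    integrable_finsetSum _ fun _ _ => integrable_finsetSum _ fun _ _ => L2.integrable_inner _ _]
  refine Finset.sum_congr rfl fun nn _ => ?_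
  rw [← sum_sum_integral fun _ _ => L2.integrable_inner _ _]
  rfl

/-- Point masses at the origin have constant transforms, so testing with two of them isolates a
single entry of the symbol in an integrand known to be integrable as a sum of inner products of `L²`
functions. -/
theorem integrable_qInfHat (S : Setup V μ₀ k q) (hkd : k ≤ d) (a b : Comp n) :
    Integrable (fun θ => qInfHat V k q θ a b) (nu d) := by
  refine (S.integrable_inner_amp (unitSeq 0 a)
    (unitSeq 0 b)).congr ?_
  filter_upwards [S.ae_sum_amp hkd (unitSeq 0 a)
    (unitSeq 0 b)] with θ h
  rw [h]
  simp [ftest_unitSeq, ch_zero]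

/-- Fubini, for the absolutely convergent series defining the transform of `Ψ` against the
integrable symbol. -/
theorem hasSum_QInfForm_entry (S : Setup V μ₀ k q) (hkd : k ≤ d) (Ψ : RapidSeq d n) (a b : Comp n) :
    HasSum (fun p : Latt d × Latt d =>
      qInf V k q (p.1 - p.2) a b * (Ψ.1 p.1 a : ℂ) * (Ψ.1 p.2 b : ℂ))
      (∫ θ, (starRingEnd ℂ) (ftest Ψ θ a) * qInfHat V k q θ a b * ftest Ψ θ b ∂nu d) := by
  have hq := S.integrable_qInfHat hkd a b
  have ha := summable_rapid_apply Ψ a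
  have hb := summable_rapid_apply Ψ b
  set F : Latt d × Latt d → (Fin d → ℝ) → ℂ := fun p θ =>
    (ch (-p.1) θ * (Ψ.1 p.1 a : ℂ)) * qInfHat V k q θ a b * (ch p.2 θ * (Ψ.1 p.2 b : ℂ)) with hF
  have hFe : ∀ p θ, F p θ = ((Ψ.1 p.1 a : ℂ) * (Ψ.1 p.2 b : ℂ)) *
      (ch (-(p.1 - p.2)) θ * qInfHat V k q θ a b) := fun p θ => by
    rw [hF, neg_sub, sub_eq_neg_add, ch_add]
    ring
  have hci : ∀ z : Latt d, Integrable (fun θ => ch z θ * qInfHat V k q θ a b) (nu d) := fun z =>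
    hq.bdd_mul (c := 1) (continuous_ch _).aestronglyMeasurable
      (Eventually.of_forall fun θ => (norm_ch _ _).le)
  have hFi : ∀ p, Integrable (F p) (nu d) := fun p => by
    simp only [funext (hFe p)]
    exact (hci _).const_mul _
  have hn : ∀ p θ, ‖F p θ‖ = |Ψ.1 p.1 a| * |Ψ.1 p.2 b| * ‖qInfHat V k q θ a b‖ := fun p θ => by
    rw [hFe, norm_mul, norm_mul, norm_mul, norm_ch, one_mul, Complex.norm_real, Complex.norm_real,
      Real.norm_eq_abs, Real.norm_eq_abs]
  have hs : Summable fun p => ∫ θ, ‖F p θ‖ ∂nu d := by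
    simp only [hn, integral_const_mul]
    exact (ha.mul_of_nonneg hb (fun _ => abs_nonneg _) (fun _ => abs_nonneg _)).mul_right _
  have h := hasSum_integral_of_summable_integral_norm hFi hs
  have e : ∀ θ, ∑' p, F p θ =
      (starRingEnd ℂ) (ftest Ψ θ a) * qInfHat V k q θ a b * ftest Ψ θ b := by
    intro θ
    have h1 : Summable fun x => ‖ch (-x) θ * (Ψ.1 x a : ℂ)‖ := by
      refine ha.congr fun x => ?_
      rw [norm_mul, norm_ch, one_mul, Complex.norm_real, Real.norm_eq_abs]
    have h2 : Summable fun x => ‖ch x θ * (Ψ.1 x b : ℂ)‖ := by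
      refine hb.congr fun x => ?_
      rw [norm_mul, norm_ch, one_mul, Complex.norm_real, Real.norm_eq_abs]
    rw [ftest, ftest, conj_symb, symb, mul_right_comm, tsum_mul_tsum_of_summable_norm h1 h2,
      ← tsum_mul_right]
    exact tsum_congr fun p => mul_right_comm _ _ _
  simp only [e] at h
  refine h.congr_fun fun p => ?_
  simp only [hFe, integral_const_mul]
  rw [integral_nu, qInf, Matrix.of_apply]
  have e2 : ∀ θ, Complex.exp (-Complex.I * (dotZ (p.1 - p.2) θ : ℂ)) = ch (-(p.1 - p.2)) θ := by
    intro θ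
    rw [ch, dotZ_neg, Complex.ofReal_neg, mul_neg, neg_mul]
  simp only [e2]
  ring

theorem QInfForm_eq (hkd : k ≤ d) (Ψ : RapidSeq d n) :
    QInfForm V k q Ψ = S.waves.limForm (S.amp Ψ) (S.amp Ψ) := by
  have h1 : ∀ a b, Integrable (fun θ =>
      (starRingEnd ℂ) (ftest Ψ θ a) * qInfHat V k q θ a b * ftest Ψ θ b) (nu d) := by
    intro a b
    refine Integrable.mul_bdd (c := ∑' x, |Ψ.1 x b|) ?_
      (continuous_ftest Ψ b).aestronglyMeasurable (Eventually.of_forall (norm_ftest_le Ψ b))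
    refine (S.integrable_qInfHat hkd a b).bdd_mul (c := ∑' x, |Ψ.1 x a|)
      (Complex.continuous_conj.comp (continuous_ftest Ψ a)).aestronglyMeasurable
      (Eventually.of_forall fun θ => ?_)
    rw [RCLike.norm_conj]
    exact norm_ftest_le Ψ a θ
  rw [S.limForm_amp hkd, ← sum_sum_integral h1]
  exact (hasSum_sum fun a _ => hasSum_sum fun b _ => S.hasSum_QInfForm_entry hkd Ψ a b).tsum_eq

end Setup

end LimitCovariance

open ProbabilityTheory

/-! ### Truncation to finite sets of sites -/

section Truncation

variable {d : ℕ}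

/-- Restriction of a sequence to a finite set. -/
def trunc (S : Finset (Latt d)) (u : L2seq d ℂ) : L2seq d ℂ := ∑ x ∈ S, lp.single 2 x (u x)

theorem tendsto_trunc (u : L2seq d ℂ) : Tendsto (fun S => trunc S u) atTop (𝓝 u) :=
  lp.hasSum_single (by norm_num) u

theorem trunc_apply (S : Finset (Latt d)) (u : L2seq d ℂ) (y : Latt d) [Decidable (y ∈ S)] :
    trunc S u y = if y ∈ S then u y else 0 := by
  have h : trunc S u y = ∑ x ∈ S, (lp.single 2 x (u x) : L2seq d ℂ) y := by
    rw [trunc]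
    exact map_sum (evalSeq ℂ y) _ _
  rw [h]
  simp only [lp.single_apply, Pi.single_apply]
  simp

theorem covOp_trunc {K : Latt d → Latt d → ℝ} {k : Latt d → ℝ} (hk : Summable k)
    (hK : ∀ x y, |K x y| ≤ k (x - y)) (S : Finset (Latt d)) (u : L2seq d ℂ) (x : Latt d) :
    covOp K k hK (trunc S u) x = ∑ y ∈ S, (K x y : ℂ) * u y := by
  classical
  refine (hasSum_covOp_apply hk hK _ x).unique ?_
  have h : HasSum (fun y => (K x y : ℂ) * trunc S u y) (∑ y ∈ S, (K x y : ℂ) * trunc S u y) :=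
    hasSum_sum_of_ne_finset_zero fun y hy => by rw [trunc_apply, if_neg hy, mul_zero]
  rwa [Finset.sum_congr rfl fun y hy => by rw [trunc_apply, if_pos hy]] at h

theorem inner_trunc_covOp_trunc {K : Latt d → Latt d → ℝ} {k : Latt d → ℝ} (hk : Summable k)
    (hK : ∀ x y, |K x y| ≤ k (x - y)) (S : Finset (Latt d)) {u v : L2seq d ℂ} {f g : Latt d → ℝ}
    (hu : ∀ x, u x = f x) (hv : ∀ x, v x = g x) :
    inner ℂ (trunc S u) (covOp K k hK (trunc S v)) =
      ((∑ x ∈ S, ∑ y ∈ S, K x y * f x * g y : ℝ) : ℂ) := by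
  rw [trunc, sum_inner]
  push_cast
  refine Finset.sum_congr rfl fun x _ => ?_
  rw [lp.inner_single_left, RCLike.inner_apply, covOp_trunc hk, Finset.sum_mul]
  refine Finset.sum_congr rfl fun y _ => ?_
  rw [hu, hv, Complex.conj_ofReal]
  ring

end Truncation

/-! ### One-dimensional Gaussian laws -/

section GaussianLaw

variable {Ω : Type*} [MeasurableSpace Ω] {μ : Measure Ω}

theorem map_eq_gaussianReal [IsProbabilityMeasure μ] {Z : Ω → ℝ} (hZ : Measurable Z) {v : NNReal}
    (h : ∀ s : ℝ, ∫ ω, Complex.exp (Complex.I * ((s * Z ω : ℝ) : ℂ)) ∂μ =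
      Complex.exp (-(((v * s ^ 2 : ℝ) : ℂ)) / 2)) : μ.map Z = gaussianReal 0 v := by
  have := Measure.isProbabilityMeasure_map (μ := μ) hZ.aemeasurable
  refine Measure.ext_of_charFun (funext fun s => ?_)
  rw [charFun_gaussianReal, charFun_apply_real, integral_map hZ.aemeasurable (by fun_prop)]
  have e : ∀ ω, Complex.exp (s * Z ω * Complex.I) =
      Complex.exp (Complex.I * ((s * Z ω : ℝ) : ℂ)) := fun ω => by
    push_cast
    ring_nf
  simp only [e, h]
  push_cast
  ring_nf

theorem integral_sq_of_map_eq_gaussianReal {Z : Ω → ℝ} (hZ : Measurable Z) {v : NNReal}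
    (h : μ.map Z = gaussianReal 0 v) : Integrable (fun ω => Z ω ^ 2) μ ∧ ∫ ω, Z ω ^ 2 ∂μ = v := by
  have hm : AEStronglyMeasurable (fun x : ℝ => x ^ 2) (μ.map Z) := by fun_prop
  have h1 : Integrable (fun x : ℝ => x ^ 2) (μ.map Z) := by
    rw [h]
    exact (memLp_id_gaussianReal (μ := 0) (v := v) 2).integrable_sq
  refine ⟨(integrable_map_measure hm hZ.aemeasurable).1 h1, ?_⟩
  have h2 : ∫ ω, Z ω ^ 2 ∂μ = ∫ x, x ^ 2 ∂(μ.map Z) := (integral_map hZ.aemeasurable hm).symm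
  rw [h2, h]
  have h3 := variance_id_gaussianReal (μ := 0) (v := v)
  rw [variance_eq_integral (by fun_prop)] at h3
  simpa [integral_id_gaussianReal] using h3

end GaussianLaw

/-! ### Characteristic functionals of continuous linear functionals -/

section Characteristic

variable {d n : ℕ} {α : ℝ}

theorem continuous_exp_mul (L : PhaseSpace d n α →L[ℝ] ℝ) :
    Continuous fun Y => Complex.exp (Complex.I * (L Y : ℂ)) := by fun_prop

theorem norm_exp_mul (r : ℝ) : ‖Complex.exp (Complex.I * (r : ℂ))‖ = 1 := by
  rw [mul_comm, Complex.norm_exp_ofReal_mul_I]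

/-- The characteristic functional of a continuous linear functional is determined by the values on
test sequences. -/
theorem tendsto_integral_exp_finSeq (μ : Measure (PhaseSpace d n α)) [IsFiniteMeasure μ]
    (L : PhaseSpace d n α →L[ℝ] ℝ) :
    Tendsto (fun A : Finset (Latt d) => ∫ Y, Complex.exp (Complex.I *
        (pairL α (finSeq A fun x a => L (pointP d n α x (EuclideanSpace.single a 1))) Y : ℂ)) ∂μ)
        atTop (𝓝 (∫ Y, Complex.exp (Complex.I * (L Y : ℂ)) ∂μ)) := by
  refine tendsto_integral_filter_of_dominated_convergence (fun _ => 1)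
    (Eventually.of_forall fun A => (continuous_exp_mul _).aestronglyMeasurable)
    (Eventually.of_forall fun A => Eventually.of_forall fun Y => (norm_exp_mul _).le)
    (integrable_const _) (Eventually.of_forall fun Y => ?_)
  have h3 := hasSum_dual L Y
  have h4 : Continuous fun r : ℝ => Complex.exp (Complex.I * (r : ℂ)) := by fun_prop
  refine ((h4.tendsto _).comp h3).congr fun A => ?_
  simp only [Function.comp_apply, pairL_finSeq]

end Characteristic

/-! ### The initial measure -/

section GaussianInitial

variable {d n k : ℕ} {α : ℝ} {V : Latt d → Matrix (Fin n) (Fin n) ℝ}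
  {μ₀ : Measure (PhaseSpace d n α)} {q : Corner d k → Latt d → Matrix (Comp n) (Comp n) ℝ}

theorem pairL_smul (s : ℝ) (Ψ : RapidSeq d n) (Y : PhaseSpace d n α) :
    pairL α (s • Ψ) Y = s * pairL α Ψ Y := by
  refine (hasSum_pairL _ Y).unique (((hasSum_pairL Ψ Y).mul_left s).congr_fun fun x => ?_)
  rw [Finset.mul_sum]
  refine Finset.sum_congr rfl fun a _ => ?_
  change Y x a * (s * Ψ.1 x a) = _
  ring

/-- Along the ray `s • Ψ` the functional has the characteristic function of a centred normal law of
variance `Q Ψ`. The abstract form `Q` can therefore be replaced by the second moment. -/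
theorem integral_exp_pairL (hP : IsProbabilityMeasure μ₀) (hG : IsGaussianMeasure μ₀)
    (Ψ : RapidSeq d n) : Integrable (fun Y => pairL α Ψ Y ^ 2) μ₀ ∧
      ∫ Y, Complex.exp (Complex.I * (pairL α Ψ Y : ℂ)) ∂μ₀ =
      Complex.exp (-((∫ Y, pairL α Ψ Y ^ 2 ∂μ₀ : ℝ) : ℂ) / 2) := by
  obtain ⟨Q, hQ, hQ2⟩ := hG
  have h : ∀ Φ : RapidSeq d n, ∫ Y, Complex.exp (Complex.I * (pairL α Φ Y : ℂ)) ∂μ₀ =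
      Complex.exp (-((Q Φ : ℝ) : ℂ) / 2) := fun Φ => by
    rw [← hQ2 Φ, charFunctional]
    simp only [pairing_eq]
  have hlaw : μ₀.map (pairL α Ψ) = gaussianReal 0 ⟨Q Ψ, hQ Ψ⟩ := by
    refine map_eq_gaussianReal (pairL α Ψ).continuous.measurable fun s => ?_
    simp only [← pairL_smul, h, QuadraticMap.map_smul]
    congr 4
    change s * s * Q Ψ = Q Ψ * s ^ 2
    ring
  obtain ⟨h1, h2⟩ := integral_sq_of_map_eq_gaussianReal (pairL α Ψ).continuous.measurable hlaw
  refine ⟨h1, ?_⟩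
  rw [h2, h]
  rfl

theorem integral_pairL_finSeq_sq (h2 : FiniteSecondMoments μ₀) (S : Finset (Latt d))
    (l : Latt d → Comp n → ℝ) : ∫ Y, pairL α (finSeq S l) Y ^ 2 ∂μ₀ =
      ∑ a, ∑ b, ∑ x ∈ S, ∑ y ∈ S, cov μ₀ x y a b * l x a * l y b := by
  have e : ∀ Y : PhaseSpace d n α, pairL α (finSeq S l) Y ^ 2 =
      ∑ a, ∑ b, ∑ x ∈ S, ∑ y ∈ S, (Y x a * Y y b) * (l x a * l y b) := fun Y => by
    rw [pairL_finSeq, Finset.sum_comm, sq, Finset.sum_mul_sum]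
    refine Finset.sum_congr rfl fun a _ => Finset.sum_congr rfl fun b _ => ?_
    rw [Finset.sum_mul_sum]
    exact Finset.sum_congr rfl fun x _ => Finset.sum_congr rfl fun y _ => by ring
  have hi : ∀ x y a b, Integrable (fun Y : PhaseSpace d n α => (Y x a * Y y b) *
      (l x a * l y b)) μ₀ := fun x y a b => ((h2 x a).integrable_mul (h2 y b)).mul_const _
  simp only [e]
  rw [integral_finsetSum _ fun a _ => integrable_finsetSum _ fun b _ => integrable_finsetSum _
    fun x _ => integrable_finsetSum _ fun y _ => hi x y a b]
  refine Finset.sum_congr rfl fun a _ => ?_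
  rw [integral_finsetSum _ fun b _ => integrable_finsetSum _
    fun x _ => integrable_finsetSum _ fun y _ => hi x y a b]
  refine Finset.sum_congr rfl fun b _ => ?_
  rw [integral_finsetSum _ fun x _ => integrable_finsetSum _ fun y _ => hi x y a b]
  refine Finset.sum_congr rfl fun x _ => ?_
  rw [integral_finsetSum _ fun y _ => hi x y a b]
  refine Finset.sum_congr rfl fun y _ => ?_
  rw [integral_mul_const, mul_assoc]
  rfl

namespace Setup

variable (S : Setup V μ₀ k q)

theorem tendsto_integral_pairL_finSeq (S : Setup V μ₀ k q) {F : Comp n → Lp ℂ 2 (nu d)}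
    {l : Latt d → Comp n → ℝ} (hF : ∀ x a, coef (F a) x = l x a) :
    Tendsto (fun A : Finset (Latt d) => ((∫ Y, pairL α (finSeq A l) Y ^ 2 ∂μ₀ : ℝ) : ℂ)) atTop
      (𝓝 (S.waves.form F)) := by
  have h : Tendsto (fun A : Finset (Latt d) => ∑ a, ∑ b, inner ℂ (trunc A (coef (F a)))
      (S.waves.T a b (trunc A (coef (F b))))) atTop (𝓝 (S.waves.form F)) :=
    tendsto_finsetSum _ fun a _ => tendsto_finsetSum _ fun b _ =>
      (tendsto_trunc _).inner (((S.waves.T a b).continuous.tendsto _).comp (tendsto_trunc _))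
  refine h.congr fun A => ?_
  rw [integral_pairL_finSeq_sq S.s2.1]
  push_cast
  refine Finset.sum_congr rfl fun a _ => Finset.sum_congr rfl fun b _ => ?_
  have := inner_trunc_covOp_trunc S.waves.summable_dom (S.waves.K_le a b) A
    (fun x => hF x a) (fun x => hF x b)
  push_cast at this
  exact this

/-- The characteristic functional of the initial measure. -/
theorem integral_exp_of_rep (S : Setup V μ₀ k q) (hP : IsProbabilityMeasure μ₀)
    (hG : IsGaussianMeasure μ₀) {F : Comp n → Lp ℂ 2 (nu d)} {L : PhaseSpace d n α →L[ℝ] ℝ}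
    (hL : Rep L F) : (∃ v : NNReal, S.waves.form F = ((v : ℝ) : ℂ)) ∧
      ∫ Y, Complex.exp (Complex.I * (L Y : ℂ)) ∂μ₀ = Complex.exp (-S.waves.form F / 2) := by
  have h1 := S.tendsto_integral_pairL_finSeq hL
  constructor
  -- The form is a limit of second moments, hence real and nonnegative.
  · have hre := (Complex.continuous_re.tendsto _).comp h1
    have him := (Complex.continuous_im.tendsto _).comp h1
    simp only [Function.comp_def, Complex.ofReal_re, Complex.ofReal_im] at hre him
    have h0 : 0 ≤ (S.waves.form F).re :=
      ge_of_tendsto' hre fun A => integral_nonneg fun Y => sq_nonneg _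
    refine ⟨⟨_, h0⟩, Complex.ext rfl ?_⟩
    rw [Complex.ofReal_im]
    exact tendsto_nhds_unique him tendsto_const_nhds
  · refine tendsto_nhds_unique (tendsto_integral_exp_finSeq μ₀ L) ?_
    have h3 : Continuous fun z : ℂ => Complex.exp (-z / 2) := by fun_prop
    exact ((h3.tendsto _).comp h1).congr fun A => (integral_exp_pairL hP hG _).2.symm

end Setup

end GaussianInitial

/-! ### Compact embedding of weighted spaces and tightness -/

section CompactEmbedding

variable {d n : ℕ} {α α' : ℝ}

theorem tendsto_bracket_rpow_cofinite {β : ℝ} (hβ : β < 0) :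
    Tendsto (fun x : Latt d => bracket x ^ β) cofinite (𝓝 0) := by
  have h := (summable_bracket_rpow (d := d) (β := -(d + 1 : ℝ)) (by linarith)).tendsto_cofinite_zero
  have hp : 0 < -β / (d + 1 : ℝ) := by
    have : 0 < -β := by linarith
    positivity
  have h2 := h.rpow_const (p := -β / (d + 1 : ℝ)) (Or.inr hp.le)
  rw [Real.zero_rpow hp.ne'] at h2
  refine h2.congr fun x => ?_
  rw [← Real.rpow_mul (bracket_pos x).le]
  congr 1
  have : (d + 1 : ℝ) ≠ 0 := by positivity
  field_simp

theorem norm_bracket_rpow_smul_id_le (h : α ≤ α') (x : Latt d) :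
    ‖(bracket x ^ (α - α')) • ContinuousLinearMap.id ℝ (Fib n)‖ ≤ 1 := by
  refine ContinuousLinearMap.opNorm_le_bound _ zero_le_one fun v => ?_
  rw [_root_.smul_apply, ContinuousLinearMap.id_apply, norm_smul, Real.norm_eq_abs,
    abs_of_nonneg (Real.rpow_nonneg (bracket_pos x).le _)]
  gcongr
  exact Real.rpow_le_one_of_one_le_of_nonpos (one_le_bracket x) (by linarith)

/-- The embedding of the space with the weight `⟨x⟩^α'` into `ℋ_α`. -/
def embedOp (n : ℕ) (h : α ≤ α') : L2seq d (Fib n) →L[ℝ] PhaseSpace d n α :=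
  (weightEquiv d n α).symm.toContinuousLinearEquiv.toContinuousLinearMap.comp
    (lpShift 0 (fun x => (bracket x ^ (α - α')) • ContinuousLinearMap.id ℝ (Fib n)) 1
      (norm_bracket_rpow_smul_id_le h))

theorem embedOp_apply (h : α ≤ α') (u : L2seq d (Fib n)) (x : Latt d) :
    embedOp n h u x = bracket x ^ (-α') • u x := by
  have e : embedOp n h u x = bracket x ^ (-α) • (bracket x ^ (α - α')) • u (x - 0) :=
    weightEquiv_symm_apply _ x
  rw [e, sub_zero, smul_smul, ← Real.rpow_add (bracket_pos x)]
  congr 2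
  ring

/-- The finite rank truncations of `embedOp`. -/
def embedFin (n : ℕ) (α α' : ℝ) (A : Finset (Latt d)) : L2seq d (Fib n) →L[ℝ] PhaseSpace d n α :=
  ∑ x ∈ A, (pointP d n α x).comp ((bracket x ^ (-α')) • evalSeq ℝ x)

theorem embedFin_apply (A : Finset (Latt d)) (u : L2seq d (Fib n)) (x : Latt d)
    [Decidable (x ∈ A)] :
    embedFin n α α' A u x = if x ∈ A then bracket x ^ (-α') • u x else 0 := by
  have e : embedFin n α α' A u x = ∑ y ∈ A, pointP d n α y (bracket y ^ (-α') • u y) x := by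
    rw [embedFin, ← evalP_apply, _root_.sum_apply, map_sum]
    exact Finset.sum_congr rfl fun y _ => evalP_apply _ _
  rw [e]
  simp only [pointP_apply]
  simp

theorem norm_embedOp_sub_le (h : α ≤ α') {A : Finset (Latt d)} {ε : ℝ} (hε : 0 ≤ ε)
    (hA : ∀ x ∉ A, bracket x ^ (α - α') ≤ ε) : ‖embedOp n h - embedFin n α α' A‖ ≤ ε := by
  classical
  set M : Latt d → Fib n →L[ℝ] Fib n := fun x =>
    (if x ∈ A then 0 else bracket x ^ (α - α')) • ContinuousLinearMap.id ℝ (Fib n)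
  have hM : ∀ x, ‖M x‖ ≤ ε := fun x => by
    refine ContinuousLinearMap.opNorm_le_bound _ hε fun v => ?_
    change ‖(if x ∈ A then 0 else bracket x ^ (α - α')) • v‖ ≤ ε * ‖v‖
    rw [norm_smul, Real.norm_eq_abs]
    gcongr
    split_ifs with hx
    · simpa using hε
    · rw [abs_of_nonneg (Real.rpow_nonneg (bracket_pos x).le _)]
      exact hA x hx
  refine ContinuousLinearMap.opNorm_le_bound _ hε fun u => ?_
  rw [← (weightEquiv d n α).norm_map]
  have e : weightEquiv d n α ((embedOp n h - embedFin n α α' A : L2seq d (Fib n) →L[ℝ] PhaseSpace d n α) u) = lpShift 0 M ε hM u := by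
    ext x : 2
    have h1 : lpShift 0 M ε hM u x = (if x ∈ A then 0 else bracket x ^ (α - α')) • u x := by
      rw [lpShift_apply, sub_zero]
      rfl
    have h2 : ((embedOp n h - embedFin n α α' A : L2seq d (Fib n) →L[ℝ] PhaseSpace d n α) u) x = embedOp n h u x - embedFin n α α' A u x :=
      rfl
    rw [h1, weightEquiv_apply, h2, embedOp_apply, embedFin_apply]
    split_ifs
    · simp
    · rw [sub_zero, smul_smul, ← Real.rpow_add (bracket_pos x)]
      rfl
  rw [e]
  exact ((lpShift 0 M ε hM).le_opNorm u).trans (by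
    gcongr
    exact norm_lpShift_le 0 M ε hM)

/-- The finite-rank truncations converge in norm, because `⟨x⟩^{α-α'}` tends to zero at infinity;
this uses the strict inequality `α < α'`. -/
theorem isCompactOperator_embedOp (h : α < α') : IsCompactOperator (embedOp (d := d) n h.le) := by
  classical
  have hfin : ∀ A : Finset (Latt d), IsCompactOperator (embedFin n α α' A) := fun A => by
    induction A using Finset.induction_on with
    | empty => simpa [embedFin] using isCompactOperator_zero
    | insert x A hx ih =>
      have e : embedFin n α α' (insert x A) = (pointP d n α x).comp
          ((bracket x ^ (-α')) • evalSeq ℝ x) + embedFin n α α' A := by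
        rw [embedFin, Finset.sum_insert hx]
        rfl
      rw [e]
      refine IsCompactOperator.add ?_ ih
      exact (isCompactOperator_of_locallyCompactSpace_rng
        (pointP d n α x)).comp_clm ((bracket x ^ (-α')) • evalSeq ℝ x)
  refine isCompactOperator_of_tendsto (l := atTop) (F := embedFin (d := d) n α α') ?_
    (Eventually.of_forall hfin)
  rw [Metric.tendsto_atTop]
  intro ε hε
  have h1 := (tendsto_bracket_rpow_cofinite (d := d) (β := α - α') (by linarith)).eventually
    (gt_mem_nhds (half_pos hε))
  have h2 : {x : Latt d | ¬ bracket x ^ (α - α') < ε / 2}.Finite := h1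
  refine ⟨h2.toFinset, fun A hA => ?_⟩
  rw [dist_comm, dist_eq_norm]
  refine (norm_embedOp_sub_le h.le (half_pos hε).le fun x hx => ?_).trans_lt (half_lt_self hε)
  by_contra hc
  exact hx (hA (h2.mem_toFinset.2 fun h3 => hc h3.le))

/-- The weighted square sum with values in `[0, ∞]`. -/
def energy (α' : ℝ) (Y : PhaseSpace d n α) : ENNReal :=
  ∑' x, ENNReal.ofReal (bracket x ^ (2 * α') * ‖Y x‖ ^ 2)

theorem measurable_energy (α' : ℝ) : Measurable (energy (d := d) (n := n) (α := α) α') := by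
  refine Measurable.tsum fun x => ?_
  have : Continuous fun Y : PhaseSpace d n α => bracket x ^ (2 * α') * ‖Y x‖ ^ 2 := by
    simp only [← evalP_apply]
    fun_prop
  exact ENNReal.measurable_ofReal.comp this.measurable

/-- A configuration of bounded energy is the image of a point of a fixed ball under the compact
embedding. The energy takes values in `[0, ∞]` because elements of `ℋ_α` need not be summable with
the stronger weight. -/
theorem exists_isCompact_energy (h : α < α') (R : ℝ) :
    ∃ K : Set (PhaseSpace d n α), IsCompact K ∧
      ∀ Y : PhaseSpace d n α, energy α' Y ≤ ENNReal.ofReal R → Y ∈ K := by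
  refine ⟨closure (embedOp n h.le '' Metric.closedBall 0 (Real.sqrt R)),
    (isCompactOperator_embedOp h).isCompact_closure_image_closedBall
      (f := (embedOp n h.le).toLinearMap) _, fun Y hY => subset_closure ?_⟩
  have hne : energy α' Y ≠ ⊤ := ne_top_of_le_ne_top ENNReal.ofReal_ne_top hY
  have hnn : ∀ x, 0 ≤ bracket x ^ (2 * α') * ‖Y x‖ ^ 2 := fun x =>
    mul_nonneg (Real.rpow_nonneg (bracket_pos x).le _) (sq_nonneg _)
  have hs : Summable fun x => bracket x ^ (2 * α') * ‖Y x‖ ^ 2 := by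
    have := ENNReal.summable_toReal hne
    exact this.congr fun x => ENNReal.toReal_ofReal (hnn x)
  have e : ∀ x, ‖bracket x ^ α' • Y x‖ ^ 2 = bracket x ^ (2 * α') * ‖Y x‖ ^ 2 := fun x => by
    rw [norm_smul, mul_pow, Real.norm_eq_abs, sq_abs, bracket_rpow_sq]
  have hs2 : Summable fun x => ‖bracket x ^ α' • Y x‖ ^ 2 := hs.congr fun x => (e x).symm
  refine ⟨⟨fun x => bracket x ^ α' • Y x, memlp_two_iff.2 hs2⟩, ?_, ?_⟩
  · rw [mem_closedBall_zero_iff]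
    refine L2seq_norm_le (Real.sqrt_nonneg _) ?_
    change ∑' x, ‖bracket x ^ α' • Y x‖ ^ 2 ≤ _
    simp only [e]
    rcases le_or_gt 0 R with hR | hR
    · rw [Real.sq_sqrt hR, ← ENNReal.ofReal_le_ofReal_iff hR, ENNReal.ofReal_tsum_of_nonneg hnn hs]
      exact hY
    · rw [Real.sqrt_eq_zero_of_nonpos hR.le, sq, zero_mul]
      rw [ENNReal.ofReal_of_nonpos hR.le, ← ENNReal.ofReal_zero, energy,
        ← ENNReal.ofReal_tsum_of_nonneg hnn hs, ENNReal.ofReal_le_ofReal_iff le_rfl] at hY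
      exact hY
  · refine PhaseSpace.ext fun x => ?_
    rw [embedOp_apply]
    change bracket x ^ (-α') • bracket x ^ α' • Y x = Y x
    rw [smul_smul, bracket_rpow_neg_mul, one_smul]

theorem isTightMeasureSet_of_energy (h : α < α') {T : Set (Measure (PhaseSpace d n α))} {C : ℝ}
    (hC : ∀ μ ∈ T, ∫⁻ Y, energy α' Y ∂μ ≤ ENNReal.ofReal C) : IsTightMeasureSet T := by
  rw [isTightMeasureSet_iff_exists_isCompact_measure_compl_le]
  intro ε hε
  obtain ⟨δ, hδ0, hδ⟩ : ∃ δ : ℝ, 0 < δ ∧ ENNReal.ofReal δ ≤ ε := by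
    rcases eq_or_ne ε ⊤ with rfl | hne
    · exact ⟨1, one_pos, le_top⟩
    · exact ⟨ε.toReal, ENNReal.toReal_pos hε.ne' hne, ENNReal.ofReal_toReal_le⟩
  -- At this level Markov's inequality leaves mass at most `C / R ≤ δ`; the `|C| + 1` keeps the
  -- level positive.
  set R : ℝ := (|C| + 1) / δ
  have hR : 0 < R := by positivity
  obtain ⟨K, hK, hKR⟩ := exists_isCompact_energy (d := d) (n := n) h R
  refine ⟨K, hK, fun μ hμ => ?_⟩
  have h1 : Kᶜ ⊆ {Y | ENNReal.ofReal R ≤ energy α' Y} := fun Y hY => by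
    by_contra hc
    exact hY (hKR Y (not_le.1 hc).le)
  calc μ Kᶜ ≤ μ {Y | ENNReal.ofReal R ≤ energy α' Y} := measure_mono h1
    _ ≤ (∫⁻ Y, energy α' Y ∂μ) / ENNReal.ofReal R :=
        meas_ge_le_lintegral_div (measurable_energy α').aemeasurable
          (ENNReal.ofReal_pos.2 hR).ne' ENNReal.ofReal_ne_top
    _ ≤ ENNReal.ofReal C / ENNReal.ofReal R := by gcongr; exact hC μ hμ
    _ = ENNReal.ofReal (C / R) := (ENNReal.ofReal_div_of_pos hR).symm
    _ ≤ ENNReal.ofReal δ := by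
        refine ENNReal.ofReal_le_ofReal ?_
        rw [div_le_iff₀ hR]
        have : δ * R = |C| + 1 := by
          simp only [R]
          field_simp
        linarith [le_abs_self C]
    _ ≤ ε := hδ

end CompactEmbedding

/-! ### Uniform second moments -/

section Moments

variable {d n k : ℕ} {α : ℝ} {V : Latt d → Matrix (Fin n) (Fin n) ℝ}
  {μ₀ : Measure (PhaseSpace d n α)} {q : Corner d k → Latt d → Matrix (Comp n) (Comp n) ℝ}

theorem Rep.smul {L : PhaseSpace d n α →L[ℝ] ℝ} {F : Comp n → Lp ℂ 2 (nu d)} (hF : Rep L F)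
    (s : ℝ) : Rep (s • L) fun a => (s : ℂ) • F a := by
  intro x a
  rw [map_smul]
  change (s : ℂ) * coef (F a) x = _
  rw [hF x a, _root_.smul_apply, smul_eq_mul, Complex.ofReal_mul]

namespace WaveData

variable {κ B N J : Type*} [Fintype κ] [Fintype B] [Fintype N] [Fintype J]
  (D : WaveData d κ B N J)

theorem form_smul (F : κ → Lp ℂ 2 (nu d)) (s : ℝ) :
    D.form (fun a => (s : ℂ) • F a) = (s : ℂ) ^ 2 * D.form F := by
  simp only [form, map_smul, inner_smul_left, inner_smul_right, Complex.conj_ofReal,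
    Finset.mul_sum]
  refine Finset.sum_congr rfl fun a _ => Finset.sum_congr rfl fun b _ => ?_
  ring

theorem norm_form_le (F : κ → Lp ℂ 2 (nu d)) :
    ‖D.form F‖ ≤ (∑' z, D.dom z) * (∑ a, ‖F a‖) ^ 2 := by
  have h : ∀ a b, ‖inner ℂ (coef (F a)) (D.T a b (coef (F b)))‖ ≤
      (∑' z, D.dom z) * (‖F a‖ * ‖F b‖) := fun a b => by
    refine (norm_inner_le_norm _ _).trans ?_
    have h1 := (D.T a b).le_opNorm (coef (F b))
    have h2 := norm_covOp_le D.summable_dom (D.K_le a b)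
    rw [LinearIsometryEquiv.norm_map] at h1 ⊢
    calc ‖F a‖ * ‖D.T a b (coef (F b))‖ ≤ ‖F a‖ * ((∑' z, D.dom z) * ‖F b‖) := by
          gcongr
          exact h1.trans (by gcongr; exact h2)
      _ = _ := by ring
  refine (norm_sum_le _ _).trans ((Finset.sum_le_sum fun a _ => norm_sum_le _ _).trans
    ((Finset.sum_le_sum fun a _ => Finset.sum_le_sum fun b _ => h a b).trans_eq ?_))
  rw [sq, Finset.sum_mul_sum, Finset.mul_sum]
  simp only [Finset.mul_sum]

theorem norm_evol_le (f : B → κ → Lp ℂ 2 (nu d)) (t : ℝ) (a : κ) :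
    ‖D.evol f t a‖ ≤ ∑ β, ‖f β a‖ :=
  (norm_sum_le _ _).trans (Finset.sum_le_sum fun β _ => (norm_oscOp (D.aem β) t _).le)

end WaveData

namespace Setup

variable (S : Setup V μ₀ k q)

/-- Replacing `L` by `s • L` multiplies the form by `s²`, so `L` is normally distributed under `μ₀`
and its second moment can be read off. -/
theorem map_rep (S : Setup V μ₀ k q) (hP : IsProbabilityMeasure μ₀) (hG : IsGaussianMeasure μ₀)
    {F : Comp n → Lp ℂ 2 (nu d)} {L : PhaseSpace d n α →L[ℝ] ℝ} (hL : Rep L F) :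
    Integrable (fun Y => L Y ^ 2) μ₀ ∧ ∫ Y, L Y ^ 2 ∂μ₀ = (S.waves.form F).re := by
  obtain ⟨⟨v, hv⟩, -⟩ := S.integral_exp_of_rep hP hG hL
  have h := map_eq_gaussianReal (μ := μ₀) (v := v) L.continuous.measurable fun s => by
    have h2 := (S.integral_exp_of_rep hP hG (hL.smul s)).2
    rw [S.waves.form_smul, hv] at h2
    refine Eq.trans ?_ (h2.trans ?_)
    · simp only [_root_.smul_apply, smul_eq_mul]
    · push_cast
      ring_nf
  have h3 := integral_sq_of_map_eq_gaussianReal L.continuous.measurable h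
  rw [hv, Complex.ofReal_re]
  exact h3

/-- Moving the unit mass from one site to another multiplies its transform by a unimodular
character, so the bound is uniform in `x`. -/
theorem exists_norm_amp_unitSeq_le (S : Setup V μ₀ k q) :
    ∃ M : ℝ, ∀ x a, (∑ c, ∑ β, ‖S.amp (unitSeq x a) β c‖) ≤ M := by
  have h : ∀ β c x a, ‖S.amp (unitSeq x a) β c‖ ≤
      ‖(memLp_modAdj S.e1 S.e3 S.e6 β c a).toLp‖ := fun β c x a => by
    refine Lp.norm_le_norm_of_ae_le ?_
    filter_upwards [S.coeFn_amp (unitSeq x a) β c,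
      MemLp.coeFn_toLp (memLp_modAdj S.e1 S.e3 S.e6 β c a)] with θ h1 h2
    rw [h1, h2]
    simp [Matrix.mulVec, dotProduct, ftest_unitSeq, norm_ch]
  refine ⟨∑ a, ∑ c, ∑ β, ‖(memLp_modAdj S.e1 S.e3 S.e6 β c a).toLp‖, fun x a => ?_⟩
  refine (Finset.sum_le_sum fun c _ => Finset.sum_le_sum fun β _ => h β c x a).trans ?_
  exact Finset.single_le_sum
    (f := fun a => ∑ c, ∑ β, ‖(memLp_modAdj S.e1 S.e3 S.e6 β c a).toLp‖)
    (fun a _ => Finset.sum_nonneg fun c _ => Finset.sum_nonneg fun β _ => norm_nonneg _)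
    (Finset.mem_univ a)

theorem pairL_unitSeq (x : Latt d) (a : Comp n) (Y : PhaseSpace d n α) :
    pairL α (unitSeq x a) Y = Y x a := by
  rw [unitSeq, pairL_finSeq]
  simp [Pi.single_apply]

open scoped Matrix.Norms.L2Operator in
/-- Second moments are bounded uniformly in time and space. -/
theorem exists_moment_le (S : Setup V μ₀ k q) (hP : IsProbabilityMeasure μ₀)
    (hG : IsGaussianMeasure μ₀) : ∃ M : ℝ, 0 ≤ M ∧ ∀ t x a,
      ∫⁻ Y, ENNReal.ofReal ((prop V α t Y) x a ^ 2) ∂μ₀ ≤ ENNReal.ofReal M := by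
  obtain ⟨M, hM⟩ := S.exists_norm_amp_unitSeq_le
  have hdom : 0 ≤ ∑' z, S.waves.dom z := tsum_nonneg fun z => by
    by_cases h : Nonempty (Comp n)
    · obtain ⟨a⟩ := h
      have := S.waves.K_le a a z 0
      rw [sub_zero] at this
      exact (abs_nonneg _).trans this
    · have h2 := S.s2.2.choose_spec.2.2 z 0
      rw [sub_zero] at h2
      exact (norm_nonneg _).trans h2
  refine ⟨(∑' z, S.waves.dom z) * M ^ 2, by positivity, fun t x a => ?_⟩
  obtain ⟨h1, h2⟩ := S.map_rep hP hG (S.rep_evol (unitSeq x a) t)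
  simp only [ContinuousLinearMap.comp_apply, pairL_unitSeq] at h1 h2
  rw [← ofReal_integral_eq_lintegral_ofReal h1 (Eventually.of_forall fun _ => sq_nonneg _), h2]
  refine ENNReal.ofReal_le_ofReal ((Complex.re_le_norm _).trans ((S.waves.norm_form_le _).trans ?_))
  gcongr
  exact (Finset.sum_le_sum fun c _ => S.waves.norm_evol_le _ t c).trans (hM x a)

theorem measurable_prop (t : ℝ) : Measurable (prop V α t) := (prop V α t).continuous.measurable

/-- Uniformly bounded second moments are summed against the weights `⟨x⟩^{2α'}`, which are summable
because `2α' < -d`. -/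
theorem exists_lintegral_energy_le (S : Setup V μ₀ k q) (hP : IsProbabilityMeasure μ₀)
    (hG : IsGaussianMeasure μ₀) {α' : ℝ} (hα' : α' < -(d : ℝ) / 2) :
    ∃ C : ℝ, ∀ t, ∫⁻ Y, energy α' Y ∂(μ₀.map (prop V α t)) ≤ ENNReal.ofReal C := by
  obtain ⟨M, hM0, hM⟩ := S.exists_moment_le hP hG
  have hs := (summable_bracket_rpow (d := d) (β := 2 * α') (by linarith)).mul_right
    (Fintype.card (Comp n) * M)
  refine ⟨∑' x : Latt d, bracket x ^ (2 * α') * (Fintype.card (Comp n) * M), fun t => ?_⟩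
  have hw : ∀ x : Latt d, 0 ≤ bracket x ^ (2 * α') := fun x =>
    Real.rpow_nonneg (bracket_pos x).le _
  rw [lintegral_map (measurable_energy α') (measurable_prop t),
    ENNReal.ofReal_tsum_of_nonneg (fun x => mul_nonneg (hw x) (by positivity)) hs]
  have hmeas : ∀ (x : Latt d) (a : Comp n), Measurable fun Y : PhaseSpace d n α =>
      ENNReal.ofReal ((prop V α t Y) x a ^ 2) := fun x a => by
    have : Continuous fun Y : PhaseSpace d n α => (prop V α t Y) x a ^ 2 := by
      simp only [← coordP_apply]
      fun_prop
    exact ENNReal.measurable_ofReal.comp this.measurable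
  have e : ∀ (Y : PhaseSpace d n α), energy α' (prop V α t Y) = ∑' x : Latt d,
      ENNReal.ofReal (bracket x ^ (2 * α')) *
        ∑ a, ENNReal.ofReal ((prop V α t Y) x a ^ 2) := fun Y => by
    refine tsum_congr fun x => ?_
    rw [ENNReal.ofReal_mul (hw x), EuclideanSpace.norm_sq_eq,
      ← ENNReal.ofReal_sum_of_nonneg fun a _ => sq_nonneg _]
    simp only [Real.norm_eq_abs, sq_abs]
  simp only [e]
  rw [lintegral_tsum fun x => ((Finset.measurable_fun_sum _ fun a _ =>
    hmeas x a).const_mul _).aemeasurable]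
  refine ENNReal.tsum_le_tsum fun x => ?_
  rw [lintegral_const_mul _ (Finset.measurable_fun_sum _ fun a _ => hmeas x a),
    ENNReal.ofReal_mul (hw x), lintegral_finsetSum _ fun a _ => hmeas x a]
  gcongr
  calc ∑ a, ∫⁻ Y, ENNReal.ofReal ((prop V α t Y) x a ^ 2) ∂μ₀
      ≤ ∑ _a : Comp n, ENNReal.ofReal M := Finset.sum_le_sum fun a _ => hM t x a
    _ = ENNReal.ofReal (Fintype.card (Comp n) * M) := by
        rw [Finset.sum_const, Finset.card_univ, nsmul_eq_mul, ENNReal.ofReal_mul (by positivity),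
          ENNReal.ofReal_natCast]

/-- The gap between `α` and `-d/2` leaves room for an exponent `α'` with both summable weights and a
compact embedding. -/
theorem isTight (S : Setup V μ₀ k q) (hP : IsProbabilityMeasure μ₀)
    (hG : IsGaussianMeasure μ₀) (hα : α < -(d : ℝ) / 2) :
    IsTightMeasureSet (Set.range fun t => μ₀.map (prop V α t)) := by
  obtain ⟨α', h1, h2⟩ := exists_between hα
  obtain ⟨C, hC⟩ := S.exists_lintegral_energy_le hP hG h2
  refine isTightMeasureSet_of_energy h1 (C := C) ?_
  rintro _ ⟨t, rfl⟩
  exact hC t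

end Setup

end Moments

/-! ### Uniqueness and convergence of measures through test sequences -/

section Characteristic

variable {d n : ℕ} {α : ℝ}

/-- Each continuous functional is a pointwise limit of pairings with finitely supported sequences.
Equality on test sequences therefore extends to the characteristic functional on the full dual,
which determines a finite measure. -/
theorem ext_of_pairL {μ ν : Measure (PhaseSpace d n α)} [IsFiniteMeasure μ] [IsFiniteMeasure ν]
    (h : ∀ Ψ : RapidSeq d n, ∫ Y, Complex.exp (Complex.I * (pairL α Ψ Y : ℂ)) ∂μ =
      ∫ Y, Complex.exp (Complex.I * (pairL α Ψ Y : ℂ)) ∂ν) : μ = ν := by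
  refine Measure.ext_of_charFunDual (funext fun L => ?_)
  rw [charFunDual_apply, charFunDual_apply]
  simp only [mul_comm _ Complex.I]
  refine tendsto_nhds_unique (tendsto_integral_exp_finSeq μ L) ?_
  simp only [h]
  exact tendsto_integral_exp_finSeq ν L

theorem tendsto_integral_exp {ι : Type*} {l : Filter ι} {P : ι → ProbabilityMeasure (PhaseSpace d n α)}
    {μ : ProbabilityMeasure (PhaseSpace d n α)} (h : Tendsto P l (𝓝 μ))
    (L : PhaseSpace d n α →L[ℝ] ℝ) :
    Tendsto (fun i => ∫ Y, Complex.exp (Complex.I * (L Y : ℂ)) ∂(P i : Measure (PhaseSpace d n α)))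
      l (𝓝 (∫ Y, Complex.exp (Complex.I * (L Y : ℂ)) ∂(μ : Measure (PhaseSpace d n α)))) := by
  have := (ProbabilityMeasure.tendsto_iff_forall_integral_rclike_tendsto ℂ).1 h
    (BoundedContinuousFunction.ofNormedAddCommGroup _ (continuous_exp_mul L) 1
      fun _ => (norm_exp_mul _).le)
  exact this

/-- Prokhorov's theorem gives relative compactness. Every cluster point has the characteristic
functional `φ`, so there is only one and the family converges to it; that `φ` is a characteristic
functional need not be known beforehand. -/
theorem exists_limit_of_isTight {P : ℝ → ProbabilityMeasure (PhaseSpace d n α)}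
    (hP : IsTightMeasureSet (Set.range fun t => (P t : Measure (PhaseSpace d n α))))
    {φ : RapidSeq d n → ℂ} (h : ∀ Ψ, Tendsto (fun t => ∫ Y, Complex.exp (Complex.I *
      (pairL α Ψ Y : ℂ)) ∂(P t : Measure (PhaseSpace d n α))) atTop (𝓝 (φ Ψ))) :
    ∃ μ : ProbabilityMeasure (PhaseSpace d n α), Tendsto P atTop (𝓝 μ) := by
  have hK : IsCompact (closure (Set.range P)) := by
    refine isCompact_closure_of_isTightMeasureSet ?_
    refine hP.subset ?_
    rintro _ ⟨_, ⟨t, rfl⟩, rfl⟩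
    exact ⟨t, rfl⟩
  have hmem : ∀ t, P t ∈ closure (Set.range P) := fun t => subset_closure ⟨t, rfl⟩
  have hc : ∀ ν, MapClusterPt ν atTop P → ∀ Ψ, ∫ Y, Complex.exp (Complex.I *
      (pairL α Ψ Y : ℂ)) ∂(ν : Measure (PhaseSpace d n α)) = φ Ψ := by
    intro ν hν Ψ
    obtain ⟨U, hU, hU2⟩ := mapClusterPt_iff_ultrafilter.1 hν
    exact tendsto_nhds_unique (tendsto_integral_exp hU2 _) ((h Ψ).mono_left hU)
  obtain ⟨μ, -, hμ⟩ := hK.exists_mapClusterPt (f := atTop) (u := P)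
    (tendsto_principal.2 (Eventually.of_forall hmem))
  refine ⟨μ, hK.tendsto_nhds_of_unique_mapClusterPt (Eventually.of_forall hmem) fun ν _ hν => ?_⟩
  have e : (ν : Measure (PhaseSpace d n α)) = μ :=
    ext_of_pairL fun Ψ => (hc ν hν Ψ).trans (hc μ hμ Ψ).symm
  exact Subtype.ext e

end Characteristic

/-! ### The limit state, its stationarity and asymptotic factorization -/

section LimitState

variable {d n k : ℕ} {α : ℝ} {V : Latt d → Matrix (Fin n) (Fin n) ℝ}
  {μ₀ : Measure (PhaseSpace d n α)} {q : Corner d k → Latt d → Matrix (Comp n) (Comp n) ℝ}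

namespace Setup

/-- The state at time `t`. -/
def stateAt (V : Latt d → Matrix (Fin n) (Fin n) ℝ) (hP : IsProbabilityMeasure μ₀) (t : ℝ) :
    ProbabilityMeasure (PhaseSpace d n α) :=
  ⟨μ₀.map (prop V α t), Measure.isProbabilityMeasure_map (measurable_prop t).aemeasurable⟩

theorem integral_stateAt (hP : IsProbabilityMeasure μ₀) (t : ℝ)
    {f : PhaseSpace d n α → ℂ} (hf : Continuous f) :
    ∫ Y, f Y ∂(stateAt V hP t : Measure (PhaseSpace d n α)) = ∫ Y, f (prop V α t Y) ∂μ₀ :=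
  integral_map (measurable_prop t).aemeasurable hf.aestronglyMeasurable

theorem tendsto_integral_stateAt (S : Setup V μ₀ k q) (hP : IsProbabilityMeasure μ₀)
    (hG : IsGaussianMeasure μ₀) {f : Branch V → Comp n → Lp ℂ 2 (nu d)} (hf : Modal f)
    {L : PhaseSpace d n α →L[ℝ] ℝ} (hL : Rep L fun a => ∑ β, f β a) :
    Tendsto (fun t => ∫ Y, Complex.exp (Complex.I * (L Y : ℂ))
      ∂(stateAt V hP t : Measure (PhaseSpace d n α))) atTop
      (𝓝 (Complex.exp (-S.waves.limForm f f / 2))) := by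
  have h3 : Continuous fun z : ℂ => Complex.exp (-z / 2) := by fun_prop
  refine ((h3.tendsto _).comp (S.waves.tendsto_form f (S.nonResonant hf))).congr fun t => ?_
  rw [integral_stateAt hP t (continuous_exp_mul L)]
  exact (S.integral_exp_of_rep hP hG (hL.comp_prop S.e1 S.e3 S.waves.aem hf t)).2.symm

/-- Existence of the limit state. -/
theorem exists_limit (S : Setup V μ₀ k q) (hP : IsProbabilityMeasure μ₀)
    (hG : IsGaussianMeasure μ₀) (hα : α < -(d : ℝ) / 2) :
    ∃ μ : ProbabilityMeasure (PhaseSpace d n α), Tendsto (stateAt V hP) atTop (𝓝 μ) :=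
  exists_limit_of_isTight (S.isTight hP hG hα)
    fun Ψ => S.tendsto_integral_stateAt hP hG (S.modal_amp Ψ) (S.rep_amp Ψ)

variable {μ : ProbabilityMeasure (PhaseSpace d n α)}

theorem integral_exp_limit (S : Setup V μ₀ k q) (hP : IsProbabilityMeasure μ₀)
    (hG : IsGaussianMeasure μ₀) (hμ : Tendsto (stateAt V hP) atTop (𝓝 μ))
    {f : Branch V → Comp n → Lp ℂ 2 (nu d)} (hf : Modal f)
    {L : PhaseSpace d n α →L[ℝ] ℝ} (hL : Rep L fun a => ∑ β, f β a) :
    ∫ Y, Complex.exp (Complex.I * (L Y : ℂ)) ∂(μ : Measure (PhaseSpace d n α)) =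
      Complex.exp (-S.waves.limForm f f / 2) :=
  tendsto_nhds_unique (tendsto_integral_exp hμ L) (S.tendsto_integral_stateAt hP hG hf hL)

/-- The group property moves the state at time `t` to the state at time `s + t`, which has the same
limit. -/
theorem map_prop_limit (hP : IsProbabilityMeasure μ₀)
    (hμ : Tendsto (stateAt V hP) atTop (𝓝 μ)) (s : ℝ) :
    (μ : Measure (PhaseSpace d n α)).map (prop V α s) = μ := by
  have : IsProbabilityMeasure ((μ : Measure (PhaseSpace d n α)).map (prop V α s)) :=
    Measure.isProbabilityMeasure_map (measurable_prop s).aemeasurable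
  refine ext_of_pairL fun Ψ => ?_
  rw [integral_map (measurable_prop s).aemeasurable (continuous_exp_mul _).aestronglyMeasurable]
  have h1 := tendsto_integral_exp hμ ((pairL α Ψ).comp (prop V α s))
  have h2 := (tendsto_integral_exp hμ (pairL α Ψ)).comp (tendsto_atTop_add_const_left atTop s tendsto_id)
  refine tendsto_nhds_unique h1 (h2.congr fun t => ?_)
  simp only [Function.comp_apply, id]
  rw [integral_stateAt hP _ (continuous_exp_mul _), integral_stateAt hP _ (continuous_exp_mul _),
    prop_add]
  rfl

theorem measurePreserving_prop (hP : IsProbabilityMeasure μ₀)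
    (hμ : Tendsto (stateAt V hP) atTop (𝓝 μ)) (s : ℝ) :
    MeasurePreserving (prop V α s) (μ : Measure (PhaseSpace d n α)) μ :=
  ⟨measurable_prop s, map_prop_limit hP hμ s⟩

/-- The characteristic functional of the limit factorizes asymptotically along the flow. -/
theorem tendsto_integral_exp_mixed (S : Setup V μ₀ k q) (hP : IsProbabilityMeasure μ₀)
    (hG : IsGaussianMeasure μ₀) (hμ : Tendsto (stateAt V hP) atTop (𝓝 μ)) (Ψ Φ : RapidSeq d n) :
    Tendsto (fun t => ∫ Y, Complex.exp (Complex.I * (pairL α Ψ (prop V α t Y) : ℂ)) *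
      Complex.exp (Complex.I * (pairL α Φ Y : ℂ)) ∂(μ : Measure (PhaseSpace d n α))) atTop
      (𝓝 ((∫ Y, Complex.exp (Complex.I * (pairL α Ψ Y : ℂ)) ∂(μ : Measure (PhaseSpace d n α))) *
        ∫ Y, Complex.exp (Complex.I * (pairL α Φ Y : ℂ)) ∂(μ : Measure (PhaseSpace d n α)))) := by
  -- These are the amplitudes of `⟨U(t)Y, Ψ⟩`. They are modal, as is their sum with those of `Φ`, so
  -- the formula for the limit functional covers the product of the two exponentials.
  set g : ℝ → Branch V → Comp n → Lp ℂ 2 (nu d) := fun t β a => S.waves.U β t (S.amp Ψ β a) with hg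
  have hgm : ∀ t, Modal (g t) := fun t β => by
    filter_upwards [S.modal_amp Ψ β, ae_all_iff.2 fun a =>
      coeFn_oscOp (S.waves.aem β) t (S.amp Ψ β a)] with θ h1 h2
    have h3 : (fun a => g t β a θ) = fun a => osc (bfreq β) t θ * S.amp Ψ β a θ := funext h2
    rw [h3]
    refine ⟨fun a => ?_, ?_⟩
    · have := h1.1 a
      simp only at this ⊢
      rw [this]
      ring
    · have h4 : (fun a => osc (bfreq β) t θ * S.amp Ψ β (Sum.inr a) θ) =
          osc (bfreq β) t θ • fun a => S.amp Ψ β (Sum.inr a) θ := rfl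
      rw [h4, Matrix.mulVec_smul, h1.2, smul_comm]
  have hsum : ∀ t, Modal fun β a => g t β a + S.amp Φ β a := fun t β => by
    filter_upwards [hgm t β, S.modal_amp Φ β, ae_all_iff.2 fun a =>
      Lp.coeFn_add (g t β a) (S.amp Φ β a)] with θ h1 h2 h3
    simp only [h3, Pi.add_apply]
    refine ⟨fun a => ?_, ?_⟩
    · have e1 := h1.1 a
      have e2 := h2.1 a
      simp only at e1 e2 ⊢
      rw [e1, e2]
      ring
    · have h4 : (fun a => g t β (Sum.inr a) θ + S.amp Φ β (Sum.inr a) θ) =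
          (fun a => g t β (Sum.inr a) θ) + fun a => S.amp Φ β (Sum.inr a) θ := rfl
      rw [h4, Matrix.mulVec_add, h1.2, h2.2, smul_add]
  have hrep : ∀ t, Rep ((pairL α Ψ).comp (prop V α t) + pairL α Φ)
      fun a => ∑ β, (g t β a + S.amp Φ β a) := fun t => by
    simp only [Finset.sum_add_distrib]
    exact (S.rep_evol Ψ t).add (S.rep_amp Φ)
  -- By stationarity the term of `g t` with itself does not depend on `t`. Only the mixed terms do,
  -- and they tend to zero.
  have h1 : ∀ t, ∫ Y, Complex.exp (Complex.I * (pairL α Ψ (prop V α t Y) : ℂ)) *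
      Complex.exp (Complex.I * (pairL α Φ Y : ℂ)) ∂(μ : Measure (PhaseSpace d n α)) =
      (∫ Y, Complex.exp (Complex.I * (pairL α Ψ Y : ℂ)) ∂(μ : Measure (PhaseSpace d n α))) *
        (∫ Y, Complex.exp (Complex.I * (pairL α Φ Y : ℂ)) ∂(μ : Measure (PhaseSpace d n α))) *
        Complex.exp (-(S.waves.limForm (g t) (S.amp Φ) + S.waves.limForm (S.amp Φ) (g t)) / 2) := by
    intro t
    have e1 := S.integral_exp_limit hP hG hμ (hsum t) (hrep t)
    have e2 := S.integral_exp_limit hP hG hμ (hgm t) (S.rep_evol Ψ t)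
    have e3 := S.integral_exp_limit hP hG hμ (S.modal_amp Φ) (S.rep_amp Φ)
    have e4 : ∫ Y, Complex.exp (Complex.I * (pairL α Ψ Y : ℂ)) ∂(μ : Measure (PhaseSpace d n α)) =
        ∫ Y, Complex.exp (Complex.I * (((pairL α Ψ).comp (prop V α t)) Y : ℂ))
          ∂(μ : Measure (PhaseSpace d n α)) := by
      conv_lhs => rw [← map_prop_limit hP hμ t]
      exact integral_map (measurable_prop t).aemeasurable
        (continuous_exp_mul _).aestronglyMeasurable
    rw [e4, e2, e3, ← Complex.exp_add, ← Complex.exp_add]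
    refine Eq.trans ?_ (e1.trans ?_)
    · refine integral_congr_ae (Eventually.of_forall fun Y => ?_)
      simp only [_root_.add_apply, ContinuousLinearMap.comp_apply]
      rw [← Complex.exp_add]
      push_cast
      ring_nf
    · rw [S.waves.limForm_add_left, S.waves.limForm_add_right, S.waves.limForm_add_right]
      ring_nf
  simp only [h1]
  have h2 := S.waves.tendsto_limForm_evol_left S.ae_exists_velocity_ne_zero (S.amp Φ) (S.amp Ψ)
  have h3 := S.waves.tendsto_limForm_evol S.ae_exists_velocity_ne_zero (S.amp Φ) (S.amp Ψ)
  have h4 : Continuous fun z : ℂ => Complex.exp (-z / 2) := by fun_prop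
  have h5 := (h4.tendsto _).comp (h2.add h3)
  simpa using tendsto_const_nhds.mul h5

end Setup

end LimitState

/-! ### The limit quadratic form -/

section QuadraticForm

variable {d n k : ℕ} {α : ℝ} {V : Latt d → Matrix (Fin n) (Fin n) ℝ}
  {μ₀ : Measure (PhaseSpace d n α)} {q : Corner d k → Latt d → Matrix (Comp n) (Comp n) ℝ}

theorem summable_ftest (Ψ : RapidSeq d n) (a : Comp n) (θ : Fin d → ℝ) :
    Summable fun x => ch x θ * (Ψ.1 x a : ℂ) := by
  refine Summable.of_norm ((summable_rapid_apply Ψ a).congr fun x => ?_)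
  rw [norm_mul, norm_ch, one_mul, Complex.norm_real, Real.norm_eq_abs]

theorem ftest_add (Ψ Φ : RapidSeq d n) (θ : Fin d → ℝ) :
    ftest (Ψ + Φ) θ = ftest Ψ θ + ftest Φ θ := by
  funext a
  refine Eq.trans ?_ ((summable_ftest Ψ a θ).tsum_add (summable_ftest Φ a θ))
  refine tsum_congr fun x => ?_
  have : (Ψ + Φ).1 x a = Ψ.1 x a + Φ.1 x a := rfl
  simp only [this]
  push_cast
  ring

theorem ftest_smul (s : ℝ) (Ψ : RapidSeq d n) (θ : Fin d → ℝ) :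
    ftest (s • Ψ) θ = (s : ℂ) • ftest Ψ θ := by
  funext a
  rw [Pi.smul_apply, smul_eq_mul, ftest, ftest, symb, symb, ← tsum_mul_left]
  refine tsum_congr fun x => ?_
  have : (s • Ψ).1 x a = s * Ψ.1 x a := rfl
  rw [this]
  push_cast
  ring

theorem WaveData.limForm_smul_left {κ B N J : Type*} [Fintype κ] [Fintype B] [Fintype N]
    [Fintype J] (D : WaveData d κ B N J) (s : ℝ) (f g : B → κ → Lp ℂ 2 (nu d)) :
    D.limForm (fun β a => (s : ℂ) • f β a) g = s * D.limForm f g := by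
  simp only [limForm, inner_smul_left, Complex.conj_ofReal, Finset.mul_sum]

theorem WaveData.limForm_smul_right {κ B N J : Type*} [Fintype κ] [Fintype B] [Fintype N]
    [Fintype J] (D : WaveData d κ B N J) (s : ℝ) (f g : B → κ → Lp ℂ 2 (nu d)) :
    D.limForm f (fun β a => (s : ℂ) • g β a) = s * D.limForm f g := by
  simp only [limForm, map_smul, inner_smul_right, Finset.mul_sum]

namespace Setup

theorem amp_add (S : Setup V μ₀ k q) (Ψ Φ : RapidSeq d n) :
    S.amp (Ψ + Φ) = fun β a => S.amp Ψ β a + S.amp Φ β a := by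
  funext β a
  refine Lp.ext ?_
  filter_upwards [S.coeFn_amp (Ψ + Φ) β a, S.coeFn_amp Ψ β a, S.coeFn_amp Φ β a,
    Lp.coeFn_add (S.amp Ψ β a) (S.amp Φ β a)] with θ h1 h2 h3 h4
  rw [h1, h4, Pi.add_apply, h2, h3, ftest_add, Matrix.mulVec_add, Pi.add_apply]

theorem amp_smul (S : Setup V μ₀ k q) (s : ℝ) (Ψ : RapidSeq d n) :
    S.amp (s • Ψ) = fun β a => (s : ℂ) • S.amp Ψ β a := by
  funext β a
  refine Lp.ext ?_
  filter_upwards [S.coeFn_amp (s • Ψ) β a, S.coeFn_amp Ψ β a,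
    Lp.coeFn_smul (s : ℂ) (S.amp Ψ β a)] with θ h1 h2 h3
  rw [h1, h3, Pi.smul_apply, h2, ftest_smul, Matrix.mulVec_smul, Pi.smul_apply]

/-- The real quadratic form of the limit state. -/
def limQuad (S : Setup V μ₀ k q) : QuadraticForm ℝ (RapidSeq d n) :=
  LinearMap.BilinMap.toQuadraticMap (LinearMap.mk₂ ℝ
    (fun Ψ Φ => (S.waves.limForm (S.amp Ψ) (S.amp Φ)).re)
    (fun Ψ Ψ' Φ => by rw [S.amp_add, S.waves.limForm_add_left, Complex.add_re])
    (fun s Ψ Φ => by rw [S.amp_smul, S.waves.limForm_smul_left, Complex.re_ofReal_mul, smul_eq_mul])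
    (fun Ψ Φ Φ' => by rw [S.amp_add, S.waves.limForm_add_right, Complex.add_re])
    (fun s Ψ Φ => by rw [S.amp_smul, S.waves.limForm_smul_right, Complex.re_ofReal_mul, smul_eq_mul]))

theorem limQuad_apply (S : Setup V μ₀ k q) (Ψ : RapidSeq d n) :
    S.limQuad Ψ = (S.waves.limForm (S.amp Ψ) (S.amp Ψ)).re := rfl

/-- The value is a limit of variances of real functionals under `μ₀`, hence real and nonnegative. -/
theorem limForm_amp_self (S : Setup V μ₀ k q) (hP : IsProbabilityMeasure μ₀)
    (hG : IsGaussianMeasure μ₀) (Ψ : RapidSeq d n) :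
    0 ≤ S.limQuad Ψ ∧ S.waves.limForm (S.amp Ψ) (S.amp Ψ) = ((S.limQuad Ψ : ℝ) : ℂ) := by
  have h1 := S.waves.tendsto_form _ (S.nonResonant (S.modal_amp Ψ))
  have hv : ∀ t, ∃ v : NNReal, S.waves.form (S.waves.evol (S.amp Ψ) t) = ((v : ℝ) : ℂ) := fun t =>
    (S.integral_exp_of_rep hP hG (S.rep_evol Ψ t)).1
  choose v hv using hv
  simp only [hv] at h1
  have hre := (Complex.continuous_re.tendsto _).comp h1
  have him := (Complex.continuous_im.tendsto _).comp h1
  simp only [Function.comp_def, Complex.ofReal_re, Complex.ofReal_im] at hre him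
  refine ⟨ge_of_tendsto' hre fun t => (v t).2, Complex.ext rfl ?_⟩
  rw [Complex.ofReal_im]
  exact tendsto_nhds_unique him tendsto_const_nhds

variable {μ : ProbabilityMeasure (PhaseSpace d n α)}

theorem charFunctional_limit (S : Setup V μ₀ k q) (hP : IsProbabilityMeasure μ₀)
    (hG : IsGaussianMeasure μ₀) (hμ : Tendsto (stateAt V hP) atTop (𝓝 μ)) (Ψ : RapidSeq d n) :
    charFunctional (μ : Measure (PhaseSpace d n α)) Ψ =
      Complex.exp (-S.waves.limForm (S.amp Ψ) (S.amp Ψ) / 2) := by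
  rw [charFunctional]
  simp only [pairing_eq]
  exact S.integral_exp_limit hP hG hμ (S.modal_amp Ψ) (S.rep_amp Ψ)

theorem isGaussianMeasure_limit (S : Setup V μ₀ k q) (hP : IsProbabilityMeasure μ₀)
    (hG : IsGaussianMeasure μ₀) (hμ : Tendsto (stateAt V hP) atTop (𝓝 μ)) :
    IsGaussianMeasure (μ : Measure (PhaseSpace d n α)) := by
  refine ⟨S.limQuad, fun Ψ => (S.limForm_amp_self hP hG Ψ).1, fun Ψ => ?_⟩
  rw [S.charFunctional_limit hP hG hμ, (S.limForm_amp_self hP hG Ψ).2]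

end Setup

end QuadraticForm

/-! ### Translation invariance of the limit -/

section Translations

variable {d n k : ℕ} {α : ℝ} {V : Latt d → Matrix (Fin n) (Fin n) ℝ}
  {μ₀ : Measure (PhaseSpace d n α)} {q : Corner d k → Latt d → Matrix (Comp n) (Comp n) ℝ}

theorem norm_shiftMul_le (z x : Latt d) :
    ‖(bracket x ^ α * bracket (x - z) ^ (-α)) • ContinuousLinearMap.id ℝ (Fib n)‖ ≤
      2 ^ |α| * bracket z ^ |α| := by
  have h := bracket_rpow_le α x (x - z)
  rw [sub_sub_cancel] at h
  refine ContinuousLinearMap.opNorm_le_bound _ (by have := bracket_pos z; positivity) fun v => ?_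
  rw [_root_.smul_apply, ContinuousLinearMap.id_apply, norm_smul, Real.norm_eq_abs,
    abs_of_nonneg (by have := bracket_pos x; have := bracket_pos (x - z); positivity)]
  refine mul_le_mul_of_nonneg_right ?_ (norm_nonneg _)
  calc bracket x ^ α * bracket (x - z) ^ (-α)
      ≤ 2 ^ |α| * bracket z ^ |α| * bracket (x - z) ^ α * bracket (x - z) ^ (-α) := by
        have := bracket_pos (x - z)
        gcongr
    _ = 2 ^ |α| * bracket z ^ |α| := by rw [mul_assoc, bracket_rpow_mul_neg, mul_one]

/-- The shift `(T_z Y)(x) = Y(x - z)` of the phase space. -/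
def shiftOp (n : ℕ) (α : ℝ) (z : Latt d) : PhaseSpace d n α →L[ℝ] PhaseSpace d n α :=
  ((weightEquiv d n α).symm.toContinuousLinearEquiv.toContinuousLinearMap.comp
    (lpShift z (fun x => (bracket x ^ α * bracket (x - z) ^ (-α)) • ContinuousLinearMap.id ℝ (Fib n))
      _ (norm_shiftMul_le z))).comp
    (weightEquiv d n α).toContinuousLinearEquiv.toContinuousLinearMap

theorem shiftOp_apply (z : Latt d) (Y : PhaseSpace d n α) (x : Latt d) :
    shiftOp n α z Y x = Y (x - z) := by
  have e : shiftOp n α z Y x = bracket x ^ (-α) • (bracket x ^ α * bracket (x - z) ^ (-α)) •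
      bracket (x - z) ^ α • Y (x - z) := weightEquiv_symm_apply _ x
  rw [e, smul_smul, smul_smul, mul_assoc, mul_assoc, bracket_rpow_neg_mul, mul_one,
    bracket_rpow_neg_mul, one_smul]

theorem shiftSet_eq (h : Latt d) (B : Set (PhaseSpace d n α)) :
    shiftSet h B = shiftOp n α (-h) ⁻¹' B := by
  ext Y
  rw [shiftSet, Set.mem_ofPred_eq, Set.mem_preimage]
  constructor
  · rintro ⟨Z, hZ, hY⟩
    have : shiftOp n α (-h) Y = Z := PhaseSpace.ext fun x => by
      rw [shiftOp_apply, hY, sub_neg_eq_add, add_sub_cancel_right]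
    rwa [this]
  · intro hB
    refine ⟨_, hB, fun x => ?_⟩
    rw [shiftOp_apply, sub_neg_eq_add, sub_add_cancel]

/-- The shift of a test sequence. -/
def shiftSeq (z : Latt d) (Ψ : RapidSeq d n) : RapidSeq d n :=
  ⟨fun x => Ψ.1 (x + z), fun N => by
    obtain ⟨C, hC⟩ := Ψ.2 N
    refine ⟨(2 * bracket z) ^ N * C, fun x => ?_⟩
    have h1 := bracket_add_le (x + z) (-z)
    rw [add_neg_cancel_right, bracket_neg] at h1
    have hx := bracket_pos x
    have hz := bracket_pos z
    have hxz := bracket_pos (x + z)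
    calc bracket x ^ N * ‖Ψ.1 (x + z)‖
        ≤ (2 * bracket (x + z) * bracket z) ^ N * ‖Ψ.1 (x + z)‖ := by gcongr
      _ = (2 * bracket z) ^ N * (bracket (x + z) ^ N * ‖Ψ.1 (x + z)‖) := by ring
      _ ≤ (2 * bracket z) ^ N * C := by
        gcongr
        exact hC _⟩

theorem pairL_shiftOp (z : Latt d) (Ψ : RapidSeq d n) (Y : PhaseSpace d n α) :
    pairL α Ψ (shiftOp n α z Y) = pairL α (shiftSeq z Ψ) Y := by
  have h := hasSum_pairL Ψ (shiftOp n α z Y)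
  rw [← (Equiv.addRight z).hasSum_iff] at h
  refine h.unique ((hasSum_pairL (shiftSeq z Ψ) Y).congr_fun fun x => ?_)
  refine Finset.sum_congr rfl fun a _ => ?_
  simp only [Equiv.coe_addRight, shiftOp_apply, add_sub_cancel_right]
  rfl

theorem ftest_shiftSeq (z : Latt d) (Ψ : RapidSeq d n) (θ : Fin d → ℝ) (a : Comp n) :
    ftest (shiftSeq z Ψ) θ a = ch (-z) θ * ftest Ψ θ a := by
  have h := (summable_ftest Ψ a θ).hasSum
  rw [← (Equiv.addRight z).hasSum_iff] at h
  refine ((h.mul_left (ch (-z) θ)).congr_fun fun x => ?_).tsum_eq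
  simp only [Function.comp_apply, Equiv.coe_addRight]
  rw [← mul_assoc, ← ch_add, neg_add_cancel_comm_assoc]
  rfl

/-- A shift multiplies the transform of a test sequence by a character, which cancels against its
conjugate because the limit form is given by a multiplier. -/
theorem Setup.translationInvariant_limit (S : Setup V μ₀ k q) (hkd : k ≤ d)
    (hP : IsProbabilityMeasure μ₀) (hG : IsGaussianMeasure μ₀)
    {μ : ProbabilityMeasure (PhaseSpace d n α)}
    (hμ : Tendsto (Setup.stateAt V hP) atTop (𝓝 μ)) :
    TranslationInvariant (μ : Measure (PhaseSpace d n α)) := by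
  intro h B hB
  have hm : Measurable (shiftOp n α (-h)) := (shiftOp n α (-h)).continuous.measurable
  have : IsProbabilityMeasure ((μ : Measure (PhaseSpace d n α)).map (shiftOp n α (-h))) :=
    Measure.isProbabilityMeasure_map hm.aemeasurable
  have e : (μ : Measure (PhaseSpace d n α)).map (shiftOp n α (-h)) = μ := by
    refine ext_of_pairL fun Ψ => ?_
    rw [integral_map hm.aemeasurable (continuous_exp_mul _).aestronglyMeasurable]
    simp only [pairL_shiftOp]
    rw [S.integral_exp_limit hP hG hμ (S.modal_amp _) (S.rep_amp _),
      S.integral_exp_limit hP hG hμ (S.modal_amp _) (S.rep_amp _), S.limForm_amp hkd,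
      S.limForm_amp hkd]
    congr 3
    refine integral_congr_ae (Eventually.of_forall fun θ => ?_)
    refine Finset.sum_congr rfl fun a _ => Finset.sum_congr rfl fun b _ => ?_
    rw [ftest_shiftSeq, ftest_shiftSeq, map_mul, conj_ch, neg_neg, neg_neg]
    linear_combination (starRingEnd ℂ (ftest Ψ θ a) * qInfHat V k q θ a b * ftest Ψ θ b) *
      ch_neg_mul_self h θ
  rw [shiftSet_eq, ← Measure.map_apply hm hB, e]

end Translations

/-! ### Density of the exponentials in `L²` of the limit measure -/

section Density

variable {d n : ℕ} {α : ℝ} {μ : Measure (PhaseSpace d n α)}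

/-- The positive and negative parts of `r` are the densities of two finite measures with the same
characteristic functional, hence agree almost everywhere. -/
theorem ae_eq_zero_of_integral_exp_mul {r : PhaseSpace d n α → ℝ} (hr : Integrable r μ)
    (h : ∀ Ψ : RapidSeq d n, ∫ Y, Complex.exp (Complex.I * (pairL α Ψ Y : ℂ)) * r Y ∂μ = 0) :
    r =ᵐ[μ] 0 := by
  have hlt : ∀ s : PhaseSpace d n α → ℝ, Integrable s μ → ∫⁻ Y, ENNReal.ofReal (s Y) ∂μ ≠ ⊤ :=
    fun s hs => (lt_of_le_of_lt (lintegral_ofReal_le_lintegral_enorm s) hs.2).ne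
  have h1 := hlt r hr
  have h2 := hlt (fun Y => -r Y) hr.neg
  have hm1 : AEMeasurable (fun Y => ENNReal.ofReal (r Y)) μ := hr.1.aemeasurable.ennreal_ofReal
  have hm2 : AEMeasurable (fun Y => ENNReal.ofReal (-r Y)) μ :=
    hr.1.aemeasurable.neg.ennreal_ofReal
  have := isFiniteMeasure_withDensity h1
  have := isFiniteMeasure_withDensity h2
  have hi : ∀ (s : PhaseSpace d n α → ℝ), Integrable s μ → ∀ Ψ : RapidSeq d n, Integrable (fun Y =>
      (ENNReal.ofReal (s Y)).toReal • Complex.exp (Complex.I * (pairL α Ψ Y : ℂ))) μ := by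
    intro s hs Ψ
    refine hs.norm.mono' ?_ (Eventually.of_forall fun Y => ?_)
    · exact (hs.1.aemeasurable.ennreal_ofReal.ennreal_toReal.aestronglyMeasurable).smul
        (continuous_exp_mul _).aestronglyMeasurable
    · rw [norm_smul, norm_exp_mul, mul_one, Real.norm_eq_abs, Real.norm_eq_abs,
        ENNReal.toReal_ofReal', abs_of_nonneg (le_max_right _ _)]
      exact max_le (le_abs_self _) (abs_nonneg _)
  have key : μ.withDensity (fun Y => ENNReal.ofReal (r Y)) =
      μ.withDensity fun Y => ENNReal.ofReal (-r Y) := by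
    refine ext_of_pairL fun Ψ => ?_
    rw [integral_withDensity_eq_integral_toReal_smul₀ hm1
        (Eventually.of_forall fun _ => ENNReal.ofReal_lt_top),
      integral_withDensity_eq_integral_toReal_smul₀ hm2
        (Eventually.of_forall fun _ => ENNReal.ofReal_lt_top), ← sub_eq_zero,
      ← integral_sub (hi r hr Ψ) (hi (fun Y => -r Y) hr.neg Ψ), ← h Ψ]
    refine integral_congr_ae (Eventually.of_forall fun Y => ?_)
    simp only [ENNReal.toReal_ofReal', Complex.real_smul, ← sub_mul]
    rw [mul_comm, ← Complex.ofReal_sub]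
    congr 2
    rcases le_total 0 (r Y) with h0 | h0
    · rw [max_eq_left h0, max_eq_right (by linarith), sub_zero]
    · rw [max_eq_right h0, max_eq_left (by linarith)]
      ring
  filter_upwards [(withDensity_eq_iff hm1 hm2 h1).1 key] with Y hY
  rcases le_total 0 (r Y) with h0 | h0
  · rw [ENNReal.ofReal_of_nonpos (by linarith : -r Y ≤ 0), ENNReal.ofReal_eq_zero] at hY
    exact le_antisymm hY h0
  · rw [ENNReal.ofReal_of_nonpos h0, eq_comm, ENNReal.ofReal_eq_zero] at hY
    exact le_antisymm h0 (show (0 : ℝ) ≤ r Y by linarith)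

variable [IsFiniteMeasure μ]

variable (μ) in
/-- The exponentials of linear functionals as elements of `L²`. -/
def expLp (Ψ : RapidSeq d n) : Lp ℂ 2 μ :=
  (MemLp.of_bound (continuous_exp_mul (pairL α Ψ)).aestronglyMeasurable 1
    (Eventually.of_forall fun _ => (norm_exp_mul _).le)).toLp

theorem coeFn_expLp (Ψ : RapidSeq d n) :
    expLp μ Ψ =ᵐ[μ] fun Y => Complex.exp (Complex.I * (pairL α Ψ Y : ℂ)) := MemLp.coeFn_toLp _

theorem conj_exp_mul (Ψ : RapidSeq d n) (Y : PhaseSpace d n α) :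
    (starRingEnd ℂ) (Complex.exp (Complex.I * (pairL α Ψ Y : ℂ))) =
      Complex.exp (Complex.I * (pairL α ((-1 : ℝ) • Ψ) Y : ℂ)) := by
  rw [← Complex.exp_conj, map_mul, Complex.conj_I, Complex.conj_ofReal, pairL_smul]
  push_cast
  ring_nf

/-- The conjugate of an exponential is the exponential of `-Ψ`. A function orthogonal to all
exponentials and its conjugate thus both integrate to zero against them, and the previous lemma
applies to the real and imaginary parts. -/
theorem topologicalClosure_span_expLp :
    (Submodule.span ℂ (Set.range (expLp (d := d) (n := n) (α := α) μ))).topologicalClosure = ⊤ := by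
  rw [Submodule.topologicalClosure_eq_top_iff, Submodule.eq_bot_iff]
  intro f hf
  have hfi : Integrable f μ := (Lp.memLp f).integrable (by norm_num)
  have h1 : ∀ Ψ : RapidSeq d n,
      ∫ Y, Complex.exp (Complex.I * (pairL α Ψ Y : ℂ)) * f Y ∂μ = 0 := by
    intro Ψ
    have h := (Submodule.mem_orthogonal _ _).1 hf (expLp μ ((-1 : ℝ) • Ψ))
      (Submodule.subset_span ⟨_, rfl⟩)
    rw [L2.inner_def] at h
    rw [← h]
    refine integral_congr_ae ?_
    filter_upwards [coeFn_expLp (μ := μ) ((-1 : ℝ) • Ψ)] with Y hY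
    rw [hY, RCLike.inner_apply, conj_exp_mul, smul_smul, mul_comm]
    norm_num
  have hexp : ∀ (Ψ : RapidSeq d n) {g : PhaseSpace d n α → ℂ}, Integrable g μ →
      Integrable (fun Y => Complex.exp (Complex.I * (pairL α Ψ Y : ℂ)) * g Y) μ := fun Ψ g hg =>
    hg.bdd_mul (c := 1) (continuous_exp_mul _).aestronglyMeasurable
      (Eventually.of_forall fun _ => (norm_exp_mul _).le)
  have hci : Integrable (fun Y => (starRingEnd ℂ) (f Y)) μ :=
    (Complex.conjCLE.toContinuousLinearMap.integrable_comp hfi)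
  have h2 : ∀ Ψ : RapidSeq d n,
      ∫ Y, Complex.exp (Complex.I * (pairL α Ψ Y : ℂ)) * (starRingEnd ℂ) (f Y) ∂μ = 0 := by
    intro Ψ
    rw [← map_zero (starRingEnd ℂ), ← h1 ((-1 : ℝ) • Ψ), ← integral_conj]
    refine integral_congr_ae (Eventually.of_forall fun Y => ?_)
    simp only [map_mul]
    rw [conj_exp_mul, smul_smul]
    norm_num
  have hre := ae_eq_zero_of_integral_exp_mul hfi.re fun Ψ => by
    have e : ∀ Y, Complex.exp (Complex.I * (pairL α Ψ Y : ℂ)) * ((RCLike.re (f Y) : ℝ) : ℂ) =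
        (1 / 2 : ℂ) * (Complex.exp (Complex.I * (pairL α Ψ Y : ℂ)) * f Y +
          Complex.exp (Complex.I * (pairL α Ψ Y : ℂ)) * (starRingEnd ℂ) (f Y)) := fun Y => by
      have := Complex.add_conj (f Y)
      rw [← mul_add, this]
      push_cast
      change _ * (((f Y).re : ℝ) : ℂ) = _
      ring
    simp only [e]
    rw [integral_const_mul, integral_add (hexp Ψ hfi) (hexp Ψ hci), h1, h2]
    simp
  have him := ae_eq_zero_of_integral_exp_mul hfi.im fun Ψ => by
    have e : ∀ Y, Complex.exp (Complex.I * (pairL α Ψ Y : ℂ)) * ((RCLike.im (f Y) : ℝ) : ℂ) =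
        (-Complex.I / 2 : ℂ) * (Complex.exp (Complex.I * (pairL α Ψ Y : ℂ)) * f Y -
          Complex.exp (Complex.I * (pairL α Ψ Y : ℂ)) * (starRingEnd ℂ) (f Y)) := fun Y => by
      have := Complex.sub_conj (f Y)
      rw [← mul_sub, this]
      push_cast
      change _ * (((f Y).im : ℝ) : ℂ) = _
      linear_combination (Complex.exp (Complex.I * (pairL α Ψ Y : ℂ)) * ((f Y).im : ℂ)) *
        Complex.I_sq
    simp only [e]
    rw [integral_const_mul, integral_sub (hexp Ψ hfi) (hexp Ψ hci), h1, h2]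
    simp
  refine Lp.ext ?_
  filter_upwards [hre, him, Lp.coeFn_zero ℂ 2 μ] with Y h3 h4 h5
  rw [h5]
  exact Complex.ext h3 h4

end Density

/-! ### Mixing and ergodicity -/

section Mixing

theorem tendsto_zero_of_span {E : Type*} [NormedAddCommGroup E] [NormedSpace ℂ E]
    {φ : ℝ → E →L[ℂ] ℂ} {C : ℝ} (hC : ∀ t, ‖φ t‖ ≤ C) {D : Set E}
    (hD : (Submodule.span ℂ D).topologicalClosure = ⊤)
    (h : ∀ v ∈ D, Tendsto (fun t => φ t v) atTop (𝓝 0)) (v : E) :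
    Tendsto (fun t => φ t v) atTop (𝓝 0) := by
  have h1 : ∀ w ∈ Submodule.span ℂ D, Tendsto (fun t => φ t w) atTop (𝓝 0) := by
    intro w hw
    induction hw using Submodule.span_induction with
    | mem w hw => exact h w hw
    | zero => simp
    | add w w' _ _ h1 h2 => simpa using h1.add h2
    | smul c w _ h1 => simpa using h1.const_mul c
  have hC0 : 0 ≤ C := (norm_nonneg _).trans (hC 0)
  have hv : v ∈ closure (Submodule.span ℂ D : Set E) := by
    rw [← Submodule.topologicalClosure_coe, hD]
    trivial
  rw [Metric.tendsto_atTop]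
  intro ε hε
  obtain ⟨w, hw, hvw⟩ := Metric.mem_closure_iff.1 hv (ε / (2 * (C + 1))) (by positivity)
  obtain ⟨T, hT⟩ := Metric.tendsto_atTop.1 (h1 w hw) (ε / 2) (half_pos hε)
  refine ⟨T, fun t ht => ?_⟩
  have h2 := hT t ht
  rw [dist_zero_right] at h2 ⊢
  rw [dist_eq_norm] at hvw
  have h3 : ‖φ t (v - w)‖ ≤ C * ‖v - w‖ := (φ t).le_of_opNorm_le (hC t) _
  have h4 : C * ‖v - w‖ ≤ ε / 2 := by
    calc C * ‖v - w‖ ≤ (C + 1) * (ε / (2 * (C + 1))) := by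
          gcongr
          linarith
      _ = ε / 2 := by field_simp
  calc ‖φ t v‖ = ‖φ t (v - w) + φ t w‖ := by rw [← map_add, sub_add_cancel]
    _ ≤ ‖φ t (v - w)‖ + ‖φ t w‖ := norm_add_le _ _
    _ < ε := by linarith

variable {d n k : ℕ} {α : ℝ} {V : Latt d → Matrix (Fin n) (Fin n) ℝ}
  {μ₀ : Measure (PhaseSpace d n α)} {q : Corner d k → Latt d → Matrix (Comp n) (Comp n) ℝ}
  {μ : ProbabilityMeasure (PhaseSpace d n α)}

namespace Setup

/-- The Koopman operators of the flow. -/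
def koopman (hP : IsProbabilityMeasure μ₀) (hμ : Tendsto (stateAt V hP) atTop (𝓝 μ)) (t : ℝ) :
    Lp ℂ 2 (μ : Measure (PhaseSpace d n α)) →ₗᵢ[ℂ] Lp ℂ 2 (μ : Measure (PhaseSpace d n α)) :=
  Lp.compMeasurePreservingₗᵢ ℂ (prop V α t) (measurePreserving_prop hP hμ t)

theorem coeFn_koopman (hP : IsProbabilityMeasure μ₀) (hμ : Tendsto (stateAt V hP) atTop (𝓝 μ))
    (t : ℝ) (f : Lp ℂ 2 (μ : Measure (PhaseSpace d n α))) :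
    koopman hP hμ t f =ᵐ[(μ : Measure (PhaseSpace d n α))] fun Y => f (prop V α t Y) :=
  Lp.coeFn_compMeasurePreserving f (measurePreserving_prop hP hμ t)

/-- The constant function `1`. -/
def oneLp (μ : ProbabilityMeasure (PhaseSpace d n α)) : Lp ℂ 2 (μ : Measure (PhaseSpace d n α)) :=
  (memLp_const (1 : ℂ)).toLp

theorem inner_oneLp (f : Lp ℂ 2 (μ : Measure (PhaseSpace d n α))) :
    inner ℂ (oneLp μ) f = ∫ Y, f Y ∂(μ : Measure (PhaseSpace d n α)) := by
  rw [L2.inner_def]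
  refine integral_congr_ae ?_
  filter_upwards [MemLp.coeFn_toLp (memLp_const (p := 2) (μ := (μ : Measure (PhaseSpace d n α)))
    (1 : ℂ))] with Y hY
  rw [oneLp, hY, RCLike.inner_apply]
  simp

theorem norm_oneLp_le : ‖oneLp μ‖ ≤ 1 := by
  rw [oneLp, Lp.norm_toLp, eLpNorm_const _ (by norm_num) (NeZero.ne _)]
  simp

/-- The deviation from asymptotic independence, as a functional of the evolved function. -/
def mixR (hP : IsProbabilityMeasure μ₀) (hμ : Tendsto (stateAt V hP) atTop (𝓝 μ))
    (g : Lp ℂ 2 (μ : Measure (PhaseSpace d n α))) (t : ℝ) :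
    Lp ℂ 2 (μ : Measure (PhaseSpace d n α)) →L[ℂ] ℂ :=
  (innerSL ℂ g).comp (koopman hP hμ t).toContinuousLinearMap -
    (inner ℂ g (oneLp μ)) • innerSL ℂ (oneLp μ)

theorem mixR_apply (hP : IsProbabilityMeasure μ₀) (hμ : Tendsto (stateAt V hP) atTop (𝓝 μ))
    (f g : Lp ℂ 2 (μ : Measure (PhaseSpace d n α))) (t : ℝ) :
    mixR hP hμ g t f = inner ℂ g (koopman hP hμ t f) -
      inner ℂ g (oneLp μ) * inner ℂ (oneLp μ) f := rfl

theorem norm_inner_sub_le (hP : IsProbabilityMeasure μ₀) (hμ : Tendsto (stateAt V hP) atTop (𝓝 μ))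
    (f g : Lp ℂ 2 (μ : Measure (PhaseSpace d n α))) (t : ℝ) :
    ‖mixR hP hμ g t f‖ ≤ 2 * ‖f‖ * ‖g‖ := by
  rw [mixR_apply]
  have h1 := norm_inner_le_norm (𝕜 := ℂ) g (koopman hP hμ t f)
  rw [LinearIsometry.norm_map] at h1
  have h2 := norm_inner_le_norm (𝕜 := ℂ) g (oneLp μ)
  have h3 := norm_inner_le_norm (𝕜 := ℂ) (oneLp μ) f
  have h0 := norm_oneLp_le (μ := μ)
  have h4 : ‖inner ℂ g (oneLp μ) * inner ℂ (oneLp μ) f‖ ≤ ‖g‖ * ‖f‖ := by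
    rw [norm_mul]
    gcongr
    · exact h2.trans (mul_le_of_le_one_right (norm_nonneg _) h0)
    · exact h3.trans (mul_le_of_le_one_left (norm_nonneg _) h0)
  refine (norm_sub_le _ _).trans ?_
  linarith

/-- The same deviation, as a functional of the other function. -/
def mixL (hP : IsProbabilityMeasure μ₀) (hμ : Tendsto (stateAt V hP) atTop (𝓝 μ))
    (f : Lp ℂ 2 (μ : Measure (PhaseSpace d n α))) (t : ℝ) :
    Lp ℂ 2 (μ : Measure (PhaseSpace d n α)) →L[ℂ] ℂ :=
  innerSL ℂ (koopman hP hμ t f) - (inner ℂ f (oneLp μ)) • innerSL ℂ (oneLp μ)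

theorem mixL_apply (hP : IsProbabilityMeasure μ₀) (hμ : Tendsto (stateAt V hP) atTop (𝓝 μ))
    (f g : Lp ℂ 2 (μ : Measure (PhaseSpace d n α))) (t : ℝ) :
    mixL hP hμ f t g = (starRingEnd ℂ) (mixR hP hμ g t f) := by
  rw [mixR_apply, map_sub, map_mul, inner_conj_symm, inner_conj_symm, inner_conj_symm, mul_comm]
  rfl

/-- The inner product conjugates the exponential of `Φ`, so the factorization is used with `-Φ`. -/
theorem tendsto_mixR_expLp (S : Setup V μ₀ k q) (hP : IsProbabilityMeasure μ₀)
    (hG : IsGaussianMeasure μ₀) (hμ : Tendsto (stateAt V hP) atTop (𝓝 μ)) (Ψ Φ : RapidSeq d n) :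
    Tendsto (fun t => mixR hP hμ (expLp (μ : Measure (PhaseSpace d n α)) Φ) t
      (expLp (μ : Measure (PhaseSpace d n α)) Ψ)) atTop (𝓝 0) := by
  have h := S.tendsto_integral_exp_mixed hP hG hμ Ψ ((-1 : ℝ) • Φ)
  have h2 := h.sub_const ((∫ Y, Complex.exp (Complex.I * (pairL α Ψ Y : ℂ))
    ∂(μ : Measure (PhaseSpace d n α))) * ∫ Y, Complex.exp (Complex.I *
      (pairL α ((-1 : ℝ) • Φ) Y : ℂ)) ∂(μ : Measure (PhaseSpace d n α)))
  rw [sub_self] at h2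
  refine h2.congr fun t => ?_
  rw [mixR_apply, inner_oneLp, ← inner_conj_symm (expLp _ Φ) (oneLp μ), inner_oneLp,
    integral_congr_ae (coeFn_expLp Ψ), integral_congr_ae (coeFn_expLp Φ), ← integral_conj,
    L2.inner_def]
  simp only [conj_exp_mul]
  rw [mul_comm (∫ Y, Complex.exp (Complex.I * (pairL α Ψ Y : ℂ)) ∂(μ : Measure (PhaseSpace d n α)))]
  congr 1
  refine integral_congr_ae ?_
  filter_upwards [coeFn_expLp (μ := (μ : Measure (PhaseSpace d n α))) Φ,
    coeFn_koopman hP hμ t (expLp (μ : Measure (PhaseSpace d n α)) Ψ),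
    (measurePreserving_prop hP hμ t).quasiMeasurePreserving.ae
      (coeFn_expLp (μ := (μ : Measure (PhaseSpace d n α))) Ψ)] with Y h3 h4 h5
  rw [h3, h4, h5, RCLike.inner_apply, conj_exp_mul]

/-- The deviation is bounded by `2 ‖f‖ ‖g‖` uniformly in time, so the span of the exponentials can
be used in one argument and then in the other. Passing to the conjugate `mixL` makes the dependence
on `g` linear. -/
theorem tendsto_mixR (S : Setup V μ₀ k q) (hP : IsProbabilityMeasure μ₀)
    (hG : IsGaussianMeasure μ₀) (hμ : Tendsto (stateAt V hP) atTop (𝓝 μ))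
    (f g : Lp ℂ 2 (μ : Measure (PhaseSpace d n α))) :
    Tendsto (fun t => mixR hP hμ g t f) atTop (𝓝 0) := by
  have hbR : ∀ g t, ‖mixR hP hμ g t‖ ≤ 2 * ‖g‖ := fun g t =>
    ContinuousLinearMap.opNorm_le_bound _ (by positivity) fun f =>
      (norm_inner_sub_le hP hμ f g t).trans_eq (by ring)
  have hbL : ∀ f t, ‖mixL hP hμ f t‖ ≤ 2 * ‖f‖ := fun f t =>
    ContinuousLinearMap.opNorm_le_bound _ (by positivity) fun g => by
      rw [mixL_apply, RCLike.norm_conj]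
      exact norm_inner_sub_le hP hμ f g t
  have hconj : ∀ {z : ℝ → ℂ}, Tendsto z atTop (𝓝 0) →
      Tendsto (fun t => (starRingEnd ℂ) (z t)) atTop (𝓝 0) := fun {z} hz => by
    have := (Complex.continuous_conj.tendsto 0).comp hz
    rwa [map_zero] at this
  have h1 : ∀ Φ f, Tendsto (fun t => mixR hP hμ (expLp (μ : Measure (PhaseSpace d n α)) Φ) t f)
      atTop (𝓝 0) := fun Φ f => by
    refine tendsto_zero_of_span (hbR _) topologicalClosure_span_expLp ?_ f
    rintro _ ⟨Ψ, rfl⟩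
    exact S.tendsto_mixR_expLp hP hG hμ Ψ Φ
  have h2 : Tendsto (fun t => mixL hP hμ f t g) atTop (𝓝 0) := by
    refine tendsto_zero_of_span (hbL f) topologicalClosure_span_expLp ?_ g
    rintro _ ⟨Φ, rfl⟩
    simp only [mixL_apply]
    exact hconj (h1 Φ f)
  refine (hconj h2).congr fun t => ?_
  rw [mixL_apply, Complex.conj_conj]

theorem flow_eq (S : Setup V μ₀ k q) (t : ℝ) :
    (flow V t : PhaseSpace d n α → PhaseSpace d n α) = prop V α t :=
  funext fun Y => flow_eq_prop S.e1 t Y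

theorem isMixingFlow_limit (S : Setup V μ₀ k q) (hP : IsProbabilityMeasure μ₀)
    (hG : IsGaussianMeasure μ₀) (hμ : Tendsto (stateAt V hP) atTop (𝓝 μ)) :
    IsMixingFlow (flow V) (μ : Measure (PhaseSpace d n α)) := by
  intro f g hf hg
  -- Mixing is stated without conjugation, hence the conjugate of `g` enters the inner product.
  have hg' : MemLp (fun Y => (starRingEnd ℂ) (g Y)) 2 (μ : Measure (PhaseSpace d n α)) := hg.star
  have h := S.tendsto_mixR hP hG hμ hf.toLp hg'.toLp
  have h2 := h.add_const ((∫ Y, f Y ∂(μ : Measure (PhaseSpace d n α))) *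
    ∫ Y, g Y ∂(μ : Measure (PhaseSpace d n α)))
  rw [zero_add] at h2
  refine h2.congr fun t => ?_
  rw [mixR_apply, inner_oneLp, ← inner_conj_symm hg'.toLp (oneLp μ), inner_oneLp,
    integral_congr_ae hf.coeFn_toLp, integral_congr_ae hg'.coeFn_toLp, ← integral_conj, L2.inner_def]
  simp only [Complex.conj_conj]
  rw [mul_comm (∫ Y, f Y ∂(μ : Measure (PhaseSpace d n α))), sub_add_cancel]
  refine integral_congr_ae ?_
  filter_upwards [hg'.coeFn_toLp, coeFn_koopman hP hμ t hf.toLp,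
    (measurePreserving_prop hP hμ t).quasiMeasurePreserving.ae hf.coeFn_toLp] with Y h3 h4 h5
  rw [h3, h4, h5, RCLike.inner_apply, Complex.conj_conj, S.flow_eq]

end Setup

/-- For the indicator of an invariant set `B` the correlations are constant, so mixing gives `ρ(B) =
ρ(B)²`. -/
theorem IsMixingFlow.isErgodicFlow {ρ : Measure (PhaseSpace d n α)} [IsProbabilityMeasure ρ]
    {U : ℝ → PhaseSpace d n α → PhaseSpace d n α} (h : IsMixingFlow U ρ) : IsErgodicFlow U ρ := by
  intro B hB hU
  have hm : MemLp (B.indicator fun _ => (1 : ℂ)) 2 ρ :=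
    (memLp_const (1 : ℂ)).indicator hB
  have h1 := h _ _ hm hm
  have hint : ∫ Y, B.indicator (fun _ => (1 : ℂ)) Y ∂ρ = ((ρ.real B : ℝ) : ℂ) := by
    rw [integral_indicator hB]
    simp
  have h2 : ∀ t, ∫ Y, B.indicator (fun _ => (1 : ℂ)) (U t Y) * B.indicator (fun _ => (1 : ℂ)) Y ∂ρ =
      ((ρ.real B : ℝ) : ℂ) := fun t => by
    rw [← hint]
    refine integral_congr_ae ?_
    filter_upwards [(hU t).mem_iff] with Y hY
    by_cases hYB : Y ∈ B
    · have : U t Y ∈ B := hY.2 hYB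
      simp [hYB, this]
    · simp [hYB]
  simp only [h2, hint] at h1
  have h3 : ((ρ.real B : ℝ) : ℂ) = ρ.real B * ρ.real B :=
    tendsto_nhds_unique tendsto_const_nhds h1
  have h4 : ρ.real B * (ρ.real B - 1) = 0 := by
    have h5 : ρ.real B = ρ.real B * ρ.real B := by exact_mod_cast h3
    linarith
  rcases mul_eq_zero.1 h4 with h5 | h5
  · exact Or.inl ((measureReal_eq_zero_iff).1 h5)
  · right
    rw [← ENNReal.ofReal_toReal (measure_ne_top ρ B)]
    change ENNReal.ofReal (ρ.real B) = 1
    rw [sub_eq_zero.1 h5, ENNReal.ofReal_one]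

end Mixing

end HarmonicCrystal

end

/-! ### The main theorem -/

theorem lemma2p14 (d n k : ℕ) (hd : 1 ≤ d) (hn : 1 ≤ n) (hk : 1 ≤ k) (hkd : k ≤ d)
    (α : ℝ) (hα : α < -(d : ℝ) / 2)
    (V : Latt d → Matrix (Fin n) (Fin n) ℝ)
    (hE1 : CondE1 V) (hE2 : CondE2 V) (hE3 : CondE3 V) (hE4 : CondE4 V) (hE6 : CondE6 V)
    (μ₀ : Measure (PhaseSpace d n α)) (hμ₀ : IsProbabilityMeasure μ₀)
    (hG : IsGaussianMeasure μ₀) (hS1 : CondS1 μ₀) (hS2 : CondS2 μ₀)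
    (q : Corner d k → Latt d → Matrix (Comp n) (Comp n) ℝ) (hS3 : CondS3 μ₀ k q)
    (hE5 : CondE5' V k q) :
    (∀ a b : Comp n, IntegrableOn (fun θ => qInfHat V k q θ a b) (cell d)) ∧
    ∃ μ : Measure (PhaseSpace d n α), IsProbabilityMeasure μ ∧
      -- (i) weak convergence to a translation-invariant Gaussian limit with covariance `q_∞`
      WeaklyConverges (evolved V μ₀) μ ∧
      IsGaussianMeasure μ ∧ TranslationInvariant μ ∧
      (∀ Ψ : RapidSeq d n, charFunctional μ Ψ = Complex.exp (-(1 / 2) * QInfForm V k q Ψ)) ∧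
      -- (ii) stationarity
      (∀ t : ℝ, μ.map (flow V t) = μ) ∧
      -- (iii) mixing and ergodicity
      IsMixingFlow (flow V) μ ∧ IsErgodicFlow (flow V) μ := by
  have S : Setup V μ₀ k q := ⟨hd, hE1, hE3, hE4, hE5, hE6, hS2, hS3⟩
  refine ⟨fun a b => integrable_nu_iff.1 (S.integrable_qInfHat hkd a b), ?_⟩
  obtain ⟨μ, hμ⟩ := S.exists_limit hμ₀ hG hα
  refine ⟨μ, inferInstance, fun f => ?_, S.isGaussianMeasure_limit hμ₀ hG hμ,
    S.translationInvariant_limit hkd hμ₀ hG hμ, fun Ψ => ?_, fun t => ?_,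
    S.isMixingFlow_limit hμ₀ hG hμ, (S.isMixingFlow_limit hμ₀ hG hμ).isErgodicFlow⟩
  · simp only [evolved, S.flow_eq]
    exact ProbabilityMeasure.tendsto_iff_forall_integral_tendsto.1 hμ f
  · rw [S.charFunctional_limit hμ₀ hG hμ, S.QInfForm_eq hkd]
    congr 1
    ring
  · rw [S.flow_eq]
    exact Setup.map_prop_limit hμ₀ hμ t
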